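/- **Setting.** Let $d\ge 1$, let $B_1,\dots,B_d$ be real $3\times 3$ matrices and $B$ a real $2\times 3$ matrix. Write $x=(x',x_d)$, $x'=(t,y)\in\mathbb R\times\mathbb R^{d-1}$, $\partial_0=\partial_t$, $B_0=I$. Assume: (1) (strict hyperbolicity) $\det[\tau I+\sum_j\xi_jB_j]=\prod_{k=1}^3(\tau+\lambda_k(\xi))$ for $\xi\in\mathbb R^d\setminus\{0\}$, with $\lambda_1<\lambda_2<\lambda_3$ real analytic and positively homogeneous of degree $1$ on $\mathbb R^d\setminus\{0\}$; (2) $B_d$ is invertible and $\operatorname{rank}B=2$ is the number of positive eigenvalues of $B_d$. Put $A_j=B_d^{-1}B_j$ for $0\le j\le d-1$ and $L(\partial)=\partial_d+\sum_{j=0}^{d-1}A_j\partial_j$; (3) (weak stability) for $\zeta=(\tau-i\gamma,\eta)\neq0$, $\gamma\ge0$, let $\mathcal A(\zeta)=-iB_d^{-1}((\tau-i\gamma)I+\sum_{j<d}\eta_jB_j)$, and let $\mathbb E^s(\zeta)$ be its stable subspace for $\gamma>0$, extended continuously to $\gamma=0$. Let $\Sigma=\{|\zeta|=1,\gamma\ge0\}$.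 Then $\ker B\cap\mathbb E^s(\zeta)=\{0\}$ for $\gamma>0$; the set $\Upsilon_0$ of $\zeta\in\Sigma$ with $\gamma=0$ and $\ker B\cap\mathbb E^s(\zeta)\ne\{0\}$ is nonempty, and $\mathcal A(\zeta)$ is diagonalizable with purely imaginary eigenvalues for $\zeta\in\Upsilon_0$; near each point of $\Upsilon_0$ in $\Sigma$ there are a $C^\infty$ basis $E_1,E_2$ of $\mathbb E^s$, a $C^\infty$ invertible matrix $P$ and a real $C^\infty$ function $\sigma$ with $B(E_1\ E_2)=P\,\mathrm{diag}(\gamma+i\sigma,1)$. Let $\beta=(\underline\tau,\underline\eta)\in\Upsilon_0$. Let $\omega_1,\omega_2,\omega_3$ be the smooth real branches near $\beta$ of the roots $\omega$ of $\det[\tau I+\sum_{j<d}\eta_jB_j+\omega B_d]=0$, distinct at $\beta$; write $\underline\omega_m=\omega_m(\beta)$ and $\phi_m(x)=\beta\cdot x'+\underline\omega_mx_d$. Let $k_m$ be the index with $\underline\tau+\lambda_{k_m}(\underline\eta,\underline\omega_m)=0$. Assume $\phi_1,\phi_3$ are incoming ($\partial_{\xi_d}\lambda_{k_m}(\underline\eta,\underline\omega_m)>0$),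 $\phi_2$ is outgoing ($<0$), and $n_1\phi_1=n_2\phi_2+n_3\phi_3$ with $(n_1,n_2,n_3)\in\mathbb Z^3\setminus\{0\}$. Let $r_m$ be a real vector spanning $\ker L(d\phi_m)$, where $L(d\phi_m)=\underline\omega_mI+\sum_{j<d}\beta_jA_j$, let $(\ell_m)$ be the dual basis of $(r_m)$, and put $P_mv=(\ell_m\cdot v)r_m$, $R_m=\sum_{k\ne m}(\underline\omega_m-\underline\omega_k)^{-1}P_k$. Let $e\in\mathbb R^3\setminus\{0\}$ and $b\in\mathbb R^2\setminus\{0\}$ satisfy $\ker B\cap\mathbb E^s(\beta)=\mathrm{Span}\{e\}$ and $B\,\mathbb E^s(\beta)=\{X\in\mathbb C^2: b\cdot X=0\}$, and let $e_m=P_me$, so that $e=e_1+e_3$. Set $$X_{\phi_m}=\partial_d-\sum_{j=0}^{d-1}\partial_{\xi_j}\omega_m(\beta)\,\partial_j,\qquad X_{Lop}=\sum_{j=0}^{d-1}\Big(b\cdot B\sum_{m\in\{1,3\}}R_mA_je_m\Big)\partial_j .$$ For $T>0$ let $\Omega_T=\{(x,\theta):x_d\ge 0,\ t<T,\ \theta\in\mathbb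 R/2\pi\mathbb Z\}$ and $b\Omega_T=\{(x',\theta_0):t<T,\ \theta_0\in\mathbb R/2\pi\mathbb Z\}$, let $H^s$ be the usual Sobolev spaces of real functions, and let $\langle\cdot\rangle_s$ be the norm of $H^s(b\Omega_T)$. For $\sigma=\sum_kf_k(x)e^{ik\theta}$ put $\sigma_{n_1}=\sum_kf_{kn_1}(x)e^{ikn_1\theta}$. Given real constants $c_0,\dots,c_6$, the key profile subsystem for $V=(V',a)$, $V'=(\sigma_1(x,\theta_1),\sigma_3(x,\theta_3),\tau_2(x,\theta_2))$, $a=a(x',\theta_0)$, is $$\begin{aligned} &X_{\phi_1}\sigma_1+c_1\sigma_1=0,\qquad X_{\phi_3}\sigma_3+c_3\sigma_3=0 &&\text{in }\Omega_T,\\ &X_{\phi_2}\tau_2+c_0\tau_2+c_2\int_0^{2\pi}\sigma_{1,n_1}\Big(x,\tfrac{n_2}{n_1}\theta_2+\tfrac{n_3}{n_1}\theta_3\Big)\sigma_3(x,\theta_3)\,d\theta_3=0 &&\text{in }\Omega_T,\\ &X_{Lop}a+c_4a+c_5\,\partial_{\theta_0}\tau_2|_{x_d=0}+c_6\,\partial_{\theta_0}(a^2)=g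 &&\text{on }b\Omega_T,\\ &\sigma_i(x',0,\theta_0)\,r_i=a(x',\theta_0)\,e_i,\quad i=1,3, &&\text{on }b\Omega_T,\\ &V=0 &&\text{in }t\le0. \end{aligned}$$ **Proposition.** Fix $T>0$ and let $\alpha_0=\left[\frac{d+1}2\right]+1$, $\alpha=2\alpha_0+4$, $\tilde\alpha=2\alpha-\alpha_0$, where $[\rho]$ is the smallest integer greater than $\rho$. There is $\delta>0$ such that for every $g\in H^{\tilde\alpha-2}(b\Omega_T)$ vanishing in $t\le0$ with $\langle g\rangle_\alpha\le\delta$ the subsystem has a solution $V$ with $V'\in H^{\alpha-1}(\Omega_T)$ and $(V'|_{x_d=0},a)\in H^{\alpha-1}(b\Omega_T)$. If moreover $g$ has mean zero in $\theta_0$, then $\sigma_1,\sigma_3,\tau_2,a$ have mean zero in their periodic variable. -/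

import Mathlib

open Set Filter Topology MeasureTheory
open scoped ENNReal ContDiff Matrix

noncomputable section

namespace KeyProfile

/-! ### Sobolev spaces on `U × 𝕋`, where `𝕋 = ℝ / 2πℤ`

Functions on `U × 𝕋` are functions on `ℝᵏ × ℝ` that are `2π`-periodic in the last variable `θ`,
integrated over `U × (0, 2π)`. -/

/-- The space `ℝᵏ × ℝ` of points `(z, θ)`. -/
abbrev Cyl (k : ℕ) : Type := (Fin k → ℝ) × ℝ

/-- `2π`-periodicity in `θ`. -/
def PeriodicTheta {k : ℕ} (u : Cyl k → ℝ) : Prop :=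
  ∀ z θ, u (z, θ + 2 * Real.pi) = u (z, θ)

/-- Lebesgue measure on `U × 𝕋`, realised on the fundamental cell `U × (0, 2π)`. -/
def cylMeasure {k : ℕ} (U : Set (Fin k → ℝ)) : Measure (Cyl k) :=
  volume.restrict (U ×ˢ Ioo 0 (2 * Real.pi))

/-- Test functions on `U × 𝕋`: smooth, periodic in `θ`, compactly supported in `U × 𝕋`. -/
structure IsTest {k : ℕ} (U : Set (Fin k → ℝ)) (φ : Cyl k → ℝ) : Prop where
  smooth : ContDiff ℝ ∞ φ
  periodic : PeriodicTheta φ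
  support : ∃ K : Set (Fin k → ℝ), IsCompact K ∧ K ⊆ U ∧ ∀ z ∉ K, ∀ θ, φ (z, θ) = 0

/-- The coordinate directions: `none` is `∂_θ`, `some i` is `∂_{z_i}`. -/
def dir {k : ℕ} : Option (Fin k) → Cyl k
  | none => (0, 1)
  | some i => (Pi.single i 1, 0)

/-- `w ∈ L²(U × 𝕋)` is the weak derivative `∂_{v 0} ⋯ ∂_{v (m-1)} u` on `U × 𝕋`. -/
def HasWeakDeriv {k : ℕ} (U : Set (Fin k → ℝ)) (m : ℕ) (v : Fin m → Cyl k)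
    (u w : Cyl k → ℝ) : Prop :=
  MemLp w 2 (cylMeasure U) ∧
    ∀ φ : Cyl k → ℝ, IsTest U φ →
      ∫ p, u p * iteratedFDeriv ℝ m φ p v ∂(cylMeasure U)
        = (-1) ^ m * ∫ p, w p * φ p ∂(cylMeasure U)

/-- Membership in `Hˢ(U × 𝕋)`. -/
def MemSobolev {k : ℕ} (U : Set (Fin k → ℝ)) (s : ℕ) (u : Cyl k → ℝ) : Prop :=
  PeriodicTheta u ∧ MemLp u 2 (cylMeasure U) ∧
    ∀ m ≤ s, ∀ I : Fin m → Option (Fin k), ∃ w, HasWeakDeriv U m (fun j => dir (I j)) u w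

/-- The norm of `Hˢ(U × 𝕋)`: the square root of the sum of the squared `L²` norms of all weak
derivatives of order at most `s` (these are almost everywhere unique, so that the infimum only
selects them). -/
def sobolevNorm {k : ℕ} (U : Set (Fin k → ℝ)) (s : ℕ) (u : Cyl k → ℝ) : ℝ≥0∞ :=
  (∑ m ∈ Finset.range (s + 1), ∑ I : Fin m → Option (Fin k),
    ⨅ w : Cyl k → ℝ, ⨅ _ : HasWeakDeriv U m (fun j => dir (I j)) u w,
      eLpNorm w 2 (cylMeasure U) ^ 2) ^ (1 / 2 : ℝ)

/-- Zero mean in `θ`. -/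
def MeanZero {k : ℕ} (U : Set (Fin k → ℝ)) (u : Cyl k → ℝ) : Prop :=
  ∀ᵐ z ∂(volume.restrict U), ∫ θ in (0 : ℝ)..(2 * Real.pi), u (z, θ) = 0

/-! ### The space-time domains

`d = n + 1` is the space dimension. A boundary point is `x' = (t, y) ∈ ℝ × ℝⁿ` (`t` has index `0`),
an interior point is `x = (x', x_d)` (`x_d` has the last index). -/

/-- `{x' : t < T}`; the product with `𝕋` is `bΩ_T`. -/
def bdryDomain (n : ℕ) (T : ℝ) : Set (Fin (n + 1) → ℝ) := {z | z 0 < T}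

/-- `{x : t < T, x_d > 0}`; the product with `𝕋` is (the interior of) `Ω_T`. -/
def intDomain (n : ℕ) (T : ℝ) : Set (Fin (n + 2) → ℝ) := {z | z 0 < T ∧ 0 < z (Fin.last (n + 1))}

/-- The point `x = (x', s)`. -/
def atHeight {n : ℕ} (z : Fin (n + 1) → ℝ) (s : ℝ) : Fin (n + 2) → ℝ :=
  Fin.snoc (α := fun _ => ℝ) z s

/-- `u = 0` in `t ≤ 0`, on the part `U` of space-time. -/
def VanishesInPast {k : ℕ} (U : Set (Fin (k + 1) → ℝ)) (u : Cyl (k + 1) → ℝ) : Prop :=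
  ∀ᵐ p ∂(cylMeasure U), p.1 0 ≤ 0 → u p = 0

/-- `h = u|_{x_d = 0}` in the sense of traces of `H¹` functions, by Green's formula: the weak
derivative `∂_d u` exists and
`∫_{Ω_T} (u ∂_d φ + φ ∂_d u) = - ∫_{bΩ_T} h φ|_{x_d = 0}`
for all test functions `φ` supported in `t < T` (they need not vanish at `x_d = 0`). -/
def IsTrace {n : ℕ} (T : ℝ) (u : Cyl (n + 2) → ℝ) (h : Cyl (n + 1) → ℝ) : Prop :=
  ∃ w, HasWeakDeriv (intDomain n T) 1 ![dir (some (Fin.last (n + 1)))] u w ∧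
    ∀ φ : Cyl (n + 2) → ℝ, IsTest {z | z 0 < T} φ →
      ∫ p, (u p * fderiv ℝ φ p (dir (some (Fin.last (n + 1)))) + w p * φ p)
          ∂(cylMeasure (intDomain n T))
        = - ∫ q, h q * φ (atHeight q.1 0, q.2) ∂(cylMeasure (bdryDomain n T))

/-! ### The `3 × 3` hyperbolic boundary problem

The operator is `∂_t + ∑_{j=1}^d B_j ∂_j` on `x_d > 0`; `B j` for `j : Fin (n + 1)` are the
matrices `B_1, …, B_d`, and `M` is the `2 × 3` matrix of the linearised boundary condition. -/

/-- Strict hyperbolicity: `det (τ I + ∑ ξ_j B_j) = ∏_k (τ + λ_k(ξ))` with `λ_1 < λ_2 < λ_3`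
analytic and positively homogeneous of degree `1` on `ℝᵈ ∖ {0}`. -/
structure StrictlyHyperbolic {n : ℕ} (B : Fin (n + 1) → Matrix (Fin 3) (Fin 3) ℝ)
    (lam : Fin 3 → (Fin (n + 1) → ℝ) → ℝ) : Prop where
  analytic : ∀ k, AnalyticOnNhd ℝ (lam k) {0}ᶜ
  homogeneous : ∀ k, ∀ ξ ≠ 0, ∀ s > 0, lam k (s • ξ) = s * lam k ξ
  ordered : ∀ ξ ≠ 0, lam 0 ξ < lam 1 ξ ∧ lam 1 ξ < lam 2 ξ
  det_eq : ∀ ξ ≠ 0, ∀ τ : ℝ,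
    (τ • (1 : Matrix (Fin 3) (Fin 3) ℝ) + ∑ j, ξ j • B j).det = ∏ k, (τ + lam k ξ)

/-- Noncharacteristic boundary, and `M` of maximal rank `2`, which is the number of positive
eigenvalues of `B_d`. -/
structure NoncharacteristicBoundary {n : ℕ} (B : Fin (n + 1) → Matrix (Fin 3) (Fin 3) ℝ)
    (M : Matrix (Fin 2) (Fin 3) ℝ) : Prop where
  det_ne_zero : (B (Fin.last n)).det ≠ 0
  rank_eq : M.rank = 2
  card_pos : ((B (Fin.last n)).charpoly.roots.filter (fun x => 0 < x)).card = 2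

/-- Frequencies `ζ = (τ - iγ, η)`. -/
abbrev Freq (n : ℕ) : Type := ℂ × (Fin n → ℝ)

/-- `𝒜(ζ) = -i B_d⁻¹ ((τ - iγ) I + ∑_{j<d} η_j B_j)`. -/
def symbolA {n : ℕ} (B : Fin (n + 1) → Matrix (Fin 3) (Fin 3) ℝ) (ζ : Freq n) :
    Matrix (Fin 3) (Fin 3) ℂ :=
  (-Complex.I) • (((B (Fin.last n))⁻¹).map Complex.ofReal *
    (ζ.1 • (1 : Matrix (Fin 3) (Fin 3) ℂ)
      + ∑ j : Fin n, (ζ.2 j : ℂ) • (B j.castSucc).map Complex.ofReal))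

/-- `Ξ ∖ Ξ₀ = {γ > 0}`. -/
def freqOpen (n : ℕ) : Set (Freq n) := {ζ | ζ.1.im < 0}

/-- The unit half-sphere `Σ = {τ² + γ² + |η|² = 1, γ ≥ 0}`. -/
def sphereHalf (n : ℕ) : Set (Freq n) :=
  {ζ | ζ.1.im ≤ 0 ∧ ζ.1.re ^ 2 + ζ.1.im ^ 2 + ∑ j, ζ.2 j ^ 2 = 1}

/-- `Σ₀ = Σ ∩ {γ = 0}`. -/
def sphereReal (n : ℕ) : Set (Freq n) := {ζ | ζ ∈ sphereHalf n ∧ ζ.1.im = 0}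

/-- The stable subspace of `𝒜(ζ)`: the sum of the generalised eigenspaces for the eigenvalues of
negative real part. -/
def stableSubspace {n : ℕ} (B : Fin (n + 1) → Matrix (Fin 3) (Fin 3) ℝ) (ζ : Freq n) :
    Submodule ℂ (Fin 3 → ℂ) :=
  ⨆ μ : ℂ, ⨆ _ : μ.re < 0, Module.End.maxGenEigenspace (Matrix.toLin' (symbolA B ζ)) μ

open Classical in
/-- The bundle `𝔼ˢ`: the stable subspace for `γ > 0`, extended by continuity to `γ = 0`
(`v ∈ 𝔼ˢ(ζ)` when the distance of `v` to `𝔼ˢ(z)` tends to `0` as `z → ζ` with `γ > 0`). -/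
def stableBundle {n : ℕ} (B : Fin (n + 1) → Matrix (Fin 3) (Fin 3) ℝ) (ζ : Freq n) :
    Set (Fin 3 → ℂ) :=
  if ζ ∈ freqOpen n then (stableSubspace B ζ : Set (Fin 3 → ℂ))
  else {v | Tendsto (fun z => Metric.infDist v (stableSubspace B z : Set (Fin 3 → ℂ)))
    (𝓝[freqOpen n] ζ) (𝓝 0)}

/-- `𝒜(ζ)` is diagonalisable with purely imaginary eigenvalues (for real `ζ` this is the
hyperbolic region). -/
def InHyperbolicRegion {n : ℕ} (B : Fin (n + 1) → Matrix (Fin 3) (Fin 3) ℝ) (ζ : Freq n) : Prop :=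
  (⨆ μ : ℂ, ⨆ _ : μ.re = 0, Module.End.eigenspace (Matrix.toLin' (symbolA B ζ)) μ) = ⊤

/-- The complexified boundary matrix. -/
def bdryMat (M : Matrix (Fin 2) (Fin 3) ℝ) : Matrix (Fin 2) (Fin 3) ℂ := M.map Complex.ofReal

/-- The set `Υ₀` of real unit frequencies where `ker M ∩ 𝔼ˢ(ζ) ≠ {0}`. -/
def lopSet {n : ℕ} (B : Fin (n + 1) → Matrix (Fin 3) (Fin 3) ℝ) (M : Matrix (Fin 2) (Fin 3) ℝ) :
    Set (Freq n) :=
  {ζ | ζ ∈ sphereReal n ∧ ∃ v ∈ stableBundle B ζ, v ≠ 0 ∧ bdryMat M *ᵥ v = 0}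

/-- The weak stability assumption: no exponentially growing mode, the uniform Lopatinskii
condition fails only in the hyperbolic region, and there the Lopatinskii matrix factors as
`M [E_1 E_2] = P diag (γ + iσ, 1)` with smooth `E`, `P`, `σ`, `P` invertible and `σ` real.
Smoothness on a piece of `Σ` is smoothness of an extension to an open set. -/
structure WeaklyStable {n : ℕ} (B : Fin (n + 1) → Matrix (Fin 3) (Fin 3) ℝ)
    (M : Matrix (Fin 2) (Fin 3) ℝ) : Prop where
  no_growth : ∀ ζ ∈ freqOpen n, ∀ v ∈ stableBundle B ζ, bdryMat M *ᵥ v = 0 → v = 0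
  nonempty : (lopSet B M).Nonempty
  hyperbolic : ∀ ζ ∈ lopSet B M, InHyperbolicRegion B ζ
  factor : ∀ ζ₀ ∈ lopSet B M, ∃ O : Set (Freq n), IsOpen O ∧ ζ₀ ∈ O ∧
    ∃ (σ : Freq n → ℝ) (E : Fin 2 → Freq n → Fin 3 → ℂ) (P : Freq n → Fin 2 → Fin 2 → ℂ),
      ContDiffOn ℝ ∞ σ O ∧ (∀ i, ContDiffOn ℝ ∞ (E i) O) ∧ ContDiffOn ℝ ∞ P O ∧
      ∀ ζ ∈ O ∩ sphereHalf n,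
        LinearIndependent ℂ (fun i => E i ζ) ∧
        (Submodule.span ℂ (range fun i => E i ζ) : Set (Fin 3 → ℂ)) = stableBundle B ζ ∧
        IsUnit (Matrix.of (P ζ)).det ∧
        bdryMat M * Matrix.of (fun r i => E i ζ r)
          = Matrix.of (P ζ) * Matrix.diagonal ![((-ζ.1.im : ℝ) : ℂ) + Complex.I * (σ ζ : ℂ), 1]

/-- The real boundary frequency `(τ, η)` as an element of `ℂ × ℝⁿ`. -/
def toFreq {n : ℕ} (ξ : Fin (n + 1) → ℝ) : Freq n := ((ξ 0 : ℂ), Fin.tail ξ)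

/-- The matrices `I, B_1, …, B_{d-1}` that multiply `∂_t, ∂_{y_1}, …, ∂_{y_{d-1}}`. -/
def tanMat {n : ℕ} (B : Fin (n + 1) → Matrix (Fin 3) (Fin 3) ℝ) :
    Fin (n + 1) → Matrix (Fin 3) (Fin 3) ℝ :=
  Fin.cons 1 (fun j : Fin n => B j.castSucc)

/-- `L₀(ξ', w) = τ I + ∑_{j<d} η_j B_j + w B_d` for `ξ' = (τ, η)`. -/
def symbolL {n : ℕ} (B : Fin (n + 1) → Matrix (Fin 3) (Fin 3) ℝ) (ξ : Fin (n + 1) → ℝ) (w : ℝ) :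
    Matrix (Fin 3) (Fin 3) ℝ :=
  ∑ j, ξ j • tanMat B j + w • B (Fin.last n)

/-- The derivative `∂_{ξ_d} λ_k(η, w)` at a root `τ + λ_k(η, w) = 0`; it is the normal component
of the group velocity, and its sign says whether the phase is incoming (`> 0`) or
outgoing (`< 0`). -/
def IsNormalGroupVelocity {n : ℕ} (lam : Fin 3 → (Fin (n + 1) → ℝ) → ℝ) (ξ : Fin (n + 1) → ℝ)
    (w v : ℝ) : Prop :=
  ∃ k, ξ 0 + lam k (Fin.snoc (α := fun _ => ℝ) (Fin.tail ξ) w) = 0 ∧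
    v = fderiv ℝ (lam k) (Fin.snoc (α := fun _ => ℝ) (Fin.tail ξ) w) (Pi.single (Fin.last n) 1)

/-- The planar phase `φ_m(x) = β · x' + w x_d`, with `w = ω_m`. -/
def phase {n : ℕ} (β : Fin (n + 1) → ℝ) (w : ℝ) (z : Fin (n + 1) → ℝ) (s : ℝ) : ℝ :=
  ∑ j, β j * z j + w * s

/-- The three phases with trace `β · x'`. The functions `om m` are the smooth root branches
`ω_m(ξ')` of the dispersion relation near `β`, `r m` is a real basis vector of `ker L₀(dφ_m)`
and `ℓ m` is the dual basis. The indices `0, 1, 2` stand for the phases `φ_1, φ_2, φ_3`;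
`φ_1, φ_3` are incoming, `φ_2` is outgoing, and `N 0 φ_1 = N 1 φ_2 + N 2 φ_3` is a resonance. -/
structure IsResonantTriple {n : ℕ} (B : Fin (n + 1) → Matrix (Fin 3) (Fin 3) ℝ)
    (lam : Fin 3 → (Fin (n + 1) → ℝ) → ℝ) (β : Fin (n + 1) → ℝ)
    (om : Fin 3 → (Fin (n + 1) → ℝ) → ℝ) (r ℓ : Fin 3 → Fin 3 → ℝ) (N : Fin 3 → ℤ) : Prop where
  smooth : ∀ m, ContDiffAt ℝ ∞ (om m) β
  dispersion : ∀ m, ∀ᶠ ξ in 𝓝 β, (symbolL B ξ (om m ξ)).det = 0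
  distinct : Function.Injective fun m => om m β
  kernel : ∀ m, symbolL B β (om m β) *ᵥ r m = 0
  dual : ∀ m m', ℓ m ⬝ᵥ r m' = if m = m' then 1 else 0
  incoming_one : ∃ v > 0, IsNormalGroupVelocity lam β (om 0 β) v
  outgoing_two : ∃ v < 0, IsNormalGroupVelocity lam β (om 1 β) v
  incoming_three : ∃ v > 0, IsNormalGroupVelocity lam β (om 2 β) v
  ne_zero : N ≠ 0
  resonance : ∀ z s, (N 0 : ℝ) * phase β (om 0 β) z s
    = (N 1 : ℝ) * phase β (om 1 β) z s + (N 2 : ℝ) * phase β (om 2 β) z s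

/-- The real vectors `e` and `b` with `ker M ∩ 𝔼ˢ(β) = Span {e}` and
`M 𝔼ˢ(β) = {X : b · X = 0}`. -/
structure IsLopatinskiiPair {n : ℕ} (B : Fin (n + 1) → Matrix (Fin 3) (Fin 3) ℝ)
    (M : Matrix (Fin 2) (Fin 3) ℝ) (β : Fin (n + 1) → ℝ) (e : Fin 3 → ℝ) (b : Fin 2 → ℝ) :
    Prop where
  e_ne_zero : e ≠ 0
  b_ne_zero : b ≠ 0
  ker_eq : ∀ v : Fin 3 → ℂ, (v ∈ stableBundle B (toFreq β) ∧ bdryMat M *ᵥ v = 0) ↔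
    ∃ c : ℂ, v = fun i => c * (e i : ℂ)
  range_eq : ∀ X : Fin 2 → ℂ, (∃ v ∈ stableBundle B (toFreq β), bdryMat M *ᵥ v = X) ↔
    (fun i => (b i : ℂ)) ⬝ᵥ X = 0

/-- The projector `P_m v = (ℓ_m · v) r_m`. -/
def proj (r ℓ : Fin 3 → Fin 3 → ℝ) (m : Fin 3) (v : Fin 3 → ℝ) : Fin 3 → ℝ := (ℓ m ⬝ᵥ v) • r m

/-- The partial inverse `R_m = ∑_{k ≠ m} (ω_m - ω_k)⁻¹ P_k`. -/
def partialInv (w : Fin 3 → ℝ) (r ℓ : Fin 3 → Fin 3 → ℝ) (m : Fin 3) (v : Fin 3 → ℝ) :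
    Fin 3 → ℝ :=
  ∑ k ∈ Finset.univ.erase m, (w m - w k)⁻¹ • proj r ℓ k v

/-- The direction of the characteristic field
`X_{φ_m} = ∂_d - ∑_{j=0}^{d-1} ∂_{ξ_j} ω_m(β) ∂_j`. -/
def fieldPhase {n : ℕ} (β : Fin (n + 1) → ℝ) (om : (Fin (n + 1) → ℝ) → ℝ) : Cyl (n + 2) :=
  (atHeight (fun j => -(fderiv ℝ om β (Pi.single j 1))) 1, 0)

/-- The direction of `X_Lop = b · M ∑_{m incoming} R_m L(∂) e_m`, where
`L(∂) = ∂_d + ∑_{j<d} B_d⁻¹ B_j ∂_j` (with `B_0 = I`) and `e_m = P_m e`. The `∂_d` part is absent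
because `R_m e_m = 0`. -/
def fieldLop {n : ℕ} (B : Fin (n + 1) → Matrix (Fin 3) (Fin 3) ℝ) (M : Matrix (Fin 2) (Fin 3) ℝ)
    (w : Fin 3 → ℝ) (r ℓ : Fin 3 → Fin 3 → ℝ) (e : Fin 3 → ℝ) (b : Fin 2 → ℝ) : Cyl (n + 1) :=
  (fun j => b ⬝ᵥ (M *ᵥ ∑ m ∈ ({0, 2} : Finset (Fin 3)),
    partialInv w r ℓ m (((B (Fin.last n))⁻¹ * tanMat B j) *ᵥ proj r ℓ m e)), 0)

/-! ### The key profile subsystem -/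

/-- The `j`-th Fourier coefficient of `u(z, ·)`. -/
def coeffTheta {k : ℕ} (u : Cyl k → ℝ) (z : Fin k → ℝ) (j : ℤ) : ℂ :=
  (1 / (2 * Real.pi) : ℂ) *
    ∫ θ in (0 : ℝ)..(2 * Real.pi), (u (z, θ) : ℂ) * Complex.exp (-(Complex.I * j * θ))

/-- The preparation map `∑_j f_j e^{ijθ} ↦ ∑_j f_{jN} e^{ijNθ}` (it preserves real functions). -/
def prepare {k : ℕ} (N : ℤ) (u : Cyl k → ℝ) : Cyl k → ℝ := fun p =>
  (∑' j : ℤ, coeffTheta u p.1 (j * N) * Complex.exp (Complex.I * ((j * N : ℤ) : ℂ) * p.2)).re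

/-- The interaction integral
`∫_0^{2π} σ_{1,n₁}(x, (n₂/n₁) θ₂ + (n₃/n₁) θ₃) σ₃(x, θ₃) dθ₃`. -/
def interaction {k : ℕ} (N : Fin 3 → ℤ) (σ₁ σ₃ : Cyl k → ℝ) : Cyl k → ℝ := fun p =>
  ∫ θ in (0 : ℝ)..(2 * Real.pi),
    prepare (N 0) σ₁ (p.1, (N 1 : ℝ) / (N 0 : ℝ) * p.2 + (N 2 : ℝ) / (N 0 : ℝ) * θ) * σ₃ (p.1, θ)

/-- The unknown `V = (V', a)`, `V' = (σ₁, σ₃, τ₂)`, together with the traces of `V'`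
on `x_d = 0`. -/
structure Profile (n : ℕ) where
  sigma1 : Cyl (n + 2) → ℝ
  sigma3 : Cyl (n + 2) → ℝ
  tau2 : Cyl (n + 2) → ℝ
  a : Cyl (n + 1) → ℝ
  trSigma1 : Cyl (n + 1) → ℝ
  trSigma3 : Cyl (n + 1) → ℝ
  trTau2 : Cyl (n + 1) → ℝ

/-- `V' ∈ Hˢ(Ω_T)` and `(V'|_{x_d = 0}, a) ∈ Hˢ(bΩ_T)`. -/
structure Profile.MemSobolev {n : ℕ} (V : Profile n) (T : ℝ) (s : ℕ) : Prop where
  sigma1 : KeyProfile.MemSobolev (intDomain n T) s V.sigma1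
  sigma3 : KeyProfile.MemSobolev (intDomain n T) s V.sigma3
  tau2 : KeyProfile.MemSobolev (intDomain n T) s V.tau2
  a : KeyProfile.MemSobolev (bdryDomain n T) s V.a
  trSigma1 : KeyProfile.MemSobolev (bdryDomain n T) s V.trSigma1
  trSigma3 : KeyProfile.MemSobolev (bdryDomain n T) s V.trSigma3
  trTau2 : KeyProfile.MemSobolev (bdryDomain n T) s V.trTau2

/-- All components of `V` have zero mean in `θ`. -/
structure Profile.MeanZero {n : ℕ} (V : Profile n) (T : ℝ) : Prop where
  sigma1 : KeyProfile.MeanZero (intDomain n T) V.sigma1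
  sigma3 : KeyProfile.MeanZero (intDomain n T) V.sigma3
  tau2 : KeyProfile.MeanZero (intDomain n T) V.tau2
  a : KeyProfile.MeanZero (bdryDomain n T) V.a

/-- `V` solves the key subsystem with boundary source `g`. `X₁, X₂, X₃, XL` are the directions of
`X_{φ_1}, X_{φ_2}, X_{φ_3}, X_Lop`; `c 0, …, c 6` are the constants; `r m` and `em m` are the
vectors in `σ_m|_{x_d=0} r_m = a e_m`. -/
structure IsSolution {n : ℕ} (T : ℝ) (X₁ X₂ X₃ : Cyl (n + 2)) (XL : Cyl (n + 1)) (N : Fin 3 → ℤ)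
    (c : Fin 7 → ℝ) (r em : Fin 3 → Fin 3 → ℝ) (g : Cyl (n + 1) → ℝ) (V : Profile n) : Prop where
  /-- `X_{φ_1} σ₁ + c₁ σ₁ = 0` in `Ω_T`. -/
  eq_sigma1 : HasWeakDeriv (intDomain n T) 1 ![X₁] V.sigma1 (fun p => -(c 1 * V.sigma1 p))
  /-- `X_{φ_3} σ₃ + c₃ σ₃ = 0` in `Ω_T`. -/
  eq_sigma3 : HasWeakDeriv (intDomain n T) 1 ![X₃] V.sigma3 (fun p => -(c 3 * V.sigma3 p))
  /-- `X_{φ_2} τ₂ + c₀ τ₂ + c₂ ∫ σ_{1,n₁} σ₃ = 0` in `Ω_T`. -/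
  eq_tau2 : HasWeakDeriv (intDomain n T) 1 ![X₂] V.tau2
    (fun p => -(c 0 * V.tau2 p + c 2 * interaction N V.sigma1 V.sigma3 p))
  /-- `X_Lop a + c₄ a + c₅ ∂_θ τ₂|_{x_d=0} + c₆ ∂_θ (a²) = g` on `bΩ_T`. -/
  eq_a : ∃ w₁ w₂ w₃ : Cyl (n + 1) → ℝ,
    HasWeakDeriv (bdryDomain n T) 1 ![XL] V.a w₁ ∧
    HasWeakDeriv (bdryDomain n T) 1 ![dir none] V.trTau2 w₂ ∧
    HasWeakDeriv (bdryDomain n T) 1 ![dir none] (fun q => V.a q ^ 2) w₃ ∧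
    ∀ᵐ q ∂(cylMeasure (bdryDomain n T)),
      w₁ q + c 4 * V.a q + c 5 * w₂ q + c 6 * w₃ q = g q
  trace_sigma1 : IsTrace T V.sigma1 V.trSigma1
  trace_sigma3 : IsTrace T V.sigma3 V.trSigma3
  trace_tau2 : IsTrace T V.tau2 V.trTau2
  /-- `σ₁|_{x_d=0} r_1 = a e_1` and `σ₃|_{x_d=0} r_3 = a e_3`. -/
  boundary_sigma1 : ∀ᵐ q ∂(cylMeasure (bdryDomain n T)), V.trSigma1 q • r 0 = V.a q • em 0
  boundary_sigma3 : ∀ᵐ q ∂(cylMeasure (bdryDomain n T)), V.trSigma3 q • r 2 = V.a q • em 2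
  /-- `V = 0` in `t ≤ 0`. -/
  past_sigma1 : VanishesInPast (intDomain n T) V.sigma1
  past_sigma3 : VanishesInPast (intDomain n T) V.sigma3
  past_tau2 : VanishesInPast (intDomain n T) V.tau2
  past_a : VanishesInPast (bdryDomain n T) V.a

/-- `[ρ]`, the smallest integer greater than `ρ` (for `ρ ≥ 0`). -/
def bracket (ρ : ℝ) : ℕ := ⌊ρ⌋₊ + 1

/-- `α₀ = [(d + 1) / 2] + 1`. -/
def alphaZero (d : ℕ) : ℕ := bracket (((d : ℝ) + 1) / 2) + 1

/-- `α = 2 α₀ + 4`. -/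
def alphaReg (d : ℕ) : ℕ := 2 * alphaZero d + 4

/-- `α̃ = 2 α - α₀` (no truncation occurs, since `α₀ ≤ α`). -/
def alphaTilde (d : ℕ) : ℕ := 2 * alphaReg d - alphaZero d

end KeyProfile

end

/-!
The interior equations are solved by integration along characteristics: `σ₁`, `σ₃` are transported
from the boundary into `x_d > 0` along the incoming fields (`transport`), and `τ₂` is the integral
of the source along the outgoing field, which reaches `t ≤ 0` after a bounded length. Hence `τ₂` on
`x_d = 0` is a bilinear, causal integral operator `𝓑(a, a)` of the boundary amplitude, and only
`X_Lop a + c₄ a + c₅ ∂_θ 𝓑(a, a) + c₆ ∂_θ (a²) = g` remains to be solved.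

Two facts make this a hyperbolic equation.

* The time component of `X_Lop` is not zero (`lop_time_ne_zero`). A branch of stable eigenvectors
  over the damped frequencies, normalised at `β`, is differentiated in the damping `γ` by the implicit
  function theorem (`exists_eigen_branch`). Since the derivative of an eigenvector is a combination
  of the `R_m A₀ e_m`, the vanishing of that component would give stable vectors `W(γ)`, close to `e`,
  with `B W(γ) = o(γ)`. This is impossible since `B (E₁ E₂) = P diag(γ + iσ, 1)` and
  `|γ + iσ| ≥ γ` (`eq_zero_of_lop_factor`).
* The term `∂_θ 𝓑(a, a)` loses no derivative. By the resonance `n₁ = n₂ + n₃`, a translation of the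
  argument `θ₂` of the interaction integral can be absorbed, by changing the variable of integration,
  into a translation of either factor (`quot_eq`). So `∂_θ` may be moved to the
  factor that carries fewer derivatives, and `∂_θ 𝓑` obeys tame estimates (`IsTame`) like those of the
  Burgers term `a ∂_θ a`.

The boundary equation is solved by an explicit Lax–Friedrichs scheme with step `h` along `X_Lop`
(`SchemeData`), where `𝓑` is replaced by a Riemann sum with its own difference quotient
and `g` by mollifications. All objects are smooth and defined for all times. The argument uses only
a few properties of a norm (`IsAdmissible`), which the exponentially weighted supremum and `L²` norms
share: a small source gives a bound for derivatives of order `≤ K` in the supremum norm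
(`exists_sup_bound`), and with it derivatives of order `≤ 2K - 1` are bounded in `L²`
(`exists_l2_bound`), as in each product one factor has order `≤ K`. The smallness of `g` enters
through a Sobolev embedding into bounded functions (`sq_le_of_eLpNorm`).

The bounds are uniform in `h`, so a subsequence converges pointwise, with weak derivatives
of order `≤ 2K - 1` in the limit (`exists_weak_limit`). The difference equations pass to the weak
equations (`tendsto_quot`, `weak_eq`, `eq_tau`), and the Riemann sums to the interaction integral, whose
Fourier projection `σ_{1,n₁}` is an average over translations by `2π/n₁` (`prepare_eq_prepAvg`).
The scheme, the transport formulas and the Riemann sums preserve or asymptotically preserve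
zero mean in `θ`, which gives the last assertion.
-/

open Set Filter Topology MeasureTheory
open scoped ENNReal ContDiff Matrix Real
open ENNReal (ofReal ofReal_mul ofReal_le_ofReal ofReal_pow ofReal_ne_top ofReal_one ofReal_add ofReal_natCast)
open Finset (sum_congr mul_sum sum_le_sum sum_const sum_mul card_range sum_sub_distrib abs_sum_le_sum_abs sum_nonneg)

noncomputable section

namespace KeyProfile

local notation "bΩ" => bdryDomain
local notation "vol" => cylMeasure
local notation "Fn" k:max => Cyl k → ℝ
local notation "Pt" k:max => Fin k → ℝ

/-! ### Iterated partial derivatives and translations on the cylinder -/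

section Words
variable {k : ℕ}
variable {f g : Fn k}

/-- Derivative of `f` in the constant direction `v`. -/
def dv (v : Cyl k) (f : Fn k) : Fn k := fun p => fderiv ℝ f p v

/-- Words of coordinate directions. -/
abbrev Word (k : ℕ) : Type := List (Option (Fin k))

/-- The iterated partial derivative of `f` along a word of coordinate directions; the first letter
is the derivative taken first. -/
def dw : Word k → Fn k → Fn k
  | [], f => f
  | i :: I, f => dw I (dv (dir i) f)

/-- The derivatives of `f` of order at most `m` are bounded by `A` on `U × 𝕋`. -/
def DerivLE (U : Set (Pt k)) (m : ℕ) (f : Fn k) (A : ℝ) : Prop :=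
  ∀ I : Word k, I.length ≤ m → ∀ x : Cyl k, x.1 ∈ U → |dw I f x| ≤ A

/-- The derivatives of `f` of order at most `m` are bounded by `R` in `L²(U × 𝕋)`. -/
def DerivL2LE (U : Set (Pt k)) (m : ℕ) (f : Fn k) (R : ℝ≥0∞) : Prop :=
  ∀ I : Word k, I.length ≤ m → eLpNorm (dw I f) 2 (vol U) ≤ R

/-- Translation by `b`. -/
def shift (b : Cyl k) (f : Fn k) : Fn k := fun x => f (x + b)

/-- Smooth functions on `ℝᵏ × 𝕋`. -/
structure SmoothPer (f : Fn k) : Prop where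
  smooth : ContDiff ℝ ∞ f
  periodic : PeriodicTheta f

lemma PeriodicTheta.add_int (hf : PeriodicTheta f) (z : Pt k) (θ : ℝ) (m : ℤ) :
    f (z, θ + m * (2 * π)) = f (z, θ) := by
  have : Function.Periodic (fun θ => f (z, θ)) (2 * π) := fun θ => hf z θ
  exact this.int_mul m θ

lemma SmoothPer.continuous (hf : SmoothPer f) : Continuous f := hf.smooth.continuous

lemma SmoothPer.differentiable (hf : SmoothPer f) : Differentiable ℝ f :=
  hf.smooth.differentiable (by simp)

lemma SmoothPer.dv (hf : SmoothPer f) (v : Cyl k) : SmoothPer (dv v f) := by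
  refine ⟨?_, fun z θ => ?_⟩
  · exact (hf.smooth.fderiv_right (m := ∞) (by simp)).clm_apply contDiff_const
  · have h : (fun x => f (x + (0, 2 * π))) = f := by
      funext x; have := hf.periodic x.1 x.2; simpa [Prod.add_def] using this
    have h2 : fderiv ℝ (fun x => f (x + (0, 2 * π))) (z, θ) = fderiv ℝ f ((z, θ) + (0, 2 * π)) :=
      fderiv_comp_add_right _
    rw [h] at h2
    simp only [KeyProfile.dv]
    rw [h2]; simp

lemma SmoothPer.dw (hf : SmoothPer f) (I : Word k) : SmoothPer (dw I f) := by
  induction I generalizing f with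
  | nil => exact hf
  | cons i I ih => exact ih (hf.dv _)

lemma SmoothPer.zero : SmoothPer (fun _ : Cyl k => (0 : ℝ)) := ⟨contDiff_const, fun _ _ => rfl⟩

lemma SmoothPer.add (hf : SmoothPer f) (hg : SmoothPer g) : SmoothPer (fun x => f x + g x) :=
  ⟨hf.smooth.add hg.smooth, fun z θ => by rw [hf.periodic, hg.periodic]⟩

lemma SmoothPer.sub (hf : SmoothPer f) (hg : SmoothPer g) : SmoothPer (fun x => f x - g x) :=
  ⟨hf.smooth.sub hg.smooth, fun z θ => by rw [hf.periodic, hg.periodic]⟩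

lemma SmoothPer.mul (hf : SmoothPer f) (hg : SmoothPer g) : SmoothPer (fun x => f x * g x) :=
  ⟨hf.smooth.mul hg.smooth, fun z θ => by rw [hf.periodic, hg.periodic]⟩

lemma SmoothPer.const_mul (hf : SmoothPer f) (c : ℝ) : SmoothPer (fun x => c * f x) :=
  ⟨contDiff_const.mul hf.smooth, fun z θ => by rw [hf.periodic]⟩

lemma SmoothPer.shift (hf : SmoothPer f) (b : Cyl k) : SmoothPer (shift b f) := by
  refine ⟨hf.smooth.comp (contDiff_id.add contDiff_const), fun z θ => ?_⟩
  have := hf.periodic (z + b.1) (θ + b.2)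
  simp only [KeyProfile.shift, Prod.add_def]
  rw [← this]; congr 2; ring

lemma SmoothPer.sum {ι : Type*} {s : Finset ι} {f : ι → Fn k} (hf : ∀ i ∈ s, SmoothPer (f i)) :
    SmoothPer (fun x => ∑ i ∈ s, f i x) :=
  ⟨ContDiff.sum fun i hi => (hf i hi).smooth,
    fun z θ => sum_congr rfl fun i hi => (hf i hi).periodic z θ⟩

lemma dv_add (hf : SmoothPer f) (hg : SmoothPer g) (v : Cyl k) :
    dv v (fun x => f x + g x) = fun x => dv v f x + dv v g x := by
  funext x
  simp only [dv]
  rw [fderiv_fun_add (hf.differentiable x) (hg.differentiable x)]; rfl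

lemma dv_mul (hf : SmoothPer f) (hg : SmoothPer g) (v : Cyl k) :
    dv v (fun x => f x * g x) = fun x => dv v f x * g x + f x * dv v g x := by
  funext x
  simp only [dv]
  rw [fderiv_fun_mul (hf.differentiable x) (hg.differentiable x)]
  simp; ring

lemma dv_const_mul (hf : SmoothPer f) (c : ℝ) (v : Cyl k) :
    dv v (fun x => c * f x) = fun x => c * dv v f x := by
  funext x
  simp only [dv]
  rw [fderiv_const_mul (hf.differentiable x)]; simp

lemma dv_zero (v : Cyl k) : dv v (fun _ => 0) = fun _ => 0 := by funext x; simp [dv]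

lemma dv_shift (f : Fn k) (b v : Cyl k) : dv v (shift b f) = shift b (dv v f) := by
  funext x
  show fderiv ℝ (fun y => f (y + b)) x v = fderiv ℝ f (x + b) v
  rw [fderiv_comp_add_right]

lemma dw_add (hf : SmoothPer f) (hg : SmoothPer g) (I : Word k) :
    dw I (fun x => f x + g x) = fun x => dw I f x + dw I g x := by
  induction I generalizing f g with
  | nil => rfl
  | cons i I ih => simp only [dw]; rw [dv_add hf hg, ih (hf.dv _) (hg.dv _)]

lemma dw_const_mul (hf : SmoothPer f) (c : ℝ) (I : Word k) :
    dw I (fun x => c * f x) = fun x => c * dw I f x := by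
  induction I generalizing f with
  | nil => rfl
  | cons i I ih => simp only [dw]; rw [dv_const_mul hf, ih (hf.dv _)]

lemma dw_zero (I : Word k) : dw I (fun _ => (0 : ℝ)) = fun _ => 0 := by
  induction I with
  | nil => rfl
  | cons i I ih => simp only [dw]; rw [dv_zero, ih]

lemma dw_sub (hf : SmoothPer f) (hg : SmoothPer g) (I : Word k) :
    dw I (fun x => f x - g x) = fun x => dw I f x - dw I g x := by
  have h : (fun x => f x - g x) = fun x => f x + (-1) * g x := by funext x; ring
  rw [h, dw_add hf (hg.const_mul _), dw_const_mul hg]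
  funext x; ring

lemma dw_shift (f : Fn k) (b : Cyl k) (I : Word k) : dw I (shift b f) = shift b (dw I f) := by
  induction I generalizing f with
  | nil => rfl
  | cons i I ih => simp only [dw]; rw [dv_shift, ih]

lemma dw_sum {ι : Type*} {s : Finset ι} {f : ι → Fn k} (hf : ∀ i ∈ s, SmoothPer (f i))
    (I : Word k) :
    dw I (fun x => ∑ i ∈ s, f i x) = fun x => ∑ i ∈ s, dw I (f i) x := by
  classical
  induction s using Finset.induction_on with
  | empty => simpa using dw_zero I
  | insert a s ha ih =>
    have h1 : (fun x => ∑ i ∈ insert a s, f i x) = fun x => f a x + ∑ i ∈ s, f i x := by grind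
    rw [h1, dw_add (hf a (by simp)) (SmoothPer.sum fun i hi => hf i (by simp [hi])),
      ih fun i hi => hf i (by simp [hi])]
    funext x; rw [Finset.sum_insert ha]

/-- Derivatives are local. -/
lemma dw_congr_open {O : Set (Cyl k)} (hO : IsOpen O) (h : EqOn f g O)
    (I : Word k) : EqOn (dw I f) (dw I g) O := by
  induction I generalizing f g with
  | nil => exact h
  | cons i I ih =>
    refine ih fun x hx => ?_
    have : f =ᶠ[𝓝 x] g := by filter_upwards [hO.mem_nhds hx] with y hy using h hy
    simp only [dv]; rw [this.fderiv_eq]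

/-- The ways of splitting a word into a pair of complementary subwords of which the first is
nonempty. -/
def splits {α : Type*} : List α → List (List α × List α)
  | [] => []
  | i :: I => (splits I).map (fun s => (s.1, i :: s.2)) ++
      ([i], I) :: (splits I).map (fun s => (i :: s.1, s.2))

lemma length_splits_le {α : Type*} (I : List α) : (splits I).length + 1 = 2 ^ I.length := by
  induction I with
  | nil => simp [splits]
  | cons i I ih => simp [splits, pow_succ]; omega

lemma mem_splits {α : Type*} {I : List α} {s : List α × List α} (h : s ∈ splits I) :
    s.1.length + s.2.length = I.length ∧ 1 ≤ s.1.length := by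
  induction I generalizing s with
  | nil => simp [splits] at h
  | cons i I ih =>
    simp only [splits, List.mem_append, List.mem_map, List.mem_cons] at h
    rcases h with ⟨a, ha, rfl⟩ | rfl | ⟨a, ha, rfl⟩
    · have := ih ha; simp; omega
    · simp; omega
    · have := ih ha; simp; omega

lemma SmoothPer.list_sum {ι : Type*} {l : List ι} {f : ι → Fn k}
    (hf : ∀ i ∈ l, SmoothPer (f i)) : SmoothPer (fun x => (l.map fun i => f i x).sum) := by
  induction l with
  | nil => simpa using SmoothPer.zero
  | cons i l ih => simpa using (hf i (by simp)).add (ih fun j hj => hf j (by simp [hj]))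

/-- A bilinear operation on smooth functions that satisfies the Leibniz rule for every partial
derivative. -/
structure IsLeibniz (E : Fn k → Fn k → Fn k) : Prop where
  smooth : ∀ {u v}, SmoothPer u → SmoothPer v → SmoothPer (E u v)
  dv_eq : ∀ {u v} (i : Option (Fin k)), SmoothPer u → SmoothPer v →
    dv (dir i) (E u v) = fun x => E (dv (dir i) u) v x + E u (dv (dir i) v) x

/-- The iterated Leibniz rule. -/
lemma IsLeibniz.dw_eq {E : Fn k → Fn k → Fn k} (hE : IsLeibniz E)
    {u v : Fn k} (hu : SmoothPer u) (hv : SmoothPer v) (I : Word k) :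
    dw I (E u v) = fun x => E u (dw I v) x +
      ((splits I).map fun s => E (dw s.1 u) (dw s.2 v) x).sum := by
  induction I generalizing u v with
  | nil => funext x; simp [dw, splits]
  | cons i I ih =>
    simp only [dw]
    rw [hE.dv_eq i hu hv, dw_add (hE.smooth (hu.dv _) hv) (hE.smooth hu (hv.dv _)),
      ih (hu.dv _) hv, ih hu (hv.dv _)]
    funext x
    simp only [splits, List.map_append, List.map_map, List.map_cons, List.sum_append,
      List.sum_cons, Function.comp_def, dw]
    ring

lemma isLeibniz_mul : IsLeibniz (k := k) (fun u v x => u x * v x) :=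
  ⟨fun hu hv => hu.mul hv, fun _ hu hv => dv_mul hu hv _⟩

lemma IsLeibniz.comp {E : Fn k → Fn k → Fn k} (hE : IsLeibniz E)
    {A B : Fn k → Fn k} (hA : ∀ {u}, SmoothPer u → SmoothPer (A u))
    (hB : ∀ {u}, SmoothPer u → SmoothPer (B u))
    (hA' : ∀ {u} (i : Option (Fin k)), SmoothPer u → dv (dir i) (A u) = A (dv (dir i) u))
    (hB' : ∀ {u} (i : Option (Fin k)), SmoothPer u → dv (dir i) (B u) = B (dv (dir i) u)) :
    IsLeibniz (fun u v => E (A u) (B v)) :=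
  ⟨fun hu hv => hE.smooth (hA hu) (hB hv), fun i hu hv => by
    rw [hE.dv_eq i (hA hu) (hB hv), hA' i hu, hB' i hv]⟩

lemma IsLeibniz.const_mul {E : Fn k → Fn k → Fn k} (hE : IsLeibniz E) (c : ℝ) :
    IsLeibniz (fun u v x => c * E u v x) :=
  ⟨fun hu hv => (hE.smooth hu hv).const_mul c, fun i hu hv => by
    rw [dv_const_mul (hE.smooth hu hv), hE.dv_eq i hu hv]; funext x; ring⟩

lemma IsLeibniz.sum {ι : Type*} {s : Finset ι} {E : ι → Fn k → Fn k → Fn k}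
    (hE : ∀ i ∈ s, IsLeibniz (E i)) : IsLeibniz (fun u v x => ∑ i ∈ s, E i u v x) :=
  ⟨fun hu hv => SmoothPer.sum fun i hi => (hE i hi).smooth hu hv, fun j hu hv => by
    have := dw_sum (s := s) (f := fun i => E i _ _) (fun i hi => (hE i hi).smooth hu hv) [j]
    simp only [dw] at this
    rw [this]; funext x
    rw [← Finset.sum_add_distrib]
    exact sum_congr rfl fun i hi => by rw [(hE i hi).dv_eq j hu hv]⟩

/-- Difference bounds from a bound on the `θ`-derivative. -/
lemma abs_sub_le_of_dv_theta (hf : SmoothPer f) {S : ℝ} {z : Pt k}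
    (h : ∀ θ, |dv (dir none) f (z, θ)| ≤ S) (θ θ' : ℝ) :
    |f (z, θ') - f (z, θ)| ≤ S * |θ' - θ| := by
  have hd : ∀ t, HasDerivAt (fun t => f (z, t)) (dv (dir none) f (z, t)) t := by
    intro t
    have h1 := (hf.differentiable (z, t)).hasFDerivAt
    have h2 : HasDerivAt (fun t : ℝ => ((z, t) : Cyl k)) (0, 1) t :=
      (hasDerivAt_const t z).prodMk (hasDerivAt_id t)
    exact h1.comp_hasDerivAt t h2
  have := Convex.norm_image_sub_le_of_norm_hasDerivWithin_le (s := univ) (C := S)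
    (f := fun t => f (z, t)) (fun t _ => (hd t).hasDerivWithinAt) (fun t _ => h t) convex_univ
    (mem_univ θ) (mem_univ θ')
  simpa using this

end Words

/-! ### Integration over one period -/

section Cell
variable {k : ℕ}
variable {F f u : Fn k} {U K : Set (Pt k)} {C : ℝ}

lemma lintegral_period_add {F : ℝ → ℝ≥0∞} (hF : Function.Periodic F (2 * π)) (c : ℝ) :
    ∫⁻ θ in Ioo 0 (2 * π), F (θ + c) = ∫⁻ θ in Ioo 0 (2 * π), F θ := by
  have hp : (0 : ℝ) < 2 * π := Real.two_pi_pos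
  have e1 : ∫⁻ θ in Ioo 0 (2 * π), F (θ + c) = ∫⁻ θ in Ioc c (c + 2 * π), F θ := by
    rw [restrict_Ioo_eq_restrict_Ioc, ← lintegral_indicator measurableSet_Ioc,
      ← lintegral_indicator measurableSet_Ioc]
    conv_rhs => rw [← lintegral_add_right_eq_self _ c]
    refine lintegral_congr fun θ => ?_
    simp only [indicator, mem_Ioc]
    congr 1
    apply propext; constructor <;> rintro ⟨h1, h2⟩ <;> constructor <;> linarith
  rw [e1, restrict_Ioo_eq_restrict_Ioc]
  have h1 := isAddFundamentalDomain_Ioc (μ := volume) hp c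
  have h2 := isAddFundamentalDomain_Ioc (μ := volume) hp 0
  rw [zero_add] at h2
  refine h1.setLIntegral_eq h2 F ?_
  rintro ⟨g, hg⟩ x
  obtain ⟨m, rfl⟩ := AddSubgroup.mem_zmultiples_iff.1 hg
  have := hF.zsmul m x
  rw [AddSubgroup.vadd_def, vadd_eq_add, add_comm]
  exact this

/-- Translation by `b` on `ℝᵏ × 𝕋`, in the fundamental cell. -/
def wrap (b : Cyl k) (x : Cyl k) : Cyl k := (x.1 + b.1, 2 * π * Int.fract ((x.2 + b.2) / (2 * π)))

lemma wrap_apply {α : Type*} {F : Cyl k → α} (hF : ∀ z θ, F (z, θ + 2 * π) = F (z, θ))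
    (b x : Cyl k) : F (wrap b x) = F (x + b) := by
  have h : Function.Periodic (fun θ => F (x.1 + b.1, θ)) (2 * π) := fun θ => hF _ θ
  have h2 := h.int_mul ⌊(x.2 + b.2) / (2 * π)⌋ (2 * π * Int.fract ((x.2 + b.2) / (2 * π)))
  have h3 : 2 * π * Int.fract ((x.2 + b.2) / (2 * π)) +
      (⌊(x.2 + b.2) / (2 * π)⌋ : ℝ) * (2 * π) = x.2 + b.2 := by
    have := Int.fract_add_floor ((x.2 + b.2) / (2 * π))
    have hp : (2 * π) ≠ 0 := Real.two_pi_pos.ne'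
    calc _ = 2 * π * (Int.fract ((x.2 + b.2) / (2 * π)) + ⌊(x.2 + b.2) / (2 * π)⌋) := by ring
      _ = _ := by rw [this]; field_simp
  rw [h3] at h2
  exact h2.symm

lemma cylMeasure_eq_prod (U : Set (Pt k)) :
    vol U = (volume.restrict U).prod (volume.restrict (Ioo 0 (2 * π))) := by
  rw [cylMeasure, Measure.prod_restrict]; rfl

lemma cylMeasure_eq_restrict (U : Set (Pt k)) (hU : MeasurableSet U) :
    vol U = (vol univ).restrict (U ×ˢ univ) := by
  rw [cylMeasure, cylMeasure, Measure.restrict_restrict (hU.prod MeasurableSet.univ)]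
  congr 1; ext x; simp [and_comm]

/-- `wrap b` permutes the pieces of `(0, 2π)` on both sides of the point that is moved to `0`. -/
lemma measurePreserving_wrap (b : Cyl k) :
    MeasurePreserving (wrap b) (vol (univ : Set (Pt k))) (vol univ) := by
  rw [cylMeasure_eq_prod, Measure.restrict_univ]
  have h1 : MeasurePreserving (fun z : Pt k => z + b.1) volume volume :=
    measurePreserving_add_right volume b.1
  have hm : Measurable (fun θ : ℝ => 2 * π * Int.fract ((θ + b.2) / (2 * π))) :=
    (measurable_fract.comp ((measurable_id.add_const b.2).div_const (2 * π))).const_mul (2 * π)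
  have h2 : MeasurePreserving (fun θ : ℝ => 2 * π * Int.fract ((θ + b.2) / (2 * π)))
      (volume.restrict (Ioo 0 (2 * π))) (volume.restrict (Ioo 0 (2 * π))) := by
    refine ⟨hm, Measure.ext fun s hs => ?_⟩
    rw [← lintegral_indicator_one hs, lintegral_map (measurable_one.indicator hs) hm]
    have hper : Function.Periodic (fun θ => s.indicator (1 : ℝ → ℝ≥0∞)
        (2 * π * Int.fract (θ / (2 * π)))) (2 * π) := by
      intro θ
      have : (θ + 2 * π) / (2 * π) = θ / (2 * π) + 1 := by
        have hp : (2 * π) ≠ 0 := Real.two_pi_pos.ne'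
        field_simp
      simp only [this, Int.fract_add_one]
    have := lintegral_period_add hper b.2
    rw [this, ← lintegral_indicator_one (μ := volume.restrict (Ioo 0 (2 * π))) hs]
    refine lintegral_congr_ae ?_
    filter_upwards [ae_restrict_mem measurableSet_Ioo] with θ hθ
    have hp := Real.two_pi_pos
    have : Int.fract (θ / (2 * π)) = θ / (2 * π) := by
      rw [Int.fract_eq_self]
      exact ⟨div_nonneg hθ.1.le hp.le, (div_lt_one hp).2 hθ.2⟩
    simp only [this]
    congr 1; field_simp
  exact h1.prod h2

lemma lintegral_cyl_shift {F : Cyl k → ℝ≥0∞} (hm : Measurable F)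
    (hF : ∀ z θ, F (z, θ + 2 * π) = F (z, θ)) (b : Cyl k) :
    ∫⁻ x, F (x + b) ∂vol univ = ∫⁻ x, F x ∂vol univ := by
  rw [← (measurePreserving_wrap b).lintegral_comp hm]
  exact lintegral_congr fun x => (wrap_apply hF b x).symm

lemma integral_cyl_shift (hm : AEStronglyMeasurable F (vol univ))
    (hF : PeriodicTheta F) (b : Cyl k) :
    ∫ x, F (x + b) ∂vol univ = ∫ x, F x ∂vol univ := by
  have h := measurePreserving_wrap b
  have h2 : ∫ x, F x ∂vol univ = ∫ x, F (wrap b x) ∂vol univ := by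
    conv_lhs => rw [← h.map_eq]
    refine integral_map h.measurable.aemeasurable ?_
    rw [h.map_eq]; exact hm
  rw [h2]
  exact integral_congr_ae (ae_of_all _ fun x => (wrap_apply hF b x).symm)

lemma eLpNorm_cyl_shift (hm : AEStronglyMeasurable F (vol univ))
    (hF : PeriodicTheta F) (b : Cyl k) (p : ℝ≥0∞) :
    eLpNorm (shift b F) p (vol univ) = eLpNorm F p (vol univ) := by
  rw [← eLpNorm_comp_measurePreserving hm (measurePreserving_wrap b)]
  congr 1; funext x; exact (wrap_apply hF b x).symm

lemma eLpNorm_cyl_eq_indicator (U : Set (Pt k)) (hU : MeasurableSet U) (F : Fn k)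
    (p : ℝ≥0∞) : eLpNorm F p (vol U) = eLpNorm ((U ×ˢ univ).indicator F) p (vol univ) := by
  rw [cylMeasure_eq_restrict U hU, eLpNorm_indicator_eq_eLpNorm_restrict (hU.prod MeasurableSet.univ)]

/-- Translations that map `U` into `U'` do not increase norms. -/
lemma eLpNorm_shift_le {U' : Set (Pt k)} (hU : MeasurableSet U) (hU' : MeasurableSet U')
    (hm : Measurable F) (hF : PeriodicTheta F) {b : Cyl k}
    (hb : ∀ z ∈ U, z + b.1 ∈ U') (p : ℝ≥0∞) :
    eLpNorm (shift b F) p (vol U) ≤ eLpNorm F p (vol U') := by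
  rw [eLpNorm_cyl_eq_indicator U hU, eLpNorm_cyl_eq_indicator U' hU',
    ← eLpNorm_cyl_shift (hm.indicator (hU'.prod MeasurableSet.univ)).aestronglyMeasurable ?_ b]
  · refine eLpNorm_mono fun x => ?_
    by_cases hx : x.1 ∈ U
    · have h1 : x ∈ U ×ˢ (univ : Set ℝ) := ⟨hx, mem_univ _⟩
      have h2 : x + b ∈ U' ×ˢ (univ : Set ℝ) := ⟨hb _ hx, mem_univ _⟩
      rw [indicator_of_mem h1]
      simp only [shift]
      rw [indicator_of_mem h2]
    · have h1 : x ∉ U ×ˢ (univ : Set ℝ) := fun h => hx h.1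
      rw [indicator_of_notMem h1]; simp
  · intro z θ
    simp only [indicator, mem_prod, mem_univ, and_true]
    by_cases hz : z ∈ U' <;> simp [hz, hF z θ]

/-- Continuous functions are bounded by their values over a period. -/
lemma exists_bound_of_compact (hf : Continuous f) (hp : PeriodicTheta f)
    (hK : IsCompact K) (h0 : ∀ z ∉ K, ∀ θ, f (z, θ) = 0) :
    ∃ C, 0 ≤ C ∧ ∀ x, |f x| ≤ C := by
  obtain ⟨C, hC⟩ := (hK.prod (isCompact_Icc (a := (0 : ℝ)) (b := 2 * π))).exists_bound_of_continuousOn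
    hf.continuousOn
  refine ⟨max C 0, le_max_right _ _, fun x => ?_⟩
  by_cases hx : x.1 ∈ K
  · have h := wrap_apply (F := f) hp 0 x
    rw [add_zero] at h
    rw [← h]
    refine le_trans (hC _ ⟨by simpa [wrap] using hx, ?_⟩) (le_max_left _ _)
    have h1 := Int.fract_nonneg ((x.2 + (0 : Cyl k).2) / (2 * π))
    have h2 := (Int.fract_lt_one ((x.2 + (0 : Cyl k).2) / (2 * π))).le
    have hp := Real.two_pi_pos
    exact ⟨mul_nonneg hp.le h1, by simpa [wrap] using mul_le_of_le_one_right hp.le h2⟩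
  · rw [h0 x.1 hx x.2]; simp

/-- Smooth functions on `ℝᵏ × 𝕋` of compact support. -/
structure CptSmooth (f : Fn k) (K : Set (Pt k)) : Prop extends SmoothPer f where
  compact : IsCompact K
  support : ∀ z ∉ K, ∀ θ, f (z, θ) = 0

lemma IsTest.cptSmooth (h : IsTest U f) : ∃ K, CptSmooth f K ∧ K ⊆ U := by
  obtain ⟨K, hK, hKU, h0⟩ := h.support
  exact ⟨K, ⟨⟨h.smooth, h.periodic⟩, hK, h0⟩, hKU⟩

lemma CptSmooth.isTest (h : CptSmooth f K) (hK : K ⊆ U) :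
    IsTest U f := ⟨h.smooth, h.periodic, K, h.compact, hK, h.support⟩

lemma CptSmooth.dv (h : CptSmooth f K) (v : Cyl k) : CptSmooth (dv v f) K := by
  refine ⟨h.toSmoothPer.dv v, h.compact, fun z hz θ => ?_⟩
  have : f =ᶠ[𝓝 (z, θ)] fun _ => 0 := by
    have : (Kᶜ ×ˢ (univ : Set ℝ)) ∈ 𝓝 (z, θ) :=
      prod_mem_nhds (h.compact.isClosed.isOpen_compl.mem_nhds hz) univ_mem
    filter_upwards [this] with x hx using h.support x.1 hx.1 x.2
  simp only [KeyProfile.dv]; rw [this.fderiv_eq]; simp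

lemma CptSmooth.bound (h : CptSmooth f K) : ∃ C, 0 ≤ C ∧ ∀ x, |f x| ≤ C :=
  exists_bound_of_compact h.continuous h.periodic h.compact h.support

lemma CptSmooth.mul {g : Fn k} (hg : SmoothPer g) (h : CptSmooth f K) :
    CptSmooth (fun x => g x * f x) K :=
  ⟨hg.mul h.toSmoothPer, h.compact, fun z hz θ => by rw [h.support z hz, mul_zero]⟩

lemma CptSmooth.lipschitz (h : CptSmooth f K) : ∃ C, 0 ≤ C ∧ ∀ x y, |f x - f y| ≤ C * ‖x - y‖ := by
  have hc : Continuous fun x => ‖fderiv ℝ f x‖ := (h.smooth.continuous_fderiv (by simp)).norm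
  have hper : PeriodicTheta fun x => ‖fderiv ℝ f x‖ := by
    intro z θ
    have h1 : (fun x => f (x + (0, 2 * π))) = f := by
      funext x; have := h.periodic x.1 x.2; simpa [Prod.add_def] using this
    have h2 : fderiv ℝ (fun x => f (x + (0, 2 * π))) (z, θ) = fderiv ℝ f ((z, θ) + (0, 2 * π)) :=
      fderiv_comp_add_right _
    rw [h1] at h2
    show ‖fderiv ℝ f (z, θ + 2 * π)‖ = ‖fderiv ℝ f (z, θ)‖
    rw [h2]; simp
  obtain ⟨C, hC0, hC⟩ := exists_bound_of_compact hc hper h.compact fun z hz θ => by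
    have : f =ᶠ[𝓝 (z, θ)] fun _ => 0 := by
      have : (Kᶜ ×ˢ (univ : Set ℝ)) ∈ 𝓝 (z, θ) :=
        prod_mem_nhds (h.compact.isClosed.isOpen_compl.mem_nhds hz) univ_mem
      filter_upwards [this] with x hx using h.support x.1 hx.1 x.2
    rw [this.fderiv_eq]; simp
  refine ⟨C, hC0, fun x y => ?_⟩
  have := Convex.norm_image_sub_le_of_norm_fderiv_le (s := univ) (C := C) (f := f) (𝕜 := ℝ)
    (fun x _ => h.toSmoothPer.differentiable x) (fun x _ => by simpa using hC x) convex_univ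
    (mem_univ y) (mem_univ x)
  simpa using this

lemma cylMeasure_compact_lt_top (hK : IsCompact K) (U : Set (Pt k)) :
    vol U (K ×ˢ univ) < ⊤ := by
  calc vol U (K ×ˢ univ) ≤ (volume.restrict (univ ×ˢ Ioo 0 (2 * π))) (K ×ˢ univ) :=
        Measure.restrict_mono (prod_mono (subset_univ _) le_rfl) le_rfl _
    _ = volume ((K ×ˢ univ) ∩ (univ ×ˢ Ioo 0 (2 * π))) := by
        rw [Measure.restrict_apply (hK.measurableSet.prod MeasurableSet.univ)]
    _ ≤ volume (K ×ˢ Icc 0 (2 * π)) := measure_mono fun x hx => ⟨hx.1.1, Ioo_subset_Icc_self hx.2.2⟩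
    _ < ⊤ := (hK.prod isCompact_Icc).measure_lt_top

/-- Dominated convergence for uniformly bounded functions supported in a fixed compact set. -/
lemma tendsto_integral_cyl (hK : IsCompact K) {F : ℕ → Fn k}
    {G : Fn k} (hm : ∀ j, AEStronglyMeasurable (F j) (vol U))
    (hC : ∀ j, ∀ᵐ x ∂vol U, |F j x| ≤ C) (h0 : ∀ j, ∀ z ∉ K, ∀ θ, F j (z, θ) = 0)
    (hlim : ∀ᵐ x ∂vol U, Tendsto (fun j => F j x) atTop (𝓝 (G x))) :
    Tendsto (fun j => ∫ x, F j x ∂vol U) atTop (𝓝 (∫ x, G x ∂vol U)) := by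
  refine tendsto_integral_of_dominated_convergence ((K ×ˢ univ).indicator fun _ => |C|) hm ?_ ?_ hlim
  · rw [integrable_indicator_iff (hK.measurableSet.prod MeasurableSet.univ)]
    exact integrableOn_const (cylMeasure_compact_lt_top hK U).ne
  · intro j
    filter_upwards [hC j] with x hx
    by_cases h : x.1 ∈ K
    · rw [indicator_of_mem (show x ∈ K ×ˢ univ from ⟨h, mem_univ _⟩)]
      exact hx.trans (le_abs_self C)
    · rw [indicator_of_notMem (fun h' => h h'.1), h0 j x.1 h x.2]; simp

lemma integrable_cyl_of_bound (hK : IsCompact K)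
    (hm : AEStronglyMeasurable F (vol U)) (hC : ∀ᵐ x ∂vol U, |F x| ≤ C)
    (h0 : ∀ z ∉ K, ∀ θ, F (z, θ) = 0) : Integrable F (vol U) := by
  refine Integrable.mono' (g := (K ×ˢ univ).indicator fun _ => |C|) ?_ hm ?_
  · rw [integrable_indicator_iff (hK.measurableSet.prod MeasurableSet.univ)]
    exact integrableOn_const (cylMeasure_compact_lt_top hK U).ne
  · filter_upwards [hC] with x hx
    by_cases h : x.1 ∈ K
    · rw [indicator_of_mem (show x ∈ K ×ˢ univ from ⟨h, mem_univ _⟩)]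
      exact hx.trans (le_abs_self C)
    · rw [indicator_of_notMem (fun h' => h h'.1), h0 x.1 h x.2]; simp

lemma CptSmooth.integrable (h : CptSmooth f K) (U : Set (Pt k)) : Integrable f (vol U) := by
  obtain ⟨C, -, hC⟩ := h.bound
  exact integrable_cyl_of_bound h.compact h.continuous.aestronglyMeasurable (ae_of_all _ hC) h.support

/-- Difference quotients of a smooth function converge to the derivative. -/
lemma tendsto_slope_dv (hf : SmoothPer f) (v x : Cyl k) {s : ℕ → ℝ}
    (hs : Tendsto s atTop (𝓝[≠] 0)) :
    Tendsto (fun j => (f (x + s j • v) - f x) / s j) atTop (𝓝 (KeyProfile.dv v f x)) := by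
  have h1 : HasDerivAt (fun t : ℝ => f (x + t • v)) (KeyProfile.dv v f x) 0 := by
    have h2 : HasDerivAt (fun t : ℝ => x + t • v) v 0 := by
      simpa using ((hasDerivAt_id (0 : ℝ)).smul_const v).const_add x
    have h3 : HasFDerivAt f (fderiv ℝ f x) (x + (0 : ℝ) • v) := by
      simpa using (hf.differentiable x).hasFDerivAt
    exact h3.comp_hasDerivAt 0 h2
  have := (hasDerivAt_iff_tendsto_slope.1 h1).comp hs
  refine this.congr fun j => ?_
  simp [slope_def_field]

lemma integral_dv_eq_zero (h : CptSmooth f K) (v : Cyl k) :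
    ∫ x, KeyProfile.dv v f x ∂vol univ = 0 := by
  obtain ⟨L, hL0, hL⟩ := h.lipschitz
  have hs : Tendsto (fun j : ℕ => 1 / ((j : ℝ) + 1)) atTop (𝓝[≠] 0) :=
    tendsto_nhdsWithin_iff.2 ⟨tendsto_one_div_add_atTop_nhds_zero_nat,
      Eventually.of_forall fun j => by simp only [mem_compl_iff, mem_singleton_iff]; positivity⟩
  set s : ℕ → ℝ := fun j => 1 / ((j : ℝ) + 1) with hsdef
  have hs0 : ∀ j, 0 < s j := fun j => by simp only [hsdef]; positivity
  have hs1 : ∀ j, s j ≤ 1 := fun j => by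
    simp only [hsdef]; rw [div_le_one (by positivity)]; linarith [(Nat.cast_nonneg j : (0:ℝ) ≤ j)]
  -- a compact set that contains the supports of all the difference quotients
  set K' : Set (Pt k) := (fun p : ℝ × (Pt k) => p.2 - p.1 • v.1) '' (Icc 0 1 ×ˢ K) with hK'
  have hK'c : IsCompact K' := (isCompact_Icc.prod h.compact).image (by fun_prop)
  have key := tendsto_integral_cyl (U := univ) hK'c (F := fun j x => (f (x + s j • v) - f x) / s j)
    (C := L * ‖v‖) (G := KeyProfile.dv v f) ?_ ?_ ?_ ?_
  · refine tendsto_nhds_unique key ?_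
    have : ∀ j, ∫ x, (f (x + s j • v) - f x) / s j ∂vol univ = 0 := by
      intro j
      have hi : Integrable f (vol univ) := h.integrable univ
      have hi2 : Integrable (fun x => f (x + s j • v)) (vol univ) := by
        have hh := h.toSmoothPer.shift (s j • v)
        obtain ⟨C, -, hC⟩ := h.bound
        refine integrable_cyl_of_bound hK'c hh.continuous.aestronglyMeasurable
          (ae_of_all _ fun x => hC _) fun z hz θ => ?_
        refine h.support _ (fun hz' => hz ⟨(s j, z + s j • v.1), ⟨⟨(hs0 j).le, hs1 j⟩, hz'⟩, by simp⟩) _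
      rw [integral_div, integral_sub hi2 hi,
        integral_cyl_shift h.continuous.aestronglyMeasurable h.periodic]
      simp
    simp [this]
  · intro j
    have hh := h.toSmoothPer.shift (s j • v)
    exact ((hh.continuous.sub h.continuous).div_const _).aestronglyMeasurable
  · intro j
    refine ae_of_all _ fun x => ?_
    rw [abs_div, abs_of_pos (hs0 j), div_le_iff₀ (hs0 j)]
    have := hL (x + s j • v) x
    rw [add_sub_cancel_left, norm_smul, Real.norm_eq_abs, abs_of_pos (hs0 j)] at this
    linarith
  · intro j z hz θ
    have h1 : f ((z, θ) + s j • v) = 0 := by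
      refine h.support _ (fun hz' => hz ⟨(s j, z + s j • v.1), ⟨⟨(hs0 j).le, hs1 j⟩, hz'⟩, by simp⟩) _
    have h2 : f (z, θ) = 0 := by
      by_cases hz2 : z ∈ K
      · exact absurd ⟨(0, z), ⟨⟨le_rfl, zero_le_one⟩, hz2⟩, by simp⟩ hz
      · exact h.support z hz2 θ
    show (f ((z, θ) + s j • v) - f (z, θ)) / s j = 0
    rw [h1, h2]; simp
  · exact ae_of_all _ fun x => tendsto_slope_dv h.toSmoothPer v x hs

/-- Integration by parts on `ℝᵏ × 𝕋`. -/
lemma integral_mul_dv (hu : SmoothPer u) (h : CptSmooth f K) (v : Cyl k) :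
    ∫ x, u x * KeyProfile.dv v f x ∂vol univ = - ∫ x, KeyProfile.dv v u x * f x ∂vol univ := by
  have h0 := integral_dv_eq_zero (h.mul hu) v
  rw [dv_mul hu h.toSmoothPer, integral_add] at h0
  · linarith
  · exact (CptSmooth.mul (hu.dv v) h).integrable _
  · exact (CptSmooth.mul hu (h.dv v)).integrable _

lemma integral_cyl_eq_univ (hU : MeasurableSet U) (hK : K ⊆ U) (h0 : ∀ z ∉ K, ∀ θ, F (z, θ) = 0) :
    ∫ x, F x ∂vol U = ∫ x, F x ∂vol univ := by
  rw [cylMeasure_eq_restrict U hU]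
  refine setIntegral_eq_integral_of_forall_compl_eq_zero fun x hx => ?_
  exact h0 x.1 (fun h => hx ⟨hK h, mem_univ _⟩) x.2

lemma iteratedFDeriv_eq_dv (hf : ContDiff ℝ ∞ f) (m : ℕ) (v : Fin (m + 1) → Cyl k) :
    (fun p => iteratedFDeriv ℝ (m + 1) f p v) =
      KeyProfile.dv (v 0) (fun p => iteratedFDeriv ℝ m f p (Fin.tail v)) := by
  funext p
  rw [iteratedFDeriv_succ_apply_left]
  simp only [KeyProfile.dv]
  have hd : DifferentiableAt ℝ (iteratedFDeriv ℝ m f) p :=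
    (hf.differentiable_iteratedFDeriv (by exact_mod_cast WithTop.coe_lt_top m)) p
  have := fderiv_continuousMultilinear_apply_const hd (Fin.tail v)
  rw [this]; rfl

lemma CptSmooth.iteratedFDeriv (h : CptSmooth f K) (m : ℕ)
    (v : Fin m → Cyl k) : CptSmooth (fun p => iteratedFDeriv ℝ m f p v) K := by
  induction m with
  | zero => simpa using h
  | succ m ih => rw [iteratedFDeriv_eq_dv h.smooth]; exact (ih _).dv _

/-- The word of a finite family of directions. -/
def word {m : ℕ} (I : Fin m → Option (Fin k)) : Word k := List.ofFn I

lemma integral_mul_iteratedFDeriv (hu : SmoothPer u)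
    (h : CptSmooth f K) (m : ℕ) (I : Fin m → Option (Fin k)) :
    ∫ x, u x * _root_.iteratedFDeriv ℝ m f x (fun j => dir (I j)) ∂vol univ =
      (-1) ^ m * ∫ x, KeyProfile.dw (word I) u x * f x ∂vol univ := by
  induction m generalizing u with
  | zero => simp [word, KeyProfile.dw]
  | succ m ih =>
    have e := iteratedFDeriv_eq_dv h.smooth m (fun j => dir (I j))
    have e' : ∀ x, _root_.iteratedFDeriv ℝ (m + 1) f x (fun j => dir (I j)) =
      KeyProfile.dv (dir (I 0)) (fun p => _root_.iteratedFDeriv ℝ m f p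
        (Fin.tail fun j => dir (I j))) x := fun x => congrFun e x
    simp only [e']
    rw [integral_mul_dv hu (h.iteratedFDeriv m _)]
    have := ih (hu.dv (dir (I 0))) (Fin.tail I)
    have e2 : (Fin.tail fun j => dir (I j)) = fun j => dir (Fin.tail I j) := rfl
    rw [e2, this]
    have e3 : word I = I 0 :: word (Fin.tail I) := by simp only [word, List.ofFn_succ]; rfl
    rw [e3]; simp only [KeyProfile.dw]; ring

end Cell

/-! ### Weighted norms -/

section Norms
variable {n : ℕ}
variable {lam τ h : ℝ} {f : Fn (n + 1)}

/-- Central difference quotient in `θ`. -/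
def cdiff {k : ℕ} (h : ℝ) (f : Fn k) : Fn k :=
  fun x => (2 * h)⁻¹ * (f (x + (0, h)) - f (x + (0, -h)))

/-- One transport step of the Lax–Friedrichs scheme for `∂_t + u ∂_θ`, with step `h` in `t` and
`θ`. -/
def friedrichs {k : ℕ} (h : ℝ) (u z : Fn k) : Fn k :=
  fun x => (z (x + (0, h)) + z (x + (0, -h))) / 2 - h * (u x * cdiff h z x)

/-- The properties of a family of (semi)norms on functions on `{t < τ} × 𝕋` that are used to
estimate the scheme. -/
structure IsAdmissible (lam : ℝ) (N : ℝ → Fn (n + 1) → ℝ≥0∞) : Prop where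
  mono : ∀ {τ τ' : ℝ} (f), τ ≤ τ' → N τ f ≤ N τ' f
  add : ∀ {f g} (τ), SmoothPer f → SmoothPer g → N τ (fun x => f x + g x) ≤ N τ f + N τ g
  smul : ∀ (c τ : ℝ) (f), N τ (fun x => c * f x) ≤ ofReal |c| * N τ f
  mul : ∀ {f g : Fn (n + 1)} {S τ : ℝ}, 0 ≤ S → (∀ x : Cyl (n + 1), x.1 0 < τ → |f x| ≤ S) →
    N τ (fun x => f x * g x) ≤ ofReal S * N τ g
  shift : ∀ {f} (τ : ℝ) (b : Cyl (n + 1)), SmoothPer f →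
    N (τ - b.1 0) (shift b f) ≤ ofReal (rexp (lam * b.1 0)) * N τ f
  diff : ∀ {f} {h : ℝ} (τ : ℝ), 0 < h → SmoothPer f → N τ (cdiff h f) ≤ N τ (dv (dir none) f)
  step : ∀ {u z} {h C τ : ℝ}, 0 < h → 0 ≤ C → SmoothPer u → SmoothPer z →
    (∀ x : Cyl (n + 1), x.1 0 < τ → |u x| ≤ 1) →
    (∀ x : Cyl (n + 1), x.1 0 < τ → |dv (dir none) u x| ≤ C) →
    N τ (friedrichs h u z) ≤ ofReal (1 + C * h) * N τ z

/-- The weighted supremum norm `sup_{t < τ} e^{-λt} |f|`. -/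
def wsup (lam τ : ℝ) (f : Fn (n + 1)) : ℝ≥0∞ :=
  ⨆ x : {x : Cyl (n + 1) // x.1 0 < τ}, ofReal (rexp (-lam * x.1.1 0) * |f x|)

lemma wsup_le_iff {ρ : ℝ} (hρ : 0 ≤ ρ) : wsup lam τ f ≤ ofReal ρ ↔
      ∀ x : Cyl (n + 1), x.1 0 < τ → |f x| ≤ ρ * rexp (lam * x.1 0) := by
  have key : ∀ x : Cyl (n + 1), ofReal (rexp (-lam * x.1 0) * |f x|) ≤ ofReal ρ ↔
      |f x| ≤ ρ * rexp (lam * x.1 0) := fun x => by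
    rw [ENNReal.ofReal_le_ofReal_iff hρ, neg_mul, Real.exp_neg, inv_mul_le_iff₀ (Real.exp_pos _),
      mul_comm]
  simp only [wsup, iSup_le_iff, Subtype.forall, key]

lemma le_wsup (f : Fn (n + 1)) {x : Cyl (n + 1)} (hx : x.1 0 < τ) :
    ofReal (rexp (-lam * x.1 0) * |f x|) ≤ wsup lam τ f :=
  le_iSup (fun x : {x : Cyl (n + 1) // x.1 0 < τ} =>
    ofReal (rexp (-lam * x.1.1 0) * |f x|)) ⟨x, hx⟩

lemma abs_le_of_central {a b : ℝ} (hh : 0 < h) {S : ℝ} (H : |a - b| ≤ S * (2 * h)) :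
    |(2 * h)⁻¹ * (a - b)| ≤ S := by
  rw [abs_mul, abs_of_pos (by positivity : 0 < (2 * h)⁻¹), inv_mul_le_iff₀ (by positivity)]
  linarith

lemma friedrichs_eq {k : ℕ} {h : ℝ} (hh : 0 < h) (u z : Fn k) (x : Cyl k) :
    friedrichs h u z x = (1 - u x) / 2 * z (x + (0, h)) + (1 + u x) / 2 * z (x + (0, -h)) := by
  simp only [friedrichs, cdiff]; field_simp; ring

lemma isAdmissible_wsup (lam : ℝ) : IsAdmissible (n := n) lam (wsup lam) where
  mono f h := iSup_le fun x => le_wsup f (x.2.trans_le h)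
  add τ _ _ := iSup_le fun x => by
    refine le_trans ?_ (add_le_add (le_wsup _ x.2) (le_wsup _ x.2))
    rw [← ofReal_add (by positivity) (by positivity), ← mul_add]
    exact ofReal_le_ofReal (mul_le_mul_of_nonneg_left (abs_add_le _ _) (Real.exp_pos _).le)
  smul c τ f := iSup_le fun x => by
    refine le_trans (le_of_eq ?_) (mul_le_mul_right (le_wsup f x.2) _)
    rw [← ofReal_mul (abs_nonneg _), abs_mul]; congr 1; ring
  mul {f g S τ} hS hf := iSup_le fun x => by
    refine le_trans ?_ (mul_le_mul_right (le_wsup _ x.2) _)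
    rw [← ofReal_mul hS, abs_mul]
    refine ofReal_le_ofReal ?_
    have := mul_le_mul_of_nonneg_right (hf x.1 x.2) (mul_nonneg (Real.exp_pos (-lam * x.1.1 0)).le
      (abs_nonneg (g x.1)))
    calc _ = _ := by ring
      _ ≤ _ := this
  shift τ b _ := iSup_le fun x => by
    have hx : (x.1 + b).1 0 < τ := by have := x.2; simp only [Prod.fst_add, Pi.add_apply]; linarith
    refine le_trans (le_of_eq ?_) (mul_le_mul_right (le_wsup _ hx) _)
    rw [← ofReal_mul (Real.exp_pos _).le, ← mul_assoc, ← Real.exp_add]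
    simp only [KeyProfile.shift, Prod.fst_add, Pi.add_apply]
    congr 3; ring
  diff {f h} τ hh hf := iSup_le fun x => by
    rcases eq_or_ne (wsup lam τ (dv (dir none) f)) ⊤ with htop | htop
    · rw [htop]; exact le_top
    obtain ⟨ρ, hρ0, hρ⟩ : ∃ ρ : ℝ, 0 ≤ ρ ∧ wsup lam τ (dv (dir none) f) = ofReal ρ :=
      ⟨_, ENNReal.toReal_nonneg, (ENNReal.ofReal_toReal htop).symm⟩
    have hb := (wsup_le_iff hρ0).1 hρ.le
    rw [hρ]
    refine le_trans (le_wsup _ x.2) ((wsup_le_iff hρ0).2 fun y hy => ?_)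
    refine abs_le_of_central hh ?_
    have := abs_sub_le_of_dv_theta hf (z := y.1) (S := ρ * rexp (lam * y.1 0))
      (fun θ => hb (y.1, θ) hy) (y.2 + -h) (y.2 + h)
    have e : |y.2 + h - (y.2 + -h)| = 2 * h := by
      rw [show y.2 + h - (y.2 + -h) = 2 * h by ring, abs_of_pos (by positivity)]
    rw [e] at this
    simpa [Prod.add_def] using this
  step {u z h C τ} hh hC hu hz h1 h2 := iSup_le fun x => by
    have e : ofReal (rexp (-lam * x.1.1 0) * |friedrichs h u z x|) ≤ wsup lam τ z := by
      rcases eq_or_ne (wsup lam τ z) ⊤ with htop | htop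
      · rw [htop]; exact le_top
      obtain ⟨ρ, hρ0, hρ⟩ : ∃ ρ : ℝ, 0 ≤ ρ ∧ wsup lam τ z = ofReal ρ :=
        ⟨_, ENNReal.toReal_nonneg, (ENNReal.ofReal_toReal htop).symm⟩
      have hb := (wsup_le_iff hρ0).1 hρ.le
      rw [hρ]
      refine le_trans (le_wsup _ x.2) ((wsup_le_iff hρ0).2 fun y hy => ?_)
      rw [friedrichs_eq hh]
      have b1 := hb (y + (0, h)) (by simpa using hy)
      have b2 := hb (y + (0, -h)) (by simpa using hy)
      simp only [Prod.fst_add, add_zero] at b1 b2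
      obtain ⟨c1, c2⟩ := abs_le.1 (h1 y hy)
      refine (abs_add_le _ _).trans ?_
      rw [abs_mul, abs_mul, abs_of_nonneg (by linarith : 0 ≤ (1 - u y) / 2),
        abs_of_nonneg (by linarith : 0 ≤ (1 + u y) / 2)]
      have d1 := mul_le_mul_of_nonneg_left b1 (by linarith : 0 ≤ (1 - u y) / 2)
      have d2 := mul_le_mul_of_nonneg_left b2 (by linarith : 0 ≤ (1 + u y) / 2)
      calc _ ≤ _ := add_le_add d1 d2
        _ = _ := by ring
    refine e.trans ?_
    conv_lhs => rw [← one_mul (wsup lam τ z)]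
    refine mul_le_mul_left ?_ _
    rw [← ofReal_one]
    exact ofReal_le_ofReal (by nlinarith)

/-- The weight `e^{-2λt}` on `t < τ`. -/
def wt (lam τ : ℝ) (x : Cyl (n + 1)) : ℝ := if x.1 0 < τ then rexp (-lam * x.1 0) ^ 2 else 0

lemma wt_nonneg (lam τ : ℝ) (x : Cyl (n + 1)) : 0 ≤ wt lam τ x := by
  unfold wt; split_ifs <;> positivity

lemma measurable_wt (lam τ : ℝ) : Measurable (wt (n := n) lam τ) := by
  have h0 : Measurable fun x : Cyl (n + 1) => x.1 0 := (measurable_pi_apply 0).comp measurable_fst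
  refine Measurable.ite (measurableSet_lt h0 measurable_const) ?_ measurable_const
  exact (Real.measurable_exp.comp (h0.const_mul _)).pow_const 2

lemma wt_theta (lam τ : ℝ) (x : Cyl (n + 1)) (s : ℝ) : wt lam τ (x + (0, s)) = wt lam τ x := by
  simp [wt]

/-- The weighted norm `‖e^{-λt} f‖_{L²(t < τ)}`. -/
def wl2 (lam τ : ℝ) (f : Fn (n + 1)) : ℝ≥0∞ :=
  eLpNorm (fun x : Cyl (n + 1) => rexp (-lam * x.1 0) * f x) 2 (vol (bΩ n τ))

lemma measurableSet_bdryDomain (τ : ℝ) : MeasurableSet (bΩ n τ) :=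
  measurableSet_lt (measurable_pi_apply 0) measurable_const

lemma eLpNorm_two_sq {α : Type*} [MeasurableSpace α] (μ : Measure α) (f : α → ℝ) :
    eLpNorm f 2 μ ^ 2 = ∫⁻ x, ofReal (f x ^ 2) ∂μ := by
  have := eLpNorm_nnreal_pow_eq_lintegral (f := f) (μ := μ) (p := 2) two_ne_zero
  simp only [NNReal.coe_ofNat, ENNReal.coe_ofNat] at this
  rw [← ENNReal.rpow_two, this]
  refine lintegral_congr fun x => ?_
  rw [ENNReal.rpow_two, Real.enorm_eq_ofReal_abs, ← ofReal_pow (abs_nonneg _), sq_abs]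

lemma wl2_sq (lam τ : ℝ) (f : Fn (n + 1)) :
    wl2 lam τ f ^ 2 = ∫⁻ x, ofReal (wt lam τ x * f x ^ 2) ∂vol univ := by
  rw [wl2, eLpNorm_two_sq, cylMeasure_eq_restrict _ (measurableSet_bdryDomain τ),
    ← lintegral_indicator ((measurableSet_bdryDomain τ).prod MeasurableSet.univ)]
  refine lintegral_congr fun x => ?_
  by_cases hx : x.1 0 < τ
  · rw [indicator_of_mem (show x ∈ bΩ n τ ×ˢ univ from ⟨hx, mem_univ _⟩)]
    simp only [wt, hx, if_true]; congr 1; ring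
  · rw [indicator_of_notMem (fun h => hx h.1)]
    simp [wt, hx]

lemma le_mul_of_sq_le {a b : ℝ≥0∞} {c : ℝ} (hc : 0 ≤ c)
    (h : a ^ 2 ≤ ofReal (c ^ 2) * b ^ 2) : a ≤ ofReal c * b := by
  rw [ofReal_pow hc, ← mul_pow] at h
  exact (ENNReal.pow_le_pow_left_iff two_ne_zero).1 h

lemma lintegral_weight_shift {F : Fn (n + 1)} (hm : Measurable F)
    (hF : PeriodicTheta F) (s : ℝ) :
    ∫⁻ x, ofReal (wt lam τ x * F (x + (0, s))) ∂vol univ =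
      ∫⁻ x, ofReal (wt lam τ x * F x) ∂vol univ := by
  have hm' : Measurable fun x => ofReal (wt lam τ x * F x) :=
    ((measurable_wt lam τ).mul hm).ennreal_ofReal
  rw [← lintegral_cyl_shift hm' ?_ (0, s)]
  · simp only [wt_theta]
  · intro z θ
    have := wt_theta lam τ (z, θ) (2 * π)
    simp only [Prod.mk_add_mk, add_zero] at this
    rw [this, hF]

lemma sq_integral_le {g : ℝ → ℝ} (hg : Continuous g) :
    (∫ s in (-1 : ℝ)..1, g s) ^ 2 ≤ 2 * ∫ s in (-1 : ℝ)..1, g s ^ 2 := by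
  set m := ∫ s in (-1 : ℝ)..1, g s
  have h0 : 0 ≤ ∫ s in (-1 : ℝ)..1, (g s - m / 2) ^ 2 :=
    intervalIntegral.integral_nonneg (by norm_num) fun s _ => sq_nonneg _
  have h1 : ∫ s in (-1 : ℝ)..1, (g s - m / 2) ^ 2 =
      (∫ s in (-1 : ℝ)..1, g s ^ 2) - m * m + m ^ 2 / 2 := by
    have e : ∀ s, (g s - m / 2) ^ 2 = (g s ^ 2 - m * g s) + m ^ 2 / 4 := fun s => by ring
    simp only [e]
    rw [intervalIntegral.integral_add, intervalIntegral.integral_sub,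
      intervalIntegral.integral_const_mul, intervalIntegral.integral_const]
    · simp only [smul_eq_mul]; ring
    all_goals exact Continuous.intervalIntegrable (by fun_prop) _ _
  nlinarith

lemma cdiff_eq_integral {k : ℕ} {f : Fn k} (hf : SmoothPer f) {h : ℝ} (hh : 0 < h) (x : Cyl k) :
    cdiff h f x = (∫ s in (-1 : ℝ)..1, dv (dir none) f (x + (0, s * h))) / 2 := by
  have hd : ∀ s ∈ uIcc (-1 : ℝ) 1, HasDerivAt (fun s : ℝ => f (x + (0, s * h)))
      (h * dv (dir none) f (x + (0, s * h))) s := by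
    intro s _
    have h1 := (hf.differentiable (x + (0, s * h))).hasFDerivAt
    have h2 : HasDerivAt (fun s : ℝ => (x + (0, s * h) : Cyl k)) (h • dir none) s := by
      refine HasDerivAt.const_add x ?_
      have := (hasDerivAt_const s (0 : Pt k)).prodMk ((hasDerivAt_id s).mul_const h)
      simpa [dir] using this
    have := h1.comp_hasDerivAt s h2
    rw [map_smul] at this
    exact this
  have hc : Continuous fun s : ℝ => dv (dir none) f (x + (0, s * h)) :=
    (hf.dv _).continuous.comp (by fun_prop)
  have := intervalIntegral.integral_eq_sub_of_hasDerivAt hd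
    (Continuous.intervalIntegrable (by fun_prop) _ _)
  rw [intervalIntegral.integral_const_mul] at this
  simp only [cdiff]
  rw [show (1 : ℝ) * h = h by ring, show (-1 : ℝ) * h = -h by ring] at this
  rw [← this]; field_simp

/-- `cdiff h f` is the mean of `∂_θ f` over an interval of length `2h`, and the weight does not depend on `θ`. -/
lemma wl2_cdiff_le (hh : 0 < h) (hf : SmoothPer f) :
    wl2 lam τ (cdiff h f) ≤ wl2 lam τ (dv (dir none) f) := by
  set g := dv (dir none) f with hg
  have hgc : Continuous g := (hf.dv _).continuous
  have hgp : PeriodicTheta g := (hf.dv _).periodic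
  have hpt : ∀ x : Cyl (n + 1), ofReal (wt lam τ x * cdiff h f x ^ 2) ≤
      ofReal (1 / 2) * ∫⁻ s in Ioc (-1 : ℝ) 1, ofReal (wt lam τ x * g (x + (0, s * h)) ^ 2) := by
    intro x
    have hc : Continuous fun s : ℝ => g (x + (0, s * h)) := hgc.comp (by fun_prop)
    have h1 := sq_integral_le hc
    have h2 : ∫⁻ s in Ioc (-1 : ℝ) 1, ofReal (wt lam τ x * g (x + (0, s * h)) ^ 2) =
        ofReal (∫ s in (-1 : ℝ)..1, wt lam τ x * g (x + (0, s * h)) ^ 2) := by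
      rw [intervalIntegral.integral_of_le (by norm_num), ofReal_integral_eq_lintegral_ofReal]
      · exact (Continuous.integrableOn_Icc (by fun_prop)).mono_set Ioc_subset_Icc_self
      · exact ae_of_all _ fun s => mul_nonneg (wt_nonneg _ _ _) (sq_nonneg _)
    rw [h2, ← ofReal_mul (by norm_num)]
    refine ofReal_le_ofReal ?_
    rw [intervalIntegral.integral_const_mul, cdiff_eq_integral hf hh]
    have := mul_le_mul_of_nonneg_left h1 (wt_nonneg lam τ x)
    nlinarith
  have hsq : wl2 lam τ (cdiff h f) ^ 2 ≤ wl2 lam τ g ^ 2 := by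
    rw [wl2_sq, wl2_sq]
    have hmeas : Measurable fun p : Cyl (n + 1) × ℝ =>
        ofReal (wt lam τ p.1 * g (p.1 + (0, p.2 * h)) ^ 2) := by
      refine (((measurable_wt lam τ).comp measurable_fst).mul ?_).ennreal_ofReal
      exact (Continuous.measurable (by fun_prop))
    calc _ ≤ ∫⁻ x, (ofReal (1 / 2) * ∫⁻ s in Ioc (-1 : ℝ) 1,
            ofReal (wt lam τ x * g (x + (0, s * h)) ^ 2)) ∂vol univ :=
          lintegral_mono hpt
      _ = ofReal (1 / 2) * ∫⁻ s in Ioc (-1 : ℝ) 1, ∫⁻ x,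
            ofReal (wt lam τ x * g (x + (0, s * h)) ^ 2) ∂vol univ := by
          have : SFinite (vol (univ : Set (Pt (n + 1)))) := by
            unfold cylMeasure; infer_instance
          rw [lintegral_const_mul _ hmeas.lintegral_prod_right', lintegral_lintegral_swap hmeas.aemeasurable]
      _ = ofReal (1 / 2) * ∫⁻ s in Ioc (-1 : ℝ) 1, ∫⁻ x,
            ofReal (wt lam τ x * g x ^ 2) ∂vol univ := by
          congr 1
          refine lintegral_congr fun s => ?_
          exact lintegral_weight_shift (F := fun x => g x ^ 2) (hgc.pow 2).measurable
            (fun z θ => by simp only [hgp z θ]) (s * h)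
      _ = _ := by
          rw [lintegral_const, Measure.restrict_apply_univ, Real.volume_Ioc, mul_comm,
            mul_assoc, ← ofReal_mul (by norm_num),
            show (1 - -1 : ℝ) * (1 / 2) = 1 by norm_num, ofReal_one, mul_one]
  exact (ENNReal.pow_le_pow_left_iff two_ne_zero).1 hsq

/-- `friedrichs h u z` is a convex combination of translates of `z`, so Jensen's inequality bounds its
square. After translating back, the weights add up to `1 + (u(θ + h) - u(θ - h)) / 2 ≤ 1 + C h`. -/
lemma wl2_friedrichs_le {u z : Fn (n + 1)} {C : ℝ} (hh : 0 < h) (hC : 0 ≤ C)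
    (hu : SmoothPer u) (hz : SmoothPer z) (h1 : ∀ x : Cyl (n + 1), x.1 0 < τ → |u x| ≤ 1)
    (h2 : ∀ x : Cyl (n + 1), x.1 0 < τ → |dv (dir none) u x| ≤ C) :
    wl2 lam τ (friedrichs h u z) ≤ ofReal (1 + C * h) * wl2 lam τ z := by
  refine le_mul_of_sq_le (by positivity) ?_
  rw [wl2_sq, wl2_sq]
  have hw := wt_nonneg (n := n) lam τ
  have hw0 : ∀ x : Cyl (n + 1), ¬ x.1 0 < τ → wt lam τ x = 0 := fun x hx => by simp [wt, hx]
  have hum := hu.continuous.measurable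
  have hzm := hz.continuous.measurable
  -- convexity of the square, as the step is a convex combination of translates
  have hconv : ∀ x, wt lam τ x * friedrichs h u z x ^ 2 ≤
      wt lam τ x * ((1 - u x) / 2 * z (x + (0, h)) ^ 2) +
        wt lam τ x * ((1 + u x) / 2 * z (x + (0, -h)) ^ 2) := by
    intro x
    by_cases hx : x.1 0 < τ
    · rw [← mul_add]
      refine mul_le_mul_of_nonneg_left ?_ (hw x)
      rw [friedrichs_eq hh]
      obtain ⟨c1, c2⟩ := abs_le.1 (h1 x hx)
      have := mul_nonneg (mul_nonneg (by linarith : 0 ≤ 1 - u x) (by linarith : 0 ≤ 1 + u x))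
        (sq_nonneg (z (x + (0, h)) - z (x + (0, -h))))
      nlinarith
    · rw [hw0 x hx]; simp
  have hnn : ∀ (s c : ℝ) (x : Cyl (n + 1)), |c| = 1 →
      0 ≤ wt lam τ x * ((1 + c * u (x + (0, s))) / 2 * z x ^ 2) := by
    intro s c x hc
    by_cases hx : x.1 0 < τ
    · have := h1 (x + (0, s)) (by simpa using hx)
      have h3 : |c * u (x + (0, s))| ≤ 1 := by rw [abs_mul, hc, one_mul]; exact this
      have := (abs_le.1 h3).1
      exact mul_nonneg (hw x) (mul_nonneg (by linarith) (sq_nonneg _))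
    · rw [hw0 x hx]; simp
  have hS : ∀ s c : ℝ, ∫⁻ x, ofReal (wt lam τ x * ((1 + c * u x) / 2 * z (x + (0, s)) ^ 2))
        ∂vol univ =
      ∫⁻ x, ofReal (wt lam τ x * ((1 + c * u (x + (0, -s))) / 2 * z x ^ 2)) ∂vol univ := by
    intro s c
    rw [← lintegral_weight_shift (F := fun x => (1 + c * u (x + (0, -s))) / 2 * z x ^ 2) _ _ s]
    · refine lintegral_congr fun x => ?_
      have e : x + (0, s) + (0, -s) = x := by ext <;> simp
      simp only [e]
    · have : Measurable fun x : Cyl (n + 1) => u (x + (0, -s)) := hum.comp (measurable_id.add_const _)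
      exact (((this.const_mul _).const_add _).div_const _).mul (hzm.pow_const 2)
    · intro y θ
      have := (hu.shift (0, -s)).periodic y θ
      simp only [KeyProfile.shift] at this
      simp only [this, hz.periodic y θ]
  calc _ ≤ ∫⁻ x, (ofReal (wt lam τ x * ((1 + (-1) * u x) / 2 * z (x + (0, h)) ^ 2)) +
        ofReal (wt lam τ x * ((1 + 1 * u x) / 2 * z (x + (0, -h)) ^ 2))) ∂vol univ := by
        refine lintegral_mono fun x => ?_
        refine le_trans (ofReal_le_ofReal (hconv x)) ?_
        refine le_trans ENNReal.ofReal_add_le (le_of_eq ?_)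
        congr 4 <;> ring
    _ = (∫⁻ x, ofReal (wt lam τ x * ((1 + (-1) * u (x + (0, -h))) / 2 * z x ^ 2)) ∂vol univ) +
        ∫⁻ x, ofReal (wt lam τ x * ((1 + 1 * u (x + (0, h))) / 2 * z x ^ 2)) ∂vol univ := by
        rw [lintegral_add_left, hS, hS, neg_neg]
        refine ((measurable_wt lam τ).mul ?_).ennreal_ofReal
        exact (((hum.const_mul _).const_add _).div_const _).mul
          ((hzm.comp (measurable_id.add_const _)).pow_const 2)
    _ ≤ ∫⁻ x, ofReal ((1 + C * h) ^ 2) * ofReal (wt lam τ x * z x ^ 2) ∂vol univ := by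
        rw [← lintegral_add_left]
        · refine lintegral_mono fun x => ?_
          simp only []
          rw [← ofReal_add (hnn _ _ _ (by simp)) (hnn _ _ _ (by simp)),
            ← ofReal_mul (by positivity)]
          refine ofReal_le_ofReal ?_
          by_cases hx : x.1 0 < τ
          · have := abs_sub_le_of_dv_theta hu (z := x.1) (S := C) (fun θ => h2 (x.1, θ) hx)
              (x.2 + -h) (x.2 + h)
            rw [show x.2 + h - (x.2 + -h) = 2 * h by ring, abs_of_pos (by positivity : 0 < 2 * h)] at this
            have e1 : x + (0, h) = (x.1, x.2 + h) := by ext <;> simp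
            have e2 : x + (0, -h) = (x.1, x.2 + -h) := by ext <;> simp
            rw [e1, e2]
            have h3 := (abs_le.1 this).2
            have h4 := mul_nonneg (hw x) (sq_nonneg (z x))
            have h5 : 0 ≤ C * h := by positivity
            nlinarith [mul_nonneg h4 (sq_nonneg (C * h)), mul_nonneg h4 h5, mul_le_mul_of_nonneg_left h3 h4]
          · rw [hw0 x hx]; simp
        · refine ((measurable_wt lam τ).mul ?_).ennreal_ofReal
          exact ((((hum.comp (measurable_id.add_const _)).const_mul _).const_add _).div_const _).mul
            (hzm.pow_const 2)
    _ = _ := lintegral_const_mul _ ((measurable_wt lam τ).mul (hzm.pow_const 2)).ennreal_ofReal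

lemma isAdmissible_wl2 (lam : ℝ) : IsAdmissible (n := n) lam (wl2 lam) where
  mono f h := by
    refine eLpNorm_mono_measure _ (Measure.restrict_mono (Set.prod_mono ?_ le_rfl) le_rfl)
    exact fun z (hz : z 0 < _) => hz.trans_le h
  add {f g} τ hf hg := by
    have e : (fun x : Cyl (n + 1) => rexp (-lam * x.1 0) * (f x + g x)) =
      (fun x : Cyl (n + 1) => rexp (-lam * x.1 0) * f x) +
        fun x : Cyl (n + 1) => rexp (-lam * x.1 0) * g x := by funext x; simp; ring
    have hf' := hf.continuous
    have hg' := hg.continuous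
    have c1 : Continuous fun x : Cyl (n + 1) => rexp (-lam * x.1 0) * f x := by fun_prop
    have c2 : Continuous fun x : Cyl (n + 1) => rexp (-lam * x.1 0) * g x := by fun_prop
    simp only [wl2]; rw [e]
    exact eLpNorm_add_le c1.aestronglyMeasurable c2.aestronglyMeasurable (by norm_num)
  smul c τ f := by
    have e : (fun x : Cyl (n + 1) => rexp (-lam * x.1 0) * (c * f x)) =
      c • (fun x : Cyl (n + 1) => rexp (-lam * x.1 0) * f x) := by funext x; simp; ring
    simp only [wl2]; rw [e, eLpNorm_const_smul, Real.enorm_eq_ofReal_abs]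
  mul {f g S τ} hS hf := by
    simp only [wl2]
    refine le_trans (eLpNorm_le_mul_eLpNorm_of_ae_le_mul (c := S)
      (g := fun x : Cyl (n + 1) => rexp (-lam * x.1 0) * g x) ?_ 2) le_rfl
    have : ∀ᵐ x ∂vol (bΩ n τ), x ∈ bΩ n τ ×ˢ Ioo 0 (2 * π) :=
      ae_restrict_mem ((measurableSet_bdryDomain τ).prod measurableSet_Ioo)
    filter_upwards [this] with x hx
    rw [Real.norm_eq_abs, Real.norm_eq_abs, abs_mul, abs_mul, abs_mul]
    have := mul_le_mul_of_nonneg_right (hf x hx.1) (mul_nonneg (abs_nonneg (rexp (-lam * x.1 0)))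
      (abs_nonneg (g x)))
    calc _ = _ := by ring
      _ ≤ _ := this
  shift {f} τ b hf := by
    set F : Fn (n + 1) := fun x => rexp (-lam * x.1 0) * f x with hF
    have hf' := hf.continuous
    have hFc : Continuous F := by fun_prop
    have hFp : PeriodicTheta F := fun z θ => by simp only [hF]; rw [hf.periodic]
    have e : (fun x : Cyl (n + 1) => rexp (-lam * x.1 0) * KeyProfile.shift b f x) =
        rexp (lam * b.1 0) • KeyProfile.shift b F := by
      funext x
      simp only [KeyProfile.shift, hF, Pi.smul_apply, smul_eq_mul, Prod.fst_add, Pi.add_apply]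
      rw [← mul_assoc, ← Real.exp_add]; congr 2; ring
    simp only [wl2]; rw [e, eLpNorm_const_smul, Real.enorm_eq_ofReal (Real.exp_pos _).le]
    refine mul_le_mul_right (eLpNorm_shift_le (measurableSet_bdryDomain _)
      (measurableSet_bdryDomain _) hFc.measurable hFp (fun z hz => ?_) 2) _
    have : z 0 < τ - b.1 0 := hz
    show (z + b.1) 0 < τ
    simp only [Pi.add_apply]; linarith
  diff τ hh hf := wl2_cdiff_le hh hf
  step hh hC hu hz h1 h2 := wl2_friedrichs_le hh hC hu hz h1 h2

end Norms

/-! ### The explicit scheme and its a priori estimates -/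

section Scheme
variable {n : ℕ}
variable {f u : Fn (n + 1)} {τ a S ρ : ℝ} {k' : ℕ}

lemma dw_append_singleton {k : ℕ} (I : Word k) (i : Option (Fin k)) (f : Fn k) :
    dw (I ++ [i]) f = dv (dir i) (dw I f) := by
  induction I generalizing f with
  | nil => rfl
  | cons j I ih => simp only [List.cons_append, dw]; exact ih _

lemma SmoothPer.cdiff {k : ℕ} {f : Fn k} (hf : SmoothPer f) (h : ℝ) : SmoothPer (cdiff h f) :=
  ((hf.shift (0, h)).sub (hf.shift (0, -h))).const_mul _

lemma dv_cdiff {k : ℕ} {f : Fn k} (hf : SmoothPer f) (h : ℝ) (v : Cyl k) :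
    dv v (KeyProfile.cdiff h f) = KeyProfile.cdiff h (dv v f) := by
  have e : KeyProfile.cdiff h f = fun x => (2 * h)⁻¹ * (KeyProfile.shift (0, h) f x +
      (-1) * KeyProfile.shift (0, -h) f x) := by
    funext x; simp only [KeyProfile.cdiff, KeyProfile.shift]; ring
  have h1 := hf.shift (0, h)
  have h2 := (hf.shift (0, -h)).const_mul (-1)
  rw [e, dv_const_mul (h1.add h2), dv_add h1 h2, dv_const_mul (hf.shift _), dv_shift, dv_shift]
  funext x; simp only [KeyProfile.cdiff, KeyProfile.shift]; ring

/-- A bilinear operation of order zero that behaves like a `θ`-derivative of a bilinear integral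
operator: the derivative may be put on either factor. It is causal. -/
structure IsTame (E : Fn (n + 1) → Fn (n + 1) → Fn (n + 1)) (CE : ℝ) : Prop where
  nonneg : 0 ≤ CE
  leibniz : IsLeibniz E
  zero : E (fun _ => 0) (fun _ => 0) = fun _ => 0
  bound_left : ∀ {lam : ℝ} {N}, 0 ≤ lam → IsAdmissible lam N → ∀ {S τ : ℝ} {u v}, 0 ≤ S →
    SmoothPer u → SmoothPer v → (∀ x : Cyl (n + 1), x.1 0 < τ → |dv (dir none) u x| ≤ S) →
    N τ (E u v) ≤ ofReal (CE * S) * N τ v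
  bound_right : ∀ {lam : ℝ} {N}, 0 ≤ lam → IsAdmissible lam N → ∀ {S τ : ℝ} {u v}, 0 ≤ S →
    SmoothPer u → SmoothPer v → (∀ x : Cyl (n + 1), x.1 0 < τ → |dv (dir none) v x| ≤ S) →
    N τ (E u v) ≤ ofReal (CE * S) * N τ u
  causal : ∀ {s : ℝ} {u u' v v' : Fn (n + 1)}, (∀ x : Cyl (n + 1), x.1 0 ≤ s → u x = u' x) →
    (∀ x : Cyl (n + 1), x.1 0 ≤ s → v x = v' x) → ∀ x : Cyl (n + 1), x.1 0 ≤ s → E u v x = E u' v' x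
  mean : ∀ {u v}, SmoothPer u → SmoothPer v → ∀ z, ∫ θ in 0..2 * π, E u v (z, θ) = 0

/-- The data of the scheme for `X a + k₄ a + k₆ a ∂_θ a + k₅ E(a, a) = G`, where
`X = ∂_t + ∑ X_j ∂_j`. -/
structure SchemeData (n : ℕ) where
  E : Fn (n + 1) → Fn (n + 1) → Fn (n + 1)
  X : Pt (n + 1)
  k4 : ℝ
  k5 : ℝ
  k6 : ℝ
  h : ℝ
  G : Fn (n + 1)

namespace SchemeData
variable (D : SchemeData n)

/-- The nonlinear terms. -/
def nonlin (u v : Fn (n + 1)) : Fn (n + 1) :=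
  fun x => D.k6 * (u x * cdiff D.h v x) + D.k5 * D.E u v x

/-- One step of the scheme, before the translation along `X`. -/
def body (u : Fn (n + 1)) : Fn (n + 1) :=
  fun x => ((u (x + (0, D.h)) + u (x + (0, -D.h))) / 2 + D.h * (D.G x - D.k4 * u x)) -
    D.h * D.nonlin u u x

/-- One step of the scheme. -/
def step (u : Fn (n + 1)) : Fn (n + 1) := shift (-(D.h • D.X), 0) (D.body u)

/-- The iterates of the scheme; the `j`-th one solves the discrete equation for `t ≤ j h`. -/
def iter : ℕ → Fn (n + 1)
  | 0 => fun _ => 0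
  | j + 1 => D.step (iter j)

/-- The standing assumptions on the data. -/
structure Good (CE : ℝ) : Prop where
  tame : IsTame D.E CE
  X_zero : D.X 0 = 1
  h_pos : 0 < D.h
  smooth : SmoothPer D.G
  past : ∀ x : Cyl (n + 1), x.1 0 ≤ 0 → D.G x = 0

variable {D} {CE : ℝ}

lemma leibniz_nonlin (hD : D.Good CE) : IsLeibniz D.nonlin := by
  have h1 : IsLeibniz (fun u v (x : Cyl (n + 1)) => D.k6 * (u x * cdiff D.h v x)) :=
    (isLeibniz_mul.comp (A := fun u => u) (B := cdiff D.h) (fun h => h) (fun h => h.cdiff _)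
      (fun _ _ => rfl) (fun _ h => dv_cdiff h _ _)).const_mul _
  have h2 := hD.tame.leibniz.const_mul D.k5
  refine ⟨fun hu hv => (h1.smooth hu hv).add (h2.smooth hu hv), fun i hu hv => ?_⟩
  show dv (dir i) (fun x => (fun x => D.k6 * _) x + (fun x => D.k5 * _) x) = _
  rw [dv_add (h1.smooth hu hv) (h2.smooth hu hv), h1.dv_eq i hu hv, h2.dv_eq i hu hv]
  funext x; simp only [nonlin]; ring

lemma smooth_body (hD : D.Good CE) (hu : SmoothPer u) : SmoothPer (D.body u) := by
  have h1 := ((hu.shift (0, D.h)).add (hu.shift (0, -D.h))).const_mul (1 / 2)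
  have h2 := (hD.smooth.sub (hu.const_mul D.k4)).const_mul D.h
  have h3 := ((leibniz_nonlin hD).smooth hu hu).const_mul D.h
  have := (h1.add h2).sub h3
  convert this using 2
  simp only [body, KeyProfile.shift]; ring

lemma smooth_iter (hD : D.Good CE) (j : ℕ) : SmoothPer (D.iter j) := by
  induction j with
  | zero => exact SmoothPer.zero
  | succ j ih => exact (smooth_body hD ih).shift _

/-- The differentiated scheme. The transport part acts on the highest derivative. -/
lemma dw_body (hD : D.Good CE) (hu : SmoothPer u) (I : Word (n + 1)) :
    dw I (D.body u) = fun x => friedrichs D.h (fun x => D.k6 * u x) (dw I u) x +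
      D.h * ((dw I D.G x + (-D.k4) * dw I u x) + ((-D.k5) * D.E u (dw I u) x +
        (-1) * ((splits I).map fun s => D.nonlin (dw s.1 u) (dw s.2 u) x).sum)) := by
  have h1 := ((hu.shift (0, D.h)).add (hu.shift (0, -D.h))).const_mul (1 / 2)
  have h2 := (hD.smooth.sub (hu.const_mul D.k4)).const_mul D.h
  have h3 := ((leibniz_nonlin hD).smooth hu hu).const_mul D.h
  have e : D.body u = fun x => ((fun x => 1 / 2 * (KeyProfile.shift (0, D.h) u x +
      KeyProfile.shift (0, -D.h) u x)) x + (fun x => D.h * (D.G x - D.k4 * u x)) x) -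
      (fun x => D.h * D.nonlin u u x) x := by
    funext x; simp only [body, KeyProfile.shift]; ring
  rw [e, dw_sub (h1.add h2) h3, dw_add h1 h2, dw_const_mul ((hu.shift _).add (hu.shift _)),
    dw_const_mul (hD.smooth.sub (hu.const_mul _)), dw_const_mul ((leibniz_nonlin hD).smooth hu hu),
    dw_add (hu.shift _) (hu.shift _), dw_sub hD.smooth (hu.const_mul _), dw_const_mul hu,
    dw_shift, dw_shift, (leibniz_nonlin hD).dw_eq hu hu]
  funext x
  simp only [friedrichs, KeyProfile.shift, nonlin]; ring

/-- The growth rate that the estimates of order `k` allow for. -/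
def rate (D : SchemeData n) (CE : ℝ) (k : ℕ) (S : ℝ) : ℝ :=
  1 + |D.k4| + (2 ^ k + 2) * ((|D.k6| + |D.k5| * CE) * S)

section Bounds
variable {lam : ℝ} {N : ℝ → Fn (n + 1) → ℝ≥0∞}

lemma _root_.KeyProfile.IsAdmissible.add_le (hN : IsAdmissible lam N) {g : Fn (n + 1)}
    {b : ℝ} (hf : SmoothPer f) (hg : SmoothPer g) (ha0 : 0 ≤ a) (hb0 : 0 ≤ b)
    (ha : N τ f ≤ ofReal a) (hb : N τ g ≤ ofReal b) :
    N τ (fun x => f x + g x) ≤ ofReal (a + b) := by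
  rw [ofReal_add ha0 hb0]
  exact (hN.add τ hf hg).trans (add_le_add ha hb)

lemma _root_.KeyProfile.IsAdmissible.smul_le (hN : IsAdmissible lam N)
    (c : ℝ) (ha : N τ f ≤ ofReal a) :
    N τ (fun x => c * f x) ≤ ofReal (|c| * a) := by
  rw [ofReal_mul (abs_nonneg _)]
  exact (hN.smul c τ f).trans (mul_le_mul_right ha _)

lemma _root_.KeyProfile.IsAdmissible.zero (hN : IsAdmissible lam N) (τ : ℝ) :
    N τ (fun _ => 0) = 0 := by
  have := hN.smul 0 τ (fun _ => 0)
  simpa using this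

lemma _root_.KeyProfile.IsAdmissible.list_sum_le (hN : IsAdmissible lam N) {ι : Type*} {l : List ι}
    {f : ι → Fn (n + 1)} (ha : 0 ≤ a) (hf : ∀ i ∈ l, SmoothPer (f i))
    (h : ∀ i ∈ l, N τ (f i) ≤ ofReal a) :
    N τ (fun x => (l.map fun i => f i x).sum) ≤ ofReal (l.length * a) := by
  induction l with
  | nil => simp [hN.zero]
  | cons i l ih =>
    have h1 := ih (fun j hj => hf j (by simp [hj])) (fun j hj => h j (by simp [hj]))
    have h2 := hN.add_le (hf i (by simp)) (SmoothPer.list_sum fun j hj => hf j (by simp [hj])) ha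
      (by positivity) (h i (by simp)) h1
    simp only [List.map_cons, List.sum_cons, List.length_cons, Nat.cast_add, Nat.cast_one]
    rw [show ((l.length : ℝ) + 1) * a = a + l.length * a by ring]
    exact h2

/-- The nonlinear terms of the differentiated equation: at least one of the two factors, with one
more derivative, is controlled in the supremum norm. -/
lemma nonlin_le (hD : D.Good CE) (hlam : 0 ≤ lam) (hN : IsAdmissible lam N) {u : Fn (n + 1)}
    (hu : SmoothPer u) {k k' : ℕ} {S ρ τ : ℝ} (hS : 0 ≤ S) (hk : k ≤ 2 * k' - 1)
    (hsup : DerivLE (bΩ n τ) k' u S)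
    (hb : ∀ I : Word (n + 1), I.length ≤ k → N τ (dw I u) ≤ ofReal ρ)
    {J K : Word (n + 1)} (hJK : J.length + K.length ≤ k) (hJ : 1 ≤ J.length) :
    N τ (D.nonlin (dw J u) (dw K u)) ≤ ofReal (((|D.k6| + |D.k5| * CE) * S) * ρ) := by
  have hJs := hu.dw J
  have hKs := hu.dw K
  have hCE := hD.tame.nonneg
  have hρ0 : ofReal (((|D.k6| + |D.k5| * CE) * S) * ρ) =
      ofReal (|D.k6| * S) * ofReal ρ + ofReal (|D.k5| * (CE * S)) * ofReal ρ := by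
    rw [← add_mul, ← ofReal_add (by positivity) (by positivity),
      ← ofReal_mul (by positivity)]
    congr 1; ring
  have hdv : ∀ I : Word (n + 1), dv (dir none) (dw I u) = dw (I ++ [none]) u :=
    fun I => (dw_append_singleton I none u).symm
  have hT : N τ (fun x => D.k6 * (dw J u x * cdiff D.h (dw K u) x)) ≤
      ofReal (|D.k6| * S) * ofReal ρ := by
    refine (hN.smul _ _ _).trans ?_
    rw [ofReal_mul (abs_nonneg _), mul_assoc]
    refine mul_le_mul_right ?_ _
    by_cases hJ' : J.length ≤ k'
    · refine (hN.mul hS (hsup J hJ')).trans (mul_le_mul_right ?_ _)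
      refine (hN.diff τ hD.h_pos hKs).trans ?_
      rw [hdv]
      exact hb _ (by simp; omega)
    · have hc : ∀ x : Cyl (n + 1), x.1 0 < τ → |cdiff D.h (dw K u) x| ≤ S := by
        intro x hx
        refine abs_le_of_central hD.h_pos ?_
        have h1 := abs_sub_le_of_dv_theta hKs (z := x.1) (S := S)
          (fun θ => by rw [hdv]; exact hsup _ (by simp; omega) (x.1, θ) hx) (x.2 + -D.h) (x.2 + D.h)
        have hh := hD.h_pos
        rw [show x.2 + D.h - (x.2 + -D.h) = 2 * D.h by ring, abs_of_pos (show 0 < 2 * D.h by linarith)] at h1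
        have e : ∀ s, x + (0, s) = (x.1, x.2 + s) := fun s => by ext <;> simp
        rw [e, e]; exact h1
      have := hN.mul (g := dw J u) hS hc
      refine le_trans (le_of_eq ?_) (this.trans (mul_le_mul_right (hb J (by omega)) _))
      congr 1; funext x; ring
  have hE : N τ (fun x => D.k5 * D.E (dw J u) (dw K u) x) ≤
      ofReal (|D.k5| * (CE * S)) * ofReal ρ := by
    refine (hN.smul _ _ _).trans ?_
    rw [ofReal_mul (abs_nonneg _), mul_assoc]
    refine mul_le_mul_right ?_ _
    by_cases hJ' : J.length + 1 ≤ k'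
    · refine (hD.tame.bound_left hlam hN hS hJs hKs fun x hx => ?_).trans
        (mul_le_mul_right (hb K (by omega)) _)
      rw [hdv]; exact hsup _ (by simpa using hJ') x hx
    · refine (hD.tame.bound_right hlam hN hS hJs hKs fun x hx => ?_).trans
        (mul_le_mul_right (hb J (by omega)) _)
      rw [hdv]; exact hsup _ (by simp; omega) x hx
  rw [hρ0]
  have s1 : SmoothPer (fun x => D.k6 * (dw J u x * cdiff D.h (dw K u) x)) :=
    (hJs.mul (hKs.cdiff _)).const_mul _
  have s2 : SmoothPer (fun x => D.k5 * D.E (dw J u) (dw K u) x) :=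
    (hD.tame.leibniz.smooth hJs hKs).const_mul _
  exact (hN.add τ s1 s2).trans (add_le_add hT hE)

/-- Bounds for all derivatives of order at most `k` propagate through one step of the scheme. -/
lemma step_bound (hD : D.Good CE) (hN : IsAdmissible lam N) {u : Fn (n + 1)}
    (hu : SmoothPer u) {k k' : ℕ} {S ρ τ τ' : ℝ} (hS : 0 ≤ S) (hρ : 0 ≤ ρ) (hk : k ≤ 2 * k' - 1)
    (hk' : 1 ≤ k') (hlam : D.rate CE k S ≤ lam) (hτ : τ' ≤ τ + D.h)
    (hsmall : ∀ x : Cyl (n + 1), x.1 0 < τ → |D.k6 * u x| ≤ 1)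
    (hsup : DerivLE (bΩ n τ) k' u S)
    (hG : ∀ I : Word (n + 1), I.length ≤ k → N τ (dw I D.G) ≤ ofReal ρ)
    (hb : ∀ I : Word (n + 1), I.length ≤ k → N τ (dw I u) ≤ ofReal ρ)
    {I : Word (n + 1)} (hI : I.length ≤ k) :
    N τ' (dw I (D.step u)) ≤ ofReal ρ := by
  have hCE := hD.tame.nonneg
  have hh := hD.h_pos
  set Q := (|D.k6| + |D.k5| * CE) * S with hQ
  have hQ0 : 0 ≤ Q := by positivity
  have hlam0 : 0 ≤ lam := le_trans (by unfold rate; positivity) hlam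
  have hIs := hu.dw I
  have t1 : N τ (friedrichs D.h (fun x => D.k6 * u x) (dw I u)) ≤
      ofReal ((1 + |D.k6| * S * D.h) * ρ) := by
    rw [ofReal_mul (by positivity)]
    refine (hN.step hh (by positivity) (hu.const_mul _) hIs hsmall fun x hx => ?_).trans
      (mul_le_mul_right (hb I hI) _)
    rw [dv_const_mul hu, abs_mul]
    exact mul_le_mul_of_nonneg_left (hsup [none] (by simpa using hk') x hx) (abs_nonneg _)
  have t2 := hN.add_le (hD.smooth.dw I) (hIs.const_mul (-D.k4)) hρ (by positivity) (hG I hI)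
    (hN.smul_le (-D.k4) (hb I hI))
  have sE := hD.tame.leibniz.smooth hu hIs
  have t3 : N τ (fun x => (-D.k5) * D.E u (dw I u) x) ≤ ofReal (|-D.k5| * (CE * S * ρ)) := by
    refine hN.smul_le _ ?_
    rw [ofReal_mul (by positivity)]
    exact (hD.tame.bound_left hlam0 hN hS hu hIs fun x hx =>
      hsup [none] (by simpa using hk') x hx).trans (mul_le_mul_right (hb I hI) _)
  have sL : ∀ s ∈ splits I, SmoothPer (D.nonlin (dw s.1 u) (dw s.2 u)) := fun s _ =>
    (leibniz_nonlin hD).smooth (hu.dw _) (hu.dw _)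
  have t4 : N τ (fun x => (-1 : ℝ) * ((splits I).map fun s => D.nonlin (dw s.1 u) (dw s.2 u) x).sum) ≤
      ofReal (|(-1 : ℝ)| * ((splits I).length * (Q * ρ))) := by
    refine hN.smul_le _ (hN.list_sum_le (by positivity) sL fun s hs => ?_)
    have := mem_splits hs
    exact nonlin_le hD hlam0 hN hu hS hk hsup hb (by omega) this.2
  have s1 : SmoothPer (friedrichs D.h (fun x => D.k6 * u x) (dw I u)) := by
    have h1 := ((hIs.shift (0, D.h)).add (hIs.shift (0, -D.h))).const_mul (1 / 2)
    have h2 := (((hu.const_mul D.k6).mul (hIs.cdiff D.h))).const_mul (-D.h)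
    convert h1.add h2 using 2
    simp only [friedrichs, KeyProfile.shift]; ring
  have s2 := (hD.smooth.dw I).add (hIs.const_mul (-D.k4))
  have s3 := (sE.const_mul (-D.k5))
  have s4 := (SmoothPer.list_sum sL).const_mul (-1)
  have t5 := hN.add_le s2 (s3.add s4) (by positivity) (by positivity) t2
    (hN.add_le s3 s4 (by positivity) (by positivity) t3 t4)
  have t6 := hN.add_le s1 ((s2.add (s3.add s4)).const_mul D.h) (by positivity) (by positivity) t1
    (hN.smul_le D.h t5)
  rw [← dw_body hD hu I] at t6
  have hlen : ((splits I).length : ℝ) ≤ 2 ^ k := by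
    have h1 := length_splits_le I
    have h2 : 2 ^ I.length ≤ 2 ^ k := Nat.pow_le_pow_right (by norm_num) hI
    exact_mod_cast (by omega : (splits I).length ≤ 2 ^ k)
  have hbound : (1 + |D.k6| * S * D.h) * ρ + |D.h| * ((ρ + |(-D.k4)| * ρ) +
      (|-D.k5| * (CE * S * ρ) + |(-1 : ℝ)| * ((splits I).length * (Q * ρ)))) ≤ (1 + lam * D.h) * ρ := by
    have e1 : |D.h| = D.h := abs_of_pos hh
    simp only [abs_neg, abs_one, one_mul, e1]
    have h1 : |D.k6| * S ≤ Q := by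
      rw [hQ, add_mul]; linarith [show 0 ≤ |D.k5| * CE * S by positivity]
    have h2 : |D.k5| * (CE * S) ≤ Q := by
      rw [hQ, add_mul]; nlinarith [show 0 ≤ |D.k6| * S by positivity]
    have h3 : ((splits I).length : ℝ) * Q ≤ 2 ^ k * Q := mul_le_mul_of_nonneg_right hlen hQ0
    have h4 : |D.k6| * S + (1 + |D.k4| + (|D.k5| * (CE * S) + (splits I).length * Q)) ≤ lam := by
      refine le_trans ?_ hlam
      unfold rate; rw [← hQ]; linarith
    have h5 := mul_le_mul_of_nonneg_right h4 (mul_nonneg hh.le hρ)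
    nlinarith
  have t7 := t6.trans (ofReal_le_ofReal hbound)
  have hb0 : ((-(D.h • D.X), 0) : Cyl (n + 1)).1 0 = -D.h := by simp [hD.X_zero]
  simp only [step]
  rw [dw_shift]
  have t8 := hN.shift τ (-(D.h • D.X), 0) ((smooth_body hD hu).dw I)
  rw [hb0] at t8
  refine (hN.mono _ (by linarith : τ' ≤ τ - -D.h)).trans (t8.trans ?_)
  refine (mul_le_mul_right t7 _).trans ?_
  rw [← ofReal_mul (Real.exp_pos _).le]
  refine ofReal_le_ofReal ?_
  have h1 : 1 + lam * D.h ≤ rexp (lam * D.h) := by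
    have := Real.add_one_le_exp (lam * D.h); linarith
  have h2 : rexp (lam * -D.h) * rexp (lam * D.h) = 1 := by rw [← Real.exp_add]; simp
  calc _ = rexp (lam * -D.h) * (1 + lam * D.h) * ρ := by ring
    _ ≤ rexp (lam * -D.h) * rexp (lam * D.h) * ρ := by gcongr
    _ = ρ := by rw [h2, one_mul]

/-- Bounds for all derivatives of order at most `k` hold for all iterates, uniformly in the step. -/
lemma iter_bound (hD : D.Good CE) (hN : IsAdmissible lam N) {k k' : ℕ} {S ρ T : ℝ} (hS : 0 ≤ S)
    (hρ : 0 ≤ ρ) (hk : k ≤ 2 * k' - 1) (hk' : 1 ≤ k') (hlam : D.rate CE k S ≤ lam)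
    (hsup : ∀ j : ℕ, (∀ I : Word (n + 1), I.length ≤ k →
        N (min (j * D.h) T) (dw I (D.iter j)) ≤ ofReal ρ) →
      ∀ x : Cyl (n + 1), x.1 0 < min (j * D.h) T → |D.k6 * D.iter j x| ≤ 1 ∧
      ∀ J : Word (n + 1), J.length ≤ k' → |dw J (D.iter j) x| ≤ S)
    (hG : ∀ I : Word (n + 1), I.length ≤ k → N T (dw I D.G) ≤ ofReal ρ)
    (j : ℕ) (I : Word (n + 1)) (hI : I.length ≤ k) :
    N (min (j * D.h) T) (dw I (D.iter j)) ≤ ofReal ρ := by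
  induction j generalizing I with
  | zero => simp only [iter]; rw [dw_zero, hN.zero]; exact zero_le
  | succ j ih =>
    have h1 := hsup j ih
    refine step_bound hD hN (smooth_iter hD j) hS hρ hk hk' hlam ?_ (fun x hx => (h1 x hx).1)
      (fun J hJ x hx => (h1 x hx).2 J hJ)
      (fun I hI => (hN.mono _ (min_le_right _ _)).trans (hG I hI)) ih hI
    have hh := hD.h_pos
    push_cast
    rcases le_total (j * D.h) T with h | h
    · rw [min_eq_left h]; exact (min_le_left _ _).trans (by linarith)
    · rw [min_eq_right h]; exact (min_le_right _ _).trans (by linarith)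

end Bounds
end SchemeData
end Scheme

/-! ### Bounds, causality and mean values of the scheme -/

section SchemeBounds
variable {n : ℕ}
variable {f u v : Fn (n + 1)} {lam T B s : ℝ}

lemma dw_eq_zero_of_past (hf : ∀ x : Cyl (n + 1), x.1 0 ≤ 0 → f x = 0)
    (I : Word (n + 1)) {x : Cyl (n + 1)} (hx : x.1 0 < 0) : dw I f x = 0 := by
  have hO : IsOpen {x : Cyl (n + 1) | x.1 0 < 0} :=
    isOpen_lt ((continuous_apply 0).comp continuous_fst) continuous_const
  have := dw_congr_open hO (f := f) (g := fun _ => 0) (fun y hy => hf y (le_of_lt hy)) I hx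
  rw [this, dw_zero]

lemma wsup_le_of_past (hf : ∀ x : Cyl (n + 1), x.1 0 ≤ 0 → f x = 0)
    {ρ : ℝ} (hlam : 0 ≤ lam) (hρ : 0 ≤ ρ) {I : Word (n + 1)}
    (h : ∀ x : Cyl (n + 1), x.1 0 < T → |dw I f x| ≤ ρ) :
    wsup lam T (dw I f) ≤ ofReal ρ := by
  refine (wsup_le_iff hρ).2 fun x hx => ?_
  by_cases h0 : x.1 0 < 0
  · rw [dw_eq_zero_of_past hf I h0, abs_zero]; positivity
  · refine (h x hx).trans (le_mul_of_one_le_right hρ (Real.one_le_exp ?_))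
    exact mul_nonneg hlam (not_lt.1 h0)

lemma wl2_le_of_past (hf : ∀ x : Cyl (n + 1), x.1 0 ≤ 0 → f x = 0)
    (hlam : 0 ≤ lam) (I : Word (n + 1)) :
    wl2 lam T (dw I f) ≤ eLpNorm (dw I f) 2 (vol (bΩ n T)) := by
  refine eLpNorm_mono fun x => ?_
  by_cases h0 : x.1 0 < 0
  · rw [dw_eq_zero_of_past hf I h0, mul_zero]
  · rw [Real.norm_eq_abs, abs_mul, abs_of_pos (Real.exp_pos _), Real.norm_eq_abs]
    refine mul_le_of_le_one_left (abs_nonneg _) (Real.exp_le_one_iff.2 ?_)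
    rw [neg_mul]; exact neg_nonpos.2 (mul_nonneg hlam (not_lt.1 h0))

lemma eLpNorm_le_wl2 {τ : ℝ} (hlam : 0 ≤ lam) (hτ : τ ≤ T) :
    eLpNorm f 2 (vol (bΩ n τ)) ≤ ofReal (rexp (lam * T)) * wl2 lam τ f := by
  refine eLpNorm_le_mul_eLpNorm_of_ae_le_mul ?_ 2
  have : ∀ᵐ x ∂vol (bΩ n τ), x ∈ bΩ n τ ×ˢ Ioo 0 (2 * π) :=
    ae_restrict_mem ((measurableSet_bdryDomain τ).prod measurableSet_Ioo)
  filter_upwards [this] with x hx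
  have hx0 : x.1 0 < τ := hx.1
  rw [Real.norm_eq_abs, Real.norm_eq_abs, abs_mul, abs_of_pos (Real.exp_pos _), ← mul_assoc,
    ← Real.exp_add]
  refine le_mul_of_one_le_left (abs_nonneg _) (Real.one_le_exp ?_)
  have := mul_nonneg hlam (by linarith : 0 ≤ T - x.1 0)
  linarith

namespace SchemeData

/-- The scheme with prescribed coefficients and a bound for the operator `E`. -/
structure HasCoeff (D : SchemeData n) (CE k4 k5 k6 : ℝ) : Prop extends D.Good CE where
  k4_eq : D.k4 = k4
  k5_eq : D.k5 = k5
  k6_eq : D.k6 = k6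

/-- The bounds of order two, for small sources: this is where the smallness of the source and the
final time enter. -/
def Small (D : SchemeData n) (T : ℝ) : Prop :=
  ∀ (j : ℕ) (x : Cyl (n + 1)), x.1 0 < min (j * D.h) T → |D.k6 * D.iter j x| ≤ 1 ∧
    ∀ J : Word (n + 1), J.length ≤ 2 → |dw J (D.iter j) x| ≤ 1

/-- A source that is small in `C²` keeps the discrete solutions small in `C²` up to time `T`: then
`|k₆ u| ≤ 1`, which is the stability (CFL) condition of the scheme. -/
lemma exists_small (n : ℕ) {CE : ℝ} (hCE : 0 ≤ CE) (k4 k5 k6 : ℝ) (T : ℝ) :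
    ∃ ρ : ℝ, 0 < ρ ∧ ∀ D : SchemeData n, D.HasCoeff CE k4 k5 k6 →
      (DerivLE (bΩ n T) 2 D.G ρ) → D.Small T := by
  set lam := 1 + |k4| + (2 ^ 2 + 2) * ((|k6| + |k5| * CE) * 1) with hlam
  have hlam0 : 0 ≤ lam := by positivity
  set r : ℝ := (1 + |k6|)⁻¹ with hr
  have hr0 : 0 < r := by positivity
  have hr1 : r ≤ 1 := inv_le_one_of_one_le₀ (by linarith [abs_nonneg k6])
  have hr6 : |k6| * r ≤ 1 := by rw [hr, ← div_eq_mul_inv, div_le_one (by positivity)]; linarith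
  set ρ := rexp (-(lam * T)) * r with hρ
  have hρ0 : 0 < ρ := by positivity
  refine ⟨ρ, hρ0, fun D hD hG => ?_⟩
  have key : ∀ j : ℕ, (∀ I : Word (n + 1), I.length ≤ 2 →
      wsup lam (min (j * D.h) T) (dw I (D.iter j)) ≤ ofReal ρ) →
      ∀ x : Cyl (n + 1), x.1 0 < min (j * D.h) T → |D.k6 * D.iter j x| ≤ 1 ∧
      ∀ J : Word (n + 1), J.length ≤ 2 → |dw J (D.iter j) x| ≤ 1 := by
    intro j hj x hx
    have h1 : ∀ J : Word (n + 1), J.length ≤ 2 → |dw J (D.iter j) x| ≤ r := by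
      intro J hJ
      refine ((wsup_le_iff hρ0.le).1 (hj J hJ) x hx).trans ?_
      rw [hρ, mul_assoc, mul_comm r, ← mul_assoc, ← Real.exp_add]
      refine mul_le_of_le_one_left hr0.le (Real.exp_le_one_iff.2 ?_)
      have := mul_nonneg hlam0 (by linarith [hx.trans_le (min_le_right _ _)] : 0 ≤ T - x.1 0)
      linarith
    refine ⟨?_, fun J hJ => (h1 J hJ).trans hr1⟩
    rw [abs_mul, hD.k6_eq]
    exact (mul_le_mul_of_nonneg_left (h1 [] (by simp)) (abs_nonneg _)).trans hr6
  intro j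
  refine key j fun I hI => iter_bound (k' := 2) hD.toGood (isAdmissible_wsup lam) zero_le_one hρ0.le
    (by norm_num) (by norm_num) ?_ key (fun I hI => ?_) j I hI
  · simp only [rate]; rw [hD.k4_eq, hD.k5_eq, hD.k6_eq]
  · exact wsup_le_of_past hD.past hlam0 hρ0.le (hG I hI)

/-- Supremum bounds of every order, uniformly in the step of the scheme. -/
lemma exists_sup_bound (n : ℕ) {CE : ℝ} (hCE : 0 ≤ CE) (k4 k5 k6 : ℝ) (T : ℝ) (k : ℕ)
    {B : ℝ} (hB : 0 ≤ B) :
    ∃ S : ℝ, 0 ≤ S ∧ ∀ D : SchemeData n, D.HasCoeff CE k4 k5 k6 → D.Small T →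
      (DerivLE (bΩ n T) k D.G B) →
      ∀ (j : ℕ) (x : Cyl (n + 1)), x.1 0 < min (j * D.h) T →
        ∀ J : Word (n + 1), J.length ≤ k → |dw J (D.iter j) x| ≤ S := by
  induction k with
  | zero => exact ⟨1, zero_le_one, fun D _ hs _ j x hx J hJ => (hs j x hx).2 J (by omega)⟩
  | succ k ih =>
    by_cases hk : k ≤ 1
    · exact ⟨1, zero_le_one, fun D _ hs _ j x hx J hJ => (hs j x hx).2 J (by omega)⟩
    obtain ⟨S, hS0, hS⟩ := ih
    set lam := 1 + |k4| + (2 ^ (k + 1) + 2) * ((|k6| + |k5| * CE) * S) with hlam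
    have hlam0 : 0 ≤ lam := by positivity
    refine ⟨B * rexp (lam * T), by positivity, fun D hD hs hG j x hx J hJ => ?_⟩
    have hS' := hS D hD hs (fun I hI => hG I (by omega))
    have := iter_bound (k := k + 1) (k' := k) hD.toGood (isAdmissible_wsup lam) hS0 hB (T := T)
      (by omega) (by omega) ?_ (fun j _ x hx => ⟨(hs j x hx).1, hS' j x hx⟩)
      (fun I hI => wsup_le_of_past hD.past hlam0 hB (hG I hI)) j J hJ
    · refine ((wsup_le_iff hB).1 this x hx).trans ?_
      gcongr
      exact (hx.trans_le (min_le_right _ _)).le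
    · simp only [rate]; rw [hD.k4_eq, hD.k5_eq, hD.k6_eq]

/-- `L²` bounds up to order `2 k' - 1`, uniformly in the step of the scheme, from supremum bounds up
to order `k'`. -/
lemma exists_l2_bound (n : ℕ) {CE : ℝ} (hCE : 0 ≤ CE) (k4 k5 k6 : ℝ) (T : ℝ)
    {k k' : ℕ} (hk : k ≤ 2 * k' - 1) (hk' : 1 ≤ k') {S B : ℝ} (hS : 0 ≤ S) (hB : 0 ≤ B) :
    ∃ R : ℝ, 0 ≤ R ∧ ∀ D : SchemeData n, D.HasCoeff CE k4 k5 k6 → D.Small T →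
      (∀ (j : ℕ) (x : Cyl (n + 1)), x.1 0 < min (j * D.h) T →
        ∀ J : Word (n + 1), J.length ≤ k' → |dw J (D.iter j) x| ≤ S) →
      (DerivL2LE (bΩ n T) k D.G (ofReal B)) →
      ∀ (j : ℕ) (I : Word (n + 1)), I.length ≤ k →
        eLpNorm (dw I (D.iter j)) 2 (vol (bΩ n (min (j * D.h) T))) ≤ ofReal R := by
  set lam := 1 + |k4| + (2 ^ k + 2) * ((|k6| + |k5| * CE) * S) with hlam
  have hlam0 : 0 ≤ lam := by positivity
  refine ⟨rexp (lam * T) * B, by positivity, fun D hD hs hS' hG j I hI => ?_⟩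
  have := iter_bound hD.toGood (isAdmissible_wl2 lam) hS hB (T := T) hk hk' ?_
    (fun j _ x hx => ⟨(hs j x hx).1, fun J hJ => hS' j x hx J hJ⟩)
    (fun I hI => (wl2_le_of_past hD.past hlam0 I).trans (hG I hI)) j I hI
  · refine (eLpNorm_le_wl2 hlam0 (min_le_right _ _)).trans ?_
    rw [ofReal_mul (Real.exp_pos _).le]
    exact mul_le_mul_right this _
  · simp only [rate]; rw [hD.k4_eq, hD.k5_eq, hD.k6_eq]

variable {D : SchemeData n} {CE : ℝ}

lemma body_congr (hD : D.Good CE) (h : ∀ x : Cyl (n + 1), x.1 0 ≤ s → u x = v x) :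
    ∀ x : Cyl (n + 1), x.1 0 ≤ s → D.body u x = D.body v x := by
  intro x hx
  have h1 : ∀ t : ℝ, u (x + (0, t)) = v (x + (0, t)) := fun t => h _ (by simpa using hx)
  simp only [body, nonlin, cdiff]
  rw [h1, h1, h x hx, hD.tame.causal h h x hx]

lemma step_congr (hD : D.Good CE) (h : ∀ x : Cyl (n + 1), x.1 0 ≤ s → u x = v x) :
    ∀ x : Cyl (n + 1), x.1 0 ≤ s + D.h → D.step u x = D.step v x := by
  intro x hx
  refine body_congr hD h _ ?_
  simp [hD.X_zero]; linarith

lemma body_zero (hD : D.Good CE) (x : Cyl (n + 1)) (hx : x.1 0 ≤ 0) : D.body (fun _ => 0) x = 0 := by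
  simp [body, nonlin, hD.tame.zero, hD.past x hx]

lemma iter_past (hD : D.Good CE) (j : ℕ) (x : Cyl (n + 1)) (hx : x.1 0 ≤ 0) : D.iter j x = 0 := by
  induction j generalizing x with
  | zero => rfl
  | succ j ih =>
    have := step_congr hD (u := D.iter j) (v := fun _ => 0) (s := 0) ih x (by linarith [hD.h_pos])
    simp only [iter]; rw [this]
    exact body_zero hD _ (by simp [hD.X_zero]; linarith [hD.h_pos])

/-- The iterates become stationary, from the past to the future. -/
lemma iter_stable (hD : D.Good CE) (j : ℕ) (x : Cyl (n + 1)) (hx : x.1 0 ≤ j * D.h) :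
    D.iter (j + 1) x = D.iter j x := by
  induction j generalizing x with
  | zero => rw [iter_past hD _ x (by simpa using hx), iter_past hD _ x (by simpa using hx)]
  | succ j ih => exact step_congr hD ih x (by push_cast at hx; linarith)

lemma periodic_integral_add {f : ℝ → ℝ} (hf : Function.Periodic f (2 * π)) (s : ℝ) :
    ∫ θ in 0..2 * π, f (θ + s) = ∫ θ in 0..2 * π, f θ := by
  rw [intervalIntegral.integral_comp_add_right]
  have := hf.intervalIntegral_add_eq (0 + s) 0
  rw [zero_add] at this ⊢
  rw [add_comm (2 * π) s, this, zero_add]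

/-- The scheme preserves zero mean in `θ`. -/
lemma iter_mean (hD : D.Good CE) (hG : ∀ z : Pt (n + 1), z 0 < T →
      ∫ θ in 0..2 * π, D.G (z, θ) = 0) (j : ℕ) (z : Pt (n + 1)) (hz : z 0 < T) :
    ∫ θ in 0..2 * π, D.iter j (z, θ) = 0 := by
  induction j generalizing z with
  | zero => simp [iter]
  | succ j ih =>
    set y := z + -(D.h • D.X) with hy
    have hy0 : y 0 < T := by simp [hy, hD.X_zero]; linarith [hD.h_pos]
    set u := D.iter j with hu
    have hus : SmoothPer u := smooth_iter hD j
    clear_value u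
    have hu' : Continuous u := hus.continuous
    have hcG : Continuous fun θ : ℝ => D.G (y, θ) := hD.smooth.continuous.comp (by fun_prop)
    have hcE : Continuous fun θ : ℝ => D.E u u (y, θ) :=
      (hD.tame.leibniz.smooth hus hus).continuous.comp (by fun_prop)
    have hper : Function.Periodic (fun θ => u (y, θ)) (2 * π) := fun θ => hus.periodic y θ
    have e : ∀ θ, D.iter (j + 1) (z, θ) = (u (y, θ + D.h) + u (y, θ + -D.h)) / 2 +
        D.h * (D.G (y, θ) - D.k4 * u (y, θ)) - D.h * (D.k6 * ((2 * D.h)⁻¹ *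
          (u (y, θ) * u (y, θ + D.h) - u (y, θ + -D.h) * u (y, θ))) + D.k5 * D.E u u (y, θ)) := by
      intro θ
      simp only [iter, step, body, nonlin, cdiff, KeyProfile.shift, Prod.mk_add_mk, add_zero, ← hu, ← hy]
      ring
    simp only [e]
    have hc1 : ∀ s : ℝ, Continuous fun θ : ℝ => u (y, θ + s) := fun s =>
      hus.continuous.comp (by fun_prop)
    have hc2 := hc1 D.h
    have hc3 := hc1 (-D.h)
    have m1 : ∀ s, ∫ θ in 0..2 * π, u (y, θ + s) = 0 := fun s => by
      rw [periodic_integral_add hper s]; exact ih y hy0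
    have m2 : ∫ θ in 0..2 * π, u (y, θ) * u (y, θ + D.h) =
        ∫ θ in 0..2 * π, u (y, θ + -D.h) * u (y, θ) := by
      have hp2 : Function.Periodic (fun θ => u (y, θ) * u (y, θ + D.h)) (2 * π) := fun θ => by
        have h1 := hus.periodic y θ
        have h2 := hus.periodic y (θ + D.h)
        simp only [h1]
        rw [show θ + 2 * π + D.h = θ + D.h + 2 * π by ring, h2]
      rw [← periodic_integral_add hp2 (-D.h)]
      simp
    rw [intervalIntegral.integral_sub, intervalIntegral.integral_add,
      intervalIntegral.integral_div, intervalIntegral.integral_add, m1, m1,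
      intervalIntegral.integral_const_mul, intervalIntegral.integral_sub, hG y hy0,
      intervalIntegral.integral_const_mul, ih y hy0, intervalIntegral.integral_const_mul,
      intervalIntegral.integral_add, intervalIntegral.integral_const_mul,
      intervalIntegral.integral_const_mul, intervalIntegral.integral_sub, m2,
      intervalIntegral.integral_const_mul, hD.tame.mean hus hus]
    · simp
    all_goals exact Continuous.intervalIntegrable (by fun_prop) _ _

end SchemeData
end SchemeBounds

/-! ### The discretised interaction integral -/

section Pairing
variable {k : ℕ}
variable {u v : Fn k} {S W : ℝ} {z : Pt k}

/-- A sum over a full period of a periodic sequence does not depend on the starting point. -/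
lemma sum_range_periodic {f : ℤ → ℝ} {M : ℕ} (hf : ∀ l, f (l + M) = f l) (a : ℤ) :
    ∑ l ∈ Finset.range M, f (l + a) = ∑ l ∈ Finset.range M, f l := by
  have step : ∀ a : ℤ, ∑ l ∈ Finset.range M, f (l + (a + 1)) = ∑ l ∈ Finset.range M, f (l + a) := by
    intro a
    have h1 := Finset.sum_range_succ (fun l : ℕ => f (l + a)) M
    have h2 := Finset.sum_range_succ' (fun l : ℕ => f (l + a)) M
    have h3 : f (M + a) = f a := by rw [add_comm]; exact hf a
    simp only [Nat.cast_add, Nat.cast_one, Nat.cast_zero, zero_add] at h2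
    have h4 : ∀ l : ℕ, f (l + (a + 1)) = f (l + 1 + a) := fun l => by congr 1; ring
    simp only [h4]
    linarith
  induction a using Int.induction_on with
  | zero => simp
  | succ i ih => rw [step, ih]
  | pred i ih => rw [← ih, ← step (-(i : ℤ) - 1)]; simp

/-- The average over the translations by multiples of `2π / N` in `θ`. -/
def prepAvg (N : ℤ) (u : Fn k) : Fn k :=
  fun x => (N.natAbs : ℝ)⁻¹ * ∑ i ∈ Finset.range N.natAbs, u (x + (0, 2 * π * i / N))

lemma prepAvg_eq (N : ℤ) (u : Fn k) : prepAvg N u = fun x => (N.natAbs : ℝ)⁻¹ *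
    ∑ i ∈ Finset.range N.natAbs, shift (0, 2 * π * i / N) u x := rfl

lemma SmoothPer.prepAvg (hu : SmoothPer u) (N : ℤ) : SmoothPer (prepAvg N u) :=
  (SmoothPer.sum fun _ _ => hu.shift _).const_mul _

lemma dv_prepAvg (hu : SmoothPer u) (N : ℤ) (i : Option (Fin k)) :
    dv (dir i) (KeyProfile.prepAvg N u) = KeyProfile.prepAvg N (dv (dir i) u) := by
  rw [prepAvg_eq, dv_const_mul (SmoothPer.sum fun _ _ => hu.shift _)]
  have := dw_sum (s := Finset.range N.natAbs) (f := fun j : ℕ => KeyProfile.shift (0, 2 * π * j / N) u)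
    (fun _ _ => hu.shift _) [i]
  simp only [dw] at this
  rw [this, prepAvg_eq]
  simp only [dv_shift]

/-- `prepAvg N u` is `2π / N`-periodic in `θ`. -/
lemma prepAvg_add {N : ℤ} (hN : N ≠ 0) (hu : PeriodicTheta u) (x : Cyl k) (m : ℤ) :
    prepAvg N u (x + (0, 2 * π * m / N)) = prepAvg N u x := by
  have hN' : (N : ℝ) ≠ 0 := by exact_mod_cast hN
  have key := sum_range_periodic (f := fun l : ℤ => u (x + (0, 2 * π * l / N))) (M := N.natAbs) ?_ m
  · simp only [prepAvg]
    congr 1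
    simp only [Int.cast_natCast] at key
    rw [← key]
    refine sum_congr rfl fun i _ => ?_
    congr 1
    rw [add_assoc]; congr 1
    simp only [Prod.mk_add_mk, add_zero, Prod.mk.injEq, true_and]
    push_cast; ring
  · intro l
    have e : x + ((0 : Pt k), 2 * π * ((l + N.natAbs : ℤ) : ℝ) / N) =
        (x.1, x.2 + 2 * π * l / N + (N.sign : ℝ) * (2 * π)) := by
      ext
      · simp
      · simp only [Prod.snd_add]
        have h1 : ((N.natAbs : ℤ) : ℝ) = N.sign * N := by
          rw [← Int.cast_mul]; congr 1
          rw [Int.sign_mul_self_eq_natAbs]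
        rw [Int.cast_add, h1]; field_simp; ring
    have e2 : x + ((0 : Pt k), 2 * π * (l : ℝ) / N) = (x.1, x.2 + 2 * π * l / N) := by
      ext <;> simp
    rw [e, e2]
    exact_mod_cast hu.add_int _ _ N.sign

/-- The data of a discretised bilinear integral operator
`∑_r w_r ∑_l (2π/M) (P u)(x + (p_r, (N₂/N) 2πl/M)) v(x + (q_r, 2πl/M))`, `P = prepAvg N`. -/
structure PairData (k : ℕ) where
  N : ℤ
  N₂ : ℤ
  M : ℕ
  R : ℕ
  w : ℕ → ℝ
  p : ℕ → Pt k
  q : ℕ → Pt k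

namespace PairData
variable (P : PairData k)

/-- The mesh in the angular variable of integration. -/
def mesh : ℝ := 2 * π / P.M

/-- The ratio `N₂ / N`. -/
def ratio : ℝ := (P.N₂ : ℝ) / P.N

/-- The step of the difference quotient in `θ`. -/
def inc : ℝ := P.N₂ * P.mesh

/-- The bilinear operator. -/
def pairing (u v : Fn k) : Fn k := fun x => ∑ r ∈ Finset.range P.R, P.w r *
  ∑ l ∈ Finset.range P.M, P.mesh * (prepAvg P.N u (x + (P.p r, P.ratio * (P.mesh * l))) *
    v (x + (P.q r, P.mesh * l)))

/-- The difference quotient in `θ` of the bilinear operator. -/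
def quot (u v : Fn k) : Fn k :=
  fun x => P.inc⁻¹ * (P.pairing u v (x + (0, P.inc)) - P.pairing u v x)

lemma leibniz_pairing : IsLeibniz P.pairing := by
  refine IsLeibniz.sum fun r _ => IsLeibniz.const_mul (IsLeibniz.sum fun l _ => IsLeibniz.const_mul ?_ _) _
  exact isLeibniz_mul.comp (A := fun u => shift (P.p r, P.ratio * (P.mesh * l)) (prepAvg P.N u))
    (B := fun v => shift (P.q r, P.mesh * l) v) (fun h => (h.prepAvg _).shift _) (fun h => h.shift _)
    (fun i h => by rw [dv_shift, dv_prepAvg h]) (fun i h => dv_shift _ _ _)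

lemma _root_.KeyProfile.IsLeibniz.quot {B : Fn k → Fn k → Fn k} (hB : IsLeibniz B)
    (c : ℝ) (b : Cyl k) : IsLeibniz (fun u v x => c * (B u v (x + b) - B u v x)) := by
  refine IsLeibniz.const_mul ⟨fun hu hv => ((hB.smooth hu hv).shift b).sub (hB.smooth hu hv),
    fun {u v} i hu hv => ?_⟩ c
  have h1 := (hB.smooth hu hv).shift b
  have h2 := hB.smooth hu hv
  have := dw_sub h1 h2 [i]
  simp only [dw, dv_shift] at this
  show dv (dir i) (fun x => shift b (B u v) x - B u v x) = _
  rw [this, hB.dv_eq i hu hv]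
  funext x; simp only [KeyProfile.shift]; ring

lemma leibniz_quot : IsLeibniz P.quot := P.leibniz_pairing.quot _ _

/-- The structural conditions: a positive number of nodes, and nonzero integers. -/
structure Good : Prop where
  N_ne : P.N ≠ 0
  N₂_ne : P.N₂ ≠ 0
  M_pos : 0 < P.M

variable {P}

lemma Good.mesh_pos (hP : P.Good) : 0 < P.mesh :=
  div_pos Real.two_pi_pos (by exact_mod_cast hP.M_pos)

lemma Good.inc_ne (hP : P.Good) : P.inc ≠ 0 :=
  mul_ne_zero (by exact_mod_cast hP.N₂_ne) hP.mesh_pos.ne'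

lemma Good.mesh_sum (hP : P.Good) : P.M * P.mesh = 2 * π := by
  have : (P.M : ℝ) ≠ 0 := by exact_mod_cast hP.M_pos.ne'
  rw [mesh]; field_simp

/-- Summation by parts: the sum over `l` is periodic in `l`, so that its index may be shifted by any
integer `m`. -/
lemma quot_eq (hP : P.Good) (hu : PeriodicTheta u) (hv : PeriodicTheta v) (x : Cyl k) (m : ℤ) :
    P.quot u v x = ∑ r ∈ Finset.range P.R, P.w r * ∑ l ∈ Finset.range P.M, P.mesh * (P.inc⁻¹ *
      (prepAvg P.N u (x + (P.p r, P.ratio * (P.mesh * l) + (P.inc - P.ratio * (P.mesh * m)))) *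
        v (x + (P.q r, P.mesh * l + (P.inc - P.mesh * m))) -
      prepAvg P.N u (x + (P.p r, P.ratio * (P.mesh * l))) * v (x + (P.q r, P.mesh * l)))) := by
  have hM := hP.mesh_sum
  simp only [quot, pairing]
  rw [← sum_sub_distrib, mul_sum]
  refine sum_congr rfl fun r _ => ?_
  have key := sum_range_periodic (M := P.M) (f := fun l : ℤ =>
    prepAvg P.N u (x + (P.p r, P.ratio * (P.mesh * l) + (P.inc - P.ratio * (P.mesh * m)))) *
      v (x + (P.q r, P.mesh * l + (P.inc - P.mesh * m)))) (fun l => ?_) m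
  · simp only [Int.cast_natCast, Int.cast_add, ← mul_sum, sum_sub_distrib] at key ⊢
    rw [← key]
    have e : ∀ (z : Pt k) (s t : ℝ), P.inc + s = t → x + (0, P.inc) + (z, s) = x + (z, t) := by
      rintro z s _ rfl
      rw [add_assoc]; congr 1
      simp
    have e1 := fun l : ℕ => e (P.p r) (P.ratio * (P.mesh * l))
      (P.ratio * (P.mesh * (l + m)) + (P.inc - P.ratio * (P.mesh * m))) (by ring)
    have e2 := fun l : ℕ => e (P.q r) (P.mesh * l) (P.mesh * (l + m) + (P.inc - P.mesh * m)) (by ring)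
    simp only [e1, e2]
    ring
  · congr 1
    · refine Eq.trans (congrArg _ ?_) (prepAvg_add hP.N_ne hu _ P.N₂)
      rw [add_assoc]
      simp only [Prod.mk_add_mk, add_zero, ← hM, ratio]
      push_cast; ring_nf
    · refine Eq.trans (congrArg v (Prod.ext (by simp) ?_)) (hv _ _)
      simp only [Prod.snd_add, ← hM]
      push_cast; ring

end PairData

lemma prepAvg_sub_le (hu : SmoothPer u) {N : ℤ} (hN : N ≠ 0)
    (h : ∀ θ, |dv (dir none) u (z, θ)| ≤ S) (θ θ' : ℝ) :
    |prepAvg N u (z, θ') - prepAvg N u (z, θ)| ≤ S * |θ' - θ| := by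
  have hN0 : (0 : ℝ) < N.natAbs := by exact_mod_cast Int.natAbs_pos.2 hN
  simp only [prepAvg]
  rw [← mul_sub, ← sum_sub_distrib, abs_mul, abs_of_pos (inv_pos.2 hN0), inv_mul_le_iff₀ hN0]
  refine (abs_sum_le_sum_abs _ _).trans ?_
  refine (Finset.sum_le_card_nsmul _ _ (S * |θ' - θ|) fun i _ => ?_).trans (by simp)
  have := abs_sub_le_of_dv_theta hu h (θ + 2 * π * i / N) (θ' + 2 * π * i / N)
  simpa using this

lemma abs_prepAvg_le {N : ℤ} (hN : N ≠ 0)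
    (h : ∀ θ, |u (z, θ)| ≤ S) (θ : ℝ) : |prepAvg N u (z, θ)| ≤ S := by
  have hN0 : (0 : ℝ) < N.natAbs := by exact_mod_cast Int.natAbs_pos.2 hN
  simp only [prepAvg]
  rw [abs_mul, abs_of_pos (inv_pos.2 hN0), inv_mul_le_iff₀ hN0]
  refine (abs_sum_le_sum_abs _ _).trans ?_
  refine (Finset.sum_le_card_nsmul _ _ S fun i _ => ?_).trans (by simp)
  simpa using h (θ + 2 * π * i / N)

section Tame
variable {n : ℕ} {lam : ℝ} {N : ℝ → Fn (n + 1) → ℝ≥0∞}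

lemma IsAdmissible.shift_le (hN : IsAdmissible lam N) (hlam : 0 ≤ lam) {f : Fn (n + 1)}
    (hf : SmoothPer f) {b : Cyl (n + 1)} (hb : b.1 0 ≤ 0) (τ : ℝ) : N τ (KeyProfile.shift b f) ≤ N τ f := by
  refine (hN.mono _ (by linarith : τ ≤ τ - b.1 0)).trans ((hN.shift τ b hf).trans ?_)
  refine mul_le_of_le_one_left zero_le ?_
  rw [← ofReal_one]
  exact ofReal_le_ofReal (Real.exp_le_one_iff.2 (mul_nonpos_of_nonneg_of_nonpos hlam hb))

lemma IsAdmissible.sum_le (hN : IsAdmissible lam N) {ι : Type*} (s : Finset ι)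
    {f : ι → Fn (n + 1)} (τ : ℝ) (hf : ∀ i ∈ s, SmoothPer (f i)) :
    N τ (fun x => ∑ i ∈ s, f i x) ≤ ∑ i ∈ s, N τ (f i) := by
  classical
  induction s using Finset.induction_on with
  | empty => simp [hN.zero]
  | insert a s ha ih =>
    simp only [Finset.sum_insert ha]
    exact (hN.add τ (hf a (by simp)) (SmoothPer.sum fun i hi => hf i (by simp [hi]))).trans
      (add_le_add le_rfl (ih fun i hi => hf i (by simp [hi])))

lemma IsAdmissible.prepAvg_le (hN : IsAdmissible lam N) (hlam : 0 ≤ lam) {f : Fn (n + 1)}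
    (hf : SmoothPer f) {m : ℤ} (hm : m ≠ 0) (τ : ℝ) : N τ (prepAvg m f) ≤ N τ f := by
  have hm0 : (0 : ℝ) < m.natAbs := by exact_mod_cast Int.natAbs_pos.2 hm
  rw [prepAvg_eq]
  refine (hN.smul _ _ _).trans ?_
  refine (mul_le_mul_right ((hN.sum_le _ τ fun _ _ => hf.shift _).trans
    (sum_le_sum fun i _ => hN.shift_le hlam hf (by simp) τ)) _).trans (le_of_eq ?_)
  rw [sum_const, card_range, nsmul_eq_mul, ← mul_assoc,
    ← ofReal_natCast, ← ofReal_mul (abs_nonneg _), abs_of_pos (inv_pos.2 hm0),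
    inv_mul_cancel₀ hm0.ne', ofReal_one, one_mul]

/-- The weighted double sums of `pairing`, measured by a subadditive and homogeneous functional. -/
lemma PairData.double_sum_le {P : PairData k} (hP : P.Good) {Φ : Fn k → ℝ≥0∞} {a : ℝ≥0∞}
    (hW : ∑ r ∈ Finset.range P.R, |P.w r| ≤ W) (hc : ∀ c g, Φ (fun x => c * g x) ≤ ofReal |c| * Φ g)
    (hs : ∀ (m : ℕ) (g : ℕ → Fn k), (∀ i, SmoothPer (g i)) →
      Φ (fun x => ∑ i ∈ Finset.range m, g i x) ≤ ∑ i ∈ Finset.range m, Φ (g i))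
    {f : ℕ → ℕ → Fn k} (hf : ∀ r l, SmoothPer (f r l)) (ha : ∀ r l, Φ (f r l) ≤ a) :
    Φ (fun x => ∑ r ∈ Finset.range P.R, P.w r * ∑ l ∈ Finset.range P.M, P.mesh * f r l x) ≤
      ofReal (2 * π * W) * a := by
  have hpi := Real.pi_pos
  have hsm : ∀ r, SmoothPer fun x => ∑ l ∈ Finset.range P.M, P.mesh * f r l x := fun r =>
    SmoothPer.sum fun l _ => (hf r l).const_mul _
  refine (hs _ _ fun r => (hsm r).const_mul _).trans ?_
  calc _ ≤ ∑ r ∈ Finset.range P.R, ofReal |P.w r| * (ofReal (2 * π) * a) := by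
        refine sum_le_sum fun r _ => (hc _ _).trans (mul_le_mul_right ?_ _)
        refine (hs _ _ fun l => (hf r l).const_mul _).trans ?_
        calc _ ≤ ∑ _l ∈ Finset.range P.M, ofReal P.mesh * a :=
              sum_le_sum fun l _ => (hc _ _).trans
                (by rw [abs_of_pos hP.mesh_pos]; exact mul_le_mul_right (ha r l) _)
          _ = _ := by
              rw [sum_const, card_range, nsmul_eq_mul, ← mul_assoc, ← hP.mesh_sum,
                ofReal_mul (by positivity), ofReal_natCast]
    _ ≤ _ := by
        rw [← sum_mul, ← mul_assoc, ← ENNReal.ofReal_sum_of_nonneg (fun _ _ => abs_nonneg _),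
          ← ofReal_mul (sum_nonneg fun _ _ => abs_nonneg _)]
        exact mul_le_mul_left (ofReal_le_ofReal (by nlinarith)) _

/-- The bound for the difference quotient of the discretised interaction integral. -/
def PairData.const (N N₂ : ℤ) (W : ℝ) : ℝ :=
  2 * π * W * (|1 - (N₂ : ℝ) / N| + |((N₂ : ℝ) - N) / N₂|)

/-- Shifting the index by `N₂` puts the difference quotient on `u`, shifting it by `N` puts it on `v`. -/
lemma PairData.isTame {P : PairData (n + 1)} (hP : P.Good)
    (hW : ∑ r ∈ Finset.range P.R, |P.w r| ≤ W) (hp : ∀ r, P.p r 0 ≤ 0) (hq : ∀ r, P.q r 0 ≤ 0) :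
    IsTame P.quot (PairData.const P.N P.N₂ W) := by
  have hW0 : 0 ≤ W := le_trans (sum_nonneg fun _ _ => abs_nonneg _) hW
  have hinc := hP.inc_ne
  have hπ := Real.pi_pos
  have main : ∀ {lam : ℝ} {N : ℝ → Fn (n + 1) → ℝ≥0∞} {S τ : ℝ} {a : ℝ≥0∞}, IsAdmissible lam N →
      0 ≤ S → ∀ {f g : ℕ → ℕ → Fn (n + 1)}, (∀ r l, SmoothPer (f r l)) → (∀ r l, SmoothPer (g r l)) →
      (∀ r l, ∀ x : Cyl (n + 1), x.1 0 < τ → |f r l x| ≤ S) → (∀ r l, N τ (g r l) ≤ a) →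
      N τ (fun x => ∑ r ∈ Finset.range P.R, P.w r * ∑ l ∈ Finset.range P.M, P.mesh *
        (f r l x * g r l x)) ≤ ofReal (2 * π * W * S) * a := fun hN hS _ _ hf hg hb ha => by
    rw [ofReal_mul (by positivity), mul_assoc]
    exact PairData.double_sum_le hP hW (fun c => hN.smul c _) (fun m g hg => hN.sum_le _ _ fun i _ => hg i)
      (fun r l => (hf r l).mul (hg r l)) fun r l =>
        (hN.mul hS (hb r l)).trans (mul_le_mul_right (ha r l) _)
  refine ⟨by unfold PairData.const; positivity, P.leibniz_quot, ?_, ?_, ?_, ?_, ?_⟩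
  · funext x; simp [PairData.quot, PairData.pairing]
  · intro lam N hlam hN S τ u v hS hu hv hb
    have e : P.quot u v = fun x => ∑ r ∈ Finset.range P.R, P.w r * ∑ l ∈ Finset.range P.M, P.mesh *
        (P.inc⁻¹ * (prepAvg P.N u (x + (P.p r, P.ratio * (P.mesh * l) + P.inc * (1 - P.ratio))) -
          prepAvg P.N u (x + (P.p r, P.ratio * (P.mesh * l)))) * shift (P.q r, P.mesh * l) v x) := by
      funext x
      rw [P.quot_eq hP hu.periodic hv.periodic x P.N₂]
      refine sum_congr rfl fun r _ => congrArg _ (sum_congr rfl fun l _ => ?_)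
      rw [show P.inc - P.ratio * (P.mesh * P.N₂) = P.inc * (1 - P.ratio) by rw [PairData.inc]; ring,
        show P.inc - P.mesh * P.N₂ = 0 by rw [PairData.inc]; ring, add_zero]
      simp only [shift]; ring
    rw [e]
    refine (main hN (S := S * |1 - (P.N₂ : ℝ) / P.N|) (a := N τ v) (by positivity)
      (fun r l => (((hu.prepAvg _).shift _).sub ((hu.prepAvg _).shift _)).const_mul _)
      (fun r l => hv.shift _) (fun r l x hx => ?_)
      (fun r l => hN.shift_le hlam hv (by simpa using hq r) τ)).trans ?_
    · have h1 := prepAvg_sub_le hu hP.N_ne (z := x.1 + P.p r) (S := S)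
        (fun θ => hb _ (by simp only [Pi.add_apply]; linarith [hp r]))
        (x.2 + P.ratio * (P.mesh * l)) (x.2 + (P.ratio * (P.mesh * l) + P.inc * (1 - P.ratio)))
      rw [abs_mul, abs_inv, inv_mul_le_iff₀ (abs_pos.2 hinc)]
      refine le_trans h1 (le_of_eq ?_)
      rw [show x.2 + (P.ratio * (P.mesh * l) + P.inc * (1 - P.ratio)) - (x.2 + P.ratio * (P.mesh * l)) =
        P.inc * (1 - P.ratio) by ring, abs_mul]
      simp only [PairData.ratio]; ring
    · refine mul_le_mul_left (ofReal_le_ofReal ?_) _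
      rw [← mul_assoc, mul_right_comm, PairData.const]
      gcongr
      exact le_add_of_nonneg_right (abs_nonneg _)
  · intro lam N hlam hN S τ u v hS hu hv hb
    have e : P.quot u v = fun x => ∑ r ∈ Finset.range P.R, P.w r * ∑ l ∈ Finset.range P.M, P.mesh *
        (P.inc⁻¹ * (v (x + (P.q r, P.mesh * l + P.mesh * (P.N₂ - P.N))) - v (x + (P.q r, P.mesh * l))) *
          shift (P.p r, P.ratio * (P.mesh * l)) (prepAvg P.N u) x) := by
      funext x
      rw [P.quot_eq hP hu.periodic hv.periodic x P.N]
      refine sum_congr rfl fun r _ => congrArg _ (sum_congr rfl fun l _ => ?_)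
      have hN' : (P.N : ℝ) ≠ 0 := by exact_mod_cast hP.N_ne
      rw [show P.inc - P.ratio * (P.mesh * P.N) = 0 by
          rw [PairData.inc, PairData.ratio]; field_simp; ring,
        show P.inc - P.mesh * P.N = P.mesh * (P.N₂ - P.N) by rw [PairData.inc]; ring, add_zero]
      simp only [shift]; ring
    rw [e]
    refine (main hN (S := S * |((P.N₂ : ℝ) - P.N) / P.N₂|) (a := N τ u) (by positivity)
      (fun r l => ((hv.shift _).sub (hv.shift _)).const_mul _)
      (fun r l => (hu.prepAvg _).shift _) (fun r l x hx => ?_)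
      (fun r l => (hN.shift_le hlam (hu.prepAvg _) (by simpa using hp r) τ).trans
        (hN.prepAvg_le hlam hu hP.N_ne τ))).trans ?_
    · have h1 := abs_sub_le_of_dv_theta hv (z := x.1 + P.q r) (S := S)
        (fun θ => hb _ (by simp only [Pi.add_apply]; linarith [hq r]))
        (x.2 + P.mesh * l) (x.2 + (P.mesh * l + P.mesh * (P.N₂ - P.N)))
      rw [abs_mul, abs_inv, inv_mul_le_iff₀ (abs_pos.2 hinc)]
      refine le_trans h1 (le_of_eq ?_)
      have hN2 : (P.N₂ : ℝ) ≠ 0 := by exact_mod_cast hP.N₂_ne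
      rw [show x.2 + (P.mesh * l + P.mesh * (P.N₂ - P.N)) - (x.2 + P.mesh * l) =
        P.inc * (((P.N₂ : ℝ) - P.N) / P.N₂) by simp only [PairData.inc]; field_simp; ring, abs_mul]
      ring
    · refine mul_le_mul_left (ofReal_le_ofReal ?_) _
      rw [← mul_assoc, mul_right_comm, PairData.const]
      gcongr
      exact le_add_of_nonneg_left (abs_nonneg _)
  · intro s u u' v v' h1 h2 x hx
    have hP1 : ∀ y : Cyl (n + 1), y.1 0 ≤ s → prepAvg P.N u y = prepAvg P.N u' y := fun y hy => by
      simp only [prepAvg]; congr 1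
      exact sum_congr rfl fun i _ => h1 _ (by simpa using hy)
    have hQ : ∀ y : Cyl (n + 1), y.1 0 ≤ s → P.pairing u v y = P.pairing u' v' y := fun y hy => by
      simp only [PairData.pairing]
      refine sum_congr rfl fun r _ => ?_
      congr 1
      refine sum_congr rfl fun l _ => ?_
      rw [hP1 _ (by simp only [Prod.fst_add, Pi.add_apply]; linarith [hp r]),
        h2 _ (by simp only [Prod.fst_add, Pi.add_apply]; linarith [hq r])]
    simp only [PairData.quot]
    rw [hQ x hx, hQ _ (by simpa using hx)]
  · intro u v hu hv z
    have hs := P.leibniz_pairing.smooth hu hv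
    have hs' := hs.continuous
    have hper : Function.Periodic (fun θ => P.pairing u v (z, θ)) (2 * π) := fun θ => hs.periodic z θ
    have e : ∀ θ, P.quot u v (z, θ) = P.inc⁻¹ * (P.pairing u v (z, θ + P.inc) - P.pairing u v (z, θ)) := by
      intro θ; simp [PairData.quot]
    simp only [e]
    rw [intervalIntegral.integral_const_mul, intervalIntegral.integral_sub,
      SchemeData.periodic_integral_add hper, sub_self, mul_zero]
    all_goals exact Continuous.intervalIntegrable (hs'.comp (by fun_prop)) _ _

end Tame
end Pairing

/-! ### Mollification on the cylinder -/

section Mollify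
variable {k : ℕ}
variable {f g ρ : Fn k} {K U : Set (Pt k)}

/-- Convolution over `U × 𝕋`; the periodic argument is the kernel `ρ`. -/
def conv (U : Set (Pt k)) (g ρ : Fn k) : Fn k := fun x => ∫ y, g y * ρ (x - y) ∂vol U

lemma integrableOn_cyl (hg : MemLp g 2 (vol U)) (hK : IsCompact K) :
    IntegrableOn g (K ×ˢ univ) (vol U) := by
  have hfin : IsFiniteMeasure ((vol U).restrict (K ×ˢ (univ : Set ℝ))) :=
    ⟨by simpa using cylMeasure_compact_lt_top hK U⟩
  exact (hg.restrict _).integrable (by norm_num)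

lemma integrable_mul_cyl {φ : Fn k}
    (hg : MemLp g 2 (vol U)) (hK : IsCompact K) (hφ : Continuous φ) {C : ℝ}
    (hC : ∀ x, |φ x| ≤ C) (h0 : ∀ z ∉ K, ∀ θ, φ (z, θ) = 0) :
    Integrable (fun y => g y * φ y) (vol U) := by
  have h1 : Integrable ((K ×ˢ (univ : Set ℝ)).indicator g) (vol U) :=
    (integrable_indicator_iff (hK.measurableSet.prod MeasurableSet.univ)).2 (integrableOn_cyl hg hK)
  refine (h1.mul_bdd (c := C) hφ.aestronglyMeasurable
    (.of_forall fun x => by simpa using hC x)).congr (.of_forall fun x => ?_)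
  by_cases hx : x.1 ∈ K
  · simp [indicator, hx]
  · simp [indicator, hx, h0 x.1 hx x.2]

lemma CptSmooth.comp_const_sub (h : CptSmooth f K) (x : Cyl k) :
    CptSmooth (fun y => f (x - y)) ((fun z => x.1 - z) ⁻¹' K) where
  smooth := h.smooth.comp (contDiff_const.sub contDiff_id)
  periodic z θ := by
    have := h.periodic (x.1 - z) (x.2 - (θ + 2 * π))
    simpa [Prod.sub_def, sub_add_eq_sub_sub] using this.symm
  compact := (Homeomorph.subLeft x.1).isCompact_preimage.2 h.compact
  support z hz θ := h.support _ hz _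

lemma contDiff_conv_aux (hU : MeasurableSet U)
    (hg : MemLp g 2 (vol U)) (hρ : CptSmooth ρ K) (x₀ : Cyl k) :
    ContDiffAt ℝ ∞ (conv U g ρ) x₀ ∧
      ∀ v, fderiv ℝ (conv U g ρ) x₀ v = conv U g (KeyProfile.dv v ρ) x₀ := by
  -- a cut-off in `θ` turns the kernel into a compactly supported one without changing
  -- the convolution near `x₀`
  set R : ℝ := |x₀.2| + 2 + 2 * π with hR
  have hpi := Real.pi_pos
  let χ : ContDiffBump (0 : ℝ) := ⟨R, R + 1, by positivity, by linarith⟩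
  set κ : Fn k := fun x => χ x.2 * ρ x with hκ
  have hκs : ContDiff ℝ ∞ κ := (χ.contDiff.comp contDiff_snd).mul hρ.smooth
  have hκc : HasCompactSupport κ := by
    refine HasCompactSupport.of_support_subset_isCompact
      (hρ.compact.prod (isCompact_closedBall (0 : ℝ) (R + 1))) fun x hx => ?_
    refine ⟨by_contra fun h => hx (by simp [hκ, hρ.support x.1 h x.2]), ?_⟩
    by_contra h
    refine hx ?_
    have h' : R + 1 < |x.2| := by simpa using h
    have : χ x.2 = 0 := χ.zero_of_le_dist (by simpa using h'.le)
    simp [hκ, this]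
  set G : Fn k := (U ×ˢ Ioo 0 (2 * π)).indicator g with hG
  have hGm : MemLp G 2 volume := (memLp_indicator_iff_restrict (hU.prod measurableSet_Ioo)).2 hg
  have hGl : LocallyIntegrable G volume := hGm.locallyIntegrable (by norm_num)
  have hκρ : ∀ x : Cyl k, |x.2 - x₀.2| < 2 → ∀ y : Cyl k, y.2 ∈ Ioo 0 (2 * π) →
      κ =ᶠ[𝓝 (x - y)] ρ := by
    intro x hx y hy
    have : ∀ᶠ p : Cyl k in 𝓝 (x - y), |p.2| < R := by
      refine (continuous_snd.abs.tendsto (x - y)).eventually_lt_const ?_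
      have h1 : |x.2| ≤ |x.2 - x₀.2| + |x₀.2| := by simpa using abs_add_le (x.2 - x₀.2) x₀.2
      have h2 : |(x - y).2| ≤ |x.2| + |y.2| := abs_sub _ _
      rw [abs_of_pos hy.1] at h2
      linarith [hy.2]
    filter_upwards [this] with p hp
    have : χ p.2 = 1 := χ.one_of_mem_closedBall (by simpa using hp.le)
    simp [hκ, this]
  have hnear : ∀ᶠ x : Cyl k in 𝓝 x₀, |x.2 - x₀.2| < 2 := by
    have : Continuous fun x : Cyl k => |x.2 - x₀.2| := by fun_prop
    exact (this.tendsto x₀).eventually_lt_const (by simp)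
  have hind : ∀ (F : Fn k), ∫ y, g y * F y ∂vol U = ∫ y, G y * F y := by
    intro F
    rw [cylMeasure, ← integral_indicator (hU.prod measurableSet_Ioo)]
    refine integral_congr_ae (.of_forall fun y => ?_)
    by_cases hy : y ∈ U ×ˢ Ioo 0 (2 * π) <;> simp [hG, hy]
  have hGeq : ∀ (y : Cyl k) (a b : ℝ), (y.2 ∈ Ioo 0 (2 * π) → a = b) → G y * a = G y * b := by
    intro y a b h
    by_cases hy : y ∈ U ×ˢ Ioo 0 (2 * π)
    · rw [h hy.2]
    · simp [hG, hy]
  have heq : conv U g ρ =ᶠ[𝓝 x₀] (convolution G κ (ContinuousLinearMap.mul ℝ ℝ) volume) := by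
    filter_upwards [hnear] with x hx
    rw [conv, hind, convolution]
    exact integral_congr_ae (.of_forall fun y =>
      hGeq y _ _ fun hy => (hκρ x hx y hy).eq_of_nhds.symm)
  refine ⟨(hκc.contDiff_convolution_right _ hGl hκs).contDiffAt.congr_of_eventuallyEq heq, fun v => ?_⟩
  have hκ1 : ContDiff ℝ 1 κ := hκs.of_le (by simp)
  have hinv : (volume : Measure (Cyl k)).IsAddHaarMeasure :=
    inferInstanceAs ((volume : Measure (Pt k)).prod (volume : Measure ℝ)).IsAddHaarMeasure
  have hd := hκc.hasFDerivAt_convolution_right (ContinuousLinearMap.mul ℝ ℝ) hGl hκ1 x₀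
  rw [heq.fderiv_eq, hd.fderiv,
    convolution_precompR_apply _ hGl (hκc.fderiv ℝ) (hκs.continuous_fderiv (by simp)), conv, hind, convolution]
  refine integral_congr_ae (.of_forall fun y => hGeq y _ _ fun hy => ?_)
  rw [(hκρ x₀ (by simp) y hy).fderiv_eq]
  rfl

lemma smoothPer_conv (hU : MeasurableSet U)
    (hg : MemLp g 2 (vol U)) (hρ : CptSmooth ρ K) : SmoothPer (conv U g ρ) where
  smooth := contDiff_iff_contDiffAt.2 fun x => (contDiff_conv_aux hU hg hρ x).1
  periodic z θ := by
    refine integral_congr_ae (.of_forall fun y => ?_)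
    have := hρ.periodic (z - y.1) (θ - y.2)
    have h2 : ((z, θ + 2 * π) : Cyl k) - y = (z - y.1, θ - y.2 + 2 * π) :=
      Prod.ext rfl (by simp; ring)
    simp only [h2, this]
    rfl

lemma dw_conv (hU : MeasurableSet U) (hg : MemLp g 2 (vol U)) (hρ : CptSmooth ρ K) (I : Word k) :
    dw I (conv U g ρ) = conv U g (dw I ρ) := by
  induction I generalizing ρ with
  | nil => rfl
  | cons i I ih =>
    have : dv (dir i) (conv U g ρ) = conv U g (dv (dir i) ρ) :=
      funext fun x => (contDiff_conv_aux hU hg hρ x).2 _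
    rw [dw, this, ih (hρ.dv _), dw]

lemma iteratedFDeriv_const_sub (hf : ContDiff ℝ ∞ f) (x : Cyl k) (m : ℕ) (v : Fin m → Cyl k) :
    (fun y => iteratedFDeriv ℝ m (fun y => f (x - y)) y v) =
      fun y => (-1) ^ m * iteratedFDeriv ℝ m f (x - y) v := by
  have hc : ContDiff ℝ ∞ fun y => f (x - y) := hf.comp (contDiff_const.sub contDiff_id)
  induction m with
  | zero => simp
  | succ m ih =>
    rw [iteratedFDeriv_eq_dv hc, ih]
    have h1 := iteratedFDeriv_eq_dv hf m v
    funext y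
    rw [show iteratedFDeriv ℝ (m + 1) f (x - y) v = _ from congrFun h1 (x - y)]
    set F : Fn k := fun p => iteratedFDeriv ℝ m f p (Fin.tail v) with hF
    have hFd : Differentiable ℝ F := by
      have := (hf.differentiable_iteratedFDeriv (m := m) (by exact_mod_cast ENat.natCast_lt_top m))
      exact fun p => ((ContinuousMultilinearMap.apply ℝ (fun _ : Fin m => Cyl k) ℝ
        (Fin.tail v)).differentiableAt).comp p (this p)
    have h3 : HasFDerivAt (fun y => (-1 : ℝ) ^ m * F (x - y))
        ((-1 : ℝ) ^ m • ((fderiv ℝ F (x - y)).comp (-(ContinuousLinearMap.id ℝ (Cyl k))))) y := by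
      refine HasFDerivAt.const_mul ?_ _
      exact (hFd (x - y)).hasFDerivAt.comp y ((hasFDerivAt_id y).const_sub x)
    rw [dv, h3.fderiv]
    simp [dv, pow_succ]

lemma iteratedFDeriv_eq_dw (hf : SmoothPer f) (m : ℕ) (I : Fin m → Option (Fin k)) :
    (fun p => iteratedFDeriv ℝ m f p (fun j => dir (I j))) = dw (word I).reverse f := by
  induction m with
  | zero => simp [word, dw]
  | succ m ih =>
    rw [iteratedFDeriv_eq_dv hf.smooth]
    have := ih (Fin.tail I)
    change dv (dir (I 0)) (fun p => iteratedFDeriv ℝ m f p fun j => dir (Fin.tail I j)) = _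
    rw [this, word, word, List.ofFn_succ, List.reverse_cons, dw_append_singleton]
    rfl

/-- Derivatives of a mollified function are mollified weak derivatives, at the points whose
translated kernel is supported in `U`. -/
lemma dw_conv_eq (hU : MeasurableSet U) {w : Fn k}
    (hg : MemLp g 2 (vol U)) (hρ : CptSmooth ρ K) {m : ℕ} {I : Fin m → Option (Fin k)}
    (hw : HasWeakDeriv U m (fun j => dir (I j)) g w) {x : Cyl k}
    (hx : (fun z => x.1 - z) ⁻¹' K ⊆ U) :
    dw (word I).reverse (conv U g ρ) x = conv U w ρ x := by
  have h := hw.2 _ ((hρ.comp_const_sub x).isTest hx)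
  have h1 := iteratedFDeriv_const_sub hρ.smooth x m (fun j => dir (I j))
  have h2 := iteratedFDeriv_eq_dw hρ.toSmoothPer m I
  rw [dw_conv hU hg hρ, conv, conv]
  have h3 : ∀ y, iteratedFDeriv ℝ m (fun y => ρ (x - y)) y (fun j => dir (I j)) =
      (-1) ^ m * dw (word I).reverse ρ (x - y) := fun y => by
    rw [← h2]; exact congrFun h1 y
  simp only [h3] at h
  have h4 : ∀ y, g y * ((-1) ^ m * dw (word I).reverse ρ (x - y)) =
      (-1) ^ m * (g y * dw (word I).reverse ρ (x - y)) := fun y => by ring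
  simp only [h4, integral_const_mul] at h
  exact mul_left_cancel₀ (pow_ne_zero m (by norm_num)) h

end Mollify

/-! ### Causal mollifiers -/

section Kernel
variable {n k : ℕ}
variable {T : ℝ} {x : Cyl (n + 1)} {φ g : Fn (n + 1)} {U : Set (Pt (n + 1))}

lemma lintegral_cyl_neg {F : Cyl k → ℝ≥0∞} (hm : Measurable F)
    (hF : ∀ z θ, F (z, θ + 2 * π) = F (z, θ)) :
    ∫⁻ x, F (-x) ∂vol univ = ∫⁻ x, F x ∂vol univ := by
  rw [cylMeasure_eq_prod, lintegral_prod (fun x => F (-x)) (hm.comp measurable_neg).aemeasurable,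
    lintegral_prod _ hm.aemeasurable, Measure.restrict_univ]
  have h1 : ∀ z : Pt k, ∫⁻ θ in Ioo 0 (2 * π), F (-(z, θ)) =
      ∫⁻ θ in Ioo 0 (2 * π), F (-z, θ) := by
    intro z
    have h2 : ∀ θ : ℝ, F (-(z, θ)) = F (-z, 2 * π - θ) := fun θ => by
      rw [show (-z, 2 * π - θ) = ((-z, -θ + 2 * π) : Cyl k) by rw [neg_add_eq_sub], hF]
      rfl
    simp only [h2]
    have h3 := (volume : Measure ℝ).measurePreserving_sub_left (2 * π)
    have h4 : (fun θ : ℝ => 2 * π - θ) ⁻¹' (Ioo 0 (2 * π)) = Ioo 0 (2 * π) := by ext θ; simp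
    have h5 := h3.restrict_preimage (measurableSet_Ioo (a := (0 : ℝ)) (b := 2 * π))
    rw [h4] at h5
    exact h5.lintegral_comp (f := fun θ => F (-z, θ)) (hm.comp measurable_prodMk_left)
  simp only [h1]
  exact lintegral_neg_eq_self (fun z : Pt k => ∫⁻ θ in Ioo 0 (2 * π), F (z, θ))

lemma mem_mollifier_support {ε : ℝ} (hε : 0 < ε) {z : Pt (n + 1)}
    (hz : z ∈ Metric.closedBall (Pi.single 0 (2 * ε)) ε) : 0 < z 0 ∧ ‖z‖ ≤ 3 * ε := by
  have h1 := Metric.mem_closedBall.1 hz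
  have h2 := (dist_le_pi_dist z (Pi.single 0 (2 * ε)) 0).trans h1
  rw [Pi.single_eq_same, Real.dist_eq, abs_le] at h2
  refine ⟨by linarith, ?_⟩
  have h3 : dist (Pi.single 0 (2 * ε) : Pt (n + 1)) 0 = 2 * ε := by
    simp [dist_zero_right, Pi.norm_single, abs_of_pos hε]
  rw [← dist_zero_right]
  have := dist_triangle z (Pi.single 0 (2 * ε)) 0
  linarith

/-- Smoothing kernels of width `ε`, supported in `t > 0` so that mollification is causal. -/
structure IsMollifier (ε : ℝ) (ρ : Fn (n + 1)) : Prop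
    extends CptSmooth ρ (Metric.closedBall (Pi.single 0 (2 * ε)) ε) where
  nonneg : ∀ x, 0 ≤ ρ x
  lintegral_eq : ∫⁻ x, ofReal (ρ x) ∂vol univ = 1
  theta_near : ∀ x, ρ x ≠ 0 → ∃ m : ℤ, |x.2 - m * (2 * π)| ≤ 4 * ε

/-- The support lies in `t > 0`, so that the convolution is causal; the factor in `θ`
is a function of `cos θ`. -/
lemma exists_isMollifier (n : ℕ) {ε : ℝ} (hε : 0 < ε) : ∃ ρ : Fn (n + 1), IsMollifier ε ρ := by
  have hpi := Real.pi_pos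
  let b : ContDiffBump (Pi.single 0 (2 * ε) : Pt (n + 1)) := ⟨ε / 2, ε, by positivity, by linarith⟩
  let q : ℝ → ℝ := fun θ => Real.smoothTransition (2 - (1 - Real.cos θ) / ε ^ 2)
  have hq : ContDiff ℝ ∞ q := by
    refine Real.smoothTransition.contDiff.comp ?_
    exact contDiff_const.sub ((contDiff_const.sub Real.contDiff_cos).div_const _)
  let f : Fn (n + 1) := fun x => b x.1 * q x.2
  have hf0 : ∀ x, 0 ≤ f x := fun x => mul_nonneg b.nonneg (Real.smoothTransition.nonneg _)
  have hb0 : ∀ z : Pt (n + 1), b z ≠ 0 → z ∈ Metric.closedBall (Pi.single 0 (2 * ε)) ε := by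
    intro z hz
    by_contra h
    exact hz (b.zero_of_le_dist (by simpa using (not_le.1 fun h' => h (Metric.mem_closedBall.2 h')).le))
  have hfs : CptSmooth f (Metric.closedBall (Pi.single 0 (2 * ε)) ε) :=
    { smooth := (b.contDiff.comp contDiff_fst).mul (hq.comp contDiff_snd)
      periodic := fun z θ => by simp [f, q]
      compact := isCompact_closedBall _ _
      support := fun z hz θ => by
        have : b z = 0 := by_contra fun h => hz (hb0 z h)
        simp [f, this] }
  have hint := hfs.integrable univ
  set J := ∫ x, f x ∂vol univ with hJ
  have hJ0 : 0 < J := by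
    rw [hJ, integral_pos_iff_support_of_nonneg hf0 hint, cylMeasure]
    have hpt : f (Pi.single 0 (2 * ε), 0) ≠ 0 := by
      have h1 : b (Pi.single 0 (2 * ε)) = 1 := b.one_of_mem_closedBall (by simp; positivity)
      simp [f, q, h1, Real.smoothTransition.one_of_one_le]
    have hopen : IsOpen (Function.support f) := hfs.continuous.isOpen_support
    have hO : IsOpen (Function.support f ∩ (univ ×ˢ Ioo 0 (2 * π))) :=
      hopen.inter (isOpen_univ.prod isOpen_Ioo)
    rw [Measure.restrict_apply' (MeasurableSet.univ.prod measurableSet_Ioo)]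
    refine hO.measure_pos _ ?_
    have h2 : ∀ᶠ θ : ℝ in 𝓝[>] 0, f (Pi.single 0 (2 * ε), θ) ≠ 0 := by
      have h3 : Continuous fun θ : ℝ => f (Pi.single 0 (2 * ε), θ) :=
        hfs.continuous.comp (by fun_prop)
      exact ((h3.tendsto 0).mono_left nhdsWithin_le_nhds).eventually_ne hpt
    have h3 : ∀ᶠ θ : ℝ in 𝓝[>] 0, θ ∈ Ioo 0 (2 * π) := Ioo_mem_nhdsGT (by positivity)
    obtain ⟨θ, h4, h5⟩ := (h2.and h3).exists
    exact ⟨(Pi.single 0 (2 * ε), θ), h4, mem_univ _, h5⟩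
  have hne : ∀ x, J⁻¹ * f x ≠ 0 → b x.1 ≠ 0 ∧ q x.2 ≠ 0 := fun x hx =>
    ⟨fun h => hx (by simp [f, h]), fun h => hx (by simp [f, h])⟩
  refine ⟨fun x => J⁻¹ * f x, ⟨⟨hfs.toSmoothPer.const_mul _, hfs.compact, fun z hz θ => by
    simp [hfs.support z hz θ]⟩, fun x => mul_nonneg (inv_nonneg.2 hJ0.le) (hf0 x), ?_,
    fun x hx => ?_⟩⟩
  · rw [← ofReal_integral_eq_lintegral_ofReal (hint.const_mul _)
      (.of_forall fun x => mul_nonneg (inv_nonneg.2 hJ0.le) (hf0 x)), integral_const_mul,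
      ← hJ, inv_mul_cancel₀ hJ0.ne', ofReal_one]
  · obtain ⟨m, hm⟩ : ∃ m : ℤ, |x.2 - m * (2 * π)| ≤ π := by
      refine ⟨round (x.2 / (2 * π)), ?_⟩
      have h1 := abs_sub_round (x.2 / (2 * π))
      have h2 : x.2 - round (x.2 / (2 * π)) * (2 * π) =
          (x.2 / (2 * π) - round (x.2 / (2 * π))) * (2 * π) := by
        field_simp
      rw [h2, abs_mul, abs_of_pos (by positivity : 0 < 2 * π)]
      nlinarith
    refine ⟨m, ?_⟩
    have h1 := (hne x hx).2
    have h2 : (1 - Real.cos x.2) / ε ^ 2 < 2 := by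
      by_contra h
      exact h1 (Real.smoothTransition.zero_of_nonpos (by linarith))
    rw [div_lt_iff₀ (by positivity)] at h2
    have h3 := Real.cos_le_one_sub_mul_cos_sq hm
    rw [Real.cos_sub_int_mul_two_pi] at h3
    set s := x.2 - m * (2 * π)
    have h4 : 2 / π ^ 2 * s ^ 2 ≤ 2 * ε ^ 2 := by linarith
    have h5 : s ^ 2 ≤ (π * ε) ^ 2 := by
      rw [div_mul_eq_mul_div, div_le_iff₀ (by positivity)] at h4
      nlinarith
    have h6 : |s| ≤ π * ε := abs_le_of_sq_le_sq h5 (by positivity)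
    nlinarith [Real.pi_le_four]

namespace IsMollifier
variable {ε : ℝ} {ρ : Fn (n + 1)}

lemma lintegral_sub_left (h : IsMollifier ε ρ) (x : Cyl (n + 1)) :
    ∫⁻ y, ofReal (ρ (x - y)) ∂vol univ = 1 := by
  have hc := h.toCptSmooth.continuous
  have hp := h.periodic
  have h1 := lintegral_cyl_shift (F := fun y => ofReal (ρ (-y))) (by fun_prop) (fun z θ => by
      have := hp (-z) (-(θ + 2 * π))
      rw [neg_add, neg_add_cancel_right, ← neg_add] at this
      exact congrArg ofReal (by rw [Prod.neg_mk, Prod.neg_mk]; exact this.symm)) (-x)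
  simp only [neg_add, neg_neg] at h1
  have h2 := lintegral_cyl_neg (F := fun y => ofReal (ρ y)) (by fun_prop) (fun z θ => by rw [hp])
  rw [← h.lintegral_eq, ← h2, ← h1]
  exact lintegral_congr fun y => by rw [neg_add_eq_sub]

lemma lintegral_sub_right (h : IsMollifier ε ρ) (y : Cyl (n + 1)) :
    ∫⁻ x, ofReal (ρ (x - y)) ∂vol univ = 1 := by
  have hc := h.toCptSmooth.continuous
  rw [← h.lintegral_eq, ← lintegral_cyl_shift (F := fun y => ofReal (ρ y)) (by fun_prop)
    (fun z θ => by rw [h.periodic]) (-y)]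
  simp [sub_eq_add_neg]

lemma _root_.KeyProfile.mollifier_preimage_subset (hε : 0 < ε) (hx : x.1 0 < T) :
    (fun z => x.1 - z) ⁻¹' (Metric.closedBall (Pi.single 0 (2 * ε)) ε) ⊆ bΩ n T := by
  intro z hz
  have := (mem_mollifier_support hε hz).1
  simp only [Pi.sub_apply, bdryDomain] at this ⊢
  exact mem_ofPred.2 (by linarith)

lemma near (h : IsMollifier ε ρ) (hε : 0 < ε) (hx : ρ x ≠ 0) : 0 < x.1 0 ∧ ‖x.1‖ ≤ 3 * ε :=
  mem_mollifier_support hε (by_contra fun hz => hx (h.support _ hz _))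

lemma lintegral_conv_sq_le (h : IsMollifier ε ρ) (x : Cyl (n + 1)) (μ : Measure (Cyl (n + 1)))
    (hμ : μ ≤ vol univ) {f : Cyl (n + 1) → ℝ≥0∞} (hf : Measurable f) :
    (∫⁻ y, f y * ofReal (ρ (x - y)) ∂μ) ^ 2 ≤ ∫⁻ y, f y ^ 2 * ofReal (ρ (x - y)) ∂μ := by
  have hc := h.toCptSmooth.continuous
  have hr : Measurable fun y => ofReal (ρ (x - y)) := by fun_prop
  set s : Cyl (n + 1) → ℝ≥0∞ := fun y => ofReal (ρ (x - y)) ^ (1 / 2 : ℝ) with hs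
  have hsm : Measurable s := hr.pow_const _
  have hss : ∀ y, s y ^ (2 : ℝ) = ofReal (ρ (x - y)) := fun y => by
    rw [hs, ← ENNReal.rpow_mul]; norm_num
  have h1 := ENNReal.lintegral_mul_le_Lp_mul_Lq μ Real.HolderConjugate.two_two
    (f := fun y => f y * s y) (g := s) (hf.mul hsm).aemeasurable hsm.aemeasurable
  have h2 : ∫⁻ y, s y ^ (2 : ℝ) ∂μ ≤ 1 := by
    simp only [hss]
    exact (lintegral_mono' hμ le_rfl).trans (h.lintegral_sub_left x).le
  have h3 : ∀ y, ((fun y => f y * s y) * s) y = f y * ofReal (ρ (x - y)) := fun y => by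
    rw [← hss y]; simp [mul_assoc, sq]
  have h4 : ∀ y, (f y * s y) ^ (2 : ℝ) = f y ^ 2 * ofReal (ρ (x - y)) := fun y => by
    rw [ENNReal.mul_rpow_of_nonneg _ _ (by norm_num), hss]; norm_num
  simp only [h3, h4] at h1
  have h5 := h1.trans (mul_le_mul_right (ENNReal.rpow_le_one h2 (by norm_num)) _)
  rw [mul_one] at h5
  refine (pow_le_pow_left₀ (zero_le) h5 2).trans ?_
  rw [← ENNReal.rpow_natCast, ← ENNReal.rpow_mul]
  norm_num

lemma eLpNorm_conv_le (h : IsMollifier ε ρ) (U : Set (Pt (n + 1))) {w : Fn (n + 1)}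
    (hw : AEStronglyMeasurable w (vol U)) :
    eLpNorm (conv U w ρ) 2 (vol U) ≤ eLpNorm w 2 (vol U) := by
  have hc := h.toCptSmooth.continuous
  have hμ : vol U ≤ vol (univ : Set (Pt (n + 1))) :=
    Measure.restrict_mono (Set.prod_mono (subset_univ _) subset_rfl) le_rfl
  obtain ⟨w', hw', hww⟩ := hw
  have h0 : conv U w ρ = conv U w' ρ := funext fun x => integral_congr_ae <| by
    filter_upwards [hww] with y hy
    rw [hy]
  rw [h0, eLpNorm_congr_ae hww]
  have hfin : SFinite (vol U) := by rw [cylMeasure]; infer_instance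
  have h1 : eLpNorm (conv U w' ρ) 2 (vol U) ^ 2 ≤ eLpNorm w' 2 (vol U) ^ 2 := by
    rw [eLpNorm_two_sq, eLpNorm_two_sq]
    have h2 : ∀ x, ofReal (conv U w' ρ x ^ 2) ≤
        ∫⁻ y, ofReal (w' y ^ 2) * ofReal (ρ (x - y)) ∂vol U := by
      intro x
      have h3 : ‖conv U w' ρ x‖ₑ ≤ ∫⁻ y, ‖w' y‖ₑ * ofReal (ρ (x - y)) ∂vol U := by
        refine (enorm_integral_le_lintegral_enorm _).trans (lintegral_mono fun y => ?_)
        rw [enorm_mul, Real.enorm_of_nonneg (h.nonneg _)]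
      have h4 := (pow_le_pow_left₀ (zero_le) h3 2).trans
        (h.lintegral_conv_sq_le x _ hμ hw'.measurable.enorm)
      simpa only [Real.enorm_eq_ofReal_abs, ← ofReal_pow (abs_nonneg _), sq_abs] using h4
    refine (lintegral_mono h2).trans ?_
    have hwm := hw'.measurable
    rw [lintegral_lintegral_swap (by fun_prop)]
    refine lintegral_mono fun y => ?_
    rw [lintegral_const_mul _ (by fun_prop)]
    calc _ ≤ ofReal (w' y ^ 2) * 1 := by
          refine mul_le_mul_right ?_ _
          exact (lintegral_mono' hμ le_rfl).trans (h.lintegral_sub_right y).le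
      _ = _ := mul_one _
  exact (ENNReal.pow_le_pow_left_iff (by norm_num)).1 h1

lemma integral_eq_one (h : IsMollifier ε ρ) (y : Cyl (n + 1)) : ∫ x, ρ (x - y) ∂vol univ = 1 := by
  have hc := h.toCptSmooth.continuous
  rw [integral_eq_lintegral_of_nonneg_ae (.of_forall fun x => h.nonneg _)
    (by fun_prop), h.lintegral_sub_right y, ENNReal.toReal_one]

lemma abs_integral_sub_le (h : IsMollifier ε ρ) (hε : 0 < ε)
    {K : Set (Pt (n + 1))} (hφ : CptSmooth φ K) {L : ℝ}
    (hL : ∀ x y, |φ x - φ y| ≤ L * ‖x - y‖) (hL0 : 0 ≤ L) (y : Cyl (n + 1)) :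
    |(∫ x, ρ (x - y) * φ x ∂vol univ) - φ y| ≤ L * (4 * ε) := by
  have hc := h.toCptSmooth.continuous
  have hφc := hφ.continuous
  obtain ⟨C, hC0, hC⟩ := hφ.bound
  have hper : PeriodicTheta fun x => ρ (x - y) := fun z θ => by
    have := h.periodic (z - y.1) (θ - y.2)
    have h2 : ((z, θ + 2 * π) : Cyl (n + 1)) - y = (z - y.1, θ - y.2 + 2 * π) :=
      Prod.ext rfl (by simp; ring)
    simp only [h2, this]
    rfl
  have hKc : IsCompact ((fun z => z - y.1) ⁻¹' (Metric.closedBall (Pi.single 0 (2 * ε)) ε)) :=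
    (Homeomorph.subRight y.1).isCompact_preimage.2 h.compact
  have hρs : CptSmooth (fun x => ρ (x - y)) _ :=
    { smooth := h.smooth.comp (contDiff_id.sub contDiff_const)
      periodic := hper, compact := hKc, support := fun z hz θ => h.support _ hz _ }
  have hi := hρs.integrable univ
  have hi2 : Integrable (fun x => ρ (x - y) * φ x) (vol univ) :=
    hi.mul_bdd (c := C) hφc.aestronglyMeasurable (.of_forall fun x => by simpa using hC x)
  have h1 : (∫ x, ρ (x - y) * φ x ∂vol univ) - φ y = ∫ x, ρ (x - y) * (φ x - φ y) ∂vol univ := by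
    simp only [mul_sub]
    rw [integral_sub hi2 (hi.mul_const _), integral_mul_const, h.integral_eq_one, one_mul]
  rw [h1]
  refine (abs_integral_le_integral_abs).trans ?_
  calc _ ≤ ∫ x, ρ (x - y) * (L * (4 * ε)) ∂vol univ := by
        refine integral_mono_of_nonneg (.of_forall fun x => abs_nonneg _)
          (hi.mul_const _) (.of_forall fun x => ?_)
        by_cases hx : ρ (x - y) = 0
        · simp [hx]
        simp only [abs_mul, abs_of_nonneg (h.nonneg _)]
        refine mul_le_mul_of_nonneg_left ?_ (h.nonneg _)
        obtain ⟨m, hm⟩ := h.theta_near _ hx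
        have h2 := (h.near hε hx).2
        have h3 : φ x = φ (x.1, x.2 - m * (2 * π)) := by
          have := hφ.periodic.add_int x.1 x.2 (-m)
          rw [← this]; push_cast; congr 2; ring
        rw [h3]
        refine (hL _ _).trans (mul_le_mul_of_nonneg_left ?_ hL0)
        rw [Prod.norm_def, max_le_iff]
        refine ⟨?_, ?_⟩
        · simp only [Prod.fst_sub] at h2 ⊢
          linarith
        · simp only [Prod.snd_sub, Real.norm_eq_abs] at hm ⊢
          rwa [sub_right_comm]
    _ = _ := by rw [integral_mul_const, h.integral_eq_one, one_mul]

lemma integrable_prod_mul {α : Type*} [MeasurableSpace α] [TopologicalSpace α] [OpensMeasurableSpace α]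
    [SecondCountableTopology α] {ν : Measure α} [SFinite ν] {U : Set (Pt k)} {K : Set (Pt k)}
    (hK : IsCompact K) {g : Fn k} (hg : MemLp g 2 (vol U)) {F : α × Cyl k → ℝ}
    (hF : Continuous F) {b : α → ℝ} (hb : Integrable b ν) (hFb : ∀ p, |F p| ≤ b p.1)
    (h0 : ∀ a, ∀ y : Cyl k, y.1 ∉ K → F (a, y) = 0) :
    Integrable (fun p : α × Cyl k => g p.2 * F p) (ν.prod (vol U)) := by
  have hfin : SFinite (vol U) := by rw [cylMeasure]; infer_instance
  have h1 : Integrable ((K ×ˢ (univ : Set ℝ)).indicator g) (vol U) :=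
    (integrable_indicator_iff (hK.measurableSet.prod MeasurableSet.univ)).2 (integrableOn_cyl hg hK)
  refine (hb.mul_prod h1).mono ?_ (.of_forall fun p => ?_)
  · exact (hg.1.comp_snd).mul hF.aestronglyMeasurable
  · by_cases hp : p.2.1 ∈ K
    · have : p.2 ∈ K ×ˢ (univ : Set ℝ) := ⟨hp, mem_univ _⟩
      rw [indicator_of_mem this, norm_mul, norm_mul, mul_comm]
      exact mul_le_mul_of_nonneg_right ((hFb p).trans (le_abs_self _)) (norm_nonneg _)
    · rw [h0 p.1 p.2 hp, mul_zero, norm_zero]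
      exact norm_nonneg _

/-- Mollified functions converge in the sense of distributions. -/
lemma tendsto_conv (hg : MemLp g 2 (vol (bΩ n T)))
    {e : ℕ → ℝ} {r : ℕ → Fn (n + 1)} (hr : ∀ j, IsMollifier (e j) (r j)) (he0 : ∀ j, 0 < e j)
    (he1 : ∀ j, e j ≤ 1) (he : Tendsto e atTop (𝓝 0))
    (hφ : IsTest (bΩ n T) φ) :
    Tendsto (fun j => ∫ x, conv (bΩ n T) g (r j) x * φ x ∂vol (bΩ n T))
      atTop (𝓝 (∫ x, g x * φ x ∂vol (bΩ n T))) := by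
  obtain ⟨K, hφ', hKU⟩ := hφ.cptSmooth
  replace hφ := hφ'
  set U := bΩ n T with hUdef
  have hU : MeasurableSet U := measurableSet_bdryDomain T
  have hμ : vol U ≤ vol (univ : Set (Pt (n + 1))) :=
    Measure.restrict_mono (Set.prod_mono (subset_univ _) subset_rfl) le_rfl
  have hφc := hφ.continuous
  obtain ⟨L, hL0, hL⟩ := hφ.lipschitz
  have hfin : ∀ V : Set (Pt (n + 1)), SFinite (vol V) := fun V => by
    rw [cylMeasure]; infer_instance
  have hK' : IsCompact (Metric.cthickening 3 K) := hφ.compact.cthickening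
  have hz : ∀ j, ∀ x y : Cyl (n + 1), y.1 ∉ Metric.cthickening 3 K → r j (x - y) * φ x = 0 := by
    intro j x y hy
    by_contra hne
    have h1 := ((hr j).near (he0 j) (left_ne_zero_of_mul hne)).2
    have h2 : x.1 ∈ K := by_contra fun h => right_ne_zero_of_mul hne (hφ.support x.1 h x.2)
    refine hy (Metric.mem_cthickening_of_dist_le _ _ _ _ h2 ?_)
    rw [dist_comm, dist_eq_norm]
    have := he1 j
    simp only [Prod.fst_sub] at h1
    linarith
  have hfub : ∀ j, ∫ x, conv U g (r j) x * φ x ∂vol U =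
      ∫ y, g y * ∫ x, r j (x - y) * φ x ∂vol univ ∂vol U := by
    intro j
    have hc := (hr j).toCptSmooth.continuous
    obtain ⟨C, hC0, hC⟩ := (hr j).toCptSmooth.bound
    rw [integral_cyl_eq_univ hU hKU (fun z hz θ => by rw [hφ.support z hz θ, mul_zero])]
    have hint := integrable_prod_mul (ν := vol univ) hK' hg
      (F := fun p : Cyl (n + 1) × Cyl (n + 1) => r j (p.1 - p.2) * φ p.1) (by fun_prop)
      (((hφ.integrable univ).abs).const_mul C)
      (fun p => by rw [abs_mul]; exact mul_le_mul_of_nonneg_right (hC _) (abs_nonneg _))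
      (fun a y hy => hz j a y hy)
    have h1 := integral_integral_swap
      (f := fun (x y : Cyl (n + 1)) => g y * (r j (x - y) * φ x)) hint
    simp only [integral_const_mul] at h1
    rw [← h1]
    refine integral_congr_ae (.of_forall fun x => ?_)
    simp only [conv]
    rw [← integral_mul_const]
    simp only [mul_assoc]
  have hi : Integrable ((Metric.cthickening 3 K ×ˢ (univ : Set ℝ)).indicator g) (vol U) :=
    (integrable_indicator_iff (hK'.measurableSet.prod MeasurableSet.univ)).2 (integrableOn_cyl hg hK')
  obtain ⟨C, hC0, hC⟩ := hφ.bound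
  have hgφ := integrable_mul_cyl hg hφ.compact hφc hC hφ.support
  have hbd : ∀ j, |(∫ x, conv U g (r j) x * φ x ∂vol U) - ∫ x, g x * φ x ∂vol U| ≤
      e j * (4 * L * ∫ y, |(Metric.cthickening 3 K ×ˢ (univ : Set ℝ)).indicator g y| ∂vol U) := by
    intro j
    have hc := (hr j).toCptSmooth.continuous
    have hint := integrable_prod_mul (ν := vol univ) hK' hg
      (F := fun p : Cyl (n + 1) × Cyl (n + 1) => r j (p.1 - p.2) * φ p.1) (by fun_prop)
      (((hφ.integrable univ).abs).const_mul ((hr j).toCptSmooth.bound.choose))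
      (fun p => by
        rw [abs_mul]
        exact mul_le_mul_of_nonneg_right ((hr j).toCptSmooth.bound.choose_spec.2 _) (abs_nonneg _))
      (fun a y hy => hz j a y hy)
    have hi2 := hint.integral_prod_right
    simp only [integral_const_mul] at hi2
    rw [hfub, ← integral_sub hi2 hgφ]
    refine abs_integral_le_integral_abs.trans ?_
    rw [← integral_const_mul, ← integral_const_mul]
    refine integral_mono_of_nonneg (.of_forall fun x => abs_nonneg _)
      ((hi.abs.const_mul _).const_mul _) (.of_forall fun y => ?_)
    simp only
    by_cases hy : y.1 ∈ Metric.cthickening 3 K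
    · have : y ∈ Metric.cthickening 3 K ×ˢ (univ : Set ℝ) := ⟨hy, mem_univ _⟩
      rw [indicator_of_mem this, ← mul_sub, abs_mul]
      have := (hr j).abs_integral_sub_le (he0 j) hφ hL hL0 y
      nlinarith [abs_nonneg (g y)]
    · have h1 : φ y = 0 := hφ.support y.1 (fun h => hy (Metric.self_subset_cthickening _ h)) y.2
      have h2 : ∫ x, r j (x - y) * φ x ∂vol univ = 0 := by simp [hz j _ y hy]
      rw [h1, h2]
      have := he0 j
      simp only [mul_zero, sub_zero, abs_zero]
      positivity
  rw [tendsto_iff_norm_sub_tendsto_zero]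
  refine squeeze_zero (fun j => norm_nonneg _) hbd ?_
  simpa using he.mul_const _

lemma conv_past (h : IsMollifier ε ρ) (hε : 0 < ε)
    (hg : VanishesInPast U g) (x : Cyl (n + 1)) (hx : x.1 0 ≤ 0) : conv U g ρ x = 0 := by
  refine integral_eq_zero_of_ae ?_
  filter_upwards [hg] with y hy
  by_cases hρ : ρ (x - y) = 0
  · simp [hρ]
  · have := (h.near hε hρ).1
    simp only [Prod.fst_sub, Pi.sub_apply] at this
    simp [hy (by linarith)]

/-- Zero mean of `g` over almost every circle gives zero mean of the convolution over every circle. -/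
lemma conv_mean (h : IsMollifier ε ρ)
    (hg : MemLp g 2 (vol U)) (hm : MeanZero U g) (z : Pt (n + 1)) :
    ∫ θ in 0..2 * π, conv U g ρ (z, θ) = 0 := by
  have hpi := Real.pi_pos
  have hc := h.toCptSmooth.continuous
  have hfin : SFinite (vol U) := by rw [cylMeasure]; infer_instance
  obtain ⟨C, hC0, hC⟩ := h.toCptSmooth.bound
  have hK' : IsCompact ((fun y => z - y) ⁻¹' (Metric.closedBall (Pi.single 0 (2 * ε)) ε)) :=
    (Homeomorph.subLeft z).isCompact_preimage.2 h.compact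
  have hint := integrable_prod_mul (ν := volume.restrict (Ioc 0 (2 * π))) hK' hg
      (F := fun p : ℝ × Cyl (n + 1) => ρ ((z, p.1) - p.2)) (by fun_prop) (b := fun _ => C)
      (integrable_const _) (fun p => hC _) (fun a y hy => h.support _ hy _)
  rw [intervalIntegral.integral_of_le (by positivity)]
  have h1 := integral_integral_swap (f := fun (θ : ℝ) y => g y * ρ ((z, θ) - y)) hint
  simp only [integral_const_mul] at h1
  change ∫ θ in Ioc 0 (2 * π), ∫ y, g y * ρ ((z, θ) - y) ∂vol U = 0
  have hi2 := hint.integral_prod_right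
  simp only [integral_const_mul] at hi2
  have h2 : ∀ y : Cyl (n + 1), ∫ θ in Ioc 0 (2 * π), ρ ((z, θ) - y) =
      ∫ θ in 0..2 * π, ρ (z - y.1, θ) := by
    intro y
    rw [← intervalIntegral.integral_of_le (by positivity),
      ← SchemeData.periodic_integral_add (f := fun θ => ρ (z - y.1, θ)) (fun θ => h.periodic _ _) (-y.2)]
    rfl
  simp only [h2] at h1 hi2
  rw [h1]
  rw [cylMeasure_eq_prod] at hi2 ⊢
  rw [integral_prod _ hi2]
  refine integral_eq_zero_of_ae ?_
  filter_upwards [hm] with y hy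
  simp only [integral_mul_const, Pi.zero_apply]
  rw [intervalIntegral.integral_of_le (by positivity), integral_Ioc_eq_integral_Ioo] at hy
  rw [hy, zero_mul]

end IsMollifier
end Kernel

/-! ### An elementary Sobolev embedding -/

section Embedding
variable {n k : ℕ}
variable {f : Fn k} {B : ℝ≥0∞}

lemma sq_le_lintegral {g g' : ℝ → ℝ} (hg : ∀ t, HasDerivAt g (g' t) t) (hg' : Continuous g') (s : ℝ) :
    ofReal (g s ^ 2) ≤ 2 * ∫⁻ t in Icc (s - 1) s, (ofReal (g t ^ 2) + ofReal (g' t ^ 2)) := by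
  have hgc : Continuous g := continuous_iff_continuousAt.2 fun t => (hg t).continuousAt
  set q : ℝ → ℝ := fun t => g t ^ 2 + g' t ^ 2 with hq
  have hqc : Continuous q := by fun_prop
  have hq0 : ∀ t, 0 ≤ q t := fun t => by positivity
  set Q := ∫ t in (s - 1)..s, q t with hQ
  have h1 : ∀ t ∈ Icc (s - 1) s, g s ^ 2 ≤ g t ^ 2 + Q := by
    intro t ht
    have h2 : ∫ r in t..s, 2 * g r * g' r = g s ^ 2 - g t ^ 2 := by
      refine intervalIntegral.integral_eq_sub_of_hasDerivAt (f := fun t => g t ^ 2) (fun r _ => ?_)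
        (Continuous.intervalIntegrable (by fun_prop) _ _)
      have := (hg r).fun_pow 2
      simpa using this
    have h3 : ∫ r in t..s, 2 * g r * g' r ≤ ∫ r in t..s, q r :=
      intervalIntegral.integral_mono_on ht.2 (Continuous.intervalIntegrable (by fun_prop) _ _)
        (hqc.intervalIntegrable _ _) fun r _ => by nlinarith [sq_nonneg (g r - g' r)]
    have h4 : ∫ r in t..s, q r ≤ Q := intervalIntegral.integral_mono_interval ht.1 ht.2 le_rfl
        (.of_forall fun r => hq0 r) (hqc.intervalIntegrable _ _)
    linarith
  have h2 : g s ^ 2 ≤ 2 * Q := by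
    have h3 : ∫ t in (s - 1)..s, g s ^ 2 ≤ ∫ t in (s - 1)..s, (g t ^ 2 + Q) :=
      intervalIntegral.integral_mono_on (by linarith) (by simp)
        (Continuous.intervalIntegrable (by fun_prop) _ _) h1
    have h4 : ∫ t in (s - 1)..s, g t ^ 2 ≤ Q := intervalIntegral.integral_mono_on (by linarith)
        (Continuous.intervalIntegrable (by fun_prop) _ _) (hqc.intervalIntegrable _ _)
        fun t _ => by simp only [hq]; nlinarith [sq_nonneg (g' t)]
    rw [intervalIntegral.integral_add (Continuous.intervalIntegrable (by fun_prop) _ _) (by simp)] at h3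
    simp at h3
    linarith
  refine (ofReal_le_ofReal h2).trans ?_
  rw [ofReal_mul (by norm_num), hQ, intervalIntegral.integral_of_le (by linarith),
    ofReal_integral_eq_lintegral_ofReal hqc.integrableOn_Ioc (.of_forall hq0),
    ENNReal.ofReal_ofNat]
  refine mul_le_mul_right ((lintegral_mono_set Ioc_subset_Icc_self).trans
    (lintegral_mono fun t => ?_)) _
  exact (ofReal_add (by positivity) (by positivity)).le

/-- The sum of the squares of the partial derivatives of order at most `m`, with multiplicity. -/
def energy : ℕ → Fn k → Cyl k → ℝ≥0∞
  | 0, f => fun p => ofReal (f p ^ 2)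
  | m + 1, f => fun p => energy m f p + ∑ i : Option (Fin k), energy m (dv (dir i) f) p

lemma measurable_energy (m : ℕ) (hf : SmoothPer f) : Measurable (energy m f) := by
  induction m generalizing f with
  | zero =>
    have := hf.continuous
    simp only [energy]
    fun_prop
  | succ m ih => exact (ih hf).add (Finset.measurable_fun_sum _ fun i _ => ih (hf.dv _))

lemma lintegral_energy_le (m : ℕ) (hf : SmoothPer f) {μ : Measure (Cyl k)}
    (h : ∀ I : Word k, I.length ≤ m → eLpNorm (dw I f) 2 μ ^ 2 ≤ B) :
    ∫⁻ p, energy m f p ∂μ ≤ (k + 2) ^ m * B := by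
  induction m generalizing f with
  | zero =>
    have := h [] le_rfl
    rw [eLpNorm_two_sq] at this
    simpa [energy, dw] using this
  | succ m ih =>
    simp only [energy]
    rw [lintegral_add_left (measurable_energy m hf),
      lintegral_finsetSum _ fun i _ => measurable_energy m (hf.dv _)]
    calc _ ≤ (k + 2) ^ m * B + ∑ i : Option (Fin k), (k + 2) ^ m * B := by
          gcongr with i
          · exact ih hf fun I hI => h I (by omega)
          · exact ih (hf.dv _) fun I hI => h (i :: I) (by simpa using hI)
      _ = _ := by
          simp only [sum_const, Finset.card_univ, Fintype.card_option, Fintype.card_fin,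
            nsmul_eq_mul]
          push_cast
          ring

lemma hasDerivAt_update_dv (hf : SmoothPer f) (z : Pt k) (i : Fin k) (θ t : ℝ) :
    HasDerivAt (fun t => f (Function.update z i t, θ))
      (dv (dir (some i)) f (Function.update z i t, θ)) t := by
  have h1 : HasDerivAt (fun t => ((Function.update z i t, θ) : Cyl k)) (dir (some i)) t :=
    (hasDerivAt_update z i t).prodMk (hasDerivAt_const t θ)
  exact (hf.differentiable _).hasFDerivAt.comp_hasDerivAt t h1

lemma hasDerivAt_theta_dv (hf : SmoothPer f) (z : Pt k) (t : ℝ) :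
    HasDerivAt (fun t => f (z, t)) (dv (dir none) f (z, t)) t := by
  have h1 : HasDerivAt (fun t => ((z, t) : Cyl k)) (dir none) t :=
    (hasDerivAt_const t z).prodMk (hasDerivAt_id t)
  exact (hf.differentiable _).hasFDerivAt.comp_hasDerivAt t h1

/-- The one-dimensional inequality, applied to one variable after the other over a cube that lies in
the past of the point. -/
lemma sq_le_lmarginal (a : Pt k) (θ : ℝ) (s : Finset (Fin k)) :
    ∀ {f : Fn k}, SmoothPer f → ∀ z : Pt k, (∀ i ∈ s, z i = a i) →
      ofReal (f (z, θ) ^ 2) ≤ 2 ^ s.card *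
        lmarginal (fun i => volume.restrict (Icc (a i - 1) (a i))) s
          (fun z' => energy s.card f (z', θ)) z := by
  induction s using Finset.induction_on with
  | empty => intro f hf z hz; simp [energy]
  | insert i s hi ih =>
    intro f hf z hz
    have hm : ∀ {f : Fn k}, SmoothPer f → ∀ m, Measurable fun z' => energy m f (z', θ) :=
      fun hf m => (measurable_energy m hf).comp measurable_prodMk_right
    rw [lmarginal_insert _ (hm hf _) hi, Finset.card_insert_of_notMem hi]
    have hzi : z i = a i := hz i (Finset.mem_insert_self _ _)
    have hd := (hf.dv (dir (some i))).continuous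
    have h1 := sq_le_lintegral (hasDerivAt_update_dv hf z i θ) (hd.comp (by fun_prop)) (z i)
    rw [Function.update_eq_self, hzi] at h1
    refine h1.trans ?_
    rw [pow_succ', mul_assoc]
    refine mul_le_mul_right ?_ _
    have hmm : Measurable fun t => lmarginal (fun i => volume.restrict (Icc (a i - 1) (a i))) s
        (fun z' => energy (s.card + 1) f (z', θ)) (Function.update z i t) :=
      ((hm hf (s.card + 1)).lmarginal _).comp (measurable_update z)
    rw [← lintegral_const_mul _ hmm]
    refine lintegral_mono fun t => ?_
    have hup : ∀ j ∈ s, Function.update z i t j = a j := fun j hj => by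
      rw [Function.update_of_ne (by rintro rfl; exact hi hj)]
      exact hz j (Finset.mem_insert_of_mem hj)
    refine (add_le_add (ih hf _ hup) (ih (hf.dv _) _ hup)).trans ?_
    rw [← mul_add]
    refine mul_le_mul_right ?_ _
    simp only [lmarginal]
    have hm1 : Measurable fun y => energy s.card f
        (Function.updateFinset (Function.update z i t) s y, θ) :=
      (hm hf s.card).comp measurable_updateFinset
    rw [← lintegral_add_left hm1]
    refine lintegral_mono fun y => ?_
    simp only [energy]
    gcongr
    exact Finset.single_le_sum (f := fun i => energy s.card (dv (dir i) f) _)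
      (fun _ _ => zero_le) (Finset.mem_univ (some i))

/-- Pointwise bounds from `L²` bounds of the derivatives of order at most `n + 2` in the past. -/
lemma sq_le_of_eLpNorm {T : ℝ} {f : Fn (n + 1)} (hf : SmoothPer f)
    (h : ∀ I : Word (n + 1), I.length ≤ n + 2 →
      eLpNorm (dw I f) 2 (vol (bΩ n T)) ^ 2 ≤ B) {x : Cyl (n + 1)} (hx : x.1 0 < T) :
    ofReal (f x ^ 2) ≤ 2 ^ (n + 2) * ((n + 3) ^ (n + 2) * B) := by
  have hpi := Real.pi_pos
  obtain ⟨a, θ⟩ := x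
  set box : Set (Pt (n + 1)) := univ.pi fun i => Icc (a i - 1) (a i) with hbox
  have hbU : box ⊆ bΩ n T := fun z hz => lt_of_le_of_lt (hz 0 (mem_univ _)).2 hx
  have h1 : ∀ {f : Fn (n + 1)}, SmoothPer f → ∀ θ, ofReal (f (a, θ) ^ 2) ≤
      2 ^ (n + 1) * ∫⁻ z in box, energy (n + 1) f (z, θ) := by
    intro f hf θ
    have := sq_le_lmarginal a θ Finset.univ hf a (fun i _ => rfl)
    rw [lmarginal_univ, ← Measure.restrict_pi_pi] at this
    rwa [Finset.card_univ, Fintype.card_fin] at this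
  have h2 : ofReal (f (a, θ) ^ 2) ≤ 2 * ∫⁻ t in Ioo 0 (2 * π),
      (ofReal (f (a, t) ^ 2) + ofReal (dv (dir none) f (a, t) ^ 2)) := by
    refine (sq_le_lintegral (hasDerivAt_theta_dv hf a)
      ((hf.dv _).continuous.comp (by fun_prop)) θ).trans (mul_le_mul_right ?_ _)
    set F : ℝ → ℝ≥0∞ := fun t => ofReal (f (a, t) ^ 2) + ofReal (dv (dir none) f (a, t) ^ 2) with hF
    have hFp : Function.Periodic F (2 * π) := fun t => by
      simp only [hF, hf.periodic a t, (hf.dv (dir none)).periodic a t]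
    rw [← lintegral_period_add hFp (θ - 2 * π)]
    have h3 := measurePreserving_add_right (volume : Measure ℝ) (θ - 2 * π)
    have h4 : (fun t : ℝ => t + (θ - 2 * π)) ⁻¹' (Ioo (θ - 2 * π) θ) = Ioo 0 (2 * π) := by
      ext t
      simp only [mem_preimage, mem_Ioo]
      constructor <;> rintro ⟨_, _⟩ <;> constructor <;> linarith
    have h5 := h3.restrict_preimage (measurableSet_Ioo (a := θ - 2 * π) (b := θ))
    rw [h4] at h5
    have hFm : Measurable F := by
      have h6 := hf.continuous
      have h7 := (hf.dv (dir none)).continuous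
      simp only [hF]
      fun_prop
    rw [h5.lintegral_comp hFm, setLIntegral_congr Ioo_ae_eq_Icc]
    exact lintegral_mono_set (Icc_subset_Icc_left (by linarith [Real.pi_gt_three]))
  refine h2.trans ?_
  have hm := measurable_energy (n + 2) hf
  calc _ ≤ 2 * ∫⁻ t in Ioo 0 (2 * π), 2 ^ (n + 1) * ∫⁻ z in box, energy (n + 2) f (z, t) := by
        refine mul_le_mul_right (lintegral_mono fun t => ?_) _
        refine (add_le_add (h1 hf t) (h1 (hf.dv _) t)).trans ?_
        rw [← mul_add]
        refine mul_le_mul_right ?_ _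
        have hm1 : Measurable fun z => energy (n + 1) f (z, t) :=
          (measurable_energy _ hf).comp measurable_prodMk_right
        rw [← lintegral_add_left hm1]
        refine lintegral_mono fun z => ?_
        refine add_le_add le_rfl (Finset.single_le_sum (f := fun i => energy (n + 1) (dv (dir i) f) (z, t))
            (fun _ _ => zero_le) (Finset.mem_univ none))
    _ = 2 ^ (n + 2) * ∫⁻ t in Ioo 0 (2 * π), ∫⁻ z in box, energy (n + 2) f (z, t) := by
        rw [lintegral_const_mul _ (by fun_prop), ← mul_assoc, ← pow_succ']
    _ ≤ 2 ^ (n + 2) * ∫⁻ p, energy (n + 2) f p ∂vol (bΩ n T) := by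
        refine mul_le_mul_right ?_ _
        rw [cylMeasure_eq_prod, lintegral_prod_symm _ hm.aemeasurable]
        exact lintegral_mono fun t => lintegral_mono_set hbU
    _ ≤ _ := by
        refine mul_le_mul_right ?_ _
        refine (lintegral_energy_le (n + 2) hf h).trans (le_of_eq ?_)
        push_cast
        rw [add_assoc]
        norm_num

end Embedding

/-! ### Smooth approximations of the source -/

section Approximation
variable {n : ℕ}
variable {T δ : ℝ} {m s : ℕ}

lemma dw_append {k : ℕ} (I J : Word k) (f : Fn k) : dw (I ++ J) f = dw J (dw I f) := by
  induction I generalizing f with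
  | nil => rfl
  | cons i I ih => exact ih _

/-- The constant of the embedding of `L²` derivatives of order `n + 2` into bounded functions. -/
def embedConst (n : ℕ) : ℝ := 2 ^ (n + 2) * (n + 3) ^ (n + 2)

lemma abs_dw_le_of_eLpNorm {B : ℝ} (hB : 0 ≤ B) {f : Fn (n + 1)} (hf : SmoothPer f)
    (h : DerivL2LE (bΩ n T) (m + (n + 2)) f (ofReal B))
    {I : Word (n + 1)} (hI : I.length ≤ m) {x : Cyl (n + 1)} (hx : x.1 0 < T) :
    |dw I f x| ≤ embedConst n * B := by
  have h1 := sq_le_of_eLpNorm (B := ofReal (B ^ 2)) (hf.dw I) (fun J hJ => by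
    rw [← dw_append, ofReal_pow hB]
    exact pow_le_pow_left₀ (zero_le) (h _ (by rw [List.length_append]; omega)) 2) hx
  have hC1 : 1 ≤ embedConst n := by
    have h2 : (1 : ℝ) ≤ 2 ^ (n + 2) := one_le_pow₀ (by norm_num)
    have h3 : (1 : ℝ) ≤ (n + 3) ^ (n + 2) := one_le_pow₀ (by
      have : (0 : ℝ) ≤ n := n.cast_nonneg
      linarith)
    rw [embedConst]
    nlinarith
  have h2 : (2 : ℝ≥0∞) ^ (n + 2) * ((n + 3) ^ (n + 2) * ofReal (B ^ 2)) =
      ofReal (embedConst n * B ^ 2) := by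
    have h3 : ofReal ((n : ℝ) + 3) = n + 3 := by
      rw [ofReal_add (by positivity) (by norm_num)]
      simp
    rw [embedConst, mul_assoc, ofReal_mul (by positivity), ofReal_mul (by positivity),
      ofReal_pow (by norm_num) (n + 2), ofReal_pow (by positivity) (n + 2), h3,
      ENNReal.ofReal_ofNat]
  rw [h2, ENNReal.ofReal_le_ofReal_iff (by positivity)] at h1
  refine abs_le_of_sq_le_sq (h1.trans ?_) (by positivity)
  rw [mul_pow]
  refine mul_le_mul_of_nonneg_right ?_ (by positivity)
  nlinarith

lemma exists_word_eq {k : ℕ} (L : Word k) :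
    ∃ I : Fin L.length → Option (Fin k), (word I).reverse = L := by
  refine ⟨fun i => L.reverse.get (i.cast (List.length_reverse).symm), ?_⟩
  rw [List.reverse_eq_iff, word]
  refine List.ext_getElem (by simp) fun i h1 h2 => by simp

lemma exists_weakDeriv_le {k s : ℕ} {U : Set (Pt k)} {g : Fn k} {δ : ℝ} (hδ : 0 < δ)
    (hn : sobolevNorm U s g ≤ ofReal δ) {m : ℕ} (hm : m ≤ s) (I : Fin m → Option (Fin k)) :
    ∃ w, HasWeakDeriv U m (fun j => dir (I j)) g w ∧ eLpNorm w 2 (vol U) ≤ ofReal (2 * δ) := by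
  have h1 : (⨅ w : Fn k, ⨅ _ : HasWeakDeriv U m (fun j => dir (I j)) g w,
      eLpNorm w 2 (vol U) ^ 2) ≤ ofReal δ ^ 2 := by
    have h0 : sobolevNorm U s g ^ 2 = ∑ m ∈ Finset.range (s + 1), ∑ I : Fin m → Option (Fin k),
        ⨅ w : Fn k, ⨅ _ : HasWeakDeriv U m (fun j => dir (I j)) g w,
          eLpNorm w 2 (vol U) ^ 2 := by
      rw [sobolevNorm, ← ENNReal.rpow_natCast, ← ENNReal.rpow_mul]
      norm_num
    refine le_trans ?_ (h0.ge.trans (pow_le_pow_left₀ (zero_le) hn 2))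
    refine le_trans ?_ (Finset.single_le_sum (f := fun m => ∑ I : Fin m → Option (Fin k),
      ⨅ w : Fn k, ⨅ _ : HasWeakDeriv U m (fun j => dir (I j)) g w,
      eLpNorm w 2 (vol U) ^ 2) (fun _ _ => zero_le)
      (Finset.mem_range.2 (Nat.lt_succ_of_le hm)))
    exact Finset.single_le_sum (f := fun I : Fin m → Option (Fin k) =>
      ⨅ w : Fn k, ⨅ _ : HasWeakDeriv U m (fun j => dir (I j)) g w,
      eLpNorm w 2 (vol U) ^ 2) (fun _ _ => zero_le) (Finset.mem_univ I)
  have h2 : ofReal δ ^ 2 < ofReal (2 * δ) ^ 2 := by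
    rw [← ofReal_pow hδ.le, ← ofReal_pow (by positivity),
      ENNReal.ofReal_lt_ofReal_iff (by positivity)]
    nlinarith
  obtain ⟨w, hw⟩ := iInf_lt_iff.1 (h1.trans_lt h2)
  obtain ⟨hw1, hw2⟩ := iInf_lt_iff.1 hw
  exact ⟨w, hw1, ((ENNReal.pow_le_pow_left_iff (by norm_num)).1 hw2.le)⟩

/-- Properties of the smooth approximations of the boundary source `g`. -/
structure IsApprox (T δ : ℝ) (s : ℕ) (g : Fn (n + 1)) (G : ℕ → Fn (n + 1)) : Prop where
  smooth : ∀ j, SmoothPer (G j)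
  past : ∀ j, ∀ x : Cyl (n + 1), x.1 0 ≤ 0 → G j x = 0
  small : ∀ j, DerivLE (bΩ n T) 2 (G j) (embedConst n * (2 * δ))
  bound : ∃ B : ℝ, 0 ≤ B ∧ ∀ j, DerivL2LE (bΩ n T) s (G j) (ofReal B)
  weak : ∀ φ, IsTest (bΩ n T) φ → Tendsto (fun j => ∫ x, G j x * φ x ∂vol (bΩ n T)) atTop
    (𝓝 (∫ x, g x * φ x ∂vol (bΩ n T)))
  mean : MeanZero (bΩ n T) g → ∀ j, ∀ z, ∫ θ in 0..2 * π, G j (z, θ) = 0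

/-- Convolution with mollifiers that act from the past needs no extension beyond `t = T` and keeps the
support in `t ≥ 0`. -/
lemma exists_isApprox (hδ : 0 < δ) {α : ℕ} (hα : n + 4 ≤ α) {g : Fn (n + 1)}
    (hg : MemSobolev (bΩ n T) s g) (hp : VanishesInPast (bΩ n T) g)
    (hn : sobolevNorm (bΩ n T) α g ≤ ofReal δ) :
    ∃ G, IsApprox T δ s g G := by
  have hU : MeasurableSet (bΩ n T) := measurableSet_bdryDomain T
  have he0 : ∀ j : ℕ, (0 : ℝ) < 1 / ((j : ℝ) + 1) := fun j => by positivity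
  choose r hr using fun j : ℕ => exists_isMollifier n (he0 j)
  have key : ∀ (j : ℕ) {m : ℕ} (I : Fin m → Option (Fin (n + 1))) (w : Fn (n + 1)),
      HasWeakDeriv (bΩ n T) m (fun j => dir (I j)) g w →
      eLpNorm (dw (word I).reverse (conv (bΩ n T) g (r j))) 2 (vol (bΩ n T)) ≤
        eLpNorm w 2 (vol (bΩ n T)) := by
    intro j m I w hw
    refine le_trans (le_of_eq ?_) ((hr j).eLpNorm_conv_le (bΩ n T) hw.1.1)
    refine eLpNorm_congr_ae ?_
    rw [cylMeasure]
    filter_upwards [ae_restrict_mem (hU.prod measurableSet_Ioo)] with x hx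
    exact dw_conv_eq hU hg.2.1 (hr j).toCptSmooth hw (mollifier_preimage_subset (he0 j) hx.1)
  have hsm : ∀ j, SmoothPer (conv (bΩ n T) g (r j)) := fun j =>
    smoothPer_conv hU hg.2.1 (hr j).toCptSmooth
  refine ⟨fun j => conv (bΩ n T) g (r j), hsm,
    fun j => (hr j).conv_past (he0 j) hp, fun j I hI x hx => ?_, ?_,
    fun φ hφ => IsMollifier.tendsto_conv hg.2.1 hr he0 (fun j => ?_)
      tendsto_one_div_add_atTop_nhds_zero_nat hφ, fun hm j => (hr j).conv_mean hg.2.1 hm⟩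
  · refine abs_dw_le_of_eLpNorm (by positivity) (hsm j) (m := 2) (fun L hL => ?_) hI hx
    obtain ⟨J, hJ⟩ := exists_word_eq L
    obtain ⟨w, hw, hwn⟩ := exists_weakDeriv_le hδ hn (m := L.length) (by omega) J
    have := key j J w hw
    rw [hJ] at this
    exact this.trans hwn
  · choose w hw using hg.2.2
    let b : Word (n + 1) → ℝ := fun L =>
      if h : L.length ≤ s then (eLpNorm (w L.length h (exists_word_eq L).choose) 2
        (vol (bΩ n T))).toReal else 0
    have hfin : {L : Word (n + 1) | L.length ≤ s}.Finite := List.finite_length_le _ _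
    refine ⟨∑ L ∈ hfin.toFinset, b L, sum_nonneg fun L _ => ?_, fun j L hL => ?_⟩
    · simp only [b]; split_ifs <;> positivity
    · have h1 := key j _ _ (hw L.length hL (exists_word_eq L).choose)
      rw [(exists_word_eq L).choose_spec] at h1
      refine h1.trans ?_
      rw [← ENNReal.ofReal_toReal (hw L.length hL (exists_word_eq L).choose).1.2.ne]
      refine ofReal_le_ofReal ?_
      have h2 : b L = _ := dif_pos hL
      rw [← h2]
      refine Finset.single_le_sum (f := b) (fun L _ => ?_) (hfin.mem_toFinset.2 hL)
      simp only [b]; split_ifs <;> positivity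
  · rw [div_le_one (by positivity)]
    linarith [(j.cast_nonneg : (0 : ℝ) ≤ j)]

end Approximation

/-! ### Compactness -/

section Compactness
variable {k : ℕ}
variable {S : ℝ} {f : Fn k} {x : Cyl k} {R : ℝ≥0∞} {K : Set (Pt k)}

/-- A diagonal subsequence converges on a dense subset, and equicontinuity extends the convergence. -/
lemma exists_subseq_tendsto {X : Type*} [PseudoMetricSpace X] [SecondCountableTopology X] {V : Set X}
    {f : ℕ → X → ℝ} {L : ℝ} (hS : ∀ j, ∀ x ∈ V, |f j x| ≤ S)
    (hL : ∀ j, ∀ x ∈ V, ∀ y ∈ V, |f j x - f j y| ≤ L * dist x y) :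
    ∃ φ : ℕ → ℕ, StrictMono φ ∧ ∀ x ∈ V, ∃ l, Tendsto (fun j => f (φ j) x) atTop (𝓝 l) := by
  rcases V.eq_empty_or_nonempty with rfl | hne
  · exact ⟨id, strictMono_id, by simp⟩
  have : Nonempty V := hne.to_subtype
  set d := TopologicalSpace.denseSeq V
  have hd := TopologicalSpace.denseRange_denseSeq V
  have hK : IsCompact (Set.pi univ fun _ : ℕ => Icc (-S) S) := isCompact_univ_pi fun _ => isCompact_Icc
  obtain ⟨y, -, φ, hφ, hy⟩ := hK.tendsto_subseq (x := fun j i => f j (d i))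
    (fun j i _ => abs_le.1 (hS j _ (d i).2))
  rw [tendsto_pi_nhds] at hy
  refine ⟨φ, hφ, fun x hx => ?_⟩
  refine cauchySeq_tendsto_of_complete (Metric.cauchySeq_iff'.2 fun ε hε => ?_)
  set L' := max L 1
  have hL' : 0 < L' := lt_of_lt_of_le one_pos (le_max_right _ _)
  obtain ⟨i, hi⟩ := Metric.denseRange_iff.1 hd ⟨x, hx⟩ (ε / (4 * L')) (by positivity)
  obtain ⟨N, hN⟩ := Metric.cauchySeq_iff'.1 (hy i).cauchySeq (ε / 4) (by positivity)
  have hclose : ∀ j, |f j x - f j (d i)| ≤ ε / 4 := fun j => by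
    refine (hL j x hx _ (d i).2).trans ?_
    have h1 : dist x (d i : X) < ε / (4 * L') := hi
    calc L * dist x (d i : X) ≤ L' * (ε / (4 * L')) :=
          mul_le_mul (le_max_left _ _) h1.le dist_nonneg hL'.le
      _ = ε / 4 := by field_simp
  refine ⟨N, fun m hm => ?_⟩
  have h1 := hN m hm
  simp only [Function.comp_apply, Real.dist_eq] at h1 ⊢
  have h2 := hclose (φ m)
  have h3 := hclose (φ N)
  rw [abs_le] at h2 h3
  rw [abs_lt] at h1 ⊢
  constructor <;> linarith [h1.1, h1.2, h2.1, h2.2, h3.1, h3.2]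

lemma eq_sum_dir (v : Cyl k) : v = v.2 • dir none + ∑ i, v.1 i • dir (some i) := by
  refine Prod.ext ?_ ?_
  · simp only [dir, Prod.fst_add, Prod.smul_fst, smul_zero, zero_add, Prod.fst_sum]
    conv_lhs => rw [← Finset.univ_sum_single v.1]
    refine sum_congr rfl fun i _ => ?_
    rw [← Pi.single_smul, smul_eq_mul, mul_one]
  · simp [dir, Prod.snd_sum]

lemma dv_eq_sum (f : Fn k) (v x : Cyl k) :
    dv v f x = v.2 * dv (dir none) f x + ∑ i, v.1 i * dv (dir (some i)) f x := by
  conv_lhs => rw [eq_sum_dir v]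
  simp [dv]

lemma abs_dv_le (h : ∀ i, |dv (dir i) f x| ≤ S) (v : Cyl k) :
    |dv v f x| ≤ (k + 1) * S * ‖v‖ := by
  have hS : 0 ≤ S := (abs_nonneg _).trans (h none)
  rw [dv_eq_sum]
  refine (abs_add_le _ _).trans ((add_le_add_right (abs_sum_le_sum_abs _ _) _).trans ?_)
  have h1 : |v.2 * dv (dir none) f x| ≤ ‖v‖ * S := by
    rw [abs_mul]
    exact mul_le_mul (norm_snd_le v) (h _) (abs_nonneg _) (norm_nonneg _)
  have h2 : ∑ i, |v.1 i * dv (dir (some i)) f x| ≤ ∑ _i : Fin k, ‖v‖ * S :=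
    sum_le_sum fun i _ => by
      rw [abs_mul]
      exact mul_le_mul ((norm_le_pi_norm v.1 i).trans (norm_fst_le v)) (h _) (abs_nonneg _) (norm_nonneg _)
  simp only [sum_const, Finset.card_univ, Fintype.card_fin, nsmul_eq_mul] at h2
  linarith

lemma abs_sub_le_of_dv (hf : SmoothPer f) {V : Set (Cyl k)} (hV : Convex ℝ V)
    (h : ∀ i, ∀ x ∈ V, |dv (dir i) f x| ≤ S) {y : Cyl k} (hx : x ∈ V) (hy : y ∈ V) :
    |f x - f y| ≤ (k + 1) * S * dist x y := by
  have hS : 0 ≤ S := (abs_nonneg _).trans (h none x hx)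
  have := hV.norm_image_sub_le_of_norm_fderiv_le (𝕜 := ℝ) (f := f) (C := (k + 1) * S)
    (fun z _ => hf.differentiable z) (fun z hz => ContinuousLinearMap.opNorm_le_bound _ (by positivity)
      fun v => abs_dv_le (fun i => h i z hz) v) hy hx
  simpa [dist_eq_norm] using this

/-- Weak sequential compactness of bounded sets of `L²`, with convergence along a fixed
nonprincipal ultrafilter. -/
lemma exists_weak_limit {α : Type*} [MeasurableSpace α] {μ : Measure α} {w : ℕ → α → ℝ}
    (hR : R ≠ ⊤) (hw : ∀ j, AEStronglyMeasurable (w j) μ) (hb : ∀ j, eLpNorm (w j) 2 μ ≤ R) :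
    ∃ v, MemLp v 2 μ ∧ ∀ ψ, MemLp ψ 2 μ → Tendsto (fun j => ∫ x, w j x * ψ x ∂μ)
      (hyperfilter ℕ : Filter ℕ) (𝓝 (∫ x, v x * ψ x ∂μ)) := by
  have hm : ∀ j, MemLp (w j) 2 μ := fun j => ⟨hw j, (hb j).trans_lt hR.lt_top⟩
  set W : ℕ → Lp ℝ 2 μ := fun j => (hm j).toLp (w j) with hW
  set F : ℕ → WeakDual ℝ (Lp ℝ 2 μ) := fun j =>
    StrongDual.toWeakDual (InnerProductSpace.toDual ℝ _ (W j)) with hF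
  have hK := WeakDual.isCompact_closedBall (𝕜 := ℝ) (E := Lp ℝ 2 μ) 0 R.toReal
  have hFK : ∀ j, F j ∈ WeakDual.toStrongDual ⁻¹' Metric.closedBall (0 : StrongDual ℝ (Lp ℝ 2 μ)) R.toReal := by
    intro j
    rw [mem_preimage, mem_closedBall_zero_iff]
    change ‖InnerProductSpace.toDual ℝ _ (W j)‖ ≤ _
    rw [LinearIsometryEquiv.norm_map, hW, Lp.norm_toLp]
    exact ENNReal.toReal_mono hR (hb j)
  obtain ⟨l, -, hl⟩ := hK.ultrafilter_le_nhds ((hyperfilter ℕ).map F) (by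
      rw [le_principal_iff]
      exact Filter.mem_map.2 (Filter.univ_mem' hFK))
  obtain ⟨V, hV⟩ := (InnerProductSpace.toDual ℝ (Lp ℝ 2 μ)).surjective (WeakDual.toStrongDual l)
  refine ⟨V, Lp.memLp V, fun ψ hψ => ?_⟩
  have hl' : Tendsto F (hyperfilter ℕ : Filter ℕ) (𝓝 l) := hl
  have h1 := (WeakDual.eval_continuous (𝕜 := ℝ) (hψ.toLp ψ)).continuousAt.tendsto.comp hl'
  have h2 : ∀ j, F j (hψ.toLp ψ) = ∫ x, w j x * ψ x ∂μ := fun j => by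
    change inner ℝ (W j) (hψ.toLp ψ) = _
    rw [L2.inner_def]
    refine integral_congr_ae ?_
    filter_upwards [(hm j).coeFn_toLp, hψ.coeFn_toLp] with x h3 h4
    simp [hW, h3, h4, mul_comm]
  have h3 : l (hψ.toLp ψ) = ∫ x, V x * ψ x ∂μ := by
    have : l (hψ.toLp ψ) = inner ℝ V (hψ.toLp ψ) := by
      change (WeakDual.toStrongDual l) _ = _
      rw [← hV]; rfl
    rw [this, L2.inner_def]
    refine integral_congr_ae ?_
    filter_upwards [hψ.coeFn_toLp] with x h4
    simp [h4, mul_comm]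
  rw [← h3]
  exact h1.congr fun j => h2 j

lemma IsTest.memLp {U V : Set (Pt k)} {φ : Fn k} (h : IsTest V φ) :
    MemLp φ 2 (vol U) := by
  obtain ⟨K, hφ, -⟩ := h.cptSmooth
  rw [memLp_two_iff_integrable_sq hφ.continuous.aestronglyMeasurable]
  simp only [sq]
  exact (CptSmooth.mul hφ.toSmoothPer hφ).integrable U

lemma ae_cylMeasure_of_forall {U : Set (Pt k)} (hU : MeasurableSet U) {p : Cyl k → Prop}
    (h : ∀ x : Cyl k, x.1 ∈ U → p x) : ∀ᵐ x ∂vol U, p x := by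
  rw [cylMeasure]
  filter_upwards [ae_restrict_mem (hU.prod measurableSet_Ioo)] with x hx using h x hx.1

lemma tendsto_integral_mul {U : Set (Pt k)} (hU : MeasurableSet U)
    (hK : IsCompact K) {F ψ : ℕ → Fn k} {G χ : Fn k} {C C' : ℝ}
    (hFm : ∀ j, AEStronglyMeasurable (F j) (vol U)) (hψm : ∀ j, Continuous (ψ j))
    (hF : ∀ j, ∀ x : Cyl k, x.1 ∈ U → |F j x| ≤ C) (hψ : ∀ j x, |ψ j x| ≤ C')
    (h0 : ∀ j, ∀ z ∉ K, ∀ θ, ψ j (z, θ) = 0)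
    (hlim : ∀ x : Cyl k, x.1 ∈ U → Tendsto (fun j => F j x) atTop (𝓝 (G x)))
    (hlim' : ∀ x, Tendsto (fun j => ψ j x) atTop (𝓝 (χ x))) :
    Tendsto (fun j => ∫ x, F j x * ψ j x ∂vol U) atTop (𝓝 (∫ x, G x * χ x ∂vol U)) := by
  refine tendsto_integral_cyl hK (C := C * C') (fun j => (hFm j).mul (hψm j).aestronglyMeasurable)
    (fun j => ae_cylMeasure_of_forall hU fun x hx => ?_) (fun j z hz θ => by rw [h0 j z hz, mul_zero])
    (ae_cylMeasure_of_forall hU fun x hx => (hlim x hx).mul (hlim' x))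
  rw [abs_mul]
  exact mul_le_mul (hF j x hx) (hψ j x) (abs_nonneg _) ((abs_nonneg _).trans (hF j x hx))

/-- Smooth functions `u j` that are bounded and converge pointwise on `U × 𝕋` to `u`. -/
structure ApproxBy (U : Set (Pt k)) (u : ℕ → Fn k) (v : Fn k) : Prop where
  smooth : ∀ j, SmoothPer (u j)
  periodic : PeriodicTheta v
  bound : ∃ C, ∀ j, ∀ x : Cyl k, x.1 ∈ U → |u j x| ≤ C
  lim : ∀ x : Cyl k, x.1 ∈ U → Tendsto (fun j => u j x) atTop (𝓝 (v x))

namespace ApproxBy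
variable {U : Set (Pt k)} {u : ℕ → Fn k} {v : Fn k}

lemma tendsto_test (h : ApproxBy U u v) (hU : MeasurableSet U) {ψ : Fn k}
    (hψ : CptSmooth ψ K) :
    Tendsto (fun j => ∫ x, u j x * ψ x ∂vol U) atTop (𝓝 (∫ x, v x * ψ x ∂vol U)) := by
  obtain ⟨C, hC⟩ := h.bound
  obtain ⟨C', -, hC'⟩ := hψ.bound
  exact tendsto_integral_mul hU hψ.compact (fun j => (h.smooth j).continuous.aestronglyMeasurable)
    (fun _ => hψ.continuous) hC (fun _ => hC') (fun _ => hψ.support) h.lim fun x => tendsto_const_nhds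

lemma aestronglyMeasurable (h : ApproxBy U u v) (hU : MeasurableSet U) :
    AEStronglyMeasurable v (vol U) :=
  aestronglyMeasurable_of_tendsto_ae atTop (fun j => (h.smooth j).continuous.aestronglyMeasurable)
    (ae_cylMeasure_of_forall hU h.lim)

lemma memLp (h : ApproxBy U u v) (hU : MeasurableSet U) (hR : R ≠ ⊤)
    (hb : ∀ j, eLpNorm (u j) 2 (vol U) ≤ R) : MemLp v 2 (vol U) := by
  refine ⟨h.aestronglyMeasurable hU, lt_of_le_of_lt ?_ hR.lt_top⟩
  refine (Lp.eLpNorm_lim_le_liminf_eLpNorm (fun j => (h.smooth j).continuous.aestronglyMeasurable) v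
    (ae_cylMeasure_of_forall hU h.lim)).trans ?_
  refine (liminf_le_liminf (.of_forall hb)).trans (by simp)

/-- Uniform `L²` bounds of a derivative of the approximants give the weak derivative of the limit,
as a weak limit. -/
lemma exists_weakDeriv (h : ApproxBy U u v) (hU : MeasurableSet U) {m : ℕ} (I : Fin m → Option (Fin k))
    (hR : R ≠ ⊤) (hb : ∀ j, eLpNorm (dw (word I) (u j)) 2 (vol U) ≤ R) :
    ∃ w, HasWeakDeriv U m (fun j => dir (I j)) v w ∧ ∀ ψ, MemLp ψ 2 (vol U) →
      Tendsto (fun j => ∫ x, dw (word I) (u j) x * ψ x ∂vol U) (hyperfilter ℕ : Filter ℕ)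
        (𝓝 (∫ x, w x * ψ x ∂vol U)) := by
  obtain ⟨w, hw, hlim⟩ := exists_weak_limit hR
    (fun j => ((h.smooth j).dw (word I)).continuous.aestronglyMeasurable) hb
  refine ⟨w, ⟨hw, fun φ hφ => ?_⟩, hlim⟩
  obtain ⟨K, hφK, hKU⟩ := hφ.cptSmooth
  have h1 := (hlim φ hφ.memLp).const_mul ((-1 : ℝ) ^ m)
  have hcs := hφK.iteratedFDeriv m (fun j => dir (I j))
  have h2 := (h.tendsto_test hU hcs).mono_left (Nat.hyperfilter_le_atTop)
  refine tendsto_nhds_unique h2 (h1.congr fun j => ?_)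
  rw [integral_cyl_eq_univ hU hKU (fun z hz θ => by rw [hφK.support z hz θ, mul_zero]),
    integral_cyl_eq_univ hU hKU (fun z hz θ => by rw [hcs.support z hz θ, mul_zero]),
    integral_mul_iteratedFDeriv (h.smooth j) hφK m I]

lemma memSobolev (h : ApproxBy U u v) (hU : MeasurableSet U) {s : ℕ} (hR : R ≠ ⊤)
    (hb : ∀ j, DerivL2LE U s (u j) R) :
    MemSobolev U s v :=
  ⟨h.periodic, h.memLp hU hR fun j => hb j [] (Nat.zero_le _), fun m hm I =>
    (h.exists_weakDeriv hU I hR fun j => hb j _ (by simpa [word] using hm)).imp fun _ hw => hw.1⟩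

end ApproxBy

lemma hasWeakDeriv_one_iff {U : Set (Pt k)} {v : Cyl k} {u w : Fn k} :
    HasWeakDeriv U 1 ![v] u w ↔ MemLp w 2 (vol U) ∧ ∀ φ, IsTest U φ →
      ∫ x, u x * dv v φ x ∂vol U = - ∫ x, w x * φ x ∂vol U := by
  have : ∀ (φ : Fn k) x, iteratedFDeriv ℝ 1 φ x ![v] = dv v φ x := fun φ x => by
    rw [iteratedFDeriv_one_apply]; rfl
  simp only [HasWeakDeriv, this, pow_one, neg_one_mul]

end Compactness

/-! ### Bounds for the discretised interaction integral -/

section PairingBounds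
variable {k : ℕ}
variable {a ρ : ℝ≥0∞} {V : Set (Pt k)} {W A : ℝ} {u v : Fn k} {m : ℕ} {I : Word k}

lemma eLpNorm_list_sum_le {α ι : Type*} [MeasurableSpace α] {μ : Measure α} {l : List ι}
    {f : ι → α → ℝ} (hf : ∀ i, AEStronglyMeasurable (f i) μ)
    (h : ∀ i ∈ l, eLpNorm (f i) 2 μ ≤ a) :
    eLpNorm (fun x => (l.map fun i => f i x).sum) 2 μ ≤ l.length * a := by
  induction l with
  | nil => simp
  | cons i l ih =>
    simp only [List.map_cons, List.sum_cons, List.length_cons]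
    have hm : AEStronglyMeasurable (fun x => (l.map fun i => f i x).sum) μ := by
      clear ih h
      induction l with
      | nil => simpa using aestronglyMeasurable_const
      | cons j l ih =>
        simp only [List.map_cons, List.sum_cons]
        exact (hf j).add ih
    refine (eLpNorm_add_le (hf i) hm (by norm_num)).trans ?_
    refine (add_le_add (h i (by simp)) (ih fun j hj => h j (by simp [hj]))).trans (le_of_eq ?_)
    push_cast
    ring

lemma abs_list_sum_le {ι : Type*} {l : List ι} {f : ι → ℝ} {a : ℝ} (h : ∀ i ∈ l, |f i| ≤ a) :
    |(l.map f).sum| ≤ l.length * a := by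
  induction l with
  | nil => simp
  | cons i l ih =>
    simp only [List.map_cons, List.sum_cons, List.length_cons]
    refine (abs_add_le _ _).trans ((add_le_add (h i (by simp)) (ih fun j hj => h j (by simp [hj]))).trans
      (le_of_eq ?_))
    push_cast
    ring

namespace PairData
variable {P : PairData k}

/-- The translations of `P` map `V` into itself. -/
structure Preserves (P : PairData k) (V : Set (Pt k)) : Prop where
  p_mem : ∀ r, ∀ z ∈ V, z + P.p r ∈ V
  q_mem : ∀ r, ∀ z ∈ V, z + P.q r ∈ V

lemma abs_pairing_le (hP : P.Good) (hV : P.Preserves V) {B : ℝ}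
    (hW : ∑ r ∈ Finset.range P.R, |P.w r| ≤ W) (hA : 0 ≤ A) (hB : 0 ≤ B)
    (hu : ∀ x : Cyl k, x.1 ∈ V → |u x| ≤ A) (hv : ∀ x : Cyl k, x.1 ∈ V → |v x| ≤ B) (x : Cyl k)
    (hx : x.1 ∈ V) : |P.pairing u v x| ≤ 2 * π * W * (A * B) := by
  have hpi := Real.pi_pos
  rw [pairing]
  refine (abs_sum_le_sum_abs _ _).trans ?_
  calc _ ≤ ∑ r ∈ Finset.range P.R, |P.w r| * (2 * π * (A * B)) := by
        refine sum_le_sum fun r _ => ?_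
        rw [abs_mul]
        refine mul_le_mul_of_nonneg_left ?_ (abs_nonneg _)
        refine (abs_sum_le_sum_abs _ _).trans ?_
        calc _ ≤ ∑ _l ∈ Finset.range P.M, P.mesh * (A * B) := by
              refine sum_le_sum fun l _ => ?_
              rw [abs_mul, abs_mul, abs_of_pos hP.mesh_pos]
              refine mul_le_mul_of_nonneg_left (mul_le_mul ?_ (hv _ (hV.q_mem r _ hx))
                (abs_nonneg _) hA) hP.mesh_pos.le
              exact abs_prepAvg_le hP.N_ne (fun θ => hu _ (hV.p_mem r _ hx)) _
          _ = _ := by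
              rw [sum_const, card_range, nsmul_eq_mul, ← mul_assoc, hP.mesh_sum]
    _ ≤ _ := by
        rw [← sum_mul]
        nlinarith [mul_le_mul_of_nonneg_right hW (by positivity : 0 ≤ 2 * π * (A * B))]

lemma eLpNorm_prepAvg_le {N : ℤ} (hN : N ≠ 0) (hVm : MeasurableSet V) (hu : SmoothPer u) :
    eLpNorm (prepAvg N u) 2 (vol V) ≤ eLpNorm u 2 (vol V) := by
  have hN' : (0 : ℝ) < N.natAbs := by exact_mod_cast Int.natAbs_pos.2 hN
  rw [prepAvg_eq]
  have h1 : (fun x => (N.natAbs : ℝ)⁻¹ * ∑ i ∈ Finset.range N.natAbs,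
      shift (0, 2 * π * i / N) u x) = (N.natAbs : ℝ)⁻¹ • ∑ i ∈ Finset.range N.natAbs,
        shift (0, 2 * π * i / N) u := by
    ext x; simp
  rw [h1, eLpNorm_const_smul, Real.enorm_of_nonneg (by positivity)]
  have h2 : eLpNorm (∑ i ∈ Finset.range N.natAbs, shift (0, 2 * π * i / N) u) 2 (vol V) ≤
      ∑ _i ∈ Finset.range N.natAbs, eLpNorm u 2 (vol V) := by
    refine (eLpNorm_sum_le (fun i _ => (hu.shift _).continuous.aestronglyMeasurable) (by norm_num)).trans
      (sum_le_sum fun i _ => ?_)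
    exact eLpNorm_shift_le hVm hVm hu.continuous.measurable hu.periodic (by simp) 2
  refine (mul_le_mul_right h2 _).trans (le_of_eq ?_)
  rw [sum_const, card_range, nsmul_eq_mul, ← mul_assoc, ← ofReal_natCast,
    ← ofReal_mul (by positivity), inv_mul_cancel₀ hN'.ne', ofReal_one, one_mul]

lemma eLpNorm_mul_le_of_bound (hVm : MeasurableSet V) {f g : Fn k}
    (hf : ∀ x : Cyl k, x.1 ∈ V → |f x| ≤ A) :
    eLpNorm (fun x => f x * g x) 2 (vol V) ≤ ofReal A * eLpNorm g 2 (vol V) :=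
  eLpNorm_le_mul_eLpNorm_of_ae_le_mul (ae_cylMeasure_of_forall hVm fun x hx => by
    rw [norm_mul]
    exact mul_le_mul_of_nonneg_right (hf x hx) (norm_nonneg _)) 2

lemma eLpNorm_pairing_le (hP : P.Good) (hVm : MeasurableSet V)
    (hV : P.Preserves V) (hW : ∑ r ∈ Finset.range P.R, |P.w r| ≤ W)
    (hu : SmoothPer u) (hv : SmoothPer v)
    (h : (∀ x : Cyl k, x.1 ∈ V → |u x| ≤ A) ∧ eLpNorm v 2 (vol V) ≤ ρ ∨
      (∀ x : Cyl k, x.1 ∈ V → |v x| ≤ A) ∧ eLpNorm u 2 (vol V) ≤ ρ) :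
    eLpNorm (P.pairing u v) 2 (vol V) ≤ ofReal (2 * π * W) * (ofReal A * ρ) := by
  have hsm : ∀ r l, SmoothPer (shift (P.p r, P.ratio * (P.mesh * (l : ℕ))) (prepAvg P.N u)) :=
    fun r l => (hu.prepAvg _).shift _
  have hsv : ∀ r l, SmoothPer (shift (P.q r, P.mesh * (l : ℕ)) v) := fun r l => hv.shift _
  refine double_sum_le hP (Φ := fun f => eLpNorm f 2 (vol V)) hW (fun c g => ?_) (fun m g hg => ?_)
    (fun r l => (hsm r l).mul (hsv r l)) fun r l => ?_
  · rw [← Real.enorm_eq_ofReal_abs, ← eLpNorm_const_smul]; rfl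
  · have := eLpNorm_sum_le (μ := vol V) (p := 2) (s := Finset.range m) (f := g)
      (fun i _ => (hg i).continuous.aestronglyMeasurable) (by norm_num)
    convert this using 2
    ext x; simp
  rcases h with ⟨h1, h2⟩ | ⟨h1, h2⟩
  · refine (eLpNorm_mul_le_of_bound hVm fun x hx =>
      abs_prepAvg_le hP.N_ne (fun θ => h1 _ (hV.p_mem r _ hx)) _).trans (mul_le_mul_right ?_ _)
    exact (eLpNorm_shift_le hVm hVm hv.continuous.measurable hv.periodic
      (b := (P.q r, P.mesh * l)) (hV.q_mem r) 2).trans h2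
  · simp only [mul_comm (prepAvg P.N u _)]
    refine (eLpNorm_mul_le_of_bound hVm fun x hx => h1 _ (hV.q_mem r _ hx)).trans (mul_le_mul_right ?_ _)
    exact ((eLpNorm_shift_le hVm hVm (hu.prepAvg P.N).continuous.measurable (hu.prepAvg P.N).periodic
      (b := (P.p r, P.ratio * (P.mesh * l))) (hV.p_mem r) 2).trans (eLpNorm_prepAvg_le hP.N_ne hVm hu)).trans h2

lemma derivLE_pairing (hP : P.Good) (hV : P.Preserves V)
    (hW : ∑ r ∈ Finset.range P.R, |P.w r| ≤ W) (hA : 0 ≤ A) (hus : SmoothPer u) (hvs : SmoothPer v)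
    (hu : DerivLE V m u A) (hv : DerivLE V m v A) :
    DerivLE V m (P.pairing u v) (2 ^ m * (2 * π * W * (A * A))) := by
  intro I hI x hx
  have hpi := Real.pi_pos
  have hW0 : 0 ≤ W := (sum_nonneg fun _ _ => abs_nonneg _).trans hW
  rw [P.leibniz_pairing.dw_eq hus hvs]
  refine (abs_add_le _ _).trans ?_
  have h1 := abs_pairing_le hP hV hW hA hA (hu [] (Nat.zero_le _)) (hv I hI) x hx
  have h2 := abs_list_sum_le (l := splits I) (f := fun s => P.pairing (dw s.1 u) (dw s.2 v) x)
    (a := 2 * π * W * (A * A)) fun s hs => by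
      have := mem_splits hs
      exact abs_pairing_le hP hV hW hA hA (hu _ (by omega)) (hv _ (by omega)) x hx
  have h3 : ((splits I).length : ℝ) + 1 ≤ 2 ^ m := by
    exact_mod_cast (length_splits_le I).le.trans (Nat.pow_le_pow_right (by norm_num) hI)
  have h4 : 0 ≤ 2 * π * W * (A * A) := by positivity
  calc _ ≤ 2 * π * W * (A * A) + (splits I).length * (2 * π * W * (A * A)) := add_le_add h1 h2
    _ = ((splits I).length + 1) * (2 * π * W * (A * A)) := by ring
    _ ≤ _ := mul_le_mul_of_nonneg_right h3 h4

/-- In each term of the Leibniz rule one factor carries at most half of the derivatives and is bounded. -/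
lemma derivL2LE_pairing (hP : P.Good) (hVm : MeasurableSet V)
    (hV : P.Preserves V) (hW : ∑ r ∈ Finset.range P.R, |P.w r| ≤ W)
    (hus : SmoothPer u) (hvs : SmoothPer v) {m' : ℕ} (hm : m ≤ 2 * m' - 1)
    (hu : DerivLE V m' u A) (hv : DerivLE V m' v A) (hu2 : DerivL2LE V m u ρ)
    (hv2 : DerivL2LE V m v ρ) :
    DerivL2LE V m (P.pairing u v) (2 ^ m * (ofReal (2 * π * W) * (ofReal A * ρ))) := by
  intro I hI
  set Z := ofReal (2 * π * W) * (ofReal A * ρ) with hZ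
  have key : ∀ J J' : Word k, J.length + J'.length ≤ m →
      eLpNorm (P.pairing (dw J u) (dw J' v)) 2 (vol V) ≤ Z := by
    intro J J' h
    refine eLpNorm_pairing_le hP hVm hV hW (hus.dw J) (hvs.dw J') ?_
    rcases le_total J.length J'.length with h1 | h1
    · exact Or.inl ⟨hu J (by omega), hv2 J' (by omega)⟩
    · exact Or.inr ⟨hv J' (by omega), hu2 J (by omega)⟩
  have hsm : ∀ s : Word k × Word k,
      SmoothPer (P.pairing (dw s.1 u) (dw s.2 v)) := fun s => P.leibniz_pairing.smooth (hus.dw _) (hvs.dw _)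
  rw [P.leibniz_pairing.dw_eq hus hvs]
  refine (eLpNorm_add_le (hsm ([], I)).continuous.aestronglyMeasurable
    (SmoothPer.list_sum fun s _ => hsm s).continuous.aestronglyMeasurable (by norm_num)).trans ?_
  have h2 := eLpNorm_list_sum_le (l := splits I) (μ := vol V)
    (f := fun s => P.pairing (dw s.1 u) (dw s.2 v))
    (fun s => (hsm s).continuous.aestronglyMeasurable) (a := Z) fun s hs => by
      have := mem_splits hs
      exact key _ _ (by omega)
  refine (add_le_add (key [] I (by simpa using hI)) h2).trans ?_
  have h3 : ((splits I).length : ℝ≥0∞) + 1 ≤ 2 ^ m := by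
    exact_mod_cast (length_splits_le I).le.trans (Nat.pow_le_pow_right (by norm_num) hI)
  calc _ = ((splits I).length + 1) * Z := by ring
    _ ≤ _ := mul_le_mul_left h3 _

end PairData
end PairingBounds

/-! ### The half space: traces and transported functions -/

section HalfSpace
variable {n : ℕ}
variable {T : ℝ}

lemma measurableSet_intDomain (n : ℕ) (T : ℝ) : MeasurableSet (intDomain n T) :=
  (measurableSet_lt (measurable_pi_apply _) measurable_const).inter
    (measurableSet_lt measurable_const (measurable_pi_apply _))

@[simp] lemma atHeight_zero (z : Pt (n + 1)) (s : ℝ) : atHeight z s 0 = z 0 := by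
  have : (0 : Fin (n + 2)) = Fin.castSucc 0 := rfl
  rw [atHeight, this, Fin.snoc_castSucc]

@[simp] lemma atHeight_last (z : Pt (n + 1)) (s : ℝ) : atHeight z s (Fin.last (n + 1)) = s := by
  rw [atHeight, Fin.snoc_last]

/-- The point of `ℝᵏ × ℝ` over a boundary point, at height `s`. -/
def lift (s : ℝ) (q : Cyl (n + 1)) : Cyl (n + 2) := (atHeight q.1 s, q.2)

lemma continuous_lift : Continuous fun p : ℝ × Cyl (n + 1) => lift p.1 p.2 := by
  refine Continuous.prodMk (continuous_pi fun i => ?_) (by fun_prop)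
  refine Fin.lastCases ?_ (fun i => ?_) i
  · simp only [atHeight_last]; fun_prop
  · simp only [atHeight, Fin.snoc_castSucc]; fun_prop

lemma lift_eq (s : ℝ) (q : Cyl (n + 1)) : lift s q = lift 0 q + s • dir (some (Fin.last (n + 1))) := by
  refine Prod.ext (funext fun i => ?_) (by simp [lift, dir])
  refine Fin.lastCases ?_ (fun i => ?_) i
  · simp [lift, dir]
  · simp [lift, dir, atHeight]

lemma measurePreserving_lift (T : ℝ) : MeasurePreserving (fun p : ℝ × Cyl (n + 1) => lift p.1 p.2)
      ((volume.restrict (Ioi 0)).prod (vol (bΩ n T))) (vol (intDomain n T)) := by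
  have h1 : MeasurePreserving (fun p : ℝ × (Pt (n + 1)) => atHeight p.2 p.1) volume volume := by
    have := (volume_preserving_piFinSuccAbove (fun _ : Fin (n + 2) => ℝ) (Fin.last (n + 1))).symm
    have he : (fun p : ℝ × (Pt (n + 1)) => atHeight p.2 p.1) =
        (MeasurableEquiv.piFinSuccAbove (fun _ : Fin (n + 2) => ℝ) (Fin.last (n + 1))).symm :=
      funext fun p => (Fin.insertNth_last' p.1 p.2).symm
    rw [he]
    exact this
  have h2 : MeasurePreserving (fun p : ℝ × Cyl (n + 1) => lift p.1 p.2) volume volume := by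
    have h3 := h1.prod (MeasurePreserving.id (volume : Measure ℝ))
    have h4 := (volume_preserving_prodAssoc (α₁ := ℝ) (β₁ := Pt (n + 1)) (γ₁ := ℝ)).symm
    exact h3.comp h4
  have h3 := h2.restrict_preimage ((measurableSet_intDomain n T).prod
    (measurableSet_Ioo (a := (0 : ℝ)) (b := 2 * π)))
  have h4 : (fun p : ℝ × Cyl (n + 1) => lift p.1 p.2) ⁻¹' (intDomain n T ×ˢ Ioo 0 (2 * π)) =
      Ioi 0 ×ˢ (bΩ n T ×ˢ Ioo 0 (2 * π)) := by
    ext p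
    simp only [mem_preimage, mem_prod, lift, intDomain, bdryDomain, mem_ofPred_eq, atHeight_zero,
      atHeight_last, mem_Ioi]
    tauto
  rw [h4] at h3
  rw [cylMeasure, cylMeasure, Measure.prod_restrict]
  exact h3

lemma intDomain_trace {u φ : Fn (n + 2)} (hu : SmoothPer u) {K : Set (Pt (n + 2))}
    (hφ : CptSmooth φ K) :
    ∫ p, (u p * dv (dir (some (Fin.last (n + 1)))) φ p + dv (dir (some (Fin.last (n + 1)))) u p * φ p)
      ∂vol (intDomain n T) =
      - ∫ q, u (lift 0 q) * φ (lift 0 q) ∂vol (bΩ n T) := by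
  have hfin : SFinite (vol (bΩ n T)) := by rw [cylMeasure]; infer_instance
  set d := dir (some (Fin.last (n + 1))) with hd
  have hf : CptSmooth (fun p => u p * φ p) K := CptSmooth.mul hu hφ
  have h1 : ∀ p, u p * dv d φ p + dv d u p * φ p = dv d (fun p => u p * φ p) p := fun p => by
    rw [dv_mul hu hφ.toSmoothPer]; ring
  simp only [h1]
  have hint := (hf.dv d).integrable (intDomain n T)
  have hmp := measurePreserving_lift (n := n) T
  have hint' : Integrable (fun p : ℝ × Cyl (n + 1) => dv d (fun p => u p * φ p) (lift p.1 p.2))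
      ((volume.restrict (Ioi 0)).prod (vol (bΩ n T))) :=
    (hmp.integrable_comp hint.1).2 hint
  rw [← hmp.map_eq, integral_map hmp.measurable.aemeasurable
    (by rw [hmp.map_eq]; exact hint.1), integral_prod_symm _ hint', ← integral_neg]
  refine integral_congr_ae (.of_forall fun q => ?_)
  have h2 : ∀ s, HasDerivAt (fun s => u (lift s q) * φ (lift s q))
      (dv d (fun p => u p * φ p) (lift s q)) s := by
    intro s
    have h3 : HasDerivAt (fun s => lift s q) d s := by
      have : (fun s => lift s q) = fun s => lift 0 q + s • d := funext fun s => lift_eq s q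
      rw [this]
      simpa using ((hasDerivAt_id s).smul_const d).const_add (lift 0 q)
    exact (hf.differentiable _).hasFDerivAt.comp_hasDerivAt s h3
  have hcd : ContDiff ℝ 1 fun s => u (lift s q) * φ (lift s q) := by
    have h3 : ContDiff ℝ 1 fun s : ℝ => lift s q := by
      have : (fun s => lift s q) = fun s => lift 0 q + s • d := funext fun s => lift_eq s q
      rw [this]; fun_prop
    exact (hf.smooth.of_le (by simp)).comp h3
  have hcs : HasCompactSupport fun s => u (lift s q) * φ (lift s q) := by
    obtain ⟨R, hR⟩ := hf.compact.isBounded.subset_closedBall 0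
    refine HasCompactSupport.of_support_subset_isCompact (isCompact_closedBall (0 : ℝ) R) fun s hs => ?_
    have h4 : (lift s q).1 ∈ K := by_contra fun h => hs (hf.support _ h q.2)
    have h5 := mem_closedBall_zero_iff.1 (hR h4)
    rw [mem_closedBall_zero_iff]
    have h6 := norm_le_pi_norm (lift s q).1 (Fin.last (n + 1))
    simp only [lift, atHeight_last] at h6 h5
    exact h6.trans h5
  have h7 := hcs.integral_Ioi_deriv_eq hcd 0
  simp only [(h2 _).deriv] at h7
  exact h7

lemma dir_vec_one {k : ℕ} (i : Option (Fin k)) :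
    (fun j : Fin 1 => (dir ((![i] : Fin 1 → Option (Fin k)) j) : Cyl k)) = ![dir i] := by
  funext j
  fin_cases j
  rfl

/-- Green's formula holds for the smooth approximations and passes to the limit. -/
lemma isTrace_of_approx {u : ℕ → Fn (n + 2)} {v : Fn (n + 2)} {h : Fn (n + 1)}
    (hu : ApproxBy (intDomain n T) u v) (hh : ApproxBy (bΩ n T) (fun j q => u j (lift 0 q)) h)
    {R : ℝ≥0∞} (hR : R ≠ ⊤) (hb : ∀ j, eLpNorm (dw [some (Fin.last (n + 1))] (u j)) 2
      (vol (intDomain n T)) ≤ R) : IsTrace T v h := by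
  have hUi := measurableSet_intDomain n T
  have hUb := measurableSet_bdryDomain (n := n) T
  obtain ⟨w, hw, hlim⟩ := hu.exists_weakDeriv hUi ![some (Fin.last (n + 1))] hR
    (by simpa [word] using hb)
  have hword : word (![some (Fin.last (n + 1))] : Fin 1 → Option (Fin (n + 2))) =
      [some (Fin.last (n + 1))] := by simp [word]
  rw [hword] at hlim
  refine ⟨w, ?_, fun φ hφ => ?_⟩
  · rw [← dir_vec_one]
    exact hw
  obtain ⟨K, hφK, -⟩ := hφ.cptSmooth
  obtain ⟨C, hC⟩ := hu.bound
  obtain ⟨C', hC'⟩ := hh.bound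
  set d := dir (some (Fin.last (n + 1))) with hd
  obtain ⟨Cφ, -, hCφ⟩ := hφK.bound
  have h1 := (hu.tendsto_test hUi (hφK.dv d)).mono_left Nat.hyperfilter_le_atTop
  have h2 := h1.add (hlim φ hφ.memLp)
  have hKb : IsCompact ((fun z : Pt (n + 2) => fun i : Fin (n + 1) => z i.castSucc) '' K) :=
    hφK.compact.image (by fun_prop)
  have hlc : Continuous fun q : Cyl (n + 1) => lift 0 q :=
    continuous_lift.comp (by fun_prop : Continuous fun q : Cyl (n + 1) => ((0 : ℝ), q))
  have h3 : Tendsto (fun j => ∫ q, u j (lift 0 q) * φ (lift 0 q) ∂vol (bΩ n T)) atTop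
      (𝓝 (∫ q, h q * φ (lift 0 q) ∂vol (bΩ n T))) :=
    tendsto_integral_mul hUb hKb (fun j => (hh.smooth j).continuous.aestronglyMeasurable)
      (fun _ => hφK.continuous.comp hlc) hC' (fun _ x => hCφ _) (fun _ z hz θ => hφK.support _
        (fun hm => hz ⟨_, hm, funext fun i => by simp [atHeight]⟩) _)
      hh.lim fun x => tendsto_const_nhds
  have h4 := h3.neg.mono_left Nat.hyperfilter_le_atTop
  have hint1 : ∀ j, Integrable (fun p => u j p * dv d φ p) (vol (intDomain n T)) := fun j =>
    (CptSmooth.mul (hu.smooth j) (hφK.dv d)).integrable _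
  have hint2 : ∀ j, Integrable (fun p => dv d (u j) p * φ p) (vol (intDomain n T)) := fun j =>
    (CptSmooth.mul ((hu.smooth j).dv d) hφK).integrable _
  have h5 : ∀ j, (∫ p, u j p * dv d φ p ∂vol (intDomain n T)) +
      ∫ p, dw [some (Fin.last (n + 1))] (u j) p * φ p ∂vol (intDomain n T) =
      - ∫ q, u j (lift 0 q) * φ (lift 0 q) ∂vol (bΩ n T) := fun j => by
    rw [← intDomain_trace (hu.smooth j) hφK]
    exact (integral_add (hint1 j) (hint2 j)).symm
  have h6 := tendsto_nhds_unique (h2.congr h5) h4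
  have hint3 : Integrable (fun p => v p * dv d φ p) (vol (intDomain n T)) := by
    obtain ⟨C2, -, hC2⟩ := (hφK.dv d).bound
    refine integrable_cyl_of_bound hφK.compact (C := C * C2)
      ((hu.aestronglyMeasurable hUi).mul (hφK.dv d).continuous.aestronglyMeasurable)
      (ae_cylMeasure_of_forall hUi fun x hx => ?_)
      (fun z hz θ => by rw [(hφK.dv d).support z hz, mul_zero])
    have h7 : |v x| ≤ C := le_of_tendsto (hu.lim x hx).abs (.of_forall fun j => hC j x hx)
    rw [abs_mul]
    exact mul_le_mul h7 (hC2 x) (abs_nonneg _) ((abs_nonneg _).trans h7)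
  have hint4 : Integrable (fun p => w p * φ p) (vol (intDomain n T)) :=
    integrable_mul_cyl hw.1 hφK.compact hφK.continuous hCφ hφK.support
  rw [← integral_add hint3 hint4] at h6
  exact h6

end HalfSpace

/-! ### Transport along the incoming fields -/

section Transport
variable {n : ℕ}
variable {a : Fn (n + 1)} {ρ T A : ℝ}

/-- The projection of space-time onto the boundary along the field with tangential part `v`. -/
def projL (v : Pt (n + 1)) : Cyl (n + 2) →L[ℝ] Cyl (n + 1) := LinearMap.toContinuousLinearMap
    { toFun := fun x => (fun i => x.1 i.castSucc - x.1 (Fin.last (n + 1)) * v i, x.2)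
      map_add' := fun x y => by
        refine Prod.ext (funext fun i => ?_) rfl
        simp; ring
      map_smul' := fun r x => by
        refine Prod.ext (funext fun i => ?_) rfl
        simp; ring }

lemma projL_apply (v : Pt (n + 1)) (x : Cyl (n + 2)) :
    projL v x = (fun i => x.1 i.castSucc - x.1 (Fin.last (n + 1)) * v i, x.2) := rfl

lemma projL_lift (v : Pt (n + 1)) (s : ℝ) (q : Cyl (n + 1)) :
    projL v (lift s q) = q + (-(s • v), 0) := by
  refine Prod.ext (funext fun i => ?_) (by simp [projL_apply, lift])
  simp [projL_apply, lift, atHeight, sub_eq_add_neg]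

lemma projL_field (v : Pt (n + 1)) : projL v (atHeight v 1, 0) = 0 := by
  refine Prod.ext (funext fun i => ?_) rfl
  simp [projL_apply, atHeight]

lemma abs_projL_dir_le (v : Pt (n + 1)) (i : Option (Fin (n + 2))) :
    |(projL v (dir i)).2| ≤ 1 ∧ ∀ l, |(projL v (dir i)).1 l| ≤ 1 + |v l| := by
  rcases i with _ | i
  · exact ⟨by simp [projL_apply, dir], fun l => by simp [projL_apply, dir]; positivity⟩
  refine ⟨by simp [projL_apply, dir], fun l => ?_⟩
  have h1 : ∀ j, |(Pi.single i (1 : ℝ) : Pt (n + 2)) j| ≤ 1 := fun j => by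
    rw [Pi.single_apply]; split_ifs <;> simp
  simp only [projL_apply, dir]
  refine (abs_sub _ _).trans (add_le_add (h1 _) ?_)
  rw [abs_mul]
  exact mul_le_of_le_one_left (abs_nonneg _) (h1 _)

/-- The solution of `(∂_d + v · ∂_{x'}) σ + c σ = 0` with boundary values `ε a`. -/
def transport (v : Pt (n + 1)) (c ε : ℝ) (a : Fn (n + 1)) : Fn (n + 2) :=
  fun x => ε * (rexp (-c * x.1 (Fin.last (n + 1))) * a (projL v x))

/-- The operator on boundary data that corresponds to a derivative of the transported function. -/
def opT (v : Pt (n + 1)) (c : ℝ) (d : Cyl (n + 2)) (a : Fn (n + 1)) : Fn (n + 1) :=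
  fun y => (-c * d.1 (Fin.last (n + 1))) * a y + dv (projL v d) a y

/-- Iterated version of `opT` along a word of coordinate directions. -/
def opW (v : Pt (n + 1)) (c : ℝ) : Word (n + 2) → Fn (n + 1) → Fn (n + 1)
  | [], a => a
  | i :: I, a => opW v c I (opT v c (dir i) a)

variable {v : Pt (n + 1)} {c ε : ℝ}

lemma smoothPer_transport (ha : SmoothPer a) : SmoothPer (transport v c ε a) where
  smooth := by
    have h1 : ContDiff ℝ ∞ fun x : Cyl (n + 2) => a (projL v x) := ha.smooth.comp (projL v).contDiff
    have h2 : ContDiff ℝ ∞ fun x : Cyl (n + 2) => x.1 (Fin.last (n + 1)) :=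
      (contDiff_apply ℝ ℝ _).comp contDiff_fst
    exact contDiff_const.mul ((Real.contDiff_exp.comp (contDiff_const.mul h2)).mul h1)
  periodic z θ := by
    simp only [transport, projL_apply]
    rw [ha.periodic]

lemma smoothPer_opT (ha : SmoothPer a) (d : Cyl (n + 2)) :
    SmoothPer (opT v c d a) := (ha.const_mul _).add (ha.dv _)

lemma smoothPer_opW (I : Word (n + 2)) (ha : SmoothPer a) : SmoothPer (opW v c I a) := by
  induction I generalizing a with
  | nil => exact ha
  | cons i I ih => exact ih (smoothPer_opT ha _)

lemma dv_transport (ha : SmoothPer a) (d : Cyl (n + 2)) :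
    dv d (transport v c ε a) = transport v c ε (opT v c d a) := by
  funext x
  have h1 : HasFDerivAt (fun x : Cyl (n + 2) => a (projL v x))
      ((fderiv ℝ a (projL v x)).comp (projL v)) x :=
    (ha.differentiable _).hasFDerivAt.comp x (projL v).hasFDerivAt
  have h2 : HasFDerivAt (fun x : Cyl (n + 2) => x.1 (Fin.last (n + 1)))
      ((ContinuousLinearMap.proj (Fin.last (n + 1))).comp (ContinuousLinearMap.fst ℝ _ ℝ)) x :=
    ((ContinuousLinearMap.proj (R := ℝ) (φ := fun _ : Fin (n + 2) => ℝ) (Fin.last (n + 1))).comp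
      (ContinuousLinearMap.fst ℝ _ ℝ)).hasFDerivAt
  have h3 := (((h2.const_mul (-c)).exp).mul h1).const_mul ε
  rw [dv, show fderiv ℝ (transport v c ε a) x = _ from h3.fderiv]
  simp [transport, opT, dv]
  ring

lemma dw_transport (I : Word (n + 2)) (ha : SmoothPer a) :
    dw I (transport v c ε a) = transport v c ε (opW v c I a) := by
  induction I generalizing a with
  | nil => rfl
  | cons i I ih => rw [dw, dv_transport ha, ih (smoothPer_opT ha _), opW]

lemma opW_past (I : Word (n + 2))
    (ha : ∀ x : Cyl (n + 1), x.1 0 < 0 → a x = 0) (x : Cyl (n + 1)) (hx : x.1 0 < 0) :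
    opW v c I a x = 0 := by
  induction I generalizing a with
  | nil => exact ha x hx
  | cons i I ih =>
    refine ih fun y hy => ?_
    have ho : IsOpen {y : Cyl (n + 1) | y.1 0 < 0} := isOpen_lt (by fun_prop) continuous_const
    have h1 : a =ᶠ[𝓝 y] fun _ => 0 := by filter_upwards [ho.mem_nhds hy] with z hz using ha z hz
    rw [opT, ha y hy, dv, h1.fderiv_eq]
    simp

/-- The constant of the bounds for derivatives of transported functions. -/
def transConst (v : Pt (n + 1)) (c : ℝ) : ℝ := |c| + (1 + ∑ l, (1 + |v l|))

/-- Each derivative of a transported function is a combination of tangential derivatives of `a` and of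
the factor `e^{-c x_d}`. -/
lemma opW_le {lam τ : ℝ} {N : ℝ → Fn (n + 1) → ℝ≥0∞} (hN : IsAdmissible lam N)
    (I : Word (n + 2)) :
    ∀ {a : Fn (n + 1)}, SmoothPer a → ∀ {ρ : ℝ}, 0 ≤ ρ →
    (∀ J : Word (n + 1), J.length ≤ I.length → N τ (dw J a) ≤ ofReal ρ) →
      N τ (opW v c I a) ≤ ofReal (transConst v c ^ I.length * ρ) := by
  have hC0 : 0 ≤ transConst v c := by
    rw [transConst]
    have : 0 ≤ ∑ l, (1 + |v l|) := sum_nonneg fun _ _ => by positivity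
    positivity
  induction I with
  | nil =>
    intro a ha ρ hρ h
    simpa [opW, dw] using h [] le_rfl
  | cons i I ih =>
    intro a ha ρ hρ h
    rw [opW]
    refine (ih (smoothPer_opT ha _) (ρ := transConst v c * ρ) (by positivity) fun J hJ => ?_).trans
      (le_of_eq ?_)
    swap
    · rw [List.length_cons, pow_succ, mul_assoc]
    have h0 : N τ (dw J a) ≤ ofReal ρ := h J (by simp; omega)
    have h1 : ∀ l, N τ (dw J (dv (dir l) a)) ≤ ofReal ρ := fun l => h (l :: J) (by simpa using hJ)
    set w := projL v (dir i) with hw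
    obtain ⟨hw2, hw1⟩ := abs_projL_dir_le v i
    have e : opT v c (dir i) a = fun y => (-c * (dir i : Cyl (n + 2)).1 (Fin.last (n + 1))) * a y +
        (w.2 * dv (dir none) a y + ∑ l ∈ Finset.univ, w.1 l * dv (dir (some l)) a y) := by
      funext y
      rw [opT, dv_eq_sum a (projL v (dir i)) y]
    have hs : SmoothPer fun y => ∑ l ∈ Finset.univ, w.1 l * dv (dir (some l)) a y :=
      SmoothPer.sum fun l _ => (ha.dv _).const_mul _
    rw [e, dw_add (ha.const_mul _) (((ha.dv _).const_mul _).add hs), dw_const_mul ha,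
      dw_add ((ha.dv _).const_mul _) hs, dw_const_mul (ha.dv _),
      dw_sum fun l _ => (ha.dv _).const_mul _]
    have hl : ∀ l, dw J (fun y => w.1 l * dv (dir (some l)) a y) =
        fun y => w.1 l * dw J (dv (dir (some l)) a) y := fun l => dw_const_mul (ha.dv _) _ _
    simp only [hl]
    have hsum : N τ (fun y => ∑ l ∈ Finset.univ, w.1 l * dw J (dv (dir (some l)) a) y) ≤
        ofReal (∑ l, (1 + |v l|) * ρ) := by
      refine (hN.sum_le _ τ fun l _ => ((ha.dv _).dw J).const_mul _).trans ?_
      rw [ENNReal.ofReal_sum_of_nonneg fun l _ => by positivity]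
      refine sum_le_sum fun l _ => (hN.smul_le _ (h1 _)).trans
        (ofReal_le_ofReal (mul_le_mul_of_nonneg_right (hw1 l) hρ))
    have hlast : |-c * (dir i : Cyl (n + 2)).1 (Fin.last (n + 1))| ≤ |c| := by
      rw [abs_mul, abs_neg]
      refine mul_le_of_le_one_right (abs_nonneg _) ?_
      rcases i with _ | i
      · simp [dir]
      · simp only [dir, Pi.single_apply]; split_ifs <;> simp
    have hsum' : SmoothPer fun y => ∑ l ∈ Finset.univ, w.1 l * dw J (dv (dir (some l)) a) y :=
      SmoothPer.sum fun l _ => ((ha.dv _).dw J).const_mul _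
    have hpos : 0 ≤ ∑ l, (1 + |v l|) * ρ := sum_nonneg fun _ _ => by positivity
    have h2 := hN.add_le (((ha.dv (dir none)).dw J).const_mul w.2) hsum' (a := |w.2| * ρ)
      (by positivity) hpos (hN.smul_le _ (h1 none)) hsum
    have h3 := hN.add_le ((ha.dw J).const_mul (-c * (dir i : Cyl (n + 2)).1 (Fin.last (n + 1))))
      ((((ha.dv (dir none)).dw J).const_mul w.2).add hsum')
      (a := |-c * (dir i : Cyl (n + 2)).1 (Fin.last (n + 1))| * ρ) (by positivity) (by positivity)
      (hN.smul_le _ h0) h2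
    refine h3.trans (ofReal_le_ofReal ?_)
    rw [← sum_mul, ← add_mul, ← add_mul, transConst]
    refine mul_le_mul_of_nonneg_right ?_ hρ
    linarith

/-- The part of space-time where transported functions are controlled by boundary data in `t < T`. -/
def closedDomain (n : ℕ) (T : ℝ) : Set (Pt (n + 2)) := {z | z 0 < T ∧ 0 ≤ z (Fin.last (n + 1))}

lemma projL_time (v : Pt (n + 1)) (x : Cyl (n + 2)) :
    (projL v x).1 0 = x.1 0 - x.1 (Fin.last (n + 1)) * v 0 := rfl

/-- The constant by which transport along `v` enlarges bounds up to the time `T`. -/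
def transBound (v : Pt (n + 1)) (c ε T : ℝ) : ℝ := |ε| * rexp (|c| * (T / v 0))

lemma transBound_nonneg (v : Pt (n + 1)) (c ε T : ℝ) : 0 ≤ transBound v c ε T := by
  rw [transBound]; positivity

lemma abs_exp_factor_le {v : Pt (n + 1)} {s : ℝ} (hv : 0 < v 0) (hs : 0 ≤ s)
    (hsT : s * v 0 ≤ T) (c ε y : ℝ) :
    |ε * (rexp (-c * s) * y)| ≤ transBound v c ε T * |y| := by
  have h1 : rexp (-c * s) ≤ rexp (|c| * (T / v 0)) := by
    refine Real.exp_le_exp.2 ?_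
    calc -c * s ≤ |c| * s := mul_le_mul_of_nonneg_right (neg_le_abs c) hs
      _ ≤ |c| * (T / v 0) := mul_le_mul_of_nonneg_left ((le_div_iff₀ hv).2 hsT) (abs_nonneg _)
  rw [abs_mul, abs_mul, abs_of_pos (Real.exp_pos _), transBound, mul_assoc]
  exact mul_le_mul_of_nonneg_left (mul_le_mul_of_nonneg_right h1 (abs_nonneg _)) (abs_nonneg _)

lemma abs_transport_le (hv : 0 < v 0) (hA : 0 ≤ A)
    (hp : ∀ x : Cyl (n + 1), x.1 0 < 0 → a x = 0) (h : ∀ x : Cyl (n + 1), x.1 0 < T → |a x| ≤ A)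
    (x : Cyl (n + 2)) (hx : x.1 ∈ closedDomain n T) :
    |transport v c ε a x| ≤ transBound v c ε T * A := by
  have hB := transBound_nonneg v c ε T
  by_cases h0 : (projL v x).1 0 < 0
  · rw [transport, hp _ h0]; simpa using mul_nonneg hB hA
  · rw [projL_time, not_lt] at h0
    have h1 : (projL v x).1 0 < T := by rw [projL_time]; nlinarith [hx.1, mul_nonneg hx.2 hv.le]
    exact (abs_exp_factor_le hv hx.2 (by linarith [hx.1]) c ε _).trans
      (mul_le_mul_of_nonneg_left (h _ h1) hB)

/-- At height `s` the function is a translate of `a`, which vanishes for `s ≥ T / v₀` as `a = 0` in the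
past; so only a bounded range of heights contributes. -/
lemma eLpNorm_transport_le (hv : 0 < v 0) (ha : SmoothPer a)
    (hp : ∀ x : Cyl (n + 1), x.1 0 < 0 → a x = 0) :
    eLpNorm (transport v c ε a) 2 (vol (intDomain n T)) ≤
      ofReal (transBound v c ε T) * ofReal (T / v 0) ^ (1 / 2 : ℝ) *
        eLpNorm a 2 (vol (bΩ n T)) := by
  have hU := measurableSet_bdryDomain (n := n) T
  have hB := transBound_nonneg v c ε T
  have hfin : SFinite (vol (bΩ n T)) := by rw [cylMeasure]; infer_instance
  have hsq : eLpNorm (transport v c ε a) 2 (vol (intDomain n T)) ^ 2 ≤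
      (ofReal (transBound v c ε T) * ofReal (T / v 0) ^ (1 / 2 : ℝ) *
        eLpNorm a 2 (vol (bΩ n T))) ^ 2 := by
    have ht := (smoothPer_transport (v := v) (c := c) (ε := ε) ha).continuous
    rw [mul_pow, mul_pow, ← ENNReal.rpow_natCast (_ ^ (1 / 2 : ℝ)), ← ENNReal.rpow_mul, eLpNorm_two_sq]
    norm_num
    rw [← (measurePreserving_lift (n := n) T).lintegral_comp (by fun_prop)]
    have hlm := (measurePreserving_lift (n := n) T).measurable
    rw [lintegral_prod _ ((by fun_prop : Measurable fun p : ℝ × Cyl (n + 1) =>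
      ofReal (transport v c ε a (lift p.1 p.2) ^ 2)).aemeasurable)]
    set E := ofReal (transBound v c ε T) ^ 2 * eLpNorm a 2 (vol (bΩ n T)) ^ 2 with hE
    have h1 : ∀ s ∈ Ioi (0 : ℝ), ∫⁻ q, ofReal (transport v c ε a (lift s q) ^ 2)
        ∂vol (bΩ n T) ≤ (Ioc 0 (T / v 0)).indicator (fun _ => E) s := by
      intro s hs
      by_cases hsT : s ∈ Ioc 0 (T / v 0)
      · rw [indicator_of_mem hsT, hE]
        have h2 : eLpNorm (shift (-(s • v), 0) a) 2 (vol (bΩ n T)) ≤ eLpNorm a 2 (vol (bΩ n T)) :=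
          eLpNorm_shift_le hU hU ha.continuous.measurable ha.periodic (fun z hz => by
            have := mul_pos hsT.1 hv
            simp only [bdryDomain, mem_ofPred_eq, Pi.add_apply, Pi.neg_apply, Pi.smul_apply,
              smul_eq_mul] at hz ⊢
            linarith) 2
        refine le_trans ?_ (mul_le_mul_right (pow_le_pow_left₀ (zero_le) h2 2) _)
        rw [eLpNorm_two_sq, ← lintegral_const_mul _ (by
          have := (ha.shift (-(s • v), 0)).continuous
          fun_prop), ← ofReal_pow hB]
        refine lintegral_mono fun q => ?_
        rw [← ofReal_mul (by positivity)]
        refine ofReal_le_ofReal ?_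
        have h3 := abs_exp_factor_le hv hsT.1.le ((le_div_iff₀ hv).1 hsT.2) c ε
          (a (q + (-(s • v), 0)))
        have h4 : transport v c ε a (lift s q) = ε * (rexp (-c * s) * a (q + (-(s • v), 0))) := by
          rw [transport, projL_lift]; simp [lift]
        rw [h4, ← sq_abs]
        refine (pow_le_pow_left₀ (abs_nonneg _) h3 2).trans (le_of_eq ?_)
        rw [mul_pow, sq_abs]
        rfl
      · rw [indicator_of_notMem hsT]
        have hsT' : T < s * v 0 := by by_contra h; exact hsT ⟨hs, (le_div_iff₀ hv).2 (not_lt.1 h)⟩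
        refine le_of_eq ((lintegral_congr_ae (ae_cylMeasure_of_forall hU fun q hq => ?_)).trans
          lintegral_zero)
        have h3 : (projL v (lift s q)).1 0 < 0 := by
          have hq' : q.1 0 < T := hq
          rw [projL_lift]; simp; linarith
        simp [transport, hp _ h3]
    refine (setLIntegral_mono' measurableSet_Ioi h1).trans ((setLIntegral_le_lintegral _ _).trans ?_)
    rw [lintegral_indicator_const measurableSet_Ioc, Real.volume_Ioc, sub_zero, hE]
    exact le_of_eq (by ring)
  exact (ENNReal.pow_le_pow_left_iff (by norm_num)).1 hsq

lemma one_le_transConst (v : Pt (n + 1)) (c : ℝ) : 1 ≤ transConst v c := by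
  have h1 : 0 ≤ ∑ l, (1 + |v l|) := sum_nonneg fun _ _ => by positivity
  rw [transConst]
  linarith [abs_nonneg c]

lemma derivLE_transport {T A : ℝ} (hv : 0 < v 0) (hA : 0 ≤ A) {a : Fn (n + 1)}
    (ha : SmoothPer a) (hp : ∀ x : Cyl (n + 1), x.1 0 ≤ 0 → a x = 0) {k : ℕ}
    (h : DerivLE (bΩ n T) k a A) :
    DerivLE (closedDomain n T) k (transport v c ε a) (transBound v c ε T * (transConst v c ^ k * A)) := by
  intro I hI x hx
  have hC := one_le_transConst v c
  have h1 := opW_le (v := v) (c := c) (isAdmissible_wsup (n := n) 0) (τ := T) I ha hA fun J hJ =>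
    wsup_le_of_past hp le_rfl hA (h J (hJ.trans hI))
  rw [wsup_le_iff (by positivity)] at h1
  rw [dw_transport I ha]
  refine abs_transport_le hv (by positivity) (opW_past I fun y hy => hp y hy.le) (fun y hy => ?_) x hx
  refine (h1 y hy).trans ?_
  rw [zero_mul, Real.exp_zero, mul_one]
  exact mul_le_mul_of_nonneg_right (pow_le_pow_right₀ hC hI) hA

lemma derivL2LE_transport {T ρ : ℝ} (hv : 0 < v 0) (hρ : 0 ≤ ρ) {a : Fn (n + 1)}
    (ha : SmoothPer a) (hp : ∀ x : Cyl (n + 1), x.1 0 ≤ 0 → a x = 0) {k : ℕ}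
    (h : DerivL2LE (bΩ n T) k a (ofReal ρ)) :
    DerivL2LE (intDomain n T) k (transport v c ε a) (ofReal (transBound v c ε T) *
      ofReal (T / v 0) ^ (1 / 2 : ℝ) * ofReal (transConst v c ^ k * ρ)) := by
  intro I hI
  have hC := one_le_transConst v c
  have h1 := opW_le (v := v) (c := c) (isAdmissible_wl2 (n := n) 0) (τ := T) I ha hρ fun J hJ =>
    (wl2_le_of_past hp le_rfl J).trans (h J (hJ.trans hI))
  rw [dw_transport I ha]
  refine (eLpNorm_transport_le hv (smoothPer_opW I ha) (opW_past I fun y hy => hp y hy.le)).trans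
    (mul_le_mul_right ?_ _)
  refine (eLpNorm_le_wl2 (lam := 0) le_rfl le_rfl).trans ?_
  rw [zero_mul, Real.exp_zero, ofReal_one, one_mul]
  exact h1.trans (ofReal_le_ofReal (mul_le_mul_of_nonneg_right (pow_le_pow_right₀ hC hI) hρ))

lemma transport_lift_zero (a : Fn (n + 1)) (q : Cyl (n + 1)) :
    transport v c ε a (lift 0 q) = ε * a q := by
  rw [transport, projL_lift]
  simp only [lift, atHeight_last, mul_zero, Real.exp_zero, one_mul, zero_smul, neg_zero]
  congr 2
  exact Prod.ext (by simp) (by simp)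

lemma opT_field (a : Fn (n + 1)) : opT v c (atHeight v 1, 0) a = fun y => -c * a y := by
  funext y
  rw [opT, projL_field]
  simp [dv]

lemma dv_field_transport (ha : SmoothPer a) (x : Cyl (n + 2)) :
    dv (atHeight v 1, 0) (transport v c ε a) x = -(c * transport v c ε a x) := by
  rw [dv_transport ha, opT_field]
  simp only [transport]
  ring

/-- Transported functions solve the transport equation, also in the limit. -/
lemma hasWeakDeriv_transport {a : ℕ → Fn (n + 1)} (ha : ∀ j, SmoothPer (a j))
    {σ : Fn (n + 2)}
    (h : ApproxBy (intDomain n T) (fun j => transport v c ε (a j)) σ) {R : ℝ≥0∞} (hR : R ≠ ⊤)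
    (hb : ∀ j, eLpNorm (transport v c ε (a j)) 2 (vol (intDomain n T)) ≤ R) :
    HasWeakDeriv (intDomain n T) 1 ![(atHeight v 1, 0)] σ (fun p => -(c * σ p)) := by
  have hU := measurableSet_intDomain n T
  rw [hasWeakDeriv_one_iff]
  refine ⟨((h.memLp hU hR hb).const_mul c).neg, fun φ hφ => ?_⟩
  obtain ⟨K, hφK, hKU⟩ := hφ.cptSmooth
  have h1 := h.tendsto_test hU (hφK.dv (atHeight v 1, 0))
  have h2 := (h.tendsto_test hU hφK).const_mul c
  have h3 : ∀ j, ∫ x, transport v c ε (a j) x * dv (atHeight v 1, 0) φ x ∂vol (intDomain n T) =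
      c * ∫ x, transport v c ε (a j) x * φ x ∂vol (intDomain n T) := fun j => by
    rw [integral_cyl_eq_univ hU hKU (fun z hz θ => by rw [(hφK.dv _).support z hz θ, mul_zero]),
      integral_cyl_eq_univ hU hKU (fun z hz θ => by rw [hφK.support z hz θ, mul_zero]),
      integral_mul_dv (h.smooth j) hφK, ← integral_const_mul, ← integral_neg]
    refine integral_congr_ae (.of_forall fun x => ?_)
    simp only [dv_field_transport (ha j)]
    ring
  rw [tendsto_nhds_unique (h1.congr h3) h2, ← integral_const_mul, ← integral_neg]
  refine integral_congr_ae (.of_forall fun x => ?_)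
  simp only
  ring

end Transport

/-! ### Passage to the limit in difference equations -/

section DifferenceLimit
variable {k : ℕ} {U : Set (Pt k)} {u : ℕ → Fn k} {v : Fn k}
variable {φ : Fn k} {K K' : Set (Pt k)} {d : Cyl k} {s : ℕ → ℝ}

/-- Difference quotients converge to derivatives in the sense of distributions. -/
lemma ApproxBy.tendsto_quot (h : ApproxBy U u v) (hU : MeasurableSet U)
    (hφ : CptSmooth φ K)
    (hs : Tendsto s atTop (𝓝[≠] 0)) (hK' : IsCompact K') (hKK : K ⊆ K')
    (hKU : K' ⊆ U) (h0 : ∀ j, ∀ z ∉ K', z - s j • d.1 ∉ K) :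
    Tendsto (fun j => ∫ x, ((u j (x + s j • d) - u j x) / s j) * φ x ∂vol U) atTop
      (𝓝 (- ∫ x, v x * dv d φ x ∂vol U)) := by
  obtain ⟨L, hL0, hL⟩ := hφ.lipschitz
  obtain ⟨C, hC⟩ := h.bound
  have hφc := hφ.continuous
  set ψ : ℕ → Fn k := fun j x => (φ (x + s j • (-d)) - φ x) / s j with hψ
  have hshift : ∀ j, CptSmooth (fun x => φ (x + s j • (-d))) K' := fun j =>
    { toSmoothPer := hφ.toSmoothPer.shift (s j • (-d))
      compact := hK'
      support := fun z hz θ => by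
        refine hφ.support _ ?_ _
        have := h0 j z hz
        simpa [sub_eq_add_neg] using this }
  have hφ' : CptSmooth φ K' := ⟨hφ.toSmoothPer, hK', fun z hz => hφ.support z fun h => hz (hKK h)⟩
  have h1 : ∀ j, ∫ x, ((u j (x + s j • d) - u j x) / s j) * φ x ∂vol U =
      ∫ x, u j x * ψ j x ∂vol U := by
    intro j
    have hsm := h.smooth j
    have i1 : Integrable (fun x => u j (x + s j • d) * φ x) (vol univ) :=
      (CptSmooth.mul (hsm.shift (s j • d)) hφ').integrable _
    have i2 : Integrable (fun x => u j x * φ x) (vol univ) := (CptSmooth.mul hsm hφ').integrable _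
    have i3 : Integrable (fun x => u j x * φ (x + s j • (-d))) (vol univ) :=
      (CptSmooth.mul hsm (hshift j)).integrable _
    rw [integral_cyl_eq_univ hU hKU (fun z hz θ => by rw [hφ'.support z hz, mul_zero]),
      integral_cyl_eq_univ hU hKU (fun z hz θ => by
        simp only [hψ]; rw [hφ'.support z hz, (hshift j).support z hz]; simp)]
    have e1 : ∀ x, ((u j (x + s j • d) - u j x) / s j) * φ x =
        (s j)⁻¹ * (u j (x + s j • d) * φ x - u j x * φ x) := fun x => by ring
    have e2 : ∀ x, u j x * ψ j x = (s j)⁻¹ * (u j x * φ (x + s j • (-d)) - u j x * φ x) := fun x => by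
      simp only [hψ]; ring
    simp only [e1, e2, integral_const_mul]
    rw [integral_sub i1 i2, integral_sub i3 i2]
    congr 2
    rw [← integral_cyl_shift i3.1 (CptSmooth.mul hsm (hshift j)).periodic (s j • d)]
    refine integral_congr_ae (.of_forall fun x => ?_)
    simp only
    congr 2
    rw [smul_neg, add_neg_cancel_right]
  simp only [h1]
  rw [← integral_neg]
  simp only [← mul_neg]
  refine tendsto_integral_mul hU hK' (fun j => (h.smooth j).continuous.aestronglyMeasurable)
    (fun j => by simp only [hψ]; fun_prop) hC (C' := L * ‖d‖) (fun j x => ?_) (fun j z hz θ => ?_)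
    h.lim (fun x => ?_)
  · simp only [hψ]
    rw [abs_div]
    rcases eq_or_ne (s j) 0 with h2 | h2
    · rw [h2]; simp; positivity
    rw [div_le_iff₀ (abs_pos.2 h2)]
    refine (hL _ _).trans (le_of_eq ?_)
    rw [add_sub_cancel_left, norm_smul, norm_neg, Real.norm_eq_abs]
    ring
  · simp only [hψ]; rw [hφ'.support z hz, (hshift j).support z hz]; simp
  · have hs' : Tendsto (fun j => - s j) atTop (𝓝[≠] 0) := by
      rw [tendsto_nhdsWithin_iff] at hs ⊢
      refine ⟨by simpa using hs.1.neg, hs.2.mono fun j hj => by simpa using hj⟩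
    refine (tendsto_slope_dv hφ.toSmoothPer d x hs').neg.congr fun j => ?_
    simp only [hψ]
    rw [smul_neg, neg_smul, div_neg, neg_neg]

/-- Translating the test function by `o(1)` does not change the limit of integrals of bounded
functions. -/
lemma tendsto_integral_translate (hU : MeasurableSet U) {H : ℕ → Fn k} {C : ℝ}
    (hm : ∀ j, Continuous (H j)) (hH : ∀ j, ∀ x : Cyl k, x.1 ∈ U → |H j x| ≤ C)
    (hφ : CptSmooth φ K) (hs : Tendsto s atTop (𝓝 0))
    (hK' : IsCompact K') (hKK : K ⊆ K') (h0 : ∀ j, ∀ z ∉ K', z + s j • d.1 ∉ K) :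
    Tendsto (fun j => ∫ x, H j x * (φ (x + s j • d) - φ x) ∂vol U) atTop (𝓝 0) := by
  obtain ⟨L, hL0, hL⟩ := hφ.lipschitz
  have hφc := hφ.continuous
  have hb : ∀ j x, |φ (x + s j • d) - φ x| ≤ L * (|s j| * ‖d‖) := fun j x => by
    refine (hL _ _).trans (le_of_eq ?_)
    rw [add_sub_cancel_left, norm_smul, Real.norm_eq_abs]
  obtain ⟨B, hB⟩ := hs.abs.bddAbove_range
  have hB' : ∀ j, |s j| ≤ B := fun j => hB ⟨j, rfl⟩
  have hlim : ∀ x : Cyl k, x.1 ∈ U → Tendsto (fun j => H j x * (φ (x + s j • d) - φ x)) atTop (𝓝 0) := by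
    intro x hx
    refine squeeze_zero_norm (a := fun j => C * (L * (|s j| * ‖d‖))) (fun j => ?_) ?_
    · rw [Real.norm_eq_abs, abs_mul]
      exact mul_le_mul (hH j x hx) (hb j x) (abs_nonneg _) ((abs_nonneg _).trans (hH j x hx))
    · have := (((hs.abs.mul_const ‖d‖).const_mul L).const_mul C)
      simpa using this
  have := tendsto_integral_cyl (U := U) hK' (F := fun j x => H j x * (φ (x + s j • d) - φ x))
    (G := fun _ => 0) (C := C * (L * (B * ‖d‖)))
    (fun j => by have := hm j; exact Continuous.aestronglyMeasurable (by fun_prop))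
    (fun j => ae_cylMeasure_of_forall hU fun x hx => by
      rw [abs_mul]
      refine mul_le_mul (hH j x hx) ((hb j x).trans ?_) (abs_nonneg _) ((abs_nonneg _).trans (hH j x hx))
      exact mul_le_mul_of_nonneg_left (mul_le_mul_of_nonneg_right (hB' j) (norm_nonneg _)) hL0)
    (fun j z hz θ => by
      have e1 : φ ((z, θ) + s j • d) = 0 := hφ.support _ (h0 j z hz) _
      rw [e1, hφ.support z (fun h => hz (hKK h)), sub_zero, mul_zero])
    (ae_cylMeasure_of_forall hU hlim)
  simpa using this

end DifferenceLimit

/-! ### Consistency of the scheme -/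

section SchemeLimit
variable {n k : ℕ}
variable {f : Fn k} {S Γ : ℝ} {φ : Fn (n + 1)}

lemma abs_taylor_theta_le (hf : SmoothPer f) (hS : 0 ≤ S) {z : Pt k}
    (h : ∀ θ, |dv (dir none) (dv (dir none) f) (z, θ)| ≤ S) (θ t : ℝ) :
    |f (z, θ + t) - f (z, θ) - t * dv (dir none) f (z, θ)| ≤ S * t ^ 2 := by
  set g : ℝ → ℝ := fun r => f (z, θ + r) - f (z, θ) - r * dv (dir none) f (z, θ) with hg
  have hd : ∀ r, HasDerivAt g (dv (dir none) f (z, θ + r) - dv (dir none) f (z, θ)) r := fun r => by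
    have h1 := (hasDerivAt_theta_dv hf z (θ + r)).comp_const_add θ r
    have h2 := (h1.sub_const (f (z, θ))).sub ((hasDerivAt_id r).mul_const (dv (dir none) f (z, θ)))
    rw [one_mul] at h2
    exact h2
  have hb : ∀ r ∈ Metric.closedBall (0 : ℝ) |t|,
      ‖dv (dir none) f (z, θ + r) - dv (dir none) f (z, θ)‖ ≤ S * |t| := fun r hr => by
    refine (abs_sub_le_of_dv_theta (hf.dv _) h θ (θ + r)).trans ?_
    rw [add_sub_cancel_left]
    exact mul_le_mul_of_nonneg_left (by simpa using hr) hS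
  have h3 := (convex_closedBall (0 : ℝ) |t|).norm_image_sub_le_of_norm_hasDerivWithin_le
    (fun r _ => (hd r).hasDerivWithinAt) hb (Metric.mem_closedBall_self (abs_nonneg _))
    (by simp : t ∈ Metric.closedBall (0 : ℝ) |t|)
  have h4 : g 0 = 0 := by simp [hg]
  rw [h4, sub_zero, sub_zero, Real.norm_eq_abs, Real.norm_eq_abs] at h3
  refine h3.trans (le_of_eq ?_)
  rw [mul_assoc, ← sq, sq_abs]

/-- The data of a convergent family of discrete solutions. -/
structure SchemeLimit (T : ℝ) (D : ℕ → SchemeData n) (k4 k5 k6 CE : ℝ) (X : Pt (n + 1))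
    (u B : ℕ → Fn (n + 1)) (inc : ℕ → ℝ) (v b : Fn (n + 1)) : Prop where
  coeff : ∀ j, (D j).HasCoeff CE k4 k5 k6
  X_eq : ∀ j, (D j).X = X
  h_le : ∀ j, (D j).h ≤ 1
  h_lim : Tendsto (fun j => (D j).h) atTop (𝓝 0)
  eq : ∀ j, ∀ x : Cyl (n + 1), x.1 0 < T → (D j).step (u j) x = u j x
  sup : ∃ S, ∀ j, DerivLE (bΩ n T) 2 (u j) S
  lim : ApproxBy (bΩ n T) u v
  E_eq : ∀ j x, (D j).E (u j) (u j) x = (inc j)⁻¹ * (B j (x + (0, inc j)) - B j x)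
  inc_lim : Tendsto inc atTop (𝓝[≠] 0)
  lim_B : ApproxBy (bΩ n T) B b
  sup_B : ∃ S, ∀ j, ∀ x : Cyl (n + 1), x.1 0 < T → |dv (dir none) (B j) x| ≤ S
  sup_G : ∃ S, ∀ j, ∀ x : Cyl (n + 1), x.1 0 < T → |(D j).G x| ≤ S

namespace SchemeLimit
variable {T k4 k5 k6 CE : ℝ} {D : ℕ → SchemeData n} {X : Pt (n + 1)}
  {u B : ℕ → Fn (n + 1)} {inc : ℕ → ℝ} {v b : Fn (n + 1)}

/-- The residual `(u - step u) / h`, before the translation along `X`. -/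
def resid (D : SchemeData n) (u : Fn (n + 1)) : Fn (n + 1) :=
  fun y => ((u (y + (0, D.h)) + u (y + (0, -D.h))) / 2 - u y) / D.h +
    (D.G y + (-D.k4 * u y + (-D.k6 * (u y * cdiff D.h u y) + -D.k5 * D.E u u y)))

lemma abs_second_le (hf : SmoothPer f) {h : ℝ} (hh : 0 < h) (hS : 0 ≤ S) {x : Cyl k}
    (H : ∀ θ, |dv (dir none) (dv (dir none) f) (x.1, θ)| ≤ S) :
    |((f (x + (0, h)) + f (x + (0, -h))) / 2 - f x) / h| ≤ S * h ∧
      |cdiff h f x - dv (dir none) f x| ≤ S * h := by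
  obtain ⟨z, θ⟩ := x
  have h1 := abs_le.1 (abs_taylor_theta_le hf hS H θ h)
  have h2 := abs_le.1 (abs_taylor_theta_le hf hS H θ (-h))
  have e1 : ((z, θ) : Cyl k) + (0, h) = (z, θ + h) := by simp
  have e2 : ((z, θ) : Cyl k) + (0, -h) = (z, θ + -h) := by simp
  rw [cdiff, e1, e2]
  set d := dv (dir none) f (z, θ)
  constructor
  · rw [abs_div, abs_of_pos hh, div_le_iff₀ hh, abs_le]
    constructor <;> nlinarith [h1.1, h1.2, h2.1, h2.2]
  · have e3 : (2 * h)⁻¹ * (f (z, θ + h) - f (z, θ + -h)) - d =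
        (f (z, θ + h) - f (z, θ + -h) - 2 * h * d) / (2 * h) := by field_simp
    rw [e3, abs_div, abs_of_pos (by positivity : 0 < 2 * h), div_le_iff₀ (by positivity), abs_le]
    constructor <;> nlinarith [h1.1, h1.2, h2.1, h2.2]

lemma smoothPer_resid {D : SchemeData n} (hD : D.Good CE) {u : Fn (n + 1)} (hu : SmoothPer u) :
    SmoothPer (resid D u) := by
  convert ((SchemeData.smooth_body hD hu).sub hu).const_mul D.h⁻¹ using 2 with y
  have hh := hD.h_pos.ne'
  rw [resid, SchemeData.body, SchemeData.nonlin]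
  field_simp
  ring

lemma quot_eq (h : SchemeLimit T D k4 k5 k6 CE X u B inc v b) (j : ℕ) (x : Cyl (n + 1)) (hx : x.1 0 < T) :
    (u j (x + (D j).h • (-X, 0)) - u j x) / (D j).h = - resid (D j) (u j) (x + (D j).h • (-X, 0)) := by
  have hh := (h.coeff j).h_pos
  have e := h.eq j x hx
  rw [SchemeData.step, shift, h.X_eq j] at e
  have e2 : x + (D j).h • ((-X, 0) : Cyl (n + 1)) = x + (-((D j).h • X), 0) := by
    simp [Prod.smul_mk]
  rw [← e2] at e
  rw [← e, SchemeData.body, resid, SchemeData.nonlin]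
  set y := x + (D j).h • ((-X, 0) : Cyl (n + 1))
  field_simp
  ring

lemma sup_E (h : SchemeLimit T D k4 k5 k6 CE X u B inc v b) :
    ∃ S, ∀ j, ∀ x : Cyl (n + 1), x.1 0 < T → |(D j).E (u j) (u j) x| ≤ S := by
  obtain ⟨S', hS'⟩ := h.sup_B
  refine ⟨S', fun j x hx => ?_⟩
  rw [h.E_eq j x, abs_mul, abs_inv]
  have h7 := abs_sub_le_of_dv_theta (h.lim_B.smooth j) (z := x.1) (fun θ => hS' j (x.1, θ) hx) x.2
    (x.2 + inc j)
  have e : x + (0, inc j) = (x.1, x.2 + inc j) := Prod.ext (by simp) rfl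
  rw [e]
  rw [add_sub_cancel_left] at h7
  rcases eq_or_ne (inc j) 0 with h8 | h8
  · rw [h8]; simpa using (abs_nonneg _).trans (hS' j x hx)
  · rw [inv_mul_le_iff₀ (abs_pos.2 h8), mul_comm]
    exact h7

lemma resid_bound (h : SchemeLimit T D k4 k5 k6 CE X u B inc v b) :
    ∃ C, ∀ j, ∀ x : Cyl (n + 1), x.1 0 < T → |resid (D j) (u j) x| ≤ C := by
  obtain ⟨S, hS⟩ := h.sup
  obtain ⟨S', hS'⟩ := h.sup_E
  obtain ⟨S'', hS''⟩ := h.sup_G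
  refine ⟨S * 1 + (S'' + (|k4| * S + (|k6| * (S * (S + S * 1)) + |k5| * S'))), fun j x hx => ?_⟩
  have hh := (h.coeff j).h_pos
  have hS0 : 0 ≤ S := (abs_nonneg _).trans (hS j [] (by simp) x hx)
  have h0 : |u j x| ≤ S := hS j [] (by simp) x hx
  have h1 : |dv (dir none) (u j) x| ≤ S := hS j [none] (by simp) x hx
  obtain ⟨h2, h3⟩ := abs_second_le (h.lim.smooth j) hh hS0 (x := x)
    (fun θ => hS j [none, none] (by simp) (x.1, θ) hx)
  have h4 : S * (D j).h ≤ S * 1 := mul_le_mul_of_nonneg_left (h.h_le j) hS0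
  have h5 : |cdiff (D j).h (u j) x| ≤ S + S * 1 := by
    have := abs_add_le (dv (dir none) (u j) x) (cdiff (D j).h (u j) x - dv (dir none) (u j) x)
    rw [add_sub_cancel] at this
    linarith
  rw [resid, (h.coeff j).k4_eq, (h.coeff j).k5_eq, (h.coeff j).k6_eq]
  refine (abs_add_le _ _).trans (add_le_add (h2.trans h4) ?_)
  refine (abs_add_le _ _).trans (add_le_add (hS'' j x hx) ?_)
  refine (abs_add_le _ _).trans (add_le_add ?_ ((abs_add_le _ _).trans (add_le_add ?_ ?_)))
  · rw [abs_mul, abs_neg]; exact mul_le_mul_of_nonneg_left h0 (abs_nonneg _)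
  · rw [abs_mul, abs_neg, abs_mul]
    exact mul_le_mul_of_nonneg_left (mul_le_mul h0 h5 (abs_nonneg _) hS0) (abs_nonneg _)
  · rw [abs_mul, abs_neg]; exact mul_le_mul_of_nonneg_left (hS' j x hx) (abs_nonneg _)

/-- Weak limit of the residual. -/
lemma tendsto_resid (h : SchemeLimit T D k4 k5 k6 CE X u B inc v b)
    {K : Set (Pt (n + 1))} (hφ : CptSmooth φ K) (hK : K ⊆ bΩ n T)
    (hG : Tendsto (fun j => ∫ x, (D j).G x * φ x ∂vol (bΩ n T)) atTop (𝓝 Γ)) :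
    Tendsto (fun j => ∫ x, resid (D j) (u j) x * φ x ∂vol (bΩ n T)) atTop
      (𝓝 (Γ - k4 * ∫ x, v x * φ x ∂vol (bΩ n T) +
        k6 / 2 * ∫ x, v x ^ 2 * dv (dir none) φ x ∂vol (bΩ n T) +
        k5 * ∫ x, b x * dv (dir none) φ x ∂vol (bΩ n T))) := by
  have hU := measurableSet_bdryDomain (n := n) T
  obtain ⟨S, hS⟩ := h.sup
  obtain ⟨C', -, hC'⟩ := hφ.bound
  have hh := fun j => (h.coeff j).h_pos
  have hsm := h.lim.smooth
  have hS0 : ∀ j, ∀ x : Cyl (n + 1), x.1 0 < T → 0 ≤ S := fun j x hx =>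
    (abs_nonneg _).trans (hS j [] (by simp) x hx)
  have htay : ∀ j, ∀ x : Cyl (n + 1), x.1 0 < T → _ := fun j x hx =>
    abs_second_le (hsm j) (hh j) (hS0 j x hx) (x := x)
      (fun θ => hS j [none, none] (by simp) (x.1, θ) hx)
  have hSh : Tendsto (fun j => S * (D j).h) atTop (𝓝 0) := by simpa using h.h_lim.const_mul S
  have hSb : ∀ j, ∀ x : Cyl (n + 1), x.1 0 < T → S * (D j).h ≤ S := fun j x hx =>
    mul_le_of_le_one_right (hS0 j x hx) (h.h_le j)
  have hc := fun j => (hsm j).continuous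
  have hcd := fun j => ((hsm j).cdiff (D j).h).continuous
  have hdv := fun j => ((hsm j).dv (dir none)).continuous
  -- the second difference tends to zero
  have t1 : Tendsto (fun j => ∫ x, (((u j (x + (0, (D j).h)) + u j (x + (0, -(D j).h))) / 2 - u j x) /
      (D j).h) * φ x ∂vol (bΩ n T)) atTop (𝓝 0) := by
    have := tendsto_integral_mul hU hφ.compact (G := fun _ => 0) (C := S)
      (F := fun j x => ((u j (x + (0, (D j).h)) + u j (x + (0, -(D j).h))) / 2 - u j x) / (D j).h)
      (ψ := fun _ => φ) (χ := φ)
      (fun j => by have := hc j; exact Continuous.aestronglyMeasurable (by fun_prop))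
      (fun _ => hφ.continuous) (fun j x hx => (htay j x hx).1.trans (hSb j x hx)) (fun _ => hC')
      (fun _ => hφ.support)
      (fun x hx => squeeze_zero_norm (fun j => (htay j x hx).1) hSh) (fun x => tendsto_const_nhds)
    simpa using this
  have t3 := (h.lim.tendsto_test hU hφ).const_mul (-k4)
  -- the central difference tends to the derivative, in conservative form
  have t4a : Tendsto (fun j => ∫ x, (u j x * (cdiff (D j).h (u j) x - dv (dir none) (u j) x)) * φ x
      ∂vol (bΩ n T)) atTop (𝓝 0) := by
    have := tendsto_integral_mul hU hφ.compact (G := fun _ => 0) (C := S * S)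
      (F := fun j x => u j x * (cdiff (D j).h (u j) x - dv (dir none) (u j) x))
      (ψ := fun _ => φ) (χ := φ)
      (fun j => ((hc j).mul ((hcd j).sub (hdv j))).aestronglyMeasurable)
      (fun _ => hφ.continuous) (fun j x hx => by
        rw [abs_mul]
        exact mul_le_mul (hS j [] (by simp) x hx) ((htay j x hx).2.trans (hSb j x hx)) (abs_nonneg _)
          (hS0 j x hx)) (fun _ => hC')
      (fun _ => hφ.support)
      (fun x hx => squeeze_zero_norm (a := fun j => S * (S * (D j).h)) (fun j => by
        rw [Real.norm_eq_abs, abs_mul]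
        exact mul_le_mul (hS j [] (by simp) x hx) (htay j x hx).2 (abs_nonneg _) (hS0 j x hx))
        (by simpa using hSh.const_mul S)) (fun x => tendsto_const_nhds)
    simpa using this
  have t4b : Tendsto (fun j => ∫ x, (u j x * dv (dir none) (u j) x) * φ x ∂vol (bΩ n T)) atTop
      (𝓝 (-(1 / 2) * ∫ x, v x ^ 2 * dv (dir none) φ x ∂vol (bΩ n T))) := by
    obtain ⟨C2, -, hC2⟩ := (hφ.dv (dir none)).bound
    have := (tendsto_integral_mul hU hφ.compact (F := fun j x => u j x ^ 2) (G := fun x => v x ^ 2)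
      (C := S ^ 2) (ψ := fun _ => dv (dir none) φ) (χ := dv (dir none) φ)
      (fun j => ((hc j).pow 2).aestronglyMeasurable) (fun _ => (hφ.dv _).continuous)
      (fun j x hx => by
        rw [abs_pow]
        exact pow_le_pow_left₀ (abs_nonneg _) (hS j [] (by simp) x hx) 2) (fun _ => hC2)
      (fun _ => (hφ.dv _).support) (fun x hx => (h.lim.lim x hx).pow 2)
      (fun x => tendsto_const_nhds)).const_mul (-(1 / 2))
    refine this.congr fun j => ?_
    have hsq : SmoothPer fun x => u j x * u j x := (hsm j).mul (hsm j)
    have e := integral_mul_dv hsq hφ (dir none)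
    rw [dv_mul (hsm j) (hsm j)] at e
    rw [integral_cyl_eq_univ hU hK (fun z hz θ => by rw [(hφ.dv _).support z hz, mul_zero]),
      integral_cyl_eq_univ hU hK (fun z hz θ => by rw [hφ.support z hz, mul_zero])]
    simp only [sq]
    rw [e, ← integral_neg, ← integral_const_mul]
    refine integral_congr_ae (.of_forall fun x => ?_)
    simp only
    ring
  have t5 := (h.lim_B.tendsto_quot hU hφ (d := (0, 1)) h.inc_lim hφ.compact subset_rfl hK
    (fun j z hz => by simpa using hz)).const_mul (-k5)
  have t4 := (t4a.add t4b).const_mul (-k6)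
  have key := t1.add (hG.add (t3.add (t4.add t5)))
  have e0 : ∀ p q r : ℝ, Γ - k4 * p + k6 / 2 * q + k5 * r =
      0 + (Γ + (-k4 * p + (-k6 * (0 + -(1 / 2) * q) + -k5 * -r))) := fun p q r => by ring
  rw [e0]
  refine key.congr fun j => ?_
  have hE : ∀ x, (D j).E (u j) (u j) x = (B j (x + inc j • (0, 1)) - B j x) / inc j := fun x => by
    rw [h.E_eq j x, Prod.smul_mk, smul_zero, smul_eq_mul, mul_one]; ring
  have hBc := (h.lim_B.smooth j).continuous
  have hci := hc j
  have hcdi := hcd j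
  have hdvi := hdv j
  have hGi := (h.coeff j).smooth.continuous
  have hI : ∀ {F : Fn (n + 1)}, Continuous F → (∃ C, ∀ x : Cyl (n + 1), x.1 0 < T → |F x| ≤ C) →
      Integrable (fun x => F x * φ x) (vol (bΩ n T)) := by
    rintro F hF ⟨C, hC⟩
    refine integrable_cyl_of_bound hφ.compact (C := C * C')
      (hF.mul hφ.continuous).aestronglyMeasurable (ae_cylMeasure_of_forall hU fun x hx => ?_)
      (fun z hz θ => by rw [hφ.support z hz, mul_zero])
    rw [abs_mul]
    exact mul_le_mul (hC x hx) (hC' x) (abs_nonneg _) ((abs_nonneg _).trans (hC x hx))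
  have i1 := hI (F := fun x => ((u j (x + (0, (D j).h)) + u j (x + (0, -(D j).h))) / 2 - u j x) / (D j).h)
    (by fun_prop) ⟨S, fun x hx => (htay j x hx).1.trans (hSb j x hx)⟩
  obtain ⟨S'', hS''⟩ := h.sup_G
  have i2 := hI hGi ⟨S'', hS'' j⟩
  have i3 := hI hci ⟨S, fun x hx => hS j [] (by simp) x hx⟩
  have i4a := hI (F := fun x => u j x * (cdiff (D j).h (u j) x - dv (dir none) (u j) x)) (by fun_prop)
    ⟨S * S, fun x hx => by
      rw [abs_mul]
      exact mul_le_mul (hS j [] (by simp) x hx) ((htay j x hx).2.trans (hSb j x hx)) (abs_nonneg _)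
          (hS0 j x hx)⟩
  have i4b := hI (F := fun x => u j x * dv (dir none) (u j) x) (by fun_prop) ⟨S * S, fun x hx => by
      rw [abs_mul]
      exact mul_le_mul (hS j [] (by simp) x hx) (hS j [none] (by simp) x hx) (abs_nonneg _)
          (hS0 j x hx)⟩
  obtain ⟨C, hC⟩ := h.resid_bound
  have i0 := hI (smoothPer_resid (h.coeff j).toGood (hsm j)).continuous ⟨C, hC j⟩
  have i5 : Integrable (fun x => (B j (x + inc j • (0, 1)) - B j x) / inc j * φ x)
      (vol (bΩ n T)) := by
    obtain ⟨S', hS'⟩ := h.sup_E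
    exact hI (by fun_prop) ⟨S', fun x hx => by rw [← hE]; exact hS' j x hx⟩
  have i4 := (i4a.fun_add i4b).const_mul (-k6)
  have i45 := i4.fun_add (i5.const_mul (-k5))
  have i345 := (i3.const_mul (-k4)).fun_add i45
  rw [← integral_const_mul, ← integral_add i4a i4b, ← integral_const_mul, ← integral_const_mul,
    ← integral_add i4 (i5.const_mul (-k5)), ← integral_add (i3.const_mul (-k4)) i45,
    ← integral_add i2 i345, ← integral_add i1 (i2.fun_add i345)]
  refine integral_congr_ae (.of_forall fun x => ?_)
  simp only [resid, hE, (h.coeff j).k4_eq, (h.coeff j).k5_eq, (h.coeff j).k6_eq]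
  ring

/-- The limit equation in weak form. -/
lemma weak_eq (h : SchemeLimit T D k4 k5 k6 CE X u B inc v b) (hφ : IsTest (bΩ n T) φ)
    (hG : Tendsto (fun j => ∫ x, (D j).G x * φ x ∂vol (bΩ n T)) atTop (𝓝 Γ)) :
    ∫ x, v x * dv (X, 0) φ x ∂vol (bΩ n T) = -(Γ - k4 * ∫ x, v x * φ x ∂vol (bΩ n T) +
        k6 / 2 * ∫ x, v x ^ 2 * dv (dir none) φ x ∂vol (bΩ n T) +
        k5 * ∫ x, b x * dv (dir none) φ x ∂vol (bΩ n T)) := by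
  have hU := measurableSet_bdryDomain (n := n) T
  obtain ⟨K, hφ, hK⟩ := hφ.cptSmooth
  have hX : X 0 = 1 := by rw [← h.X_eq 0]; exact (h.coeff 0).X_zero
  have hh := fun j => (h.coeff j).h_pos
  set K' : Set (Pt (n + 1)) := (fun p : (Pt (n + 1)) × ℝ => p.1 - p.2 • X) '' (K ×ˢ Icc 0 1)
    with hK'
  have cK' : IsCompact K' := (hφ.compact.prod isCompact_Icc).image (by fun_prop)
  have hKK : K ⊆ K' := fun z hz => ⟨(z, 0), ⟨hz, by simp⟩, by simp⟩
  have hKU : K' ⊆ bΩ n T := by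
    rintro _ ⟨⟨z, s⟩, ⟨hz, hs⟩, rfl⟩
    have h1 : z 0 < T := hK hz
    show z 0 - s * X 0 < T
    rw [hX]; linarith [hs.1]
  have h0 : ∀ j, ∀ z ∉ K', z + (D j).h • X ∉ K := fun j z hz hz' =>
    hz ⟨(z + (D j).h • X, (D j).h), ⟨hz', (hh j).le, h.h_le j⟩, by simp⟩
  have hs : Tendsto (fun j => (D j).h) atTop (𝓝[≠] 0) :=
    tendsto_nhdsWithin_iff.2 ⟨h.h_lim, Eventually.of_forall fun j => (hh j).ne'⟩
  have t1 := h.lim.tendsto_quot hU hφ (d := (-X, 0)) hs cK' hKK hKU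
    (fun j z hz => by simpa using h0 j z hz)
  obtain ⟨C, hC⟩ := h.resid_bound
  have hr := fun j => smoothPer_resid (h.coeff j).toGood (h.lim.smooth j)
  have t2 := tendsto_integral_translate hU (fun j => (hr j).continuous) hC hφ (d := (X, 0)) h.h_lim
    cK' hKK h0
  have t3 := ((h.tendsto_resid hφ hK hG).add t2).neg
  have e : dv (-X, 0) φ = fun x => -dv ((X, 0) : Cyl (n + 1)) φ x := by
    funext x
    have : ((-X, 0) : Cyl (n + 1)) = -(X, 0) := by simp
    simp only [dv, this, map_neg]
  rw [add_zero] at t3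
  have := tendsto_nhds_unique (t1.congr fun j => ?_) t3
  · rw [e] at this
    simpa [integral_neg] using this
  have i1 : Integrable (fun x => resid (D j) (u j) x * φ x) (vol (bΩ n T)) :=
    (CptSmooth.mul (hr j) hφ).integrable _
  have hφs := hφ.toSmoothPer.shift ((D j).h • X, 0)
  have hφs' : CptSmooth (shift ((D j).h • X, 0) φ) K' :=
    ⟨hφs, cK', fun z hz θ => hφ.support _ (h0 j z hz) _⟩
  have i2 : Integrable (fun x => resid (D j) (u j) x * shift ((D j).h • X, 0) φ x)
      (vol (bΩ n T)) := (CptSmooth.mul (hr j) hφs').integrable _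
  have e2 : ∀ x, shift ((D j).h • X, 0) φ x = φ (x + (D j).h • (X, 0)) := fun x => by
    simp [KeyProfile.shift, Prod.smul_mk]
  have e3 : ∫ x, resid (D j) (u j) x * φ x ∂vol (bΩ n T) +
      ∫ x, resid (D j) (u j) x * (φ (x + (D j).h • (X, 0)) - φ x) ∂vol (bΩ n T) =
      ∫ x, resid (D j) (u j) x * shift ((D j).h • X, 0) φ x ∂vol (bΩ n T) := by
    simp_rw [← e2, mul_sub]
    rw [integral_sub i2 i1]; ring
  have e4 := integral_cyl_shift (CptSmooth.mul (hr j) hφs').continuous.aestronglyMeasurable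
      (CptSmooth.mul (hr j) hφs').periodic ((D j).h • (-X, 0))
  rw [← integral_cyl_eq_univ hU hK (fun z hz θ => ?_),
    ← integral_cyl_eq_univ hU hKU (fun z hz θ => by rw [hφs'.support z hz, mul_zero])] at e4
  · rw [e3, ← e4, ← integral_neg]
    refine integral_congr_ae (ae_cylMeasure_of_forall hU fun x hx => ?_)
    simp only
    rw [h.quot_eq j x hx, neg_mul]
    congr 3
    simp [Prod.smul_mk, add_assoc]
  · simp only [KeyProfile.shift, Prod.smul_mk, Prod.mk_add_mk]
    rw [smul_neg, neg_add_cancel_right, hφ.support z hz, mul_zero]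

end SchemeLimit
end SchemeLimit

/-! ### Perturbation of a simple eigenvalue -/

section EigenBranch

/-- The coordinates of an eigenvector normalised by `V_m = 1`; the `m`-th unknown is the
eigenvalue. -/
def normVec (m : Fin 3) (x : Fin 3 → ℂ) : Fin 3 → ℂ := fun k => if k = m then 1 else x k

/-- The eigenvalue equation of `i diag w - γ A`. -/
def eigenMap (w : Fin 3 → ℝ) (A : Fin 3 → Fin 3 → ℝ) (m : Fin 3) (p : ℂ × (Fin 3 → ℂ)) : Fin 3 → ℂ :=
  fun k => Complex.I * w k * normVec m p.2 k - p.1 * ∑ j, (A k j : ℂ) * normVec m p.2 j -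
    p.2 m * normVec m p.2 k

lemma contDiff_eigenMap (w : Fin 3 → ℝ) (A : Fin 3 → Fin 3 → ℝ) (m : Fin 3) :
    ContDiff ℂ 1 (eigenMap w A m) := by
  have h : ∀ k, ContDiff ℂ 1 fun p : ℂ × (Fin 3 → ℂ) => normVec m p.2 k := fun k => by
    unfold normVec
    split_ifs <;> fun_prop
  refine contDiff_pi.2 fun k => ?_
  unfold eigenMap
  have := h k
  fun_prop

/-- First order perturbation of the simple eigenvalue `i w_m` of `i diag w`, with the
eigenvector normalised to have `m`-th coordinate `1`. -/
lemma exists_eigen_branch (w : Fin 3 → ℝ) (hw : Function.Injective w) (A : Fin 3 → Fin 3 → ℝ)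
    (m : Fin 3) :
    ∃ (μ : ℂ → ℂ) (V : ℂ → Fin 3 → ℂ), μ 0 = Complex.I * w m ∧ V 0 = Pi.single m 1 ∧
      HasDerivAt μ (-(A m m : ℂ)) 0 ∧
      (∀ k, HasDerivAt (fun γ => V γ k)
        (if k = m then 0 else Complex.I * ((w m - w k)⁻¹ * A k m : ℝ)) 0) ∧
      ∀ᶠ γ in 𝓝 (0 : ℂ), ∀ k, Complex.I * w k * V γ k - γ * ∑ j, (A k j : ℂ) * V γ j =
        μ γ * V γ k := by
  set x0 : Fin 3 → ℂ := Pi.single m (Complex.I * w m) with hx0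
  have hV0 : normVec m x0 = Pi.single m 1 := by
    funext k
    by_cases h : k = m
    · subst h; simp [normVec]
    · simp [normVec, hx0, h]
  have hw' : ∀ k, k ≠ m → Complex.I * w k - Complex.I * w m ≠ 0 := fun k hk h => by
    rw [← mul_sub] at h
    refine hk (hw ?_)
    have := (mul_eq_zero.1 h).resolve_left Complex.I_ne_zero
    exact_mod_cast sub_eq_zero.1 this
  have hF := (contDiff_eigenMap w A m).contDiffAt (x := (0, x0))
  have hF0 : eigenMap w A m (0, x0) = 0 := by
    funext k
    by_cases h : k = m
    · subst h; simp [eigenMap, hx0]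
    · simp [eigenMap, hV0, h]
  set d : Fin 3 → ℂ := fun k => if k = m then -1 else Complex.I * w k - Complex.I * w m with hd
  have hd0 : ∀ k, d k ≠ 0 := fun k => by
    simp only [hd]
    split_ifs with h
    · norm_num
    · exact hw' k h
  -- the partial derivative in the unknown is diagonal
  have hder : (fderiv ℂ (eigenMap w A m) (0, x0) ∘L .inr ℂ ℂ (Fin 3 → ℂ)) =
      ContinuousLinearMap.pi fun k => d k • ContinuousLinearMap.proj k := by
    have h1 := (hF.differentiableAt one_ne_zero).hasFDerivAt.comp x0
      (hasFDerivAt_prodMk_right (𝕜 := ℂ) (0 : ℂ) x0)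
    refine h1.unique (hasFDerivAt_pi.2 fun k => ?_)
    by_cases h : k = m
    · subst h
      have : (fun x => (eigenMap w A k ∘ fun y => ((0 : ℂ), y)) x k) =
          fun x : Fin 3 → ℂ => Complex.I * w k - x k := by
        funext x; simp [eigenMap, normVec]
      rw [this]
      refine ((ContinuousLinearMap.proj (R := ℂ) (φ := fun _ : Fin 3 => ℂ) k).hasFDerivAt.const_sub
        _).congr_fderiv ?_
      ext y
      simp [hd]
    · have : (fun x => (eigenMap w A m ∘ fun y => ((0 : ℂ), y)) x k) =
          fun x : Fin 3 → ℂ => (Complex.I * w k - x m) * x k := by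
        funext x; simp [eigenMap, normVec, h]; ring
      rw [this]
      refine (((ContinuousLinearMap.proj (R := ℂ) (φ := fun _ : Fin 3 => ℂ) m).hasFDerivAt.const_sub
        _).mul (ContinuousLinearMap.proj (R := ℂ) (φ := fun _ : Fin 3 => ℂ) k).hasFDerivAt).congr_fderiv ?_
      ext y
      simp [hd, hx0, h]
  have hinv : (fderiv ℂ (eigenMap w A m) (0, x0) ∘L .inr ℂ ℂ (Fin 3 → ℂ)).IsInvertible := by
    rw [hder]
    refine ⟨ContinuousLinearEquiv.piCongrRight fun k =>
      ContinuousLinearEquiv.unitsEquivAut ℂ (Units.mk0 (d k) (hd0 k)), ?_⟩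
    ext y k
    simp [mul_comm]
  set ψ := hF.implicitFunction one_ne_zero hinv with hψ
  have h0 : ψ 0 = x0 := hF.implicitFunction_apply_self one_ne_zero hinv
  have he : ∀ᶠ γ in 𝓝 (0 : ℂ), eigenMap w A m (γ, ψ γ) = 0 := by
    have := hF.eventually_apply_implicitFunction one_ne_zero hinv
    simpa only [hF0] using this
  have hdψ : DifferentiableAt ℂ ψ 0 :=
    (hF.hasStrictFDerivAt_implicitFunction one_ne_zero hinv).hasFDerivAt.differentiableAt
  have hk : ∀ k, HasDerivAt (fun γ => ψ γ k) (deriv ψ 0 k) 0 := hasDerivAt_pi.1 hdψ.hasDerivAt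
  set v : Fin 3 → ℂ := fun k => if k = m then 0 else deriv ψ 0 k with hv
  have hVd : ∀ k, HasDerivAt (fun γ => normVec m (ψ γ) k) (v k) 0 := fun k => by
    by_cases h : k = m
    · simpa [normVec, hv, h] using hasDerivAt_const (0 : ℂ) (1 : ℂ)
    · simpa [normVec, hv, h] using hk k
  have hVz : normVec m (ψ 0) = Pi.single m 1 := by rw [h0, hV0]
  have hμ0 : ψ 0 m = Complex.I * w m := by rw [h0]; simp [hx0]
  have key : ∀ k, Complex.I * w k * v k - A k m - (deriv ψ 0 m * (Pi.single m 1 : Fin 3 → ℂ) k +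
      Complex.I * w m * v k) = 0 := fun k => by
    have h1 := (((hVd k).const_mul (Complex.I * w k)).sub ((hasDerivAt_id (0 : ℂ)).mul
      (HasDerivAt.fun_sum fun j (_ : j ∈ Finset.univ) => (hVd j).const_mul (A k j : ℂ)))).sub
      ((hk m).mul (hVd k))
    have h2 : HasDerivAt (fun γ => eigenMap w A m (γ, ψ γ) k) 0 0 :=
      (hasDerivAt_const (0 : ℂ) (0 : ℂ)).congr_of_eventuallyEq (he.mono fun γ h => by simp [h])
    have h3 := h1.unique h2
    rw [hμ0, hVz] at h3
    refine Eq.trans ?_ h3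
    simp [Pi.single_apply]
  refine ⟨fun γ => ψ γ m, fun γ => normVec m (ψ γ), hμ0, hVz, ?_, fun k => ?_, he.mono fun γ h k => ?_⟩
  · have := key m
    simp [hv] at this
    convert hk m using 1
    linear_combination this
  · convert hVd k using 1
    split_ifs with h
    · simp [hv, h]
    · have := key k
      simp [h] at this
      have h1 : ((w m : ℂ) - w k) ≠ 0 := fun h1 => hw' k h (by linear_combination -Complex.I * h1)
      push_cast
      field_simp
      have h2 : Complex.I ^ 2 = -1 := Complex.I_sq
      linear_combination (-Complex.I) * this - (v k * (w m - w k)) * h2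
  · have := congrFun h k
    simp only [eigenMap, Pi.zero_apply] at this
    linear_combination this

end EigenBranch

/-! ### The resonant phases -/

section Spectral
variable {n : ℕ} {B : Fin (n + 1) → Matrix (Fin 3) (Fin 3) ℝ} {M : Matrix (Fin 2) (Fin 3) ℝ}
  {lam : Fin 3 → Pt (n + 1) → ℝ} {β : Pt (n + 1)}
  {om : Fin 3 → Pt (n + 1) → ℝ} {r ℓ : Fin 3 → Fin 3 → ℝ} {N : Fin 3 → ℤ}

lemma ne_zero_of_mem_sphereReal (h : toFreq β ∈ sphereReal n) : β ≠ 0 := by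
  rintro rfl
  have := h.1.2
  simp [toFreq, Fin.tail] at this

namespace IsResonantTriple

lemma sum_eq (res : IsResonantTriple B lam β om r ℓ N) (hβ : β ≠ 0) : N 0 = N 1 + N 2 := by
  obtain ⟨j, hj⟩ := Function.ne_iff.1 hβ
  have h := res.resonance (Pi.single j 1) 0
  simp only [phase, Pi.single_apply, mul_ite, mul_one, mul_zero, Finset.sum_ite_eq',
    Finset.mem_univ, if_true, add_zero] at h
  rw [← add_mul] at h
  exact_mod_cast mul_right_cancel₀ hj h

/-- The `ω_m(β)` are distinct and the relation is not trivial, so that no coefficient vanishes. -/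
lemma coeff_ne_zero (res : IsResonantTriple B lam β om r ℓ N) (hβ : β ≠ 0) (i : Fin 3) : N i ≠ 0 := by
  have h1 := res.sum_eq hβ
  have h2 := res.resonance 0 1
  simp only [phase, Pi.zero_apply, mul_zero, Finset.sum_const_zero, zero_add, mul_one] at h2
  have h3 : (N 0 : ℝ) = N 1 + N 2 := by exact_mod_cast h1
  have h01 : om 0 β ≠ om 1 β := fun h => absurd (res.distinct h) (by decide)
  have h02 : om 0 β ≠ om 2 β := fun h => absurd (res.distinct h) (by decide)
  have h12 : om 1 β ≠ om 2 β := fun h => absurd (res.distinct h) (by decide)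
  have a1 : (N 1 : ℝ) * (om 0 β - om 1 β) = N 2 * (om 2 β - om 0 β) := by grind
  have hz : ∀ {x y : ℝ} {k : ℤ}, (k : ℝ) * (x - y) = 0 → x ≠ y → k = 0 := fun h hne => by
    have := (mul_eq_zero.1 h).resolve_right (sub_ne_zero.2 hne)
    exact_mod_cast this
  have all : N 1 = 0 ∧ N 2 = 0 → False := fun ⟨h, h'⟩ => res.ne_zero (by
    funext i; fin_cases i
    · simp [h1, h, h']
    · exact h
    · exact h')
  intro hi
  fin_cases i
  · have h4 : (N 2 : ℝ) = - N 1 := by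
      have : N 0 = 0 := hi
      rw [this] at h3; push_cast at h3; linarith
    have h5 : N 1 = 0 := hz (x := om 2 β) (y := om 1 β) (by rw [h4] at a1; linear_combination a1) h12.symm
    exact all ⟨h5, by have : N 0 = 0 := hi; omega⟩
  · have h4 : N 1 = 0 := hi
    rw [h4, Int.cast_zero, zero_mul] at a1
    exact all ⟨h4, hz a1.symm h02.symm⟩
  · have h4 : N 2 = 0 := hi
    rw [h4, Int.cast_zero, zero_mul] at a1
    exact all ⟨hz a1 h01, h4⟩

end IsResonantTriple

lemma symbolL_eq (ξ : Pt (n + 1)) (w : ℝ) :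
    symbolL B ξ w = ξ 0 • (1 : Matrix (Fin 3) (Fin 3) ℝ) +
      ∑ j, (Fin.snoc (α := fun _ => ℝ) (Fin.tail ξ) w : Pt (n + 1)) j • B j := by
  rw [symbolL, Fin.sum_univ_succ, Fin.sum_univ_castSucc (n := n)]
  simp [tanMat, Fin.tail, add_assoc]

/-- The derivative of a root branch in `τ` is the inverse of the normal group velocity, up to
the sign. -/
lemma fderiv_om_time (hyp : StrictlyHyperbolic B lam) (hβ : β ≠ 0) {o : Pt (n + 1) → ℝ}
    (ho : ContDiffAt ℝ ∞ o β) (hd : ∀ᶠ ξ in 𝓝 β, (symbolL B ξ (o ξ)).det = 0) {v : ℝ}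
    (hv : IsNormalGroupVelocity lam β (o β) v) : v * fderiv ℝ o β (Pi.single 0 1) = -1 := by
  obtain ⟨k, hk, rfl⟩ := hv
  set F : Pt (n + 1) → Pt (n + 1) := fun ξ =>
    Fin.snoc (α := fun _ => ℝ) (Fin.tail ξ) (o ξ) with hF
  have hF0 : F β ≠ 0 := fun h => by
    have h1 := hd.self_of_nhds
    rw [symbolL_eq] at h1
    change (_ + ∑ j, F β j • B j).det = 0 at h1
    rw [h] at h1
    simp at h1
    refine hβ (funext fun j => ?_)
    refine Fin.cases h1 (fun i => ?_) j
    have := congrFun h i.castSucc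
    simpa [hF, Fin.tail] using this
  have hc : ContinuousAt o β := ho.continuousAt
  have hFc : ContinuousAt F β := by fun_prop
  have hlc : ∀ l, ContinuousAt (lam l) (F β) := fun l => (hyp.analytic l _ hF0).continuousAt
  have hne : ∀ l, l ≠ k → β 0 + lam l (F β) ≠ 0 := fun l hl h => by
    have h1 : lam l (F β) = lam k (F β) := by linarith
    obtain ⟨h2, h3⟩ := hyp.ordered _ hF0
    fin_cases l <;> fin_cases k <;> first | exact hl rfl | (simp at h1; linarith)
  have hroot : ∀ᶠ ξ in 𝓝 β, ξ 0 + lam k (F ξ) = 0 := by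
    have h1 : ∀ᶠ ξ in 𝓝 β, ∀ l, l ≠ k → ξ 0 + lam l (F ξ) ≠ 0 := by
      refine eventually_all.2 fun l => ?_
      by_cases hl : l = k
      · simp [hl]
      have h2 : ContinuousAt (fun ξ => ξ 0 + lam l (F ξ)) β :=
        ((continuous_apply (0 : Fin (n + 1))).continuousAt).add ((hlc l).comp hFc)
      exact (h2.eventually_ne (hne l hl)).mono fun ξ h _ => h
    filter_upwards [hd, h1, hFc.eventually_ne hF0] with ξ h2 h3 h4
    rw [symbolL_eq, hyp.det_eq _ h4] at h2
    obtain ⟨l, -, hl⟩ := Finset.prod_eq_zero_iff.1 h2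
    by_contra hne'
    exact h3 l (fun e => hne' (e ▸ hl)) hl
  -- differentiate along the time direction, which does not move the tangential frequencies
  set q : ℝ → Pt (n + 1) := fun s => β + s • Pi.single 0 1 with hq
  have hq' : HasDerivAt q (Pi.single 0 1) 0 := by
    have := ((hasDerivAt_id (0 : ℝ)).smul_const (Pi.single 0 1 : Pt (n + 1))).const_add β
    rwa [one_smul] at this
  have hq0 : q 0 = β := by simp [hq]
  have ho' : HasDerivAt (fun s => o (q s)) (fderiv ℝ o β (Pi.single 0 1)) 0 := by
    have h1 : HasFDerivAt o (fderiv ℝ o β) (q 0) := by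
      rw [hq0]; exact (ho.differentiableAt (by simp)).hasFDerivAt
    exact h1.comp_hasDerivAt 0 hq'
  have hFq : ∀ s, F (q s) = F β + (o (q s) - o β) • Pi.single (Fin.last n) 1 := fun s => by
    funext j
    refine Fin.lastCases ?_ (fun i => ?_) j
    · simp [hF]
    · have : (Fin.castSucc i) ≠ Fin.last n := (Fin.castSucc_lt_last i).ne
      simp [hF, hq, Fin.tail, this]
  have hFd : HasDerivAt (fun s => F (q s))
      (fderiv ℝ o β (Pi.single 0 1) • Pi.single (Fin.last n) 1) 0 := by
    simp_rw [hFq]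
    exact ((ho'.sub_const _).smul_const _).const_add _
  have hl' : HasDerivAt (fun s => lam k (F (q s))) (fderiv ℝ (lam k) (F β)
      (fderiv ℝ o β (Pi.single 0 1) • Pi.single (Fin.last n) 1)) 0 := by
    have h1 : HasFDerivAt (lam k) (fderiv ℝ (lam k) (F β)) (F (q 0)) := by
      rw [hq0]; exact (hyp.analytic k _ hF0).differentiableAt.hasFDerivAt
    exact h1.comp_hasDerivAt 0 hFd
  have h1 : HasDerivAt (fun s => q s 0 + lam k (F (q s))) (1 + fderiv ℝ (lam k) (F β)
      (fderiv ℝ o β (Pi.single 0 1) • Pi.single (Fin.last n) 1)) 0 := by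
    have := (hasDerivAt_pi.1 hq' 0).add hl'
    simp only [Pi.single_eq_same] at this
    exact this
  have h2 : HasDerivAt (fun s => q s 0 + lam k (F (q s))) 0 0 := by
    refine (hasDerivAt_const (0 : ℝ) (0 : ℝ)).congr_of_eventuallyEq ?_
    have : Tendsto q (𝓝 0) (𝓝 β) := by rw [← hq0]; exact hq'.continuousAt
    exact this.eventually hroot
  have h3 := h1.unique h2
  rw [map_smul, smul_eq_mul] at h3
  show fderiv ℝ (lam k) (F β) _ * _ = -1
  linarith

/-! ### The symbol in the eigenbasis at `β` -/

/-- The matrix of `B_d⁻¹` in the basis `r`. -/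
def coordA (B : Fin (n + 1) → Matrix (Fin 3) (Fin 3) ℝ) (r ℓ : Fin 3 → Fin 3 → ℝ) (k j : Fin 3) : ℝ :=
  ℓ k ⬝ᵥ ((B (Fin.last n))⁻¹ *ᵥ r j)

lemma of_mul_transpose_of (h : ∀ m m', ℓ m ⬝ᵥ r m' = if m = m' then 1 else 0) :
    Matrix.of ℓ * (Matrix.of r)ᵀ = 1 := by
  ext i j
  rw [Matrix.mul_apply, Matrix.one_apply, ← h i j]
  rfl

lemma sum_dual_smul (h : ∀ m m', ℓ m ⬝ᵥ r m' = if m = m' then 1 else 0) (v : Fin 3 → ℝ) :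
    ∑ k, (ℓ k ⬝ᵥ v) • r k = v := by
  have h1 : ((Matrix.of r)ᵀ * Matrix.of ℓ) *ᵥ v = v := by
    rw [mul_eq_one_comm.1 (of_mul_transpose_of h), Matrix.one_mulVec]
  rw [← Matrix.mulVec_mulVec] at h1
  conv_rhs => rw [← h1]
  funext i
  simp only [Finset.sum_apply, Pi.smul_apply, smul_eq_mul, Matrix.mulVec, Matrix.transpose_apply,
    Matrix.of_apply, dotProduct]
  exact sum_congr rfl fun k _ => mul_comm _ _

/-- The incoming phases are those with a positive diagonal entry of `B_d⁻¹`. -/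
lemma IsResonantTriple.coordA_self (res : IsResonantTriple B lam β om r ℓ N)
    (hB : (B (Fin.last n)).det ≠ 0) (m : Fin 3) :
    coordA B r ℓ m m = -(fderiv ℝ (om m) β (Pi.single 0 1)) := by
  set A0 := (B (Fin.last n))⁻¹ with hA0
  have hAB : A0 * B (Fin.last n) = 1 := Matrix.nonsing_inv_mul _ (Ne.isUnit hB)
  set q : ℝ → Pt (n + 1) := fun s => β + s • Pi.single 0 1 with hq
  have hq' : HasDerivAt q (Pi.single 0 1) 0 := by
    have := ((hasDerivAt_id (0 : ℝ)).smul_const (Pi.single 0 1 : Pt (n + 1))).const_add β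
    rwa [one_smul] at this
  have hq0 : q 0 = β := by simp [hq]
  set f : ℝ → ℝ := fun s => om m (q s) with hf
  have hf0 : f 0 = om m β := by rw [hf]; simp only [hq0]
  have hf' : HasDerivAt f (fderiv ℝ (om m) β (Pi.single 0 1)) 0 := by
    have h1 : HasFDerivAt (om m) (fderiv ℝ (om m) β) (q 0) := by
      rw [hq0]; exact ((res.smooth m).differentiableAt (by simp)).hasFDerivAt
    exact h1.comp_hasDerivAt 0 hq'
  have hsym : ∀ s j, symbolL B (q s) (f s) *ᵥ r j =
      s • r j + (f s - om j β) • (B (Fin.last n) *ᵥ r j) := fun s j => by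
    have e : symbolL B (q s) (f s) = symbolL B β (om j β) + s • (1 : Matrix (Fin 3) (Fin 3) ℝ) +
        (f s - om j β) • B (Fin.last n) := by
      simp only [symbolL, hq, Pi.add_apply, Pi.smul_apply, smul_eq_mul, add_smul, sub_smul,
        Finset.sum_add_distrib, Fin.sum_univ_succ]
      simp [tanMat]
      abel
    rw [e, Matrix.add_mulVec, Matrix.add_mulVec, res.kernel j, zero_add, Matrix.smul_mulVec,
      Matrix.one_mulVec, Matrix.smul_mulVec]
  set D : ℝ → Matrix (Fin 3) (Fin 3) ℝ := fun s => Matrix.of fun k j =>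
    (if k = j then f s - om j β else 0) + s * coordA B r ℓ k j with hD
  have hDe : ∀ s, D s = Matrix.of ℓ * (A0 * symbolL B (q s) (f s)) * (Matrix.of r)ᵀ := fun s => by
    ext k j
    have h1 : (Matrix.of ℓ * (A0 * symbolL B (q s) (f s)) * (Matrix.of r)ᵀ) k j =
        ℓ k ⬝ᵥ ((A0 * symbolL B (q s) (f s)) *ᵥ r j) := by
      rw [Matrix.mul_assoc, Matrix.mul_apply]; rfl
    rw [h1, ← Matrix.mulVec_mulVec, hsym, Matrix.mulVec_add, Matrix.mulVec_smul, Matrix.mulVec_smul,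
      Matrix.mulVec_mulVec, hAB, Matrix.one_mulVec, dotProduct_add, dotProduct_smul, dotProduct_smul,
      res.dual]
    simp only [hD, Matrix.of_apply, coordA, ← hA0, smul_eq_mul, mul_ite, mul_one, mul_zero]
    ring
  have hdet : ∀ᶠ s in 𝓝 (0 : ℝ), (D s).det = 0 := by
    have : Tendsto q (𝓝 0) (𝓝 β) := by rw [← hq0]; exact hq'.continuousAt
    filter_upwards [this.eventually (res.dispersion m)] with s hs
    rw [hDe, Matrix.det_mul, Matrix.det_mul, Matrix.det_mul, hs]
    ring
  have hent : ∀ k j, HasDerivAt (fun s => D s k j)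
      ((if k = j then fderiv ℝ (om m) β (Pi.single 0 1) else 0) + coordA B r ℓ k j) 0 := fun k j => by
    have h1 : HasDerivAt (fun s : ℝ => s * coordA B r ℓ k j) (coordA B r ℓ k j) 0 := by
      simpa using (hasDerivAt_id (0 : ℝ)).mul_const (coordA B r ℓ k j)
    have h2 : HasDerivAt (fun s => if k = j then f s - om j β else 0)
        (if k = j then fderiv ℝ (om m) β (Pi.single 0 1) else 0) 0 := by
      split_ifs
      · exact hf'.sub_const _
      · exact hasDerivAt_const _ _
    exact h2.add h1
  have hd0 : ∀ k j, D 0 k j = if k = j then om m β - om j β else 0 := fun k j => by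
    simp only [hD, Matrix.of_apply, hf0, zero_mul, add_zero]
  have h0 : HasDerivAt (fun s => (D s).det) 0 0 :=
    (hasDerivAt_const (0 : ℝ) (0 : ℝ)).congr_of_eventuallyEq hdet
  simp only [Matrix.det_fin_three] at h0
  have hp : ∀ a a' b b' c c' : Fin 3, _ := fun a a' b b' c c' =>
    ((hent a a').mul (hent b b')).mul (hent c c')
  have h1 := (((((hp 0 0 1 1 2 2).sub (hp 0 0 1 2 2 1)).sub (hp 0 1 1 0 2 2)).add
    (hp 0 1 1 2 2 0)).add (hp 0 2 1 0 2 1)).sub (hp 0 2 1 1 2 0)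
  have h2 := h1.unique h0
  have h01 : om 0 β - om 1 β ≠ 0 := sub_ne_zero.2 fun h => absurd (res.distinct h) (by decide)
  have h02 : om 0 β - om 2 β ≠ 0 := sub_ne_zero.2 fun h => absurd (res.distinct h) (by decide)
  have h12 : om 1 β - om 2 β ≠ 0 := sub_ne_zero.2 fun h => absurd (res.distinct h) (by decide)
  have hfin : ∀ {a b x y : ℝ}, a ≠ 0 → b ≠ 0 → a * b * (x + y) = 0 → y = -x := fun ha hb h => by
    have := (mul_eq_zero.1 h).resolve_left (mul_ne_zero ha hb)
    linarith
  fin_cases m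
  · refine hfin h01 h02 (?_ : _ * _ * (fderiv ℝ (om 0) β (Pi.single 0 1) + coordA B r ℓ 0 0) = 0)
    simp [hd0, -mul_eq_zero] at h2
    linear_combination h2
  · refine hfin h01 h12 (?_ : _ * _ * (fderiv ℝ (om 1) β (Pi.single 0 1) + coordA B r ℓ 1 1) = 0)
    simp [hd0, -mul_eq_zero] at h2
    linear_combination -h2
  · refine hfin h02 h12 (?_ : _ * _ * (fderiv ℝ (om 2) β (Pi.single 0 1) + coordA B r ℓ 2 2) = 0)
    simp [hd0, -mul_eq_zero] at h2
    linear_combination h2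

/-- The vector with complex coordinates `x` in the basis `r`. -/
def fromCoord (r : Fin 3 → Fin 3 → ℝ) (x : Fin 3 → ℂ) : Fin 3 → ℂ := fun i => ∑ k, x k * (r k i : ℂ)

lemma map_mulVec_ofReal {l m : Type*} [Fintype m] (A : Matrix l m ℝ) (v : m → ℝ) :
    A.map Complex.ofReal *ᵥ (fun i => (v i : ℂ)) = fun i => ((A *ᵥ v) i : ℂ) := by
  funext i
  simp [Matrix.mulVec, dotProduct]

/-- The frequency `c (τ - iγ, η)`, where `β = (τ, η)`. -/
def dampedFreq (β : Pt (n + 1)) (γ c : ℝ) : Freq n :=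
  (c * ((β 0 : ℂ) - γ * Complex.I), c • Fin.tail β)

lemma mulVec_fromCoord {l : Type*} (A : Matrix l (Fin 3) ℂ) (x : Fin 3 → ℂ) :
    A *ᵥ fromCoord r x = ∑ k, x k • (A *ᵥ fun i => (r k i : ℂ)) := by
  have : fromCoord r x = ∑ k, x k • fun i => (r k i : ℂ) := by funext i; simp [fromCoord]
  rw [this, Matrix.mulVec_sum]
  simp_rw [Matrix.mulVec_smul]

/-- In the basis `r_m` the symbol is `i diag(ω_m)` minus `γ` times the matrix of `A₀`. -/
lemma IsResonantTriple.symbolA_mulVec (res : IsResonantTriple B lam β om r ℓ N)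
    (hB : (B (Fin.last n)).det ≠ 0) (γ c : ℝ) (x : Fin 3 → ℂ) :
    symbolA B (dampedFreq β γ c) *ᵥ fromCoord r x = (c : ℂ) • fromCoord r fun k =>
      Complex.I * om k β * x k - γ * ∑ j, (coordA B r ℓ k j : ℂ) * x j := by
  set A0 := (B (Fin.last n))⁻¹ with hA0
  have hAB : A0 * B (Fin.last n) = 1 := Matrix.nonsing_inv_mul _ (Ne.isUnit hB)
  set S : Matrix (Fin 3) (Fin 3) ℝ := ∑ j, β j • tanMat B j with hS
  have hker : ∀ j, (A0 * S) *ᵥ r j = (-om j β) • r j := fun j => by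
    have h1 := res.kernel j
    rw [symbolL, Matrix.add_mulVec, Matrix.smul_mulVec] at h1
    rw [← Matrix.mulVec_mulVec, eq_neg_of_add_eq_zero_left h1, Matrix.mulVec_neg, Matrix.mulVec_smul,
      Matrix.mulVec_mulVec, hAB, Matrix.one_mulVec, neg_smul]
  have hsym : symbolA B (dampedFreq β γ c) = (c : ℂ) • (-Complex.I) •
      ((A0 * S).map Complex.ofReal - (γ * Complex.I) • A0.map Complex.ofReal) := by
    have e : S.map Complex.ofReal = (β 0 : ℂ) • (1 : Matrix (Fin 3) (Fin 3) ℂ) +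
        ∑ j : Fin n, (β j.succ : ℂ) • (B j.castSucc).map Complex.ofReal := by
      rw [hS, Fin.sum_univ_succ]
      ext a b
      simp [tanMat, Matrix.sum_apply, Matrix.one_apply, apply_ite]
    have e2 : (A0 * S).map Complex.ofReal = A0.map Complex.ofReal * S.map Complex.ofReal :=
      Matrix.map_mul (f := Complex.ofRealHom)
    rw [e2, e, symbolA, ← hA0, smul_comm (c : ℂ)]
    congr 1
    rw [← Matrix.mul_one (A0.map Complex.ofReal), Matrix.mul_assoc, ← Matrix.mul_smul, Matrix.mul_assoc,
      Matrix.one_mul, ← Matrix.mul_sub, ← Matrix.mul_smul]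
    congr 1
    simp only [Matrix.one_mul, dampedFreq, Pi.smul_apply, Fin.tail, smul_eq_mul, smul_sub, smul_add,
      Finset.smul_sum, smul_smul, Complex.ofReal_mul, mul_sub, sub_smul]
    abel
  have hr : ∀ j, symbolA B (dampedFreq β γ c) *ᵥ (fun i => (r j i : ℂ)) = (c : ℂ) • fun i =>
      Complex.I * om j β * r j i - γ * ∑ k, (coordA B r ℓ k j : ℂ) * r k i := fun j => by
    have h1 := congrFun (sum_dual_smul res.dual (A0 *ᵥ r j))
    rw [hsym, Matrix.smul_mulVec, Matrix.smul_mulVec, Matrix.sub_mulVec, Matrix.smul_mulVec,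
      map_mulVec_ofReal, map_mulVec_ofReal, hker]
    congr 1
    funext i
    simp only [Pi.smul_apply, Pi.sub_apply, smul_eq_mul]
    rw [← h1 i]
    simp only [Pi.smul_apply, smul_eq_mul, Finset.sum_apply, coordA, ← hA0]
    push_cast
    linear_combination (-γ * ∑ k, ((ℓ k ⬝ᵥ A0 *ᵥ r j : ℝ) : ℂ) * (r k i : ℂ)) * (-Complex.I_mul_I)
  rw [mulVec_fromCoord]
  simp_rw [hr]
  funext i
  simp only [Finset.sum_apply, Pi.smul_apply, smul_eq_mul, fromCoord, sub_mul, mul_sub,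
    sum_sub_distrib, mul_sum, sum_mul]
  congr 1
  · exact sum_congr rfl fun k _ => by ring
  · rw [Finset.sum_comm]
    exact sum_congr rfl fun k _ => sum_congr rfl fun j _ => by ring

/-! ### Stable eigenvectors at damped frequencies -/

lemma mem_stableSubspace {ζ : Freq n} {v : Fin 3 → ℂ} {μ : ℂ} (hμ : μ.re < 0)
    (h : symbolA B ζ *ᵥ v = μ • v) : v ∈ stableSubspace B ζ := by
  refine Submodule.mem_iSup_of_mem μ (Submodule.mem_iSup_of_mem hμ ?_)
  refine Module.End.mem_maxGenEigenspace _ _ _ |>.2 ⟨1, ?_⟩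
  simp [Matrix.toLin'_apply, h]

lemma continuous_fromCoord (r : Fin 3 → Fin 3 → ℝ) : Continuous (fromCoord r) := by
  unfold fromCoord; fun_prop

/-- The normalisation factor of `(τ - iγ, η)` for `|(τ, η)| = 1`. -/
def dampScale (γ : ℝ) : ℝ := (√(1 + γ ^ 2))⁻¹

lemma dampScale_pos (γ : ℝ) : 0 < dampScale γ := inv_pos.2 (Real.sqrt_pos.2 (by positivity))

lemma continuous_dampScale : Continuous dampScale :=
  Continuous.inv₀ (by fun_prop) fun γ => (Real.sqrt_pos.2 (by positivity)).ne'

lemma tendsto_dampedFreq (β : Pt (n + 1)) :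
    Tendsto (fun γ => dampedFreq β γ (dampScale γ)) (𝓝[>] 0) (𝓝 (toFreq β)) := by
  have h1 := continuous_dampScale
  have : Continuous fun γ => dampedFreq β γ (dampScale γ) := by unfold dampedFreq; fun_prop
  have h2 := this.tendsto 0
  have h3 : dampedFreq β 0 (dampScale 0) = toFreq β := by simp [dampedFreq, dampScale, toFreq]
  rw [h3] at h2
  exact h2.mono_left nhdsWithin_le_nhds

lemma dampedFreq_mem (hβ : toFreq β ∈ sphereReal n) {γ : ℝ} (hγ : 0 < γ) :
    dampedFreq β γ (dampScale γ) ∈ sphereHalf n ∧ dampedFreq β γ (dampScale γ) ∈ freqOpen n ∧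
      -(dampedFreq β γ (dampScale γ)).1.im = dampScale γ * γ := by
  have h1 := hβ.1.2
  have h2 : dampScale γ ^ 2 * (1 + γ ^ 2) = 1 := by
    rw [dampScale, inv_pow, Real.sq_sqrt (by positivity), inv_mul_cancel₀ (by positivity)]
  have hc := mul_pos (dampScale_pos γ) hγ
  simp only [toFreq, Complex.ofReal_re, Complex.ofReal_im] at h1
  refine ⟨⟨?_, ?_⟩, ?_, ?_⟩
  · simp [dampedFreq]; exact hc.le
  · simp only [dampedFreq, Complex.mul_re, Complex.mul_im, Complex.sub_re, Complex.sub_im,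
      Complex.ofReal_re, Complex.ofReal_im, Complex.I_re, Complex.I_im, Pi.smul_apply, smul_eq_mul,
      mul_pow, ← mul_sum]
    linear_combination h2 + dampScale γ ^ 2 * h1
  · show (dampedFreq β γ (dampScale γ)).1.im < 0
    simpa [dampedFreq] using hc
  · simp [dampedFreq]

/-- Linear dependence of three vectors as the vanishing of a determinant. -/
lemma mem_span_pair_iff {E : Fin 2 → Fin 3 → ℂ} (hE : LinearIndependent ℂ E) (v : Fin 3 → ℂ) :
    v ∈ Submodule.span ℂ (range E) ↔ (Matrix.of ![v, E 0, E 1]).det = 0 := by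
  rw [Submodule.mem_span_range_iff_exists_fun]
  constructor
  · rintro ⟨c, rfl⟩
    simp only [Fin.sum_univ_two, Matrix.det_fin_three, Matrix.of_apply, Matrix.cons_val,
      Pi.add_apply, Pi.smul_apply, smul_eq_mul]
    ring
  · intro h
    obtain ⟨c, hc, h⟩ := Matrix.exists_vecMul_eq_zero_iff.2 h
    have h' : c 0 • v + c 1 • E 0 + c 2 • E 1 = 0 := by
      funext i
      have := congrFun h i
      simpa [Matrix.vecMul, dotProduct, Fin.sum_univ_three] using this
    have h0 : c 0 ≠ 0 := fun h0 => by
      rw [h0, zero_smul, zero_add] at h'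
      have := Fintype.linearIndependent_iff.1 hE ![c 1, c 2] (by simpa [Fin.sum_univ_two] using h')
      refine hc (funext fun i => ?_)
      fin_cases i
      · exact h0
      · exact this 0
      · exact this 1
    refine ⟨![-(c 0)⁻¹ * c 1, -(c 0)⁻¹ * c 2], ?_⟩
    have h2 : v = (c 0)⁻¹ • (c 0 • v) := by rw [smul_smul, inv_mul_cancel₀ h0, one_smul]
    rw [h2, show c 0 • v = -(c 1 • E 0 + c 2 • E 1) from eq_neg_of_add_eq_zero_left (by rw [← h', add_assoc])]
    simp [Fin.sum_univ_two, smul_smul]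
    abel

/-- Near an incoming phase the stable bundle contains a differentiable family of eigenvectors. -/
lemma IsResonantTriple.exists_stable_branch (res : IsResonantTriple B lam β om r ℓ N)
    (hB : (B (Fin.last n)).det ≠ 0) (hβ : toFreq β ∈ sphereReal n) {m : Fin 3}
    (hm : 0 < coordA B r ℓ m m) :
    ∃ V : ℝ → Fin 3 → ℂ, V 0 = Pi.single m 1 ∧
      (∀ k, HasDerivAt (fun γ => V γ k) (if k = m then 0 else
        Complex.I * ((om m β - om k β)⁻¹ * coordA B r ℓ k m : ℝ)) 0) ∧
      ∀ᶠ γ in 𝓝[>] (0 : ℝ), fromCoord r (V γ) ∈ stableBundle B (dampedFreq β γ (dampScale γ)) := by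
  obtain ⟨μ, V, hμ0, hV0, hμ, hV, he⟩ :=
    exists_eigen_branch (fun m => om m β) res.distinct (coordA B r ℓ) m
  refine ⟨fun γ => V γ, by simpa using hV0, fun k => ?_, ?_⟩
  · have := hV k
    rw [← Complex.ofReal_zero] at this
    exact this.comp_ofReal
  have h1 : HasDerivAt (fun γ : ℝ => μ γ) (-(coordA B r ℓ m m : ℂ)) 0 := by
    rw [← Complex.ofReal_zero] at hμ
    exact hμ.comp_ofReal
  have h2 := (Complex.continuous_re.tendsto (-(coordA B r ℓ m m : ℂ))).comp h1.tendsto_slope_zero_right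
  have h3 : ∀ᶠ γ : ℝ in 𝓝[>] 0, (μ γ).re < 0 := by
    have h4 : (-(coordA B r ℓ m m : ℂ)).re < 0 := by simpa using hm
    filter_upwards [h2.eventually_lt_const h4, self_mem_nhdsWithin] with γ h5 h6
    simp only [Function.comp_apply, zero_add, Complex.ofReal_zero, hμ0] at h5
    rw [Complex.smul_re, smul_eq_mul] at h5
    have h7 := neg_of_mul_neg_right h5 (inv_pos.2 h6).le
    simpa using h7
  have h4 : Tendsto (fun γ : ℝ => (γ : ℂ)) (𝓝[>] 0) (𝓝 0) := by
    have := Complex.continuous_ofReal.tendsto 0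
    rw [Complex.ofReal_zero] at this
    exact this.mono_left nhdsWithin_le_nhds
  filter_upwards [h3, h4.eventually he, self_mem_nhdsWithin] with γ h5 h6 h7
  rw [stableBundle, if_pos (dampedFreq_mem hβ h7).2.1]
  have hc := dampScale_pos γ
  refine mem_stableSubspace (μ := dampScale γ * μ γ) (by
    rw [Complex.re_ofReal_mul]; exact mul_neg_of_pos_of_neg hc h5) ?_
  rw [res.symbolA_mulVec hB, mul_smul]
  congr 1
  rw [funext h6]
  funext i
  simp [fromCoord, mul_sum, mul_assoc]

/-- The derivative of the eigenvector in `γ` is `i R_m A₀ e_m`. -/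
lemma fromCoord_partialInv (e : Fin 3 → ℝ) (m : Fin 3) :
    fromCoord r (fun k => ((ℓ m ⬝ᵥ e : ℝ) : ℂ) * if k = m then 0 else
      Complex.I * ((om m β - om k β)⁻¹ * coordA B r ℓ k m : ℝ)) =
    fun i => Complex.I * ((partialInv (fun m => om m β) r ℓ m
      (((B (Fin.last n))⁻¹ * tanMat B 0) *ᵥ proj r ℓ m e) i : ℝ) : ℂ) := by
  funext i
  have h0 : tanMat B 0 = 1 := rfl
  rw [fromCoord, partialInv, h0, Matrix.mul_one, ← Finset.add_sum_erase _ _ (Finset.mem_univ m)]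
  simp only [if_true, mul_zero, zero_mul, zero_add, Finset.sum_apply]
  rw [Complex.ofReal_sum, mul_sum]
  refine sum_congr rfl fun k hk => ?_
  rw [if_neg (Finset.ne_of_mem_erase hk), proj, proj, Matrix.mulVec_smul, dotProduct_smul]
  simp only [coordA, Pi.smul_apply, smul_eq_mul]
  push_cast
  ring

/-! ### The time component of the Lopatinskii field -/

lemma fromCoord_injective (h : ∀ m m', ℓ m ⬝ᵥ r m' = if m = m' then 1 else 0) {x : Fin 3 → ℂ}
    (hx : fromCoord r x = 0) : x = 0 := by
  funext k
  have h1 : (fun i => (ℓ k i : ℂ)) ⬝ᵥ fromCoord r x = x k := by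
    have : ∀ j, ∑ i, (ℓ k i : ℂ) * r j i = if k = j then 1 else 0 := fun j => by
      have := h k j
      simp only [dotProduct] at this
      have h2 := congrArg Complex.ofReal this
      push_cast at h2
      rw [h2, apply_ite Complex.ofReal, Complex.ofReal_one, Complex.ofReal_zero]
    simp only [dotProduct, fromCoord, mul_sum]
    rw [Finset.sum_comm]
    simp_rw [mul_left_comm, ← mul_sum, this]
    simp
  rw [← h1, hx, dotProduct_zero]; rfl

/-- The factorised Lopatinskii matrix controls a family `W(γ)` in the stable bundle: it cannot have
`M W(γ) = o(γ)` without tending to zero. -/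
lemma eq_zero_of_lop_factor {O : Set (Freq n)} (hO : IsOpen O) {ζ₀ : Freq n} (h0 : ζ₀ ∈ O)
    {σ : Freq n → ℝ} {E : Fin 2 → Freq n → Fin 3 → ℂ} {P : Freq n → Fin 2 → Fin 2 → ℂ}
    (hE : ∀ i, ContDiffOn ℝ ∞ (E i) O) (hP : ContDiffOn ℝ ∞ P O)
    (hdet : (Matrix.of (P ζ₀)).det ≠ 0) {ζ : ℝ → Freq n} (hζ : Tendsto ζ (𝓝[>] 0) (𝓝 ζ₀))
    (him : ∀ γ, 0 < γ → -(ζ γ).1.im = dampScale γ * γ)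
    (hfac : ∀ᶠ γ in 𝓝[>] (0 : ℝ), bdryMat M * Matrix.of (fun r i => E i (ζ γ) r) =
      Matrix.of (P (ζ γ)) * Matrix.diagonal ![((-(ζ γ).1.im : ℝ) : ℂ) + Complex.I * (σ (ζ γ) : ℂ), 1])
    {W : ℝ → Fin 3 → ℂ} {e : Fin 3 → ℂ} (hW : Tendsto W (𝓝[>] 0) (𝓝 e))
    (hspan : ∀ᶠ γ in 𝓝[>] (0 : ℝ), W γ ∈ Submodule.span ℂ (range fun i => E i (ζ γ)))
    (hMW : Tendsto (fun γ : ℝ => γ⁻¹ • (bdryMat M *ᵥ W γ)) (𝓝[>] 0) (𝓝 0)) : e = 0 := by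
  have hEt : ∀ i, Tendsto (fun γ => E i (ζ γ)) (𝓝[>] 0) (𝓝 (E i ζ₀)) := fun i =>
    (((hE i).continuousOn.continuousAt (hO.mem_nhds h0)).tendsto).comp hζ
  have hPt : Tendsto (fun γ => Matrix.of (P (ζ γ))) (𝓝[>] 0) (𝓝 (Matrix.of (P ζ₀))) :=
    ((hP.continuousOn.continuousAt (hO.mem_nhds h0)).tendsto).comp hζ
  have hdt : Tendsto (fun γ => (Matrix.of (P (ζ γ))).det) (𝓝[>] 0) (𝓝 (Matrix.of (P ζ₀)).det) :=
    ((Continuous.matrix_det continuous_id).tendsto _).comp hPt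
  have hQ : Tendsto (fun γ : ℝ => (Matrix.of (P (ζ γ))).adjugate *ᵥ (γ⁻¹ • (bdryMat M *ᵥ W γ)))
      (𝓝[>] 0) (𝓝 0) := by
    have h2 : Continuous fun p : Matrix (Fin 2) (Fin 2) ℂ × (Fin 2 → ℂ) => p.1.adjugate *ᵥ p.2 :=
      (Continuous.matrix_adjugate continuous_fst).matrix_mulVec continuous_snd
    have h3 := (h2.tendsto (Matrix.of (P ζ₀), 0)).comp (hPt.prodMk_nhds hMW)
    simp only [Matrix.mulVec_zero] at h3
    exact h3
  obtain ⟨y, hy⟩ : ∃ y : ℝ → Fin 2 → ℂ, ∀ᶠ γ in 𝓝[>] (0 : ℝ), ∑ i, y γ i • E i (ζ γ) = W γ :=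
    (hspan.mono fun γ h => (Submodule.mem_span_range_iff_exists_fun ℂ).1 h).choice
  have key : ∀ᶠ γ : ℝ in 𝓝[>] 0, ∀ i, (γ : ℂ) *
      ((Matrix.of (P (ζ γ))).adjugate *ᵥ (γ⁻¹ • (bdryMat M *ᵥ W γ))) i =
      (Matrix.of (P (ζ γ))).det *
        (![((-(ζ γ).1.im : ℝ) : ℂ) + Complex.I * (σ (ζ γ) : ℂ), 1] i * y γ i) := by
    filter_upwards [hy, hfac, self_mem_nhdsWithin] with γ h1 h2 h3 i
    have h4 : W γ = Matrix.of (fun r i => E i (ζ γ) r) *ᵥ y γ := by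
      rw [← h1]
      funext j
      simp [Matrix.mulVec, dotProduct, mul_comm]
    have h5 : bdryMat M *ᵥ W γ = Matrix.of (P (ζ γ)) *ᵥ (Matrix.diagonal
        ![((-(ζ γ).1.im : ℝ) : ℂ) + Complex.I * (σ (ζ γ) : ℂ), 1] *ᵥ y γ) := by
      rw [h4, Matrix.mulVec_mulVec, h2, Matrix.mulVec_mulVec]
    have h6 : (γ : ℂ) ≠ 0 := Complex.ofReal_ne_zero.2 (ne_of_gt h3)
    have h7 : (γ⁻¹ • (bdryMat M *ᵥ W γ) : Fin 2 → ℂ) = (γ : ℂ)⁻¹ • (bdryMat M *ᵥ W γ) := by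
      funext j; simp
    rw [h7, Matrix.mulVec_smul, h5, Matrix.mulVec_mulVec, Matrix.adjugate_mul, Matrix.smul_mulVec,
      Matrix.one_mulVec, Pi.smul_apply, Pi.smul_apply, smul_eq_mul, smul_eq_mul, ← mul_assoc,
      mul_inv_cancel₀ h6, one_mul, Matrix.mulVec_diagonal]
  have hγ : Tendsto (fun γ : ℝ => ‖(γ : ℂ)‖) (𝓝[>] 0) (𝓝 0) := by
    have := (Complex.continuous_ofReal.norm).tendsto 0
    simp only [Complex.ofReal_zero, norm_zero] at this
    exact this.mono_left nhdsWithin_le_nhds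
  have hQn := fun i => ((tendsto_pi_nhds.1 hQ i).norm)
  simp only [Pi.zero_apply, norm_zero] at hQn
  have hdn := (hdt.norm).inv₀ (norm_ne_zero_iff.2 hdet)
  have hdne := hdt.eventually_ne hdet
  have hsc : Tendsto (fun γ => (dampScale γ)⁻¹) (𝓝[>] 0) (𝓝 (dampScale 0)⁻¹) :=
    ((continuous_dampScale.inv₀ fun γ => (dampScale_pos γ).ne').tendsto 0).mono_left
      nhdsWithin_le_nhds
  have hy1 : Tendsto (fun γ => y γ 1) (𝓝[>] 0) (𝓝 0) := by
    have h1 := hdn.mul (hγ.mul (hQn 1))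
    rw [mul_zero, mul_zero] at h1
    refine squeeze_zero_norm' ?_ h1
    filter_upwards [key, hdne] with γ h2 h3
    have h4 := congrArg norm (h2 1)
    rw [norm_mul, norm_mul] at h4
    simp only [Matrix.cons_val_one, Matrix.cons_val_fin_one, one_mul] at h4
    rw [h4, inv_mul_cancel_left₀ (norm_ne_zero_iff.2 h3)]
  have hy0 : Tendsto (fun γ => y γ 0) (𝓝[>] 0) (𝓝 0) := by
    have h1 := hsc.mul (hdn.mul (hQn 0))
    rw [mul_zero, mul_zero] at h1
    refine squeeze_zero_norm' ?_ h1
    filter_upwards [key, hdne, self_mem_nhdsWithin] with γ h2 h3 h4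
    have h5 := congrArg norm (h2 0)
    have h4' : (0 : ℝ) < γ := h4
    rw [norm_mul, norm_mul, norm_mul, Complex.norm_real, Real.norm_of_nonneg h4'.le] at h5
    simp only [Matrix.cons_val_zero] at h5
    -- the real part of `γ + iσ` is bounded below
    have h6 : dampScale γ * γ ≤ ‖((-(ζ γ).1.im : ℝ) : ℂ) + Complex.I * (σ (ζ γ) : ℂ)‖ := by
      refine le_trans ?_ (Complex.re_le_norm _)
      simp [← him γ h4']
    have hc := dampScale_pos γ
    have hd := norm_pos_iff.2 h3
    rw [inv_mul_eq_div, inv_mul_eq_div, div_div, le_div_iff₀ (by positivity)]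
    refine le_of_mul_le_mul_left ?_ h4'
    rw [h5]
    calc γ * (‖y γ 0‖ * (‖(Matrix.of (P (ζ γ))).det‖ * dampScale γ))
        = ‖(Matrix.of (P (ζ γ))).det‖ * ((dampScale γ * γ) * ‖y γ 0‖) := by ring
      _ ≤ _ := by gcongr
  have h1 : Tendsto (fun γ => ∑ i, y γ i • E i (ζ γ)) (𝓝[>] 0) (𝓝 (∑ i : Fin 2, (0 : ℂ) • E i ζ₀)) := by
    refine tendsto_finsetSum _ fun i _ => ?_
    fin_cases i
    · exact hy0.smul (hEt 0)
    · exact hy1.smul (hEt 1)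
  simp only [zero_smul, Finset.sum_const_zero] at h1
  exact tendsto_nhds_unique (hW.congr' (hy.mono fun γ h => h.symm)) h1

lemma fromCoord_ofReal (h : ∀ m m', ℓ m ⬝ᵥ r m' = if m = m' then 1 else 0) (v : Fin 3 → ℝ) :
    fromCoord r (fun k => ((ℓ k ⬝ᵥ v : ℝ) : ℂ)) = fun i => (v i : ℂ) := by
  funext i
  have := congrFun (sum_dual_smul h v) i
  rw [← this]
  simp [fromCoord]

/-- The Lopatinskii field has a nonzero time component: otherwise a combination `W(γ)` of the two
stable eigenvectors would satisfy `M W(γ) = o(γ)` while `W(0) = e ≠ 0`. -/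
lemma lop_time_ne_zero (res : IsResonantTriple B lam β om r ℓ N) (hB : (B (Fin.last n)).det ≠ 0)
    (hβ : toFreq β ∈ lopSet B M) (weak : WeaklyStable B M) {e : Fin 3 → ℝ} {b : Fin 2 → ℝ}
    (lop : IsLopatinskiiPair B M β e b) (h0 : 0 < coordA B r ℓ 0 0) (h2 : 0 < coordA B r ℓ 2 2) :
    (fieldLop B M (fun m => om m β) r ℓ e b).1 0 ≠ 0 := by
  intro hX
  obtain ⟨O, hO, hmem, σ, E, P, -, hE, hP, hfac⟩ := weak.factor _ hβ
  obtain ⟨V0, hV00, hV0d, hV0s⟩ := res.exists_stable_branch hB hβ.1 h0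
  obtain ⟨V2, hV20, hV2d, hV2s⟩ := res.exists_stable_branch hB hβ.1 h2
  set ζ : ℝ → Freq n := fun γ => dampedFreq β γ (dampScale γ) with hζd
  have hζ : Tendsto ζ (𝓝[>] 0) (𝓝 (toFreq β)) := tendsto_dampedFreq β
  have hin : ∀ᶠ γ : ℝ in 𝓝[>] 0, ζ γ ∈ O ∩ sphereHalf n := by
    filter_upwards [hζ.eventually (hO.mem_nhds hmem), self_mem_nhdsWithin] with γ h3 h4
    exact ⟨h3, (dampedFreq_mem hβ.1 h4).1⟩
  obtain ⟨hlin, hbun, hunit, -⟩ := hfac _ ⟨hmem, hβ.1.1⟩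
  have hEt : ∀ i, Tendsto (fun γ => E i (ζ γ)) (𝓝[>] 0) (𝓝 (E i (toFreq β))) := fun i =>
    (((hE i).continuousOn.continuousAt (hO.mem_nhds hmem)).tendsto).comp hζ
  have hsub : ∀ {V : ℝ → Fin 3 → ℂ}, (∀ᶠ γ : ℝ in 𝓝[>] 0, fromCoord r (V γ) ∈ stableBundle B (ζ γ)) →
      ∀ᶠ γ : ℝ in 𝓝[>] 0, fromCoord r (V γ) ∈ Submodule.span ℂ (range fun i => E i (ζ γ)) :=
    fun {V} h => by
    filter_upwards [hin, h] with γ h3 h4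
    rw [← (hfac _ h3).2.1] at h4
    exact h4
  have hVc : ∀ {V : ℝ → Fin 3 → ℂ} {d : Fin 3 → ℂ}, (∀ k, HasDerivAt (fun γ => V γ k) (d k) 0) →
      Tendsto V (𝓝[>] 0) (𝓝 (V 0)) := fun h =>
    ((hasDerivAt_pi.2 h).continuousAt.tendsto).mono_left nhdsWithin_le_nhds
  -- the incoming eigenvectors span the fibre of the stable bundle at `β`
  have hlimit : ∀ {V : ℝ → Fin 3 → ℂ} {d : Fin 3 → ℂ}, (∀ k, HasDerivAt (fun γ => V γ k) (d k) 0) →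
      (∀ᶠ γ : ℝ in 𝓝[>] 0, fromCoord r (V γ) ∈ stableBundle B (ζ γ)) →
      fromCoord r (V 0) ∈ Submodule.span ℂ (range fun i => E i (toFreq β)) := fun {V d} h h' => by
    rw [mem_span_pair_iff hlin]
    have hc : Continuous fun p : (Fin 3 → ℂ) × (Fin 3 → ℂ) × (Fin 3 → ℂ) =>
        (Matrix.of ![p.1, p.2.1, p.2.2]).det := by
      simp only [Matrix.det_fin_three, Matrix.of_apply, Matrix.cons_val]
      fun_prop
    have h3 := (hc.tendsto (fromCoord r (V 0), E 0 (toFreq β), E 1 (toFreq β))).comp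
      ((((continuous_fromCoord r).tendsto _).comp (hVc h)).prodMk_nhds
        ((hEt 0).prodMk_nhds (hEt 1)))
    refine tendsto_nhds_unique (h3.congr' ?_) tendsto_const_nhds
    filter_upwards [hin, hsub h'] with γ h4 h5
    exact (mem_span_pair_iff (hfac _ h4).1 _).1 h5
  have hr0 := hlimit hV0d hV0s
  have hr2 := hlimit hV2d hV2s
  rw [hV00] at hr0
  rw [hV20] at hr2
  set F : Fin 2 → Fin 3 → ℂ := ![fromCoord r (Pi.single 0 1), fromCoord r (Pi.single 2 1)] with hF
  have hcomb : ∀ c : Fin 2 → ℂ, ∑ i, c i • F i = fromCoord r ![c 0, 0, c 1] := fun c => by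
    funext i
    simp [hF, fromCoord, Fin.sum_univ_three, Fin.sum_univ_two]
  have hFlin : LinearIndependent ℂ F := by
    rw [Fintype.linearIndependent_iff]
    intro c hc i
    rw [hcomb] at hc
    have := fromCoord_injective res.dual hc
    fin_cases i
    · exact congrFun this 0
    · exact congrFun this 2
  have hFspan : Submodule.span ℂ (range F) = Submodule.span ℂ (range fun i => E i (toFreq β)) := by
    refine Submodule.eq_of_le_of_finrank_eq (Submodule.span_le.2 ?_) ?_
    · rintro _ ⟨i, rfl⟩
      fin_cases i
      · exact hr0
      · exact hr2
    · rw [finrank_span_eq_card hFlin, finrank_span_eq_card hlin]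
  have hfib : ∀ v ∈ stableBundle B (toFreq β), ∃ c : Fin 2 → ℂ, v = fromCoord r ![c 0, 0, c 1] :=
    fun v hv => by
    rw [← hbun, ← hFspan] at hv
    obtain ⟨c, hc⟩ := (Submodule.mem_span_range_iff_exists_fun ℂ).1 hv
    exact ⟨c, by rw [← hc, hcomb]⟩
  -- the decomposition of `e`
  obtain ⟨he, hMe⟩ := (lop.ker_eq fun i => (e i : ℂ)).2 ⟨1, by simp⟩
  obtain ⟨c, hc⟩ := hfib _ he
  have hc' : (fun k => ((ℓ k ⬝ᵥ e : ℝ) : ℂ)) = ![c 0, 0, c 1] := by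
    have : fromCoord r ((fun k => ((ℓ k ⬝ᵥ e : ℝ) : ℂ)) - ![c 0, 0, c 1]) = 0 := by
      have h3 : fromCoord r ((fun k => ((ℓ k ⬝ᵥ e : ℝ) : ℂ)) - ![c 0, 0, c 1]) =
          fromCoord r (fun k => ((ℓ k ⬝ᵥ e : ℝ) : ℂ)) - fromCoord r ![c 0, 0, c 1] := by
        funext i; simp [fromCoord, sub_mul, sum_sub_distrib]
      rw [h3, fromCoord_ofReal res.dual, ← hc, sub_self]
    exact sub_eq_zero.1 (fromCoord_injective res.dual this)
  -- a solution of `M v = M u` in the fibre at `β`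
  set u : Fin 3 → ℝ := ∑ m ∈ ({0, 2} : Finset (Fin 3)), partialInv (fun m => om m β) r ℓ m
    (((B (Fin.last n))⁻¹ * tanMat B 0) *ᵥ proj r ℓ m e) with hu
  have hbu : (fun i => (b i : ℂ)) ⬝ᵥ (bdryMat M *ᵥ fun i => (u i : ℂ)) = 0 := by
    have h3 : b ⬝ᵥ (M *ᵥ u) = 0 := hX
    rw [bdryMat, map_mulVec_ofReal]
    have h4 := congrArg Complex.ofReal h3
    simpa [dotProduct] using h4
  obtain ⟨v, hv, hMv⟩ := (lop.range_eq _).2 hbu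
  obtain ⟨s, hs⟩ := hfib v hv
  set Wc : ℝ → Fin 3 → ℂ := fun γ k => ((ℓ 0 ⬝ᵥ e : ℝ) - γ * (Complex.I * s 0)) * V0 γ k +
    ((ℓ 2 ⬝ᵥ e : ℝ) - γ * (Complex.I * s 1)) * V2 γ k with hWc
  set W : ℝ → Fin 3 → ℂ := fun γ => fromCoord r (Wc γ) with hW
  have hW0 : W 0 = fun i => (e i : ℂ) := by
    rw [hc]
    simp only [hW]
    congr 1
    funext k
    simp only [hWc, hV00, hV20, ← hc']
    have h1 : ((ℓ 1 ⬝ᵥ e : ℝ) : ℂ) = 0 := congrFun hc' 1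
    fin_cases k
    · simp
    · simp [h1]
    · simp
  have hcoef : ∀ (x y : ℂ), HasDerivAt (fun γ : ℝ => x - γ * y) (-y) 0 := fun x y => by
    have h3 : HasDerivAt (fun γ : ℝ => (γ : ℂ)) 1 0 := Complex.ofRealCLM.hasDerivAt
    simpa using (h3.mul_const y).const_sub x
  have hWcd : ∀ k, HasDerivAt (fun γ => Wc γ k) ((((ℓ 0 ⬝ᵥ e : ℝ) : ℂ) * (if k = 0 then 0 else
          Complex.I * ((om 0 β - om k β)⁻¹ * coordA B r ℓ k 0 : ℝ)) +
        ((ℓ 2 ⬝ᵥ e : ℝ) : ℂ) * (if k = 2 then 0 else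
          Complex.I * ((om 2 β - om k β)⁻¹ * coordA B r ℓ k 2 : ℝ))) -
        Complex.I * (![s 0, 0, s 1] : Fin 3 → ℂ) k) 0 := fun k => by
    have h3 := ((hcoef (ℓ 0 ⬝ᵥ e : ℝ) (Complex.I * s 0)).mul (hV0d k)).add
      ((hcoef (ℓ 2 ⬝ᵥ e : ℝ) (Complex.I * s 1)).mul (hV2d k))
    refine h3.congr_deriv ?_
    rw [hV00, hV20]
    fin_cases k <;> simp <;> ring
  have hWd : HasDerivAt W (fun i => Complex.I * ((u i : ℂ) - v i)) 0 := by
    refine hasDerivAt_pi.2 fun i => ?_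
    have h3 := HasDerivAt.fun_sum fun k (_ : k ∈ Finset.univ) => (hWcd k).mul_const (r k i : ℂ)
    refine h3.congr_deriv ?_
    have e0 := congrFun (fromCoord_partialInv (B := B) (β := β) (om := om) (r := r) (ℓ := ℓ) e 0) i
    have e2 := congrFun (fromCoord_partialInv (B := B) (β := β) (om := om) (r := r) (ℓ := ℓ) e 2) i
    have ev := congrFun hs i
    have eu : (u i : ℂ) = _ := congrArg Complex.ofReal (congrFun hu i)
    rw [Finset.sum_pair (by decide), Pi.add_apply, Complex.ofReal_add] at eu
    rw [eu, mul_sub, mul_add, ← e0, ← e2, ev]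
    simp only [fromCoord, sub_mul, add_mul, sum_sub_distrib, Finset.sum_add_distrib,
      mul_sum, mul_assoc]
  have hWspan : ∀ᶠ γ : ℝ in 𝓝[>] 0, W γ ∈ Submodule.span ℂ (range fun i => E i (ζ γ)) := by
    filter_upwards [hsub hV0s, hsub hV2s] with γ h3 h4
    have h5 : W γ = ((ℓ 0 ⬝ᵥ e : ℝ) - γ * (Complex.I * s 0)) • fromCoord r (V0 γ) +
        ((ℓ 2 ⬝ᵥ e : ℝ) - γ * (Complex.I * s 1)) • fromCoord r (V2 γ) := by
      funext i
      simp only [hW, hWc, fromCoord, add_mul, Finset.sum_add_distrib, Pi.add_apply, Pi.smul_apply,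
        smul_eq_mul, mul_sum, mul_assoc]
    rw [h5]
    exact Submodule.add_mem _ (Submodule.smul_mem _ _ h3) (Submodule.smul_mem _ _ h4)
  have hMW : Tendsto (fun γ : ℝ => γ⁻¹ • (bdryMat M *ᵥ W γ)) (𝓝[>] 0) (𝓝 0) := by
    have h3 : HasDerivAt (fun γ => bdryMat M *ᵥ W γ) (bdryMat M *ᵥ fun i =>
        Complex.I * ((u i : ℂ) - v i)) 0 := by
      refine hasDerivAt_pi.2 fun i => ?_
      show HasDerivAt (fun x => ∑ k, bdryMat M i k * W x k)
        (∑ k, bdryMat M i k * (Complex.I * ((u k : ℂ) - v k))) 0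
      exact HasDerivAt.fun_sum fun k _ => (hasDerivAt_pi.1 hWd k).const_mul _
    have h4 : (bdryMat M *ᵥ fun i => Complex.I * ((u i : ℂ) - v i)) = 0 := by
      have : (fun i => Complex.I * ((u i : ℂ) - v i)) = Complex.I • ((fun i => (u i : ℂ)) - v) := by
        funext i; simp
      rw [this, Matrix.mulVec_smul, Matrix.mulVec_sub, hMv, sub_self, smul_zero]
    rw [h4] at h3
    refine h3.tendsto_slope_zero_right.congr fun γ => ?_
    rw [zero_add, hW0, hMe, sub_zero]
  have hWt : Tendsto W (𝓝[>] 0) (𝓝 fun i => (e i : ℂ)) := by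
    rw [← hW0]
    exact hWd.continuousAt.tendsto.mono_left nhdsWithin_le_nhds
  have hfin := eq_zero_of_lop_factor hO hmem hE hP hunit.ne_zero hζ
    (fun γ hγ => (dampedFreq_mem hβ.1 hγ).2.2) (hin.mono fun γ h => (hfac _ h).2.2.2) hWt hWspan hMW
  exact lop.e_ne_zero (funext fun i => by simpa using congrFun hfin i)

end Spectral

/-! ### The Fourier projection as an average over translations -/

section Fourier
variable {k : ℕ}
variable {u : Fn k} {z : Pt k} {f : ℕ → Fn k} {S : ℝ}

lemma sum_exp_root {N : ℤ} (hN : N ≠ 0) (j : ℤ) :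
    ∑ i ∈ Finset.range N.natAbs, Complex.exp (Complex.I * j * (2 * π * i / N)) =
      if N ∣ j then (N.natAbs : ℂ) else 0 := by
  have hNc : (N : ℂ) ≠ 0 := Int.cast_ne_zero.2 hN
  have e : ∀ i : ℕ, Complex.exp (Complex.I * j * (2 * π * i / N)) =
      Complex.exp (Complex.I * j * (2 * π / N)) ^ i := fun i => by
    rw [← Complex.exp_nat_mul]; congr 1; ring
  simp_rw [e]
  have hpi : (2 * π * Complex.I : ℂ) ≠ 0 := Complex.two_pi_I_ne_zero
  split_ifs with h
  · obtain ⟨m, rfl⟩ := h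
    have : Complex.exp (Complex.I * ((N * m : ℤ) : ℂ) * (2 * π / N)) = 1 := by
      rw [Complex.exp_eq_one_iff]
      exact ⟨m, by push_cast; field_simp⟩
    simp only [this, one_pow, sum_const, card_range, nsmul_eq_mul, mul_one]
  · have h1 : Complex.exp (Complex.I * j * (2 * π / N)) ≠ 1 := fun h1 => h (by
      obtain ⟨m, hm⟩ := Complex.exp_eq_one_iff.1 h1
      refine ⟨m, ?_⟩
      have : (2 * π * Complex.I) * (j : ℂ) = (2 * π * Complex.I) * (N * m) := by
        field_simp at hm
        linear_combination (2 * π * Complex.I) * hm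
      exact_mod_cast mul_left_cancel₀ hpi this)
    have h2 : Complex.exp (Complex.I * j * (2 * π / N)) ^ N.natAbs = 1 := by
      rw [← Complex.exp_nat_mul, Complex.exp_eq_one_iff]
      rcases Int.natAbs_eq N with h3 | h3
      · refine ⟨j, ?_⟩
        have : ((N.natAbs : ℕ) : ℂ) = N := by rw [← Int.cast_natCast, ← h3]
        rw [this]; field_simp
      · refine ⟨-j, ?_⟩
        have : ((N.natAbs : ℕ) : ℂ) = -N := by
          rw [← Int.cast_natCast, ← Int.cast_neg]; congr 1; omega
        rw [this]; push_cast; field_simp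
    rw [geom_sum_eq h1, h2, sub_self, zero_div]

/-- Fourier inversion for an absolutely convergent Fourier series. -/
lemma hasSum_coeffTheta (hp : PeriodicTheta u)
    (hc : Continuous fun θ => u (z, θ)) (hs : Summable fun j => coeffTheta u z j) (θ : ℝ) :
    HasSum (fun j : ℤ => coeffTheta u z j * Complex.exp (Complex.I * j * θ)) (u (z, θ) : ℂ) := by
  have : Fact (0 < 2 * π) := ⟨Real.two_pi_pos⟩
  have hper : Function.Periodic (fun θ : ℝ => (u (z, θ) : ℂ)) (2 * π) := fun θ => by
    simp only [hp z θ]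
  set F : C(AddCircle (2 * π), ℂ) := ⟨hper.lift,
    QuotientAddGroup.isOpenQuotientMap_mk.isQuotientMap.continuous_iff.2 (Complex.continuous_ofReal.comp hc)⟩ with hF
  have hFv : ∀ x : ℝ, F (x : AddCircle (2 * π)) = u (z, x) := fun x => hper.lift_coe x
  have hco : ∀ j, fourierCoeff F j = coeffTheta u z j := fun j => by
    rw [fourierCoeff_eq_intervalIntegral F j 0, coeffTheta, zero_add, Complex.real_smul]
    congr 1
    · push_cast; rfl
    · refine intervalIntegral.integral_congr fun x _ => ?_
      rw [hFv, fourier_coe_apply, smul_eq_mul, mul_comm]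
      congr 2
      push_cast
      have : (π : ℂ) ≠ 0 := Complex.ofReal_ne_zero.2 Real.pi_ne_zero
      field_simp
  have h1 := has_pointwise_sum_fourier_series_of_summable (f := F)
    (by simpa only [funext hco] using hs) (θ : AddCircle (2 * π))
  rw [hFv] at h1
  refine h1.congr_fun fun j => ?_
  rw [hco, smul_eq_mul, fourier_coe_apply]
  congr 2
  push_cast
  have : (π : ℂ) ≠ 0 := Complex.ofReal_ne_zero.2 Real.pi_ne_zero
  field_simp

/-- The preparation map is an average over translations. -/
lemma prepare_eq_prepAvg (hp : PeriodicTheta u)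
    (hc : Continuous fun θ => u (z, θ)) (hs : Summable fun j => coeffTheta u z j) {N : ℤ} (hN : N ≠ 0)
    (θ : ℝ) : prepare N u (z, θ) = prepAvg N u (z, θ) := by
  have hN' : (N.natAbs : ℂ) ≠ 0 := by exact_mod_cast Int.natAbs_ne_zero.2 hN
  have h1 := (hasSum_sum (s := Finset.range N.natAbs) fun i _ =>
    hasSum_coeffTheta hp hc hs (θ + 2 * π * i / N)).mul_left (N.natAbs : ℂ)⁻¹
  have e : (fun j : ℤ => (N.natAbs : ℂ)⁻¹ * ∑ i ∈ Finset.range N.natAbs, coeffTheta u z j *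
      Complex.exp (Complex.I * j * ((θ + 2 * π * i / N : ℝ) : ℂ))) =
      fun j => if N ∣ j then coeffTheta u z j * Complex.exp (Complex.I * j * θ) else 0 := by
    funext j
    have : ∀ i : ℕ, Complex.exp (Complex.I * j * ((θ + 2 * π * i / N : ℝ) : ℂ)) =
        Complex.exp (Complex.I * j * θ) * Complex.exp (Complex.I * j * (2 * π * i / N)) :=
      fun i => by rw [← Complex.exp_add]; congr 1; push_cast; ring
    simp_rw [this, ← mul_assoc, ← mul_sum, sum_exp_root hN]
    split_ifs
    · field_simp
    · simp
  rw [e] at h1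
  have hinj : Function.Injective fun j : ℤ => j * N := fun a b h => mul_right_cancel₀ hN h
  have h2 := (hinj.hasSum_iff fun j hj => if_neg fun ⟨m, hm⟩ => hj ⟨m, by rw [hm]; ring⟩).2 h1
  have h3 := h2.congr_fun (g := fun j : ℤ => coeffTheta u z (j * N) *
    Complex.exp (Complex.I * ((j * N : ℤ) : ℂ) * θ)) fun j => by simp
  rw [prepare, h3.tsum_eq, prepAvg]
  simp only [Prod.mk_add_mk, add_zero]
  rw [← Complex.ofReal_natCast, ← Complex.ofReal_inv, ← Complex.ofReal_sum, ← Complex.ofReal_mul,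
    Complex.ofReal_re]

/-- Decay of the Fourier coefficients of a limit of functions with bounded second derivative. -/
lemma norm_coeffTheta_le (hf : ∀ j, SmoothPer (f j)) (h0 : ∀ j θ, |f j (z, θ)| ≤ S)
    (h2 : ∀ j θ, |dv (dir none) (dv (dir none) (f j)) (z, θ)| ≤ S)
    (hlim : ∀ θ, Tendsto (fun j => f j (z, θ)) atTop (𝓝 (u (z, θ)))) {m : ℤ} (hm : m ≠ 0) :
    ‖coeffTheta u z m‖ ≤ S * (1 / (m : ℝ) ^ 2) := by
  have hmc : (m : ℂ) ≠ 0 := Int.cast_ne_zero.2 hm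
  have hpi : (π : ℂ) ≠ 0 := Complex.ofReal_ne_zero.2 Real.pi_ne_zero
  have hnorm : ∀ θ : ℝ, ‖Complex.exp (-(Complex.I * m * θ))‖ = 1 := fun θ => by
    rw [show -(Complex.I * m * θ) = ((-(m * θ) : ℝ) : ℂ) * Complex.I by push_cast; ring,
      Complex.norm_exp_ofReal_mul_I]
  have hexp : ∀ θ : ℝ, HasDerivAt (fun θ : ℝ => Complex.exp (-(Complex.I * m * θ)) / (-(Complex.I * m)))
      (Complex.exp (-(Complex.I * m * θ))) θ := fun θ => by
    have h1 : HasDerivAt (fun θ : ℝ => (θ : ℂ)) 1 θ := Complex.ofRealCLM.hasDerivAt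
    have h3 := ((h1.const_mul (Complex.I * m)).fun_neg.cexp).div_const (-(Complex.I * m))
    refine h3.congr_deriv ?_
    rw [mul_one, mul_div_assoc, div_self (neg_ne_zero.2 (mul_ne_zero Complex.I_ne_zero hmc)), mul_one]
  have hend : Complex.exp (-(Complex.I * m * ((2 * π : ℝ) : ℂ))) = 1 := by
    rw [Complex.exp_eq_one_iff]
    exact ⟨-m, by push_cast; ring⟩
  -- one integration by parts
  have hibp : ∀ g : Fn k, SmoothPer g → coeffTheta g z m =
      (Complex.I * m)⁻¹ * coeffTheta (dv (dir none) g) z m := fun g hg => by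
    have hd : ∀ θ, HasDerivAt (fun θ => (g (z, θ) : ℂ)) (dv (dir none) g (z, θ) : ℂ) θ := fun θ =>
      (hasDerivAt_theta_dv hg z θ).ofReal_comp
    have hc := (hg.dv (dir none)).continuous
    have := intervalIntegral.integral_mul_deriv_eq_deriv_mul (a := 0) (b := 2 * π)
      (fun θ _ => hd θ) (fun θ _ => hexp θ)
      (Continuous.intervalIntegrable (by fun_prop) _ _) (Continuous.intervalIntegrable (by fun_prop) _ _)
    have hper : g (z, 2 * π) = g (z, 0) := by simpa using hg.periodic z 0
    rw [coeffTheta, this, hper, hend, coeffTheta]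
    simp only [Complex.ofReal_zero, mul_zero, neg_zero, Complex.exp_zero, sub_self, zero_sub]
    simp_rw [← mul_div_assoc]
    rw [intervalIntegral.integral_div]
    field_simp
  have hj : ∀ j, ‖coeffTheta (f j) z m‖ ≤ S * (1 / (m : ℝ) ^ 2) := fun j => by
    rw [hibp _ (hf j), hibp _ ((hf j).dv _), ← mul_assoc, norm_mul]
    have h3 : ‖coeffTheta (dv (dir none) (dv (dir none) (f j))) z m‖ ≤ S := by
      have := intervalIntegral.norm_integral_le_of_norm_le_const (a := 0) (b := 2 * π) (C := S)
        (f := fun θ => (dv (dir none) (dv (dir none) (f j)) (z, θ) : ℂ) *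
          Complex.exp (-(Complex.I * m * θ))) fun θ _ => by
          rw [norm_mul, hnorm, mul_one, Complex.norm_real]; exact h2 j θ
      rw [sub_zero, abs_of_pos Real.two_pi_pos] at this
      rw [coeffTheta, norm_mul]
      have h4 : ‖(1 / (2 * π) : ℂ)‖ = (2 * π)⁻¹ := by
        rw [one_div, norm_inv, norm_mul, Complex.norm_real, Real.norm_of_nonneg Real.pi_pos.le]; simp
      rw [h4, inv_mul_le_iff₀ Real.two_pi_pos, mul_comm (2 * π)]
      exact this
    have h4 : ‖(Complex.I * (m : ℂ))⁻¹ * (Complex.I * m)⁻¹‖ = 1 / (m : ℝ) ^ 2 := by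
      rw [norm_mul, norm_inv, norm_mul, Complex.norm_I, one_mul, Complex.norm_intCast, ← mul_inv, ← sq,
        sq_abs, one_div]
    rw [h4, mul_comm]
    exact mul_le_mul_of_nonneg_right h3 (by positivity)
  have hcl : Tendsto (fun j => coeffTheta (f j) z m) atTop (𝓝 (coeffTheta u z m)) := by
    refine Tendsto.const_mul _ (intervalIntegral.tendsto_integral_filter_of_dominated_convergence
      (fun _ => S) ?_ ?_ intervalIntegrable_const ?_)
    · exact Eventually.of_forall fun j => by
        have := (hf j).continuous
        exact Continuous.aestronglyMeasurable (by fun_prop)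
    · exact Eventually.of_forall fun j => Eventually.of_forall fun θ _ => by
        rw [norm_mul, hnorm, mul_one, Complex.norm_real]; exact h0 j θ
    · exact Eventually.of_forall fun θ _ =>
        ((Complex.continuous_ofReal.tendsto _).comp (hlim θ)).mul_const _
  exact le_of_tendsto hcl.norm (.of_forall hj)

lemma summable_coeffTheta (hf : ∀ j, SmoothPer (f j)) (h0 : ∀ j θ, |f j (z, θ)| ≤ S)
    (h2 : ∀ j θ, |dv (dir none) (dv (dir none) (f j)) (z, θ)| ≤ S)
    (hlim : ∀ θ, Tendsto (fun j => f j (z, θ)) atTop (𝓝 (u (z, θ)))) :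
    Summable fun j => coeffTheta u z j := by
  refine Summable.of_norm_bounded_eventually (g := fun m : ℤ => S * (1 / (m : ℝ) ^ 2))
    ((Real.summable_one_div_int_pow.2 one_lt_two).mul_left S) ?_
  refine (Set.finite_singleton (0 : ℤ)).subset fun m hm => ?_
  by_contra hne
  exact hm (norm_coeffTheta_le hf h0 h2 hlim hne)

end Fourier

/-! ### Riemann sums for the interaction integral -/

section Riemann

/-- Error of the left Riemann sum of a Lipschitz function. -/
lemma abs_riemann_sub_le {g : ℝ → ℝ} (hg : Continuous g) {L : ℝ} (hL : ∀ x y, |g x - g y| ≤ L * |x - y|)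
    {M : ℕ} {μ : ℝ} (hμ : 0 ≤ μ) (hM : M * μ = 2 * π) :
    |∑ l ∈ Finset.range M, μ * g (μ * l) - ∫ θ in 0..2 * π, g θ| ≤ 2 * π * L * μ := by
  have e : ∫ θ in 0..2 * π, g θ = ∑ l ∈ Finset.range M, ∫ θ in (μ * l)..(μ * (l + 1 : ℕ)), g θ := by
    rw [intervalIntegral.sum_integral_adjacent_intervals (a := fun l : ℕ => μ * l)
      fun l _ => hg.intervalIntegrable _ _]
    simp [← hM, mul_comm]
  have hl : ∀ l : ℕ, |μ * g (μ * l) - ∫ θ in (μ * l)..(μ * (l + 1 : ℕ)), g θ| ≤ L * μ * μ := fun l => by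
    have h1 : μ * g (μ * l) = ∫ _ in (μ * l)..(μ * (l + 1 : ℕ)), g (μ * l) := by
      rw [intervalIntegral.integral_const, smul_eq_mul]; push_cast; ring
    rw [h1, ← intervalIntegral.integral_sub intervalIntegrable_const (hg.intervalIntegrable _ _)]
    have hle : μ * (l : ℝ) ≤ μ * (l + 1 : ℕ) := by push_cast; nlinarith
    have hL0 : 0 ≤ L := by have := (abs_nonneg _).trans (hL 1 0); simpa using this
    have := intervalIntegral.norm_integral_le_of_norm_le_const (a := μ * l) (b := μ * (l + 1 : ℕ))
      (C := L * μ) (f := fun θ => g (μ * l) - g θ) fun θ hθ => by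
        rw [uIoc_of_le hle] at hθ
        refine (hL _ _).trans (mul_le_mul_of_nonneg_left ?_ hL0)
        rw [abs_sub_comm, abs_of_nonneg (by linarith [hθ.1])]
        have := hθ.2
        push_cast at this
        linarith
    rw [Real.norm_eq_abs] at this
    refine this.trans (le_of_eq ?_)
    rw [show μ * ((l + 1 : ℕ) : ℝ) - μ * l = μ by push_cast; ring, abs_of_nonneg hμ]
  rw [e, ← sum_sub_distrib]
  refine (abs_sum_le_sum_abs _ _).trans ((sum_le_sum fun l _ => hl l).trans (le_of_eq ?_))
  rw [sum_const, card_range, nsmul_eq_mul, ← hM]; ring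

/-- Convergence of the Riemann sums of a convergent equi-Lipschitz family. -/
lemma tendsto_riemann {g : ℕ → ℝ → ℝ} {f : ℝ → ℝ} {L A : ℝ} (hg : ∀ j, Continuous (g j))
    (hL : ∀ j x y, |g j x - g j y| ≤ L * |x - y|) (hA : ∀ j x, |g j x| ≤ A)
    (hlim : ∀ x, Tendsto (fun j => g j x) atTop (𝓝 (f x))) {M : ℕ → ℕ} {μ : ℕ → ℝ} (hμ : ∀ j, 0 ≤ μ j)
    (hM : ∀ j, M j * μ j = 2 * π) (hμ0 : Tendsto μ atTop (𝓝 0)) :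
    Tendsto (fun j => ∑ l ∈ Finset.range (M j), μ j * g j (μ j * l)) atTop
      (𝓝 (∫ θ in 0..2 * π, f θ)) := by
  have h1 : Tendsto (fun j => ∫ θ in 0..2 * π, g j θ) atTop (𝓝 (∫ θ in 0..2 * π, f θ)) :=
    intervalIntegral.tendsto_integral_filter_of_dominated_convergence (fun _ => A)
      (.of_forall fun j => (hg j).aestronglyMeasurable)
      (.of_forall fun j => Eventually.of_forall fun x _ => hA j x) intervalIntegrable_const
      (.of_forall fun x _ => hlim x)
  have h2 : Tendsto (fun j => ∑ l ∈ Finset.range (M j), μ j * g j (μ j * l) -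
      ∫ θ in 0..2 * π, g j θ) atTop (𝓝 0) :=
    squeeze_zero_norm (fun j => abs_riemann_sub_le (hg j) (hL j) (hμ j) (hM j))
      (by simpa using hμ0.const_mul (2 * π * L))
  simpa using h2.add h1

variable {k : ℕ}

/-- The interaction integral, in terms of translations only. -/
lemma interaction_eq {N : Fin 3 → ℤ} (h0 : N 0 ≠ 0) (hN : N 0 = N 1 + N 2) {σ₁ σ₃ : Fn k}
    (h1 : PeriodicTheta σ₁) (h3 : PeriodicTheta σ₃) {z : Pt k}
    (hprep : ∀ θ, prepare (N 0) σ₁ (z, θ) = prepAvg (N 0) σ₁ (z, θ)) (θ : ℝ) :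
    interaction N σ₁ σ₃ (z, θ) = ∫ φ in 0..2 * π,
      prepAvg (N 0) σ₁ ((z, θ) + (0, (N 2 : ℝ) / N 0 * φ)) * σ₃ ((z, θ) + (0, φ)) := by
  have h0' : (N 0 : ℝ) ≠ 0 := Int.cast_ne_zero.2 h0
  have hN' : (N 0 : ℝ) = N 1 + N 2 := by exact_mod_cast hN
  have hper : Function.Periodic (fun φ => prepAvg (N 0) σ₁ (z, (N 1 : ℝ) / N 0 * θ + (N 2 : ℝ) / N 0 * φ) *
      σ₃ (z, φ)) (2 * π) := fun φ => by
    simp only [h3 z φ]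
    have := prepAvg_add h0 h1 (z, (N 1 : ℝ) / N 0 * θ + (N 2 : ℝ) / N 0 * φ) (N 2)
    rw [Prod.mk_add_mk, add_zero] at this
    rw [← this]
    congr 3
    field_simp
    ring
  rw [interaction, ← SchemeData.periodic_integral_add _ θ]
  swap
  · simp only [hprep]; exact hper
  refine intervalIntegral.integral_congr fun φ _ => ?_
  simp only [hprep, Prod.mk_add_mk, add_zero]
  have : (N 1 : ℝ) / N 0 * θ + (N 2 : ℝ) / N 0 * (φ + θ) = θ + (N 2 : ℝ) / N 0 * φ := by
    field_simp
    rw [hN']; ring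
  rw [this, add_comm φ θ]

end Riemann

section WeakTransport
variable {k : ℕ} {U : Set (Pt k)} {u F : ℕ → Fn k} {v f : Fn k}

/-- Passage to the limit in discrete transport equations along `d`. -/
lemma ApproxBy.integral_dv_eq (h : ApproxBy U u v) (hU : MeasurableSet U) {d : Pt k} {s : ℕ → ℝ}
    (hs0 : ∀ j, 0 < s j) (hs1 : ∀ j, s j ≤ 1) (hs : Tendsto s atTop (𝓝 0))
    (hdU : ∀ z ∈ U, ∀ r ∈ Icc (0 : ℝ) 1, z + r • d ∈ U)
    (hF : ∀ j, Continuous (F j)) {C : ℝ} (hC : ∀ j, ∀ x : Cyl k, x.1 ∈ U → |F j x| ≤ C)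
    (hlim : ∀ x : Cyl k, x.1 ∈ U → Tendsto (fun j => F j x) atTop (𝓝 (f x)))
    (heq : ∀ j, ∀ x : Cyl k, x.1 ∈ U → (u j (x + s j • (d, 0)) - u j x) / s j = F j x)
    {φ : Fn k} (hφ : IsTest U φ) :
    ∫ x, v x * dv (d, 0) φ x ∂vol U = - ∫ x, f x * φ x ∂vol U := by
  obtain ⟨K, hφ, hK⟩ := hφ.cptSmooth
  set K' : Set (Pt k) := (fun p : (Pt k) × ℝ => p.1 + p.2 • d) '' (K ×ˢ Icc 0 1) with hK'
  have cK' : IsCompact K' := (hφ.compact.prod isCompact_Icc).image (by fun_prop)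
  have t1 := h.tendsto_quot hU hφ (d := (d, 0))
    (tendsto_nhdsWithin_iff.2 ⟨hs, Eventually.of_forall fun j => (hs0 j).ne'⟩) cK'
    (fun z hz => ⟨(z, 0), ⟨hz, by simp⟩, by simp⟩)
    (by rintro _ ⟨⟨z, r⟩, ⟨hz, hr⟩, rfl⟩; exact hdU z (hK hz) r hr)
    (fun j z hz hz' => hz ⟨(z - s j • d, s j), ⟨hz', (hs0 j).le, hs1 j⟩, by simp⟩)
  obtain ⟨C', -, hC'⟩ := hφ.bound
  have t2 := tendsto_integral_mul hU hφ.compact (ψ := fun _ => φ) (χ := φ)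
    (fun j => (hF j).aestronglyMeasurable) (fun _ => hφ.continuous) hC (fun _ => hC')
    (fun _ => hφ.support) hlim fun x => tendsto_const_nhds
  have := tendsto_nhds_unique (t2.congr fun j =>
    integral_congr_ae (ae_cylMeasure_of_forall hU fun x hx => by simp only [heq j x hx])) t1
  rw [this, neg_neg]

end WeakTransport

/-! ### The discretised subsystem -/

section Model
variable {n : ℕ}
variable {p : ℕ} {a : Fn (n + 1)} {x : Cyl (n + 2)}

/-- The constants of the key subsystem: the tangential parts `v m` of the characteristic fields,
the coefficients `c`, the traces `σ_m = ε_m a`, the resonance, and the length `S` of the outgoing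
characteristics that is needed to reach `t ≤ 0` from `t < T`. -/
structure Model (n : ℕ) where
  v : Fin 3 → Pt (n + 1)
  c : Fin 7 → ℝ
  ε : Fin 3 → ℝ
  N : Fin 3 → ℤ
  S : ℝ
  T : ℝ

namespace Model
variable (Q : Model n)

/-- The sign conditions: the phases `0`, `2` are incoming and the phase `1` is outgoing. -/
structure Good : Prop where
  v0_pos : 0 < Q.v 0 0
  v2_pos : 0 < Q.v 2 0
  v1_neg : Q.v 1 0 < 0
  N_ne : ∀ i, Q.N i ≠ 0
  N_eq : Q.N 0 = Q.N 1 + Q.N 2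
  S_pos : 0 < Q.S
  T_le : Q.T ≤ Q.S * -Q.v 1 0

/-- The step of the discretisation with `p` nodes. -/
def step (p : ℕ) : ℝ := Q.S / p

/-- The discretised interaction integral on the boundary. -/
def bdryPair (p : ℕ) : PairData (n + 1) where
  N := Q.N 0
  N₂ := Q.N 2
  M := p
  R := p
  w r := Q.c 2 * (Q.ε 0 * Q.ε 2) * Q.step p * rexp ((Q.c 0 - Q.c 1 - Q.c 3) * (r * Q.step p))
  p r := ((r : ℝ) * Q.step p) • (Q.v 1 - Q.v 0)
  q r := ((r : ℝ) * Q.step p) • (Q.v 1 - Q.v 2)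

/-- The discretised solution operator of the outgoing transport equation. -/
def intPair (p : ℕ) : PairData (n + 2) where
  N := Q.N 0
  N₂ := Q.N 2
  M := p
  R := p
  w r := Q.c 2 * Q.step p * rexp (Q.c 0 * (r * Q.step p))
  p r := ((r : ℝ) * Q.step p) • atHeight (Q.v 1) 1
  q r := ((r : ℝ) * Q.step p) • atHeight (Q.v 1) 1

/-- The first incoming profile with boundary value `ε₀ a`. -/
def sig0 (a : Fn (n + 1)) : Fn (n + 2) := transport (Q.v 0) (Q.c 1) (Q.ε 0) a

/-- The second incoming profile with boundary value `ε₂ a`. -/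
def sig2 (a : Fn (n + 1)) : Fn (n + 2) := transport (Q.v 2) (Q.c 3) (Q.ε 2) a

/-- The discretised outgoing profile. -/
def tau (p : ℕ) (a : Fn (n + 1)) : Fn (n + 2) := (Q.intPair p).pairing (Q.sig0 a) (Q.sig2 a)

/-- The Riemann sum for the interaction integral. -/
def angular (p : ℕ) (a : Fn (n + 1)) : Fn (n + 2) := fun x =>
  ∑ l ∈ Finset.range p, (2 * π / p) * (prepAvg (Q.N 0) (Q.sig0 a)
    (x + (0, (Q.N 2 : ℝ) / Q.N 0 * (2 * π / p * l))) * Q.sig2 a (x + (0, 2 * π / p * l)))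

variable {Q}

lemma Good.bdryPair (hQ : Q.Good) (hp : 0 < p) : (Q.bdryPair p).Good :=
  ⟨hQ.N_ne 0, hQ.N_ne 2, hp⟩

lemma Good.intPair (hQ : Q.Good) (hp : 0 < p) : (Q.intPair p).Good :=
  ⟨hQ.N_ne 0, hQ.N_ne 2, hp⟩

lemma Good.step_pos (hQ : Q.Good) (hp : 0 < p) : 0 < Q.step p :=
  div_pos hQ.S_pos (by exact_mod_cast hp)

lemma Good.step_nonneg (hQ : Q.Good) (p : ℕ) : 0 ≤ Q.step p :=
  div_nonneg hQ.S_pos.le (Nat.cast_nonneg p)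

lemma mul_step (hp : 0 < p) : p * Q.step p = Q.S :=
  mul_div_cancel₀ _ (by exact_mod_cast hp.ne')

lemma Good.weight_sum_le (hQ : Q.Good) (hp : 0 < p) (κ γ : ℝ) :
    ∑ r ∈ Finset.range p, |κ * Q.step p * rexp (γ * (r * Q.step p))| ≤
      |κ| * Q.S * rexp (|γ| * Q.S) := by
  have hs := hQ.step_pos hp
  have h : ∀ r ∈ Finset.range p, |κ * Q.step p * rexp (γ * (r * Q.step p))| ≤
      |κ| * Q.step p * rexp (|γ| * Q.S) := fun r hr => by
    rw [abs_mul, abs_mul, abs_of_pos hs, Real.abs_exp]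
    have h1 : (r : ℝ) * Q.step p ≤ Q.S := by
      rw [← Q.mul_step hp]
      exact mul_le_mul_of_nonneg_right (by exact_mod_cast (Finset.mem_range.1 hr).le) hs.le
    refine mul_le_mul_of_nonneg_left (Real.exp_le_exp.2 ?_) (by positivity)
    exact (mul_le_mul_of_nonneg_right (le_abs_self γ) (by positivity)).trans
      (mul_le_mul_of_nonneg_left h1 (abs_nonneg _))
  refine (sum_le_sum h).trans (le_of_eq ?_)
  rw [sum_const, card_range, nsmul_eq_mul, ← Q.mul_step hp]
  ring

lemma field_time (Q : Model n) : atHeight (Q.v 1) 1 0 = Q.v 1 0 := rfl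

lemma field_last (Q : Model n) : atHeight (Q.v 1) 1 (Fin.last (n + 1)) = 1 := by simp

lemma Good.add_field_mem (hQ : Q.Good) {T : ℝ} {z : Pt (n + 2)} {r : ℝ} (hr : 0 ≤ r) :
    (z ∈ intDomain n T → z + r • atHeight (Q.v 1) 1 ∈ intDomain n T) ∧
      (z ∈ closedDomain n T → z + r • atHeight (Q.v 1) 1 ∈ closedDomain n T) := by
  have h := mul_nonpos_of_nonneg_of_nonpos hr hQ.v1_neg.le
  constructor
  all_goals
    rintro ⟨h1, h2⟩
    refine ⟨?_, ?_⟩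
    · show z 0 + r * atHeight (Q.v 1) 1 0 < T
      rw [field_time]; linarith
  · show 0 < z _ + r * atHeight (Q.v 1) 1 _
    rw [field_last]; linarith
  · show 0 ≤ z _ + r * atHeight (Q.v 1) 1 _
    rw [field_last]; linarith

lemma Good.preserves_int (hQ : Q.Good) (p : ℕ) : (Q.intPair p).Preserves (intDomain n Q.T) :=
  have h := fun r : ℕ => mul_nonneg (Nat.cast_nonneg r) (hQ.step_nonneg p)
  ⟨fun r _ hz => (hQ.add_field_mem (h r)).1 hz, fun r _ hz => (hQ.add_field_mem (h r)).1 hz⟩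

lemma Good.preserves_closed (hQ : Q.Good) (p : ℕ) : (Q.intPair p).Preserves (closedDomain n Q.T) :=
  have h := fun r : ℕ => mul_nonneg (Nat.cast_nonneg r) (hQ.step_nonneg p)
  ⟨fun r _ hz => (hQ.add_field_mem (h r)).2 hz, fun r _ hz => (hQ.add_field_mem (h r)).2 hz⟩

lemma Good.bdry_le (hQ : Q.Good) (p r : ℕ) :
    (Q.bdryPair p).p r 0 ≤ 0 ∧ (Q.bdryPair p).q r 0 ≤ 0 := by
  have h := mul_nonneg (Nat.cast_nonneg (α := ℝ) r) (hQ.step_nonneg p)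
  have h0 := hQ.v0_pos
  have h1 := hQ.v1_neg
  have h2 := hQ.v2_pos
  exact ⟨mul_nonpos_of_nonneg_of_nonpos h (by show Q.v 1 0 - Q.v 0 0 ≤ 0; linarith),
    mul_nonpos_of_nonneg_of_nonpos h (by show Q.v 1 0 - Q.v 2 0 ≤ 0; linarith)⟩

lemma Good.preserves_bdry (hQ : Q.Good) (p : ℕ) : (Q.bdryPair p).Preserves (bΩ n Q.T) :=
  ⟨fun r z (hz : z 0 < Q.T) => by
      show z 0 + (Q.bdryPair p).p r 0 < Q.T
      linarith [(hQ.bdry_le p r).1],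
    fun r z (hz : z 0 < Q.T) => by
      show z 0 + (Q.bdryPair p).q r 0 < Q.T
      linarith [(hQ.bdry_le p r).2]⟩

lemma transport_add (v : Pt (n + 1)) (c ε : ℝ) (a : Fn (n + 1)) (x : Cyl (n + 2)) (θ : ℝ) :
    transport v c ε a (x + (0, θ)) =
      ε * rexp (-c * x.1 (Fin.last (n + 1))) * a (projL v x + (0, θ)) := by
  have h : projL v (x + (0, θ)) = projL v x + (0, θ) := by
    rw [map_add]; congr 1
    refine Prod.ext (funext fun i => ?_) rfl
    simp [projL_apply]
  rw [transport, h, Prod.fst_add, add_zero, mul_assoc]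

lemma prepAvg_transport (v : Pt (n + 1)) (c ε : ℝ) (N : ℤ) (a : Fn (n + 1)) (x : Cyl (n + 2)) :
    prepAvg N (transport v c ε a) x =
      ε * rexp (-c * x.1 (Fin.last (n + 1))) * prepAvg N a (projL v x) := by
  simp only [prepAvg, transport_add, ← mul_sum]
  ring

/-- The trace of the discretised outgoing profile. -/
lemma tau_lift (p : ℕ) (a : Fn (n + 1)) (q : Cyl (n + 1)) :
    Q.tau p a (lift 0 q) = (Q.bdryPair p).pairing a a q := by
  rw [tau, PairData.pairing, PairData.pairing]
  refine sum_congr rfl fun r _ => ?_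
  simp only [mul_sum]
  refine sum_congr rfl fun l _ => ?_
  set s : ℝ := (r : ℝ) * Q.step p with hs
  have hx : ∀ θ, (lift 0 q + (((Q.intPair p).p r), θ) : Cyl (n + 2)) =
      lift s (q + (s • Q.v 1, 0)) + (0, θ) := fun θ => by
    refine Prod.ext (funext fun i => ?_) (by simp [lift])
    refine Fin.lastCases ?_ (fun i => ?_) i
    · simp [lift, intPair, hs]
    · simp [lift, intPair, atHeight, hs]
  have hp : ∀ m θ, (projL (Q.v m) (lift s (q + (s • Q.v 1, 0)) + (0, θ)) : Cyl (n + 1)) =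
      q + (s • (Q.v 1 - Q.v m), θ) := fun m θ => by
    refine Prod.ext (funext fun i => ?_) (by simp [projL_apply, lift])
    simp [projL_apply, lift, atHeight]; ring
  have hl : ∀ θ : ℝ, (lift s (q + (s • Q.v 1, 0)) + (0, θ) : Cyl (n + 2)).1 (Fin.last (n + 1)) = s :=
    fun θ => by simp [lift]
  have hq : (Q.intPair p).q r = (Q.intPair p).p r := rfl
  rw [hq, hx, hx, sig0, sig2, prepAvg_transport, hl, hp, transport, hl, hp]
  have e : rexp ((Q.c 0 - Q.c 1 - Q.c 3) * s) =
      rexp (Q.c 0 * s) * (rexp (-Q.c 1 * s) * rexp (-Q.c 3 * s)) := by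
    rw [← Real.exp_add, ← Real.exp_add]; congr 1; ring
  simp only [intPair, bdryPair, PairData.ratio, PairData.mesh, ← hs, e]
  ring

lemma tau_eq (p : ℕ) (a : Fn (n + 1)) (x : Cyl (n + 2)) :
    Q.tau p a x = ∑ r ∈ Finset.range p, Q.c 2 * Q.step p * rexp (Q.c 0 * (r * Q.step p)) *
      Q.angular p a (x + (((r : ℝ) * Q.step p) • atHeight (Q.v 1) 1, 0)) := by
  rw [tau, PairData.pairing]
  refine sum_congr rfl fun r _ => ?_
  simp only [intPair, angular, PairData.ratio, PairData.mesh, add_assoc, Prod.mk_add_mk, add_zero,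
    zero_add]

/-- The discrete outgoing transport equation. -/
lemma tau_sub (p : ℕ) (a : Fn (n + 1)) (x : Cyl (n + 2)) :
    Q.tau p a x - rexp (Q.c 0 * Q.step p) *
        Q.tau p a (x + Q.step p • (atHeight (Q.v 1) 1, 0)) =
      Q.c 2 * Q.step p * (Q.angular p a x - rexp (Q.c 0 * (p * Q.step p)) *
        Q.angular p a (x + ((p * Q.step p) • atHeight (Q.v 1) 1, 0))) := by
  set g : ℕ → ℝ := fun r => Q.c 2 * Q.step p * rexp (Q.c 0 * (r * Q.step p)) *
      Q.angular p a (x + (((r : ℝ) * Q.step p) • atHeight (Q.v 1) 1, 0)) with hg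
  have h1 : rexp (Q.c 0 * Q.step p) * Q.tau p a (x + Q.step p • (atHeight (Q.v 1) 1, 0)) =
      ∑ r ∈ Finset.range p, g (r + 1) := by
    rw [tau_eq, mul_sum]
    refine sum_congr rfl fun r _ => ?_
    have e1 : x + Q.step p • (atHeight (Q.v 1) 1, 0) + (((r : ℝ) * Q.step p) • atHeight (Q.v 1) 1, 0) =
        x + ((((r + 1 : ℕ) : ℝ) * Q.step p) • atHeight (Q.v 1) 1, 0) := by
      refine Prod.ext (funext fun i => ?_) (by simp)
      simp; ring
    have e2 : rexp (Q.c 0 * (((r + 1 : ℕ) : ℝ) * Q.step p)) =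
        rexp (Q.c 0 * Q.step p) * rexp (Q.c 0 * (r * Q.step p)) := by
      rw [← Real.exp_add]; congr 1; push_cast; ring
    rw [hg]
    simp only
    rw [e1, e2]; ring
  rw [h1, tau_eq, ← sum_sub_distrib, Finset.sum_range_sub' g]
  simp only [hg, Nat.cast_zero, zero_mul, mul_zero, Real.exp_zero, zero_smul, Prod.mk_zero_zero, add_zero]
  ring

lemma transport_eq_zero {v : Pt (n + 1)} (hv : 0 < v 0) (c ε : ℝ)
    (ha : ∀ x : Cyl (n + 1), x.1 0 ≤ 0 → a x = 0) (h0 : x.1 0 ≤ 0)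
    (h1 : 0 ≤ x.1 (Fin.last (n + 1))) : transport v c ε a x = 0 := by
  rw [transport, ha _ (by rw [projL_time]; nlinarith), mul_zero, mul_zero]

lemma Good.angular_eq_zero (hQ : Q.Good) (p : ℕ)
    (ha : ∀ x : Cyl (n + 1), x.1 0 ≤ 0 → a x = 0) (h0 : x.1 0 ≤ 0)
    (h1 : 0 ≤ x.1 (Fin.last (n + 1))) : Q.angular p a x = 0 := by
  refine Finset.sum_eq_zero fun l _ => ?_
  have : Q.sig2 a (x + (0, 2 * π / p * l)) = 0 :=
    transport_eq_zero hQ.v2_pos _ _ ha (by simpa using h0) (by simpa using h1)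
  rw [this, mul_zero, mul_zero]

lemma Good.tau_eq_zero (hQ : Q.Good) (p : ℕ)
    (ha : ∀ x : Cyl (n + 1), x.1 0 ≤ 0 → a x = 0) (h0 : x.1 0 ≤ 0)
    (h1 : 0 ≤ x.1 (Fin.last (n + 1))) : Q.tau p a x = 0 := by
  rw [tau_eq]
  refine Finset.sum_eq_zero fun r _ => ?_
  have h := mul_nonneg (Nat.cast_nonneg (α := ℝ) r) (hQ.step_nonneg p)
  rw [hQ.angular_eq_zero p ha, mul_zero]
  · show x.1 0 + _ * atHeight (Q.v 1) 1 0 ≤ 0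
    rw [field_time]
    linarith [mul_nonpos_of_nonneg_of_nonpos h hQ.v1_neg.le]
  · show 0 ≤ x.1 _ + _ * atHeight (Q.v 1) 1 _
    rw [field_last]; linarith

/-- The difference quotient of `tau` along the outgoing field: the sum telescopes, and the term at its
far end vanishes because the characteristic of length `S` has reached `t ≤ 0`. -/
lemma Good.tau_quot (hQ : Q.Good) (hp : 0 < p)
    (ha : ∀ x : Cyl (n + 1), x.1 0 ≤ 0 → a x = 0) (hx : x.1 ∈ intDomain n Q.T) :
    (Q.tau p a (x + Q.step p • (atHeight (Q.v 1) 1, 0)) - Q.tau p a x) / Q.step p =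
      (rexp (-Q.c 0 * Q.step p) - 1) / Q.step p * Q.tau p a x -
        Q.c 2 * rexp (-Q.c 0 * Q.step p) * Q.angular p a x := by
  have hs := (hQ.step_pos hp).ne'
  have h := Q.tau_sub p a x
  rw [Q.mul_step hp, hQ.angular_eq_zero p ha (x := x + (Q.S • atHeight (Q.v 1) 1, 0)), mul_zero,
    sub_zero] at h
  · have e : rexp (-Q.c 0 * Q.step p) * rexp (Q.c 0 * Q.step p) = 1 := by
      rw [← Real.exp_add]; simp
    generalize rexp (-Q.c 0 * Q.step p) = E at e ⊢
    generalize rexp (Q.c 0 * Q.step p) = E' at e h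
    field_simp
    linear_combination (-E) * h - Q.tau p a (x + Q.step p • (atHeight (Q.v 1) 1, 0)) * e
  · show x.1 0 + Q.S * atHeight (Q.v 1) 1 0 ≤ 0
    rw [field_time]; linarith [hx.1, hQ.T_le]
  · show 0 ≤ x.1 _ + Q.S * atHeight (Q.v 1) 1 _
    rw [field_last]; linarith [hx.2, hQ.S_pos]

end Model
end Model

/-! ### Uniformly bounded families and their limits -/

section Family
variable {n k : ℕ}
variable {v : Pt (n + 1)}

/-- Subsequential pointwise limits on a convex set, extended by zero. -/
lemma exists_limit_of_bounds {V : Set (Pt k)} (hV : Convex ℝ V) {u : ℕ → Fn k}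
    (hu : ∀ j, SmoothPer (u j)) {A : ℝ} (h : ∀ j, DerivLE V 1 (u j) A) :
    ∃ φ : ℕ → ℕ, StrictMono φ ∧ ∃ v : Fn k, PeriodicTheta v ∧
      ∀ x : Cyl k, x.1 ∈ V → Tendsto (fun j => u (φ j) x) atTop (𝓝 (v x)) := by
  have hV' : Convex ℝ {x : Cyl k | x.1 ∈ V} := hV.linear_preimage (LinearMap.fst ℝ _ _)
  obtain ⟨φ, hφ, hl⟩ := exists_subseq_tendsto (V := {x : Cyl k | x.1 ∈ V})
    (fun j x hx => h j [] (by simp) x hx)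
    fun j x hx y hy => abs_sub_le_of_dv (hu j) hV' (fun i x hx => h j [i] (by simp) x hx) hx hy
  classical
  refine ⟨φ, hφ, fun x => if x.1 ∈ V then limUnder atTop (fun j => u (φ j) x) else 0,
    fun z θ => ?_, fun x hx => ?_⟩
  · simp only [(hu _).periodic z θ]
  · simp only [if_pos hx]
    exact tendsto_nhds_limUnder (hl x hx)

/-- A family of smooth boundary data with uniform bounds of order `K` in the sup norm and of order
`s` in `L²`, and with meshes that tend to zero. -/
structure Family (Q : Model n) (K s : ℕ) (p : ℕ → ℕ) (u : ℕ → Fn (n + 1)) : Prop where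
  smooth : ∀ j, SmoothPer (u j)
  past : ∀ j, ∀ x : Cyl (n + 1), x.1 0 ≤ 0 → u j x = 0
  sup : ∃ A, 0 ≤ A ∧ ∀ j, DerivLE (bΩ n Q.T) K (u j) A
  l2 : ∃ ρ, 0 ≤ ρ ∧ ∀ j, DerivL2LE (bΩ n Q.T) s (u j) (ofReal ρ)
  pos : ∀ j, 0 < p j
  step_le : ∀ j, Q.step (p j) ≤ 1
  count : Tendsto p atTop atTop

namespace Family
variable {Q : Model n} {K s : ℕ} {p : ℕ → ℕ} {u : ℕ → Fn (n + 1)}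

lemma comp (h : Family Q K s p u) {φ : ℕ → ℕ} (hφ : StrictMono φ) :
    Family Q K s (p ∘ φ) (u ∘ φ) where
  smooth _ := h.smooth _
  past _ := h.past _
  sup := let ⟨A, hA, H⟩ := h.sup; ⟨A, hA, fun j => H (φ j)⟩
  l2 := let ⟨A, hA, H⟩ := h.l2; ⟨A, hA, fun j => H (φ j)⟩
  pos _ := h.pos _
  step_le _ := h.step_le _
  count := h.count.comp hφ.tendsto_atTop

lemma step_lim (h : Family Q K s p u) : Tendsto (fun j => Q.step (p j)) atTop (𝓝 0) :=
  (tendsto_natCast_atTop_atTop.comp h.count).const_div_atTop _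

lemma mesh_lim (h : Family Q K s p u) : Tendsto (fun j => 2 * π / (p j : ℝ)) atTop (𝓝 0) :=
  (tendsto_natCast_atTop_atTop.comp h.count).const_div_atTop _

lemma sup_transport (h : Family Q K s p u) (hv : 0 < v 0) (c ε : ℝ) :
    ∃ A, 0 ≤ A ∧ ∀ j, DerivLE (closedDomain n Q.T) K (transport v c ε (u j)) A := by
  obtain ⟨A, hA, H⟩ := h.sup
  exact ⟨_, mul_nonneg (transBound_nonneg _ _ _ _) (mul_nonneg
    (pow_nonneg (zero_le_one.trans (one_le_transConst v c)) K) hA),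
    fun j => derivLE_transport hv hA (h.smooth j) (h.past j) (H j)⟩

lemma l2_transport (h : Family Q K s p u) (hv : 0 < v 0) (c ε : ℝ) :
    ∃ R : ℝ≥0∞, R ≠ ⊤ ∧ ∀ j, DerivL2LE (intDomain n Q.T) s (transport v c ε (u j)) R := by
  obtain ⟨ρ, hρ, H⟩ := h.l2
  refine ⟨_, ?_, fun j => derivL2LE_transport hv hρ (h.smooth j) (h.past j) (H j)⟩
  exact ENNReal.mul_ne_top (ENNReal.mul_ne_top ofReal_ne_top
    (ENNReal.rpow_ne_top_of_nonneg (by norm_num) ofReal_ne_top)) ofReal_ne_top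

lemma intDomain_subset {z : Pt (n + 2)} {T : ℝ} (hz : z ∈ intDomain n T) : z ∈ closedDomain n T :=
  ⟨hz.1, hz.2.le⟩

lemma smooth_tau (h : Family Q K s p u) (j : ℕ) : SmoothPer (Q.tau (p j) (u j)) :=
  (PairData.leibniz_pairing _).smooth (smoothPer_transport (h.smooth j))
    (smoothPer_transport (h.smooth j))

lemma sup_sig (hQ : Q.Good) (h : Family Q K s p u) : ∃ A, 0 ≤ A ∧ ∀ j,
    DerivLE (closedDomain n Q.T) K (Q.sig0 (u j)) A ∧
      DerivLE (closedDomain n Q.T) K (Q.sig2 (u j)) A := by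
  obtain ⟨A, hA, H⟩ := h.sup_transport hQ.v0_pos (Q.c 1) (Q.ε 0)
  obtain ⟨A', hA', H'⟩ := h.sup_transport hQ.v2_pos (Q.c 3) (Q.ε 2)
  exact ⟨max A A', le_max_of_le_left hA, fun j =>
    ⟨fun I hI x hx => (H j I hI x hx).trans (le_max_left _ _),
      fun I hI x hx => (H' j I hI x hx).trans (le_max_right _ _)⟩⟩

lemma sup_tau (hQ : Q.Good) (h : Family Q K s p u) : ∃ A, ∀ j,
    DerivLE (closedDomain n Q.T) K (Q.tau (p j) (u j)) A := by
  obtain ⟨A, hA, H⟩ := h.sup_sig hQ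
  exact ⟨_, fun j => PairData.derivLE_pairing (hQ.intPair (h.pos j)) (hQ.preserves_closed (p j))
    (hQ.weight_sum_le (h.pos j) _ _) hA (smoothPer_transport (h.smooth j))
    (smoothPer_transport (h.smooth j)) (H j).1 (H j).2⟩

lemma l2_tau (hQ : Q.Good) (h : Family Q K s p u) (hs : s ≤ 2 * K - 1) : ∃ R : ℝ≥0∞, R ≠ ⊤ ∧ ∀ j,
    DerivL2LE (intDomain n Q.T) s (Q.tau (p j) (u j)) R := by
  obtain ⟨A, hA, H⟩ := h.sup_sig hQ
  obtain ⟨R, hR, H1⟩ := h.l2_transport hQ.v0_pos (Q.c 1) (Q.ε 0)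
  obtain ⟨R', hR', H2⟩ := h.l2_transport hQ.v2_pos (Q.c 3) (Q.ε 2)
  refine ⟨_, ?_, fun j => PairData.derivL2LE_pairing (ρ := max R R') (hQ.intPair (h.pos j))
    (measurableSet_intDomain n Q.T) (hQ.preserves_int (p j)) (hQ.weight_sum_le (h.pos j) _ _)
    (smoothPer_transport (h.smooth j)) (smoothPer_transport (h.smooth j)) hs
    (fun J hJ x hx => (H j).1 J hJ x (intDomain_subset hx))
    (fun J hJ x hx => (H j).2 J hJ x (intDomain_subset hx))
    (fun J hJ => (H1 j J hJ).trans (le_max_left _ _))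
    (fun J hJ => (H2 j J hJ).trans (le_max_right _ _))⟩
  have hm : max R R' ≠ ⊤ := (max_lt hR.lt_top hR'.lt_top).ne
  exact ENNReal.mul_ne_top (by simp) (ENNReal.mul_ne_top ofReal_ne_top
    (ENNReal.mul_ne_top ofReal_ne_top hm))

lemma sup_bdry (hQ : Q.Good) (h : Family Q K s p u) : ∃ A, ∀ j,
    DerivLE (bΩ n Q.T) K ((Q.bdryPair (p j)).pairing (u j) (u j)) A := by
  obtain ⟨A, hA, H⟩ := h.sup
  exact ⟨_, fun j => PairData.derivLE_pairing (hQ.bdryPair (h.pos j)) (hQ.preserves_bdry (p j))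
    (hQ.weight_sum_le (h.pos j) _ _) hA (h.smooth j) (h.smooth j) (H j) (H j)⟩

lemma l2_bdry (hQ : Q.Good) (h : Family Q K s p u) (hs : s ≤ 2 * K - 1) : ∃ R : ℝ≥0∞, R ≠ ⊤ ∧ ∀ j,
    DerivL2LE (bΩ n Q.T) s ((Q.bdryPair (p j)).pairing (u j) (u j)) R := by
  obtain ⟨A, hA, H⟩ := h.sup
  obtain ⟨ρ, hρ, H1⟩ := h.l2
  refine ⟨_, ?_, fun j => PairData.derivL2LE_pairing (hQ.bdryPair (h.pos j))
    (measurableSet_bdryDomain Q.T) (hQ.preserves_bdry (p j)) (hQ.weight_sum_le (h.pos j) _ _)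
    (h.smooth j) (h.smooth j) hs (H j) (H j) (H1 j) (H1 j)⟩
  exact ENNReal.mul_ne_top (by simp) (ENNReal.mul_ne_top ofReal_ne_top
    (ENNReal.mul_ne_top ofReal_ne_top ofReal_ne_top))

end Family

/-- A convergent family, together with its limits `a` and `τ`. -/
structure FamilyLimit (Q : Model n) (K s : ℕ) (p : ℕ → ℕ) (u : ℕ → Fn (n + 1))
    (a : Fn (n + 1)) (τ : Fn (n + 2)) : Prop extends Family Q K s p u where
  good : Q.Good
  two_le : 2 ≤ K
  one_le : 1 ≤ s
  le_two : s ≤ 2 * K - 1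
  a_per : PeriodicTheta a
  τ_per : PeriodicTheta τ
  a_lim : ∀ x : Cyl (n + 1), x.1 0 < Q.T → Tendsto (fun j => u j x) atTop (𝓝 (a x))
  τ_lim : ∀ x : Cyl (n + 2), x.1 ∈ closedDomain n Q.T →
    Tendsto (fun j => Q.tau (p j) (u j) x) atTop (𝓝 (τ x))

lemma convex_bdryDomain (T : ℝ) : Convex ℝ (bΩ n T) :=
  convex_halfSpace_lt (IsLinearMap.mk (fun _ _ => rfl) (fun _ _ => rfl)) T

lemma convex_closedDomain (T : ℝ) : Convex ℝ (closedDomain n T) :=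
  (convex_halfSpace_lt (f := fun z : Pt (n + 2) => z 0)
    (IsLinearMap.mk (fun _ _ => rfl) (fun _ _ => rfl)) T).inter
    (convex_halfSpace_ge (f := fun z : Pt (n + 2) => z (Fin.last (n + 1)))
    (IsLinearMap.mk (fun _ _ => rfl) (fun _ _ => rfl)) 0)

lemma Family.exists_limit {Q : Model n} (hQ : Q.Good) {K s : ℕ} (hK : 2 ≤ K) (hs1 : 1 ≤ s)
    (hs : s ≤ 2 * K - 1) {p : ℕ → ℕ} {u : ℕ → Fn (n + 1)} (h : Family Q K s p u) :
    ∃ φ : ℕ → ℕ, StrictMono φ ∧ ∃ a τ, FamilyLimit Q K s (p ∘ φ) (u ∘ φ) a τ := by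
  obtain ⟨A, hA, H⟩ := h.sup
  obtain ⟨φ, hφ, a, ha, hal⟩ := exists_limit_of_bounds (convex_bdryDomain Q.T) h.smooth
    fun j I hI x hx => H j I (by omega) x hx
  have h' := h.comp hφ
  obtain ⟨A', H'⟩ := h'.sup_tau hQ
  obtain ⟨φ', hφ', τ, hτ, hτl⟩ := exists_limit_of_bounds (convex_closedDomain Q.T) h'.smooth_tau
    fun j I hI x hx => H' j I (by omega) x hx
  exact ⟨φ ∘ φ', hφ.comp hφ', a, τ, { (h'.comp hφ') with
    good := hQ, two_le := hK, one_le := hs1, le_two := hs, a_per := ha, τ_per := hτ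
    a_lim := fun x hx => (hal x hx).comp hφ'.tendsto_atTop
    τ_lim := hτl }⟩

end Family

/-! ### Regularity, traces and incoming equations of the limit -/

section FamilyLimit
variable {n : ℕ} {Q : Model n} {K s : ℕ} {p : ℕ → ℕ} {u : ℕ → Fn (n + 1)}
  {a : Fn (n + 1)} {τ : Fn (n + 2)} {v : Pt (n + 1)}

lemma periodicTheta_transport {c ε : ℝ} (ha : PeriodicTheta a) :
    PeriodicTheta (transport v c ε a) := fun z θ => by
  simp only [transport, projL_apply]
  rw [ha]

lemma Model.angular_eq (Q : Model n) (p : ℕ) (a : Fn (n + 1)) : Q.angular p a =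
    PairData.pairing ⟨Q.N 0, Q.N 2, p, 1, 1, 0, 0⟩ (Q.sig0 a) (Q.sig2 a) := by
  funext x
  simp [Model.angular, PairData.pairing, PairData.mesh, PairData.ratio]

namespace FamilyLimit

lemma transport_lim (h : FamilyLimit Q K s p u a τ) (hv : 0 < v 0) (c ε : ℝ)
    {x : Cyl (n + 2)} (hx : x.1 ∈ closedDomain n Q.T) :
    Tendsto (fun j => transport v c ε (u j) x) atTop (𝓝 (transport v c ε a x)) := by
  refine ((h.a_lim _ ?_).const_mul _).const_mul _
  rw [projL_time]
  nlinarith [hx.1, hx.2]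

lemma approx_a (h : FamilyLimit Q K s p u a τ) : ApproxBy (bΩ n Q.T) u a := let ⟨A, _, H⟩ := h.sup
  ⟨h.smooth, h.a_per, ⟨A, fun j x hx => H j [] (Nat.zero_le _) x hx⟩, h.a_lim⟩

lemma approx_transport (h : FamilyLimit Q K s p u a τ) (hv : 0 < v 0) (c ε : ℝ) :
    ApproxBy (intDomain n Q.T) (fun j => transport v c ε (u j)) (transport v c ε a) :=
  let ⟨A, _, H⟩ := h.sup_transport hv c ε
  ⟨fun j => smoothPer_transport (h.smooth j), periodicTheta_transport h.a_per,
    ⟨A, fun j x hx => H j [] (Nat.zero_le _) x (Family.intDomain_subset hx)⟩,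
    fun _ hx => h.transport_lim hv c ε (Family.intDomain_subset hx)⟩

lemma approx_tau (h : FamilyLimit Q K s p u a τ) :
    ApproxBy (intDomain n Q.T) (fun j => Q.tau (p j) (u j)) τ :=
  let ⟨A, H⟩ := h.sup_tau h.good
  ⟨h.smooth_tau, h.τ_per, ⟨A, fun j x hx => H j [] (Nat.zero_le _) x (Family.intDomain_subset hx)⟩,
    fun x hx => h.τ_lim x (Family.intDomain_subset hx)⟩

lemma lift_mem {T : ℝ} {q : Cyl (n + 1)} (hq : q.1 ∈ bΩ n T) :
    (lift 0 q).1 ∈ closedDomain n T := ⟨hq, by simp [lift]⟩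

lemma approx_bdry (h : FamilyLimit Q K s p u a τ) : ApproxBy (bΩ n Q.T)
    (fun j => (Q.bdryPair (p j)).pairing (u j) (u j)) (fun q => τ (lift 0 q)) :=
  let ⟨A, H⟩ := h.sup_bdry h.good
  ⟨fun j => (PairData.leibniz_pairing _).smooth (h.smooth j) (h.smooth j), fun _ _ => h.τ_per _ _,
    ⟨A, fun j x hx => H j [] (Nat.zero_le _) x hx⟩,
    fun q hq => (h.τ_lim (lift 0 q) (lift_mem hq)).congr fun _ => Model.tau_lift _ _ q⟩

lemma memSobolev_a (h : FamilyLimit Q K s p u a τ) : MemSobolev (bΩ n Q.T) s a :=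
  let ⟨_, _, H⟩ := h.l2
  h.approx_a.memSobolev (measurableSet_bdryDomain _) ofReal_ne_top H

lemma memSobolev_smul_a (h : FamilyLimit Q K s p u a τ) (ε : ℝ) :
    MemSobolev (bΩ n Q.T) s (fun q => ε * a q) := by
  obtain ⟨ρ, _, H⟩ := h.l2
  obtain ⟨A, hA, H'⟩ := h.sup
  have : ApproxBy (bΩ n Q.T) (fun j q => ε * u j q) (fun q => ε * a q) :=
    ⟨fun j => (h.smooth j).const_mul ε, fun z θ => by simp only [h.a_per z θ], ⟨|ε| * A, fun j x hx => by
      rw [abs_mul]; exact mul_le_mul_of_nonneg_left (H' j [] (Nat.zero_le _) x hx) (abs_nonneg _)⟩,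
      fun x hx => (h.a_lim x hx).const_mul ε⟩
  refine this.memSobolev (measurableSet_bdryDomain _)
    (R := ofReal |ε| * ofReal ρ) (by finiteness) fun j I hI => ?_
  rw [dw_const_mul (h.smooth j)]
  refine (PairData.eLpNorm_mul_le_of_bound (measurableSet_bdryDomain _) (A := |ε|) fun x _ => le_rfl).trans ?_
  gcongr
  exact H j I hI

lemma memSobolev_transport (h : FamilyLimit Q K s p u a τ) (hv : 0 < v 0)
    (c ε : ℝ) : MemSobolev (intDomain n Q.T) s (transport v c ε a) :=
  let ⟨_, hR, H⟩ := h.l2_transport hv c ε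
  (h.approx_transport hv c ε).memSobolev (measurableSet_intDomain _ _) hR H

lemma memSobolev_tau (h : FamilyLimit Q K s p u a τ) : MemSobolev (intDomain n Q.T) s τ :=
  let ⟨_, hR, H⟩ := h.l2_tau h.good h.le_two
  h.approx_tau.memSobolev (measurableSet_intDomain _ _) hR H

lemma memSobolev_bdry (h : FamilyLimit Q K s p u a τ) :
    MemSobolev (bΩ n Q.T) s (fun q => τ (lift 0 q)) :=
  let ⟨_, hR, H⟩ := h.l2_bdry h.good h.le_two
  h.approx_bdry.memSobolev (measurableSet_bdryDomain _) hR H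

lemma isTrace_transport (h : FamilyLimit Q K s p u a τ) (hv : 0 < v 0)
    (c ε : ℝ) : IsTrace Q.T (transport v c ε a) (fun q => ε * a q) := by
  obtain ⟨R, hR, H⟩ := h.l2_transport hv c ε
  obtain ⟨A, hA, H'⟩ := h.sup
  refine isTrace_of_approx (h.approx_transport hv c ε) ?_ hR fun j => H j _ h.one_le
  simp only [transport_lift_zero]
  exact ⟨fun j => (h.smooth j).const_mul ε, fun z θ => by simp only [h.a_per z θ],
    ⟨|ε| * A, fun j x hx => by
      rw [abs_mul]; exact mul_le_mul_of_nonneg_left (H' j [] (Nat.zero_le _) x hx) (abs_nonneg _)⟩,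
    fun x hx => (h.a_lim x hx).const_mul ε⟩

lemma isTrace_tau (h : FamilyLimit Q K s p u a τ) : IsTrace Q.T τ (fun q => τ (lift 0 q)) := by
  obtain ⟨R, hR, H⟩ := h.l2_tau h.good h.le_two
  refine isTrace_of_approx h.approx_tau ?_ hR fun j => H j _ h.one_le
  simp only [Model.tau_lift]
  exact h.approx_bdry

lemma eq_transport (h : FamilyLimit Q K s p u a τ) (hv : 0 < v 0) (c ε : ℝ) :
    HasWeakDeriv (intDomain n Q.T) 1 ![(atHeight v 1, 0)] (transport v c ε a)
      (fun x => -(c * transport v c ε a x)) :=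
  let ⟨_, hR, H⟩ := h.l2_transport hv c ε
  hasWeakDeriv_transport h.smooth (h.approx_transport hv c ε) hR fun j => H j [] (Nat.zero_le _)

lemma vanishes_a (h : FamilyLimit Q K s p u a τ) : VanishesInPast (bΩ n Q.T) a :=
  ae_cylMeasure_of_forall (measurableSet_bdryDomain _) fun x hx h0 =>
    tendsto_nhds_unique (h.a_lim x hx) (tendsto_const_nhds.congr fun j => (h.past j x h0).symm)

lemma vanishes_transport (h : FamilyLimit Q K s p u a τ) (hv : 0 < v 0)
    (c ε : ℝ) : VanishesInPast (intDomain n Q.T) (transport v c ε a) :=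
  ae_cylMeasure_of_forall (measurableSet_intDomain _ _) fun _ hx h0 =>
    tendsto_nhds_unique (h.transport_lim hv c ε (Family.intDomain_subset hx)) (tendsto_const_nhds.congr
      fun j => (Model.transport_eq_zero hv c ε (h.past j) h0 hx.2.le).symm)

lemma vanishes_tau (h : FamilyLimit Q K s p u a τ) : VanishesInPast (intDomain n Q.T) τ :=
  ae_cylMeasure_of_forall (measurableSet_intDomain _ _) fun x hx h0 =>
    tendsto_nhds_unique (h.τ_lim x (Family.intDomain_subset hx)) (tendsto_const_nhds.congr
      fun j => (h.good.tau_eq_zero _ (h.past j) h0 hx.2.le).symm)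

/-- The Fourier series of the first incoming profile converges absolutely. -/
lemma prepare_sig0 (h : FamilyLimit Q K s p u a τ) {z : Pt (n + 2)} (hz : z ∈ closedDomain n Q.T)
    (θ : ℝ) : prepare (Q.N 0) (Q.sig0 a) (z, θ) = prepAvg (Q.N 0) (Q.sig0 a) (z, θ) := by
  obtain ⟨A, hA, H⟩ := h.sup_sig h.good
  have hK := h.two_le
  have hl : ∀ θ, Tendsto (fun j => Q.sig0 (u j) (z, θ)) atTop (𝓝 (Q.sig0 a (z, θ))) := fun θ =>
    h.transport_lim h.good.v0_pos _ _ hz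
  have hsm : ∀ j, SmoothPer (Q.sig0 (u j)) := fun j => smoothPer_transport (h.smooth j)
  refine prepare_eq_prepAvg (periodicTheta_transport h.a_per) ?_ ?_ (h.good.N_ne 0) θ
  · refine (LipschitzWith.of_dist_le' (K := A) fun θ θ' => ?_).continuous
    refine le_of_tendsto ((hl θ).dist (hl θ')) (.of_forall fun j => ?_)
    rw [Real.dist_eq, Real.dist_eq]
    exact abs_sub_le_of_dv_theta (hsm j) (fun θ => (H j).1 [none] (by simp; omega) (z, θ) hz) _ _
  · exact summable_coeffTheta hsm (fun j θ => (H j).1 [] (Nat.zero_le _) (z, θ) hz)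
      (fun j θ => (H j).1 [none, none] (by simpa using hK) (z, θ) hz) hl

/-- The integrand of the interaction integral is bounded and Lipschitz, uniformly. -/
lemma angular_integrand (h : FamilyLimit Q K s p u a τ) : ∃ A, 0 ≤ A ∧ ∀ j, ∀ x : Cyl (n + 2),
    x.1 ∈ closedDomain n Q.T → ∀ κ : ℝ,
      (∀ φ, |prepAvg (Q.N 0) (Q.sig0 (u j)) (x + (0, κ * φ))| ≤ A ∧ |Q.sig2 (u j) (x + (0, φ))| ≤ A) ∧
      ∀ φ φ', |prepAvg (Q.N 0) (Q.sig0 (u j)) (x + (0, κ * φ)) -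
          prepAvg (Q.N 0) (Q.sig0 (u j)) (x + (0, κ * φ'))| ≤ A * |κ| * |φ - φ'| ∧
        |Q.sig2 (u j) (x + (0, φ)) - Q.sig2 (u j) (x + (0, φ'))| ≤ A * |φ - φ'| := by
  obtain ⟨A, hA, H⟩ := h.sup_sig h.good
  have hK := h.two_le
  refine ⟨A, hA, fun j x hx κ => ?_⟩
  have e : ∀ φ : ℝ, x + (0, φ) = (x.1, x.2 + φ) := fun φ => Prod.ext (by simp) rfl
  have h1 := fun θ => And.intro ((H j).1 [] (Nat.zero_le _) (x.1, θ) hx) ((H j).2 [] (Nat.zero_le _) (x.1, θ) hx)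
  have h2 := fun θ => And.intro ((H j).1 [none] (by simp; omega) (x.1, θ) hx)
    ((H j).2 [none] (by simp; omega) (x.1, θ) hx)
  have hN := h.good.N_ne 0
  refine ⟨fun φ => ⟨?_, ?_⟩, fun φ φ' => ⟨?_, ?_⟩⟩
  · rw [e]; exact abs_prepAvg_le hN (fun θ => (h1 θ).1) _
  · rw [e]; exact (h1 _).2
  · rw [e, e]
    refine (prepAvg_sub_le (smoothPer_transport (h.smooth j)) hN (fun θ => (h2 θ).1) _ _).trans
      (le_of_eq ?_)
    rw [add_sub_add_left_eq_sub, ← mul_sub, abs_mul, mul_assoc]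
  · rw [e, e]
    refine (abs_sub_le_of_dv_theta (smoothPer_transport (h.smooth j)) (fun θ => (h2 θ).2) _ _).trans
      (le_of_eq ?_)
    rw [add_sub_add_left_eq_sub]

end FamilyLimit
end FamilyLimit

/-! ### The outgoing equation -/

section Outgoing
variable {n : ℕ} {Q : Model n} {K s : ℕ} {p : ℕ → ℕ} {u : ℕ → Fn (n + 1)}
  {a : Fn (n + 1)} {τ : Fn (n + 2)} {x : Cyl (n + 2)}

/-- The limit of the Riemann sums `Model.angular`. -/
def Model.angularLim (Q : Model n) (a : Fn (n + 1)) : Fn (n + 2) := fun x =>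
  ∫ φ in 0..2 * π, prepAvg (Q.N 0) (Q.sig0 a) (x + (0, (Q.N 2 : ℝ) / Q.N 0 * φ)) *
    Q.sig2 a (x + (0, φ))

lemma PeriodicTheta.add_right {k : ℕ} {f : Fn k} (hf : PeriodicTheta f) (z : Pt k) (θ φ : ℝ) :
    f (z, θ + 2 * π + φ) = f (z, θ + φ) := by rw [add_right_comm, hf]

lemma periodicTheta_prepAvg {k : ℕ} {f : Fn k} (hf : PeriodicTheta f) (N : ℤ) :
    PeriodicTheta (prepAvg N f) := fun z θ => by
  simp only [prepAvg, Prod.mk_add_mk, hf.add_right]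

namespace FamilyLimit

lemma smooth_angular (h : FamilyLimit Q K s p u a τ) (j : ℕ) : SmoothPer (Q.angular (p j) (u j)) := by
  rw [Model.angular_eq]
  exact (PairData.leibniz_pairing _).smooth (smoothPer_transport (h.smooth j)) (smoothPer_transport (h.smooth j))

lemma mesh_mul (h : FamilyLimit Q K s p u a τ) (j : ℕ) : p j * (2 * π / (p j : ℝ)) = 2 * π :=
  mul_div_cancel₀ _ (by exact_mod_cast (h.pos j).ne')

lemma prepAvg_lim (h : FamilyLimit Q K s p u a τ) (hx : x.1 ∈ closedDomain n Q.T) :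
    Tendsto (fun j => prepAvg (Q.N 0) (Q.sig0 (u j)) x) atTop (𝓝 (prepAvg (Q.N 0) (Q.sig0 a) x)) := by
  unfold prepAvg
  refine (tendsto_finsetSum _ fun i _ => ?_).const_mul _
  exact h.transport_lim h.good.v0_pos _ _ (by simpa using hx)

/-- The Riemann sums converge: the integrands are uniformly Lipschitz and converge pointwise. -/
lemma angular_lim (h : FamilyLimit Q K s p u a τ) (hx : x.1 ∈ closedDomain n Q.T) :
    Tendsto (fun j => Q.angular (p j) (u j) x) atTop (𝓝 (Q.angularLim a x)) := by
  obtain ⟨A, hA, H⟩ := h.angular_integrand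
  set κ : ℝ := (Q.N 2 : ℝ) / Q.N 0 with hκ
  have hmem : ∀ θ : ℝ, (x + (0, θ)).1 ∈ closedDomain n Q.T := fun θ => by simpa using hx
  refine tendsto_riemann (L := A * A + A * (A * |κ|)) (A := A * A)
    (g := fun j φ => prepAvg (Q.N 0) (Q.sig0 (u j)) (x + (0, κ * φ)) * Q.sig2 (u j) (x + (0, φ)))
    (fun j => ?_) (fun j φ φ' => ?_) (fun j φ => ?_) (fun φ => ?_)
    (fun j => by positivity) h.mesh_mul h.mesh_lim
  · have h1 := ((smoothPer_transport (h.smooth j)).prepAvg (Q.N 0) : SmoothPer (prepAvg (Q.N 0)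
      (Q.sig0 (u j)))).continuous
    have h2 := (smoothPer_transport (h.smooth j) : SmoothPer (Q.sig2 (u j))).continuous
    exact (h1.comp (by fun_prop)).mul (h2.comp (by fun_prop))
  · have h1 := (H j x hx κ).1
    have h2 := (H j x hx κ).2 φ φ'
    rw [← sub_add_sub_cancel (_ * _) (prepAvg (Q.N 0) (Q.sig0 (u j)) (x + (0, κ * φ)) *
      Q.sig2 (u j) (x + (0, φ'))), ← mul_sub, ← sub_mul]
    refine (abs_add_le _ _).trans ?_
    rw [abs_mul, abs_mul]
    have h3 := mul_le_mul (h1 φ).1 h2.2 (abs_nonneg _) hA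
    have h4 := mul_le_mul h2.1 (h1 φ').2 (abs_nonneg _) (by positivity)
    linarith
  · rw [abs_mul]
    exact mul_le_mul ((H j x hx κ).1 φ).1 ((H j x hx κ).1 φ).2 (abs_nonneg _) hA
  · exact (h.prepAvg_lim (hmem _)).mul (h.transport_lim h.good.v2_pos _ _ (hmem _))

lemma exists_angular_bound (h : FamilyLimit Q K s p u a τ) : ∃ C, ∀ j, ∀ x : Cyl (n + 2),
    x.1 ∈ closedDomain n Q.T → |Q.angular (p j) (u j) x| ≤ C := by
  obtain ⟨A, hA, H⟩ := h.sup_sig h.good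
  refine ⟨2 * π * 1 * (A * A), fun j x hx => ?_⟩
  rw [Model.angular_eq]
  exact PairData.abs_pairing_le (W := 1) ⟨h.good.N_ne 0, h.good.N_ne 2, h.pos j⟩
    ⟨fun r z hz => by simpa using hz, fun r z hz => by simpa using hz⟩ (by simp) hA hA
    ((H j).1 [] (Nat.zero_le _)) ((H j).2 [] (Nat.zero_le _)) x hx

lemma periodic_angularLim (h : FamilyLimit Q K s p u a τ) : PeriodicTheta (Q.angularLim a) := fun z θ => by
  have h1 : PeriodicTheta (prepAvg (Q.N 0) (Q.sig0 a)) :=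
    periodicTheta_prepAvg (periodicTheta_transport h.a_per) _
  have h2 : PeriodicTheta (Q.sig2 a) := periodicTheta_transport h.a_per
  simp only [Model.angularLim, Prod.mk_add_mk, h1.add_right, h2.add_right]

lemma approx_angular (h : FamilyLimit Q K s p u a τ) :
    ApproxBy (intDomain n Q.T) (fun j => Q.angular (p j) (u j)) (Q.angularLim a) :=
  let ⟨C, H⟩ := h.exists_angular_bound
  ⟨h.smooth_angular, h.periodic_angularLim, ⟨C, fun j x hx => H j x (Family.intDomain_subset hx)⟩,
    fun _ hx => h.angular_lim (Family.intDomain_subset hx)⟩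

lemma memLp_angularLim (h : FamilyLimit Q K s p u a τ) :
    MemLp (Q.angularLim a) 2 (vol (intDomain n Q.T)) := by
  obtain ⟨A, hA, H⟩ := h.sup_sig h.good
  obtain ⟨R, hR, H2⟩ := h.l2_transport h.good.v2_pos (Q.c 3) (Q.ε 2)
  refine h.approx_angular.memLp (measurableSet_intDomain _ _)
    (R := ofReal (2 * π * 1) * (ofReal A * R)) (by finiteness) fun j => ?_
  rw [Model.angular_eq]
  exact PairData.eLpNorm_pairing_le (W := 1) ⟨h.good.N_ne 0, h.good.N_ne 2, h.pos j⟩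
    (measurableSet_intDomain _ _)
    ⟨fun r z hz => by simpa using hz, fun r z hz => by simpa using hz⟩ (by simp)
    (smoothPer_transport (h.smooth j)) (smoothPer_transport (h.smooth j))
    (Or.inl ⟨fun x hx => (H j).1 [] (Nat.zero_le _) x (Family.intDomain_subset hx),
      H2 j [] (Nat.zero_le _)⟩)

lemma interaction_eq_angularLim (h : FamilyLimit Q K s p u a τ) (hx : x.1 ∈ closedDomain n Q.T) :
    interaction Q.N (Q.sig0 a) (Q.sig2 a) x = Q.angularLim a x :=
  interaction_eq (h.good.N_ne 0) h.good.N_eq (periodicTheta_transport h.a_per)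
    (periodicTheta_transport h.a_per) (h.prepare_sig0 hx) x.2

lemma coeff_lim (h : FamilyLimit Q K s p u a τ) :
    Tendsto (fun j => (rexp (-Q.c 0 * Q.step (p j)) - 1) / Q.step (p j)) atTop (𝓝 (-Q.c 0)) := by
  have hd : HasDerivAt (fun r : ℝ => rexp (-Q.c 0 * r)) (-Q.c 0) 0 := by
    simpa using ((hasDerivAt_id (0 : ℝ)).const_mul (-Q.c 0)).exp
  have := (hasDerivAt_iff_tendsto_slope_zero.1 hd).comp (tendsto_nhdsWithin_iff.2
    ⟨h.step_lim, Eventually.of_forall fun j => (h.good.step_pos (h.pos j)).ne'⟩)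
  refine this.congr fun j => ?_
  simp only [Function.comp, zero_add, mul_zero, Real.exp_zero, smul_eq_mul]
  rw [div_eq_inv_mul]

/-- The limit of `Model.Good.tau_quot`. -/
lemma eq_tau (h : FamilyLimit Q K s p u a τ) :
    HasWeakDeriv (intDomain n Q.T) 1 ![(atHeight (Q.v 1) 1, 0)] τ
      (fun x => -(Q.c 0 * τ x + Q.c 2 * interaction Q.N (Q.sig0 a) (Q.sig2 a) x)) := by
  have hU := measurableSet_intDomain n Q.T
  have hae : (fun x => -(Q.c 0 * τ x + Q.c 2 * interaction Q.N (Q.sig0 a) (Q.sig2 a) x)) =ᵐ[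
      vol (intDomain n Q.T)] fun x => -(Q.c 0 * τ x + Q.c 2 * Q.angularLim a x) :=
    ae_cylMeasure_of_forall hU fun x hx => by
      simp only [h.interaction_eq_angularLim (Family.intDomain_subset hx)]
  obtain ⟨R, hR, H2⟩ := h.l2_tau h.good h.le_two
  obtain ⟨A, H⟩ := h.sup_tau h.good
  obtain ⟨C, H'⟩ := h.exists_angular_bound
  have hτ : MemLp τ 2 (vol (intDomain n Q.T)) :=
    h.approx_tau.memLp hU hR fun j => H2 j [] (Nat.zero_le _)
  refine hasWeakDeriv_one_iff.2 ⟨(memLp_congr_ae hae).2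
    ((hτ.const_mul _).add (h.memLp_angularLim.const_mul _)).neg, fun φ hφ => ?_⟩
  rw [integral_congr_ae (f := fun x => -(Q.c 0 * τ x + Q.c 2 * interaction Q.N (Q.sig0 a) (Q.sig2 a) x) * φ x)
    (g := fun x => -(Q.c 0 * τ x + Q.c 2 * Q.angularLim a x) * φ x)
    (by filter_upwards [hae] with x hx; rw [hx])]
  have he : Tendsto (fun j => rexp (-Q.c 0 * Q.step (p j))) atTop (𝓝 1) := by
    have := (Real.continuous_exp.tendsto _).comp (h.step_lim.const_mul (-Q.c 0))
    rwa [mul_zero, Real.exp_zero] at this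
  obtain ⟨D, hD⟩ := h.coeff_lim.abs.bddAbove_range
  obtain ⟨D', hD'⟩ := he.abs.bddAbove_range
  refine h.approx_tau.integral_dv_eq hU (s := fun j => Q.step (p j)) (C := D * A + |Q.c 2| * D' * C)
    (F := fun j x => (rexp (-Q.c 0 * Q.step (p j)) - 1) / Q.step (p j) * Q.tau (p j) (u j) x -
        Q.c 2 * rexp (-Q.c 0 * Q.step (p j)) * Q.angular (p j) (u j) x)
    (fun j => h.good.step_pos (h.pos j)) h.step_le h.step_lim
    (fun z hz r hr => (h.good.add_field_mem hr.1).1 hz) (fun j => ?_) (fun j x hx => ?_) (fun x hx => ?_)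
    (fun j x hx => h.good.tau_quot (h.pos j) (h.past j) hx) hφ
  · have h1 := (h.smooth_tau j).continuous
    have h2 := (h.smooth_angular j).continuous
    fun_prop
  · have hx' := Family.intDomain_subset hx
    have h1 := hD ⟨j, rfl⟩
    have h2 := hD' ⟨j, rfl⟩
    refine (abs_sub _ _).trans (add_le_add ?_ ?_)
    · rw [abs_mul]
      exact mul_le_mul h1 (H j [] (Nat.zero_le _) x hx') (abs_nonneg _) ((abs_nonneg _).trans h1)
    · rw [abs_mul, abs_mul]
      exact mul_le_mul (mul_le_mul_of_nonneg_left h2 (abs_nonneg _)) (H' j x hx') (abs_nonneg _)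
        (mul_nonneg (abs_nonneg _) ((abs_nonneg _).trans h2))
  · have hx' := Family.intDomain_subset hx
    have := (h.coeff_lim.mul (h.τ_lim x hx')).sub ((he.const_mul (Q.c 2)).mul (h.angular_lim hx'))
    convert this using 2
    ring

end FamilyLimit
end Outgoing

/-! ### Zero mean -/

section Mean
variable {n k : ℕ} {Q : Model n} {K s : ℕ} {p : ℕ → ℕ} {u : ℕ → Fn (n + 1)}
  {a : Fn (n + 1)} {τ : Fn (n + 2)} {f : Fn k} {z : Pt k} {U : Set (Pt k)}

lemma integral_prepAvg (hf : SmoothPer f) (N : ℤ) (h : ∫ θ in 0..2 * π, f (z, θ) = 0) :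
    ∫ θ in 0..2 * π, prepAvg N f (z, θ) = 0 := by
  have hc := hf.continuous
  simp only [prepAvg, Prod.mk_add_mk, add_zero]
  rw [intervalIntegral.integral_const_mul, intervalIntegral.integral_finsetSum fun (i : ℕ) _ =>
    (by fun_prop : Continuous fun θ : ℝ => f (z, θ + 2 * π * i / N)).intervalIntegrable _ _]
  refine mul_eq_zero_of_right _ (Finset.sum_eq_zero fun i _ => ?_)
  exact (SchemeData.periodic_integral_add (f := fun θ => f (z, θ)) (fun θ => hf.periodic z θ) _).trans h

/-- A mean zero function of period `2π/N` has mean zero along `θ ↦ θ₀ + (m/N) θ`. -/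
lemma integral_dilate {f : ℝ → ℝ} (hf : Continuous f) {N m : ℤ} (hN : N ≠ 0) (hm : m ≠ 0)
    (hp : Function.Periodic f (2 * π / N)) (h : ∫ θ in 0..2 * π, f θ = 0) (θ : ℝ) :
    ∫ φ in 0..2 * π, f (θ + (m : ℝ) / N * φ) = 0 := by
  have hN' : (N : ℝ) ≠ 0 := by exact_mod_cast hN
  have hm' : (m : ℝ) ≠ 0 := by exact_mod_cast hm
  have key := fun (j : ℤ) t => hp.intervalIntegral_add_zsmul_eq j t fun _ _ => hf.intervalIntegrable _ _
  have h1 := key N 0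
  rw [zero_add, zsmul_eq_mul, mul_div_cancel₀ _ hN', h, zsmul_eq_mul, eq_comm] at h1
  have h0 := (mul_eq_zero.1 h1).resolve_left hN'
  have h2 := key m θ
  rw [hp.intervalIntegral_add_eq θ 0, h0, smul_zero, zsmul_eq_mul] at h2
  rw [intervalIntegral.integral_comp_add_mul _ (div_ne_zero hm' hN'), mul_zero, add_zero,
    show (m : ℝ) / N * (2 * π) = m * (2 * π / N) by ring, h2, smul_zero]

lemma ApproxBy.integral_tendsto {f : ℕ → Fn k} {g : Fn k}
    (h : ApproxBy U f g) (hz : z ∈ U) :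
    Tendsto (fun j => ∫ θ in 0..2 * π, f j (z, θ)) atTop (𝓝 (∫ θ in 0..2 * π, g (z, θ))) := by
  obtain ⟨C, hC⟩ := h.bound
  refine intervalIntegral.tendsto_integral_filter_of_dominated_convergence (fun _ => C)
      (.of_forall fun j => ?_)
      (.of_forall fun j => Eventually.of_forall fun θ _ => hC j (z, θ) hz)
      intervalIntegrable_const (.of_forall fun θ _ => h.lim (z, θ) hz)
  have := (h.smooth j).continuous
  exact (by fun_prop : Continuous fun θ : ℝ => f j (z, θ)).aestronglyMeasurable

lemma meanZero_of_forall (hU : MeasurableSet U)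
    (h : ∀ z ∈ U, ∫ θ in 0..2 * π, f (z, θ) = 0) : MeanZero U f :=
  (ae_restrict_mem hU).mono h

lemma transport_mk (v : Pt (n + 1)) (c ε : ℝ) (a : Fn (n + 1)) (z : Pt (n + 2)) (θ : ℝ) :
    transport v c ε a (z, θ) = ε * rexp (-c * z (Fin.last (n + 1))) *
      a ((projL v (z, 0)).1, θ) := by
  have h := Model.transport_add v c ε a (z, 0) θ
  rw [Prod.mk_add_mk, add_zero, zero_add] at h
  rw [h]
  refine congrArg (_ * a ·) (Prod.ext (by simp) (by simp [projL_apply]))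

lemma integral_transport {v : Pt (n + 1)} (hv : 0 < v 0) (c ε : ℝ) {a : Fn (n + 1)} {T : ℝ}
    (ha : ∀ z : Pt (n + 1), z 0 < T → ∫ θ in 0..2 * π, a (z, θ) = 0)
    {z : Pt (n + 2)} (hz : z ∈ closedDomain n T) :
    ∫ θ in 0..2 * π, transport v c ε a (z, θ) = 0 := by
  simp only [transport_mk]
  rw [intervalIntegral.integral_const_mul, ha, mul_zero]
  rw [projL_time]
  nlinarith [hz.1, hz.2]

namespace FamilyLimit

/-- The Riemann sums of the interaction integral have almost zero mean: their exact means are Riemann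
sums of integrals that vanish, since the prepared profile has period `2π/N₀` and zero mean. -/
lemma exists_angular_mean_le (h : FamilyLimit Q K s p u a τ) (hm : ∀ j, ∀ z : Pt (n + 1), z 0 < Q.T →
      ∫ θ in 0..2 * π, u j (z, θ) = 0) : ∃ C, ∀ j, ∀ z ∈ closedDomain n Q.T,
    |∫ θ in 0..2 * π, Q.angular (p j) (u j) (z, θ)| ≤ C * (2 * π / p j) := by
  obtain ⟨A, hA, H⟩ := h.angular_integrand
  have hN : (Q.N 0 : ℝ) ≠ 0 := by exact_mod_cast h.good.N_ne 0
  set κ : ℝ := ((-Q.N 1 : ℤ) : ℝ) / Q.N 0 with hκ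
  have hκ' : (Q.N 2 : ℝ) / Q.N 0 = κ + 1 := by
    have : (Q.N 0 : ℝ) = Q.N 1 + Q.N 2 := by exact_mod_cast h.good.N_eq
    rw [hκ]; field_simp; push_cast; linarith
  refine ⟨2 * π * (A * |κ|) * A * (2 * π), fun j z hz => ?_⟩
  set μ : ℝ := 2 * π / p j with hμ
  have hμ0 : 0 ≤ μ := by positivity
  set P := prepAvg (Q.N 0) (Q.sig0 (u j))
  set S := Q.sig2 (u j)
  have hSP : SmoothPer S := smoothPer_transport (h.smooth j)
  have hsm : SmoothPer (Q.sig0 (u j)) := smoothPer_transport (h.smooth j)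
  have hPP : SmoothPer P := hsm.prepAvg _
  have hS := hSP.continuous
  have hP := hPP.continuous
  have e1 : ∀ l : ℕ, ∫ θ in 0..2 * π, P (z, θ + (κ + 1) * (μ * l)) * S (z, θ + μ * l) =
      ∫ θ in 0..2 * π, P (z, θ + κ * (μ * l)) * S (z, θ) := fun l => by
    rw [← SchemeData.periodic_integral_add (f := fun θ => P (z, θ + κ * (μ * l)) * S (z, θ)) (fun θ => by
      simp only [hPP.periodic.add_right, hSP.periodic z θ]) (μ * l)]
    congr 1 with θ
    congr 3; ring
  have e0 : ∀ θ, Q.angular (p j) (u j) (z, θ) = ∑ l ∈ Finset.range (p j),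
      μ * (P (z, θ + (κ + 1) * (μ * l)) * S (z, θ + μ * l)) := fun θ => by
    simp only [Model.angular, Prod.mk_add_mk, add_zero, hκ', P, S, hμ]
  have e2 : ∫ θ in 0..2 * π, Q.angular (p j) (u j) (z, θ) =
      ∫ θ in 0..2 * π, (∑ l ∈ Finset.range (p j), μ * P (z, θ + κ * (μ * l))) * S (z, θ) := by
    simp only [e0, sum_mul, mul_assoc]
    rw [intervalIntegral.integral_finsetSum fun l _ => (by fun_prop : Continuous _).intervalIntegrable _ _,
      intervalIntegral.integral_finsetSum fun l _ => (by fun_prop : Continuous _).intervalIntegrable _ _]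
    refine sum_congr rfl fun l _ => ?_
    rw [intervalIntegral.integral_const_mul, intervalIntegral.integral_const_mul, e1]
  have e3 : ∀ θ, ∫ φ in 0..2 * π, P (z, θ + κ * φ) = 0 := fun θ => by
    refine integral_dilate (f := fun θ => P (z, θ)) (by fun_prop) (h.good.N_ne 0)
      (neg_ne_zero.2 (h.good.N_ne 1)) (fun θ => ?_) ?_ θ
    · have := prepAvg_add (h.good.N_ne 0) hsm.periodic (z, θ) 1
      simpa using this
    · exact integral_prepAvg hsm _ (integral_transport h.good.v0_pos _ _ (hm j) hz)
  rw [e2, ← Real.norm_eq_abs]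
  refine (intervalIntegral.norm_integral_le_of_norm_le_const
    (C := 2 * π * (A * |κ|) * μ * A) fun θ _ => ?_).trans (le_of_eq ?_)
  · rw [Real.norm_eq_abs, abs_mul]
    have h1 := abs_riemann_sub_le (g := fun φ => P (z, θ + κ * φ)) (by fun_prop) (L := A * |κ|)
      (fun φ φ' => ?_) hμ0 (h.mesh_mul j)
    · rw [e3, sub_zero] at h1
      refine mul_le_mul h1 ?_ (abs_nonneg _) (by positivity)
      simpa using ((H j (z, θ) hz κ).1 0).2
    · simpa using ((H j (z, θ) hz κ).2 φ φ').1
  · rw [sub_zero, abs_of_pos Real.two_pi_pos]; ring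

/-- The sums over nodes at different heights all vanish up to an error of the order of the mesh. -/
lemma integral_tau (h : FamilyLimit Q K s p u a τ) (hm : ∀ j, ∀ z : Pt (n + 1), z 0 < Q.T →
      ∫ θ in 0..2 * π, u j (z, θ) = 0) {z : Pt (n + 2)} (hz : z ∈ intDomain n Q.T) :
    ∫ θ in 0..2 * π, τ (z, θ) = 0 := by
  obtain ⟨C, hC⟩ := h.exists_angular_mean_le hm
  refine tendsto_nhds_unique (h.approx_tau.integral_tendsto hz) (squeeze_zero_norm (a := fun j =>
    |Q.c 2| * Q.S * rexp (|Q.c 0| * Q.S) * (C * (2 * π / p j))) (fun j => ?_) ?_)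
  · have hc := (h.smooth_angular j).continuous
    simp only [Model.tau_eq, Prod.mk_add_mk, add_zero]
    rw [intervalIntegral.integral_finsetSum fun l _ => (by fun_prop : Continuous _).intervalIntegrable _ _]
    simp only [intervalIntegral.integral_const_mul]
    have hb : ∀ r : ℕ, |∫ θ in 0..2 * π, Q.angular (p j) (u j)
        (z + ((r : ℝ) * Q.step (p j)) • atHeight (Q.v 1) 1, θ)| ≤ C * (2 * π / p j) := fun r =>
      hC j _ (Family.intDomain_subset ((h.good.add_field_mem
        (mul_nonneg (Nat.cast_nonneg r) (h.good.step_nonneg _))).1 hz))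
    refine (abs_sum_le_sum_abs _ _).trans ((sum_le_sum (g := fun r : ℕ =>
      |Q.c 2 * Q.step (p j) * rexp (Q.c 0 * (r * Q.step (p j)))| * (C * (2 * π / p j)))
      fun r _ => ?_).trans ?_)
    · rw [abs_mul]
      exact mul_le_mul_of_nonneg_left (hb r) (abs_nonneg _)
    · rw [← sum_mul]
      exact mul_le_mul_of_nonneg_right (h.good.weight_sum_le (h.pos j) _ _) ((abs_nonneg _).trans (hb 0))
  · simpa using (h.mesh_lim.const_mul C).const_mul (|Q.c 2| * Q.S * rexp (|Q.c 0| * Q.S))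

lemma integral_a (h : FamilyLimit Q K s p u a τ) (hm : ∀ j, ∀ z : Pt (n + 1), z 0 < Q.T →
      ∫ θ in 0..2 * π, u j (z, θ) = 0) {z : Pt (n + 1)} (hz : z 0 < Q.T) :
    ∫ θ in 0..2 * π, a (z, θ) = 0 :=
  tendsto_nhds_unique (h.approx_a.integral_tendsto hz) (tendsto_const_nhds.congr fun j => (hm j z hz).symm)

end FamilyLimit
end Mean

/-! ### The discrete solutions of the boundary equation -/

section Scheme
variable {n : ℕ}

namespace Model
variable (Q : Model n)

/-- The number of nodes of the `j`-th discretisation. -/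
def nodes (j : ℕ) : ℕ := j + 1 + ⌈Q.S⌉₊

/-- The bound of the discretised boundary operator in tame estimates. -/
def tameConst : ℝ := PairData.const (Q.N 0) (Q.N 2)
    (|Q.c 2 * (Q.ε 0 * Q.ε 2)| * Q.S * rexp (|Q.c 0 - Q.c 1 - Q.c 3| * Q.S))

/-- The scheme for the boundary equation along `X`, divided by the time component of `X`, with `p`
nodes. -/
def scheme (X : Pt (n + 1)) (p : ℕ) (G : Fn (n + 1)) : SchemeData n where
  E := (Q.bdryPair p).quot
  X := (X 0)⁻¹ • X
  k4 := (X 0)⁻¹ * Q.c 4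
  k5 := (X 0)⁻¹ * Q.c 5
  k6 := (X 0)⁻¹ * (2 * Q.c 6)
  h := Q.step p
  G := fun x => (X 0)⁻¹ * G x

/-- The discrete solution up to time `T`. -/
def discreteSol (X : Pt (n + 1)) (G : ℕ → Fn (n + 1)) (j : ℕ) : Fn (n + 1) :=
  (Q.scheme X (Q.nodes j) (G j)).iter ⌈Q.T / Q.step (Q.nodes j)⌉₊

variable {Q} {X : Pt (n + 1)} {G : ℕ → Fn (n + 1)}

lemma nodes_pos (j : ℕ) : 0 < Q.nodes j := by unfold nodes; omega

lemma Good.step_nodes_le (j : ℕ) : Q.step (Q.nodes j) ≤ 1 := by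
  have h : (0 : ℝ) < Q.nodes j := by exact_mod_cast nodes_pos j
  refine (div_le_one h).2 ((Nat.le_ceil Q.S).trans ?_)
  exact_mod_cast (by unfold nodes; omega : ⌈Q.S⌉₊ ≤ Q.nodes j)

lemma tendsto_nodes : Tendsto Q.nodes atTop atTop :=
  tendsto_atTop_mono (fun j => by simp only [nodes, id]; omega) tendsto_id

lemma Good.le_mul_step (hQ : Q.Good) (j : ℕ) :
    Q.T ≤ (⌈Q.T / Q.step (Q.nodes j)⌉₊ : ℝ) * Q.step (Q.nodes j) :=
  (div_le_iff₀ (hQ.step_pos (nodes_pos j))).1 (Nat.le_ceil _)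

lemma Good.hasCoeff (hQ : Q.Good) (hX : X 0 ≠ 0) {p : ℕ} (hp : 0 < p) {G : Fn (n + 1)}
    (hG : SmoothPer G) (h0 : ∀ x : Cyl (n + 1), x.1 0 ≤ 0 → G x = 0) :
    (Q.scheme X p G).HasCoeff Q.tameConst ((X 0)⁻¹ * Q.c 4) ((X 0)⁻¹ * Q.c 5)
      ((X 0)⁻¹ * (2 * Q.c 6)) where
  tame := PairData.isTame (hQ.bdryPair hp) (hQ.weight_sum_le hp _ _) (fun r => (hQ.bdry_le p r).1)
    fun r => (hQ.bdry_le p r).2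
  X_zero := inv_mul_cancel₀ hX
  h_pos := hQ.step_pos hp
  smooth := hG.const_mul _
  past x hx := by show _ * G x = 0; rw [h0 x hx, mul_zero]
  k4_eq := rfl
  k5_eq := rfl
  k6_eq := rfl

lemma Good.tameConst_nonneg (hQ : Q.Good) : 0 ≤ Q.tameConst :=
  (PairData.isTame (hQ.bdryPair one_pos) (hQ.weight_sum_le one_pos _ _) (fun r => (hQ.bdry_le 1 r).1)
    fun r => (hQ.bdry_le 1 r).2).nonneg

lemma Good.step_discreteSol (hQ : Q.Good) (hX : X 0 ≠ 0) (hG : ∀ j, SmoothPer (G j))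
    (h0 : ∀ j, ∀ x : Cyl (n + 1), x.1 0 ≤ 0 → G j x = 0) (j : ℕ) (x : Cyl (n + 1)) (hx : x.1 0 < Q.T) :
    (Q.scheme X (Q.nodes j) (G j)).step (Q.discreteSol X G j) x = Q.discreteSol X G j x :=
  SchemeData.iter_stable (hQ.hasCoeff hX (nodes_pos j) (hG j) (h0 j)).toGood _ x
    (hx.le.trans (hQ.le_mul_step j))

/-- For small sources, the discrete solutions are bounded uniformly in the mesh. -/
lemma Good.exists_family (hQ : Q.Good) (hX : X 0 ≠ 0) {K s σ : ℕ} (hK : 1 ≤ K) (hs : s ≤ 2 * K - 1)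
    (hKσ : K + (n + 2) ≤ σ) (hsσ : s ≤ σ) :
    ∃ δ : ℝ, 0 < δ ∧ ∀ (g : Fn (n + 1)) (G : ℕ → Fn (n + 1)), IsApprox Q.T δ σ g G →
      Family Q K s Q.nodes (Q.discreteSol X G) := by
  obtain ⟨ρ, hρ, hsmall⟩ := SchemeData.exists_small n hQ.tameConst_nonneg ((X 0)⁻¹ * Q.c 4)
    ((X 0)⁻¹ * Q.c 5) ((X 0)⁻¹ * (2 * Q.c 6)) Q.T
  have hE : 0 ≤ |(X 0)⁻¹| * embedConst n := mul_nonneg (abs_nonneg _) (by unfold embedConst; positivity)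
  refine ⟨ρ / (2 * (|(X 0)⁻¹| * embedConst n + 1)), by positivity, fun g G hG => ?_⟩
  obtain ⟨B, hB, hGB⟩ := hG.bound
  have hdw : ∀ j (I : Word (n + 1)), dw I (Q.scheme X (Q.nodes j) (G j)).G =
      fun x => (X 0)⁻¹ * dw I (G j) x := fun j I => dw_const_mul (hG.smooth j) _ _
  have hc := fun j => hQ.hasCoeff hX (nodes_pos (Q := Q) j) (hG.smooth j) (hG.past j)
  have hsm : ∀ j, (Q.scheme X (Q.nodes j) (G j)).Small Q.T := fun j => hsmall _ (hc j) fun I hI x hx => by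
    rw [hdw, abs_mul]
    refine (mul_le_mul_of_nonneg_left (hG.small j I hI x hx) (abs_nonneg _)).trans ?_
    rw [← mul_assoc, mul_div_assoc', mul_div_assoc', div_le_iff₀ (by positivity)]
    nlinarith
  obtain ⟨S, hS, hsup⟩ := SchemeData.exists_sup_bound n hQ.tameConst_nonneg ((X 0)⁻¹ * Q.c 4)
    ((X 0)⁻¹ * Q.c 5) ((X 0)⁻¹ * (2 * Q.c 6)) Q.T K (B := |(X 0)⁻¹| * (embedConst n * B))
    (mul_nonneg (abs_nonneg _) (mul_nonneg (by unfold embedConst; positivity) hB))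
  obtain ⟨R, hR, hl2⟩ := SchemeData.exists_l2_bound n hQ.tameConst_nonneg ((X 0)⁻¹ * Q.c 4)
    ((X 0)⁻¹ * Q.c 5) ((X 0)⁻¹ * (2 * Q.c 6)) Q.T hs hK hS (B := |(X 0)⁻¹| * B) (by positivity)
  have hsup' := fun j => hsup _ (hc j) (hsm j) fun I hI x hx => by
    rw [hdw, abs_mul]
    exact mul_le_mul_of_nonneg_left (abs_dw_le_of_eLpNorm hB (hG.smooth j)
      (fun I hI => hGB j I (hI.trans hKσ)) hI hx) (abs_nonneg _)
  have hl2' := fun j => hl2 _ (hc j) (hsm j) (hsup' j) fun I hI => by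
    rw [hdw, ofReal_mul (abs_nonneg _)]
    refine (PairData.eLpNorm_mul_le_of_bound (measurableSet_bdryDomain _) (A := |(X 0)⁻¹|)
      fun x _ => le_rfl).trans ?_
    gcongr
    exact hGB j I (hI.trans hsσ)
  refine ⟨fun j => SchemeData.smooth_iter (hc j).toGood _, fun j => SchemeData.iter_past (hc j).toGood _,
    ⟨S, hS, fun j J hJ x hx => hsup' j _ x (lt_min (hx.trans_le (hQ.le_mul_step j)) hx) J hJ⟩,
    ⟨R, hR, fun j J hJ => ?_⟩, nodes_pos, Good.step_nodes_le, tendsto_nodes⟩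
  have := hl2' j ⌈Q.T / Q.step (Q.nodes j)⌉₊ J hJ
  rw [show (Q.scheme X (Q.nodes j) (G j)).h = Q.step (Q.nodes j) from rfl,
    min_eq_right (hQ.le_mul_step j)] at this
  exact this

lemma Good.integral_discreteSol (hQ : Q.Good) (hX : X 0 ≠ 0) (hG : ∀ j, SmoothPer (G j))
    (h0 : ∀ j, ∀ x : Cyl (n + 1), x.1 0 ≤ 0 → G j x = 0)
    (hm : ∀ j z, ∫ θ in 0..2 * π, G j (z, θ) = 0) (j : ℕ) (z : Pt (n + 1))
    (hz : z 0 < Q.T) : ∫ θ in 0..2 * π, Q.discreteSol X G j (z, θ) = 0 :=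
  SchemeData.iter_mean (hQ.hasCoeff hX (nodes_pos j) (hG j) (h0 j)).toGood (fun z _ => by
    show ∫ θ in 0..2 * π, (X 0)⁻¹ * G j (z, θ) = 0
    rw [intervalIntegral.integral_const_mul, hm, mul_zero]) _ z hz

end Model
end Scheme

/-! ### The boundary equation in the limit -/

section Boundary
variable {n : ℕ} {Q : Model n} {X : Pt (n + 1)} {K s σ : ℕ} {g : Fn (n + 1)} {δ : ℝ}
  {G : ℕ → Fn (n + 1)} {φ : ℕ → ℕ} {a : Fn (n + 1)} {τ : Fn (n + 2)}

namespace FamilyLimit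

lemma exists_weakDeriv_sq {p : ℕ → ℕ} {u : ℕ → Fn (n + 1)} (h : FamilyLimit Q K s p u a τ) :
    ∃ w, HasWeakDeriv (bΩ n Q.T) 1 ![dir none] (fun q => a q ^ 2) w := by
  obtain ⟨A, hA, H⟩ := h.sup
  obtain ⟨ρ, hρ, H2⟩ := h.l2
  have hU := measurableSet_bdryDomain (n := n) Q.T
  have happ : ApproxBy (bΩ n Q.T) (fun j q => u j q * u j q) (fun q => a q ^ 2) :=
    ⟨fun j => (h.smooth j).mul (h.smooth j), fun z θ => by simp only [h.a_per z θ],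
      ⟨A * A, fun j x hx => by
        rw [abs_mul]
        have := H j [] (Nat.zero_le _) x hx
        exact mul_le_mul this this (abs_nonneg _) hA⟩,
      fun x hx => by simpa only [sq] using (h.a_lim x hx).mul (h.a_lim x hx)⟩
  obtain ⟨w, hw, -⟩ := happ.exists_weakDeriv hU (fun _ : Fin 1 => none)
    (R := ofReal (2 * A) * ofReal ρ) (by finiteness) fun j => by
      have e : dw (word fun _ : Fin 1 => none) (fun q => u j q * u j q) =
          fun q => (2 * u j q) * dw [none] (u j) q := by
        show dv (dir none) _ = _
        rw [dv_mul (h.smooth j) (h.smooth j)]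
        funext q
        show _ = 2 * u j q * dv (dir none) (u j) q
        ring
      rw [e]
      refine (PairData.eLpNorm_mul_le_of_bound hU (A := 2 * A) fun x hx => ?_).trans
        (mul_le_mul_right (H2 j [none] h.one_le) _)
      rw [abs_mul, abs_two]
      exact mul_le_mul_of_nonneg_left (H j [] (Nat.zero_le _) x hx) zero_le_two
  refine ⟨w, ?_⟩
  convert hw using 2
  simp

lemma schemeLimit (hX : X 0 ≠ 0) (hG : IsApprox Q.T δ σ g G) (hσ : n + 2 ≤ σ)
    (h : FamilyLimit Q K s (Q.nodes ∘ φ) (Q.discreteSol X G ∘ φ) a τ) :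
    SchemeLimit Q.T (fun j => Q.scheme X (Q.nodes (φ j)) (G (φ j))) ((X 0)⁻¹ * Q.c 4)
      ((X 0)⁻¹ * Q.c 5) ((X 0)⁻¹ * (2 * Q.c 6)) Q.tameConst ((X 0)⁻¹ • X) (Q.discreteSol X G ∘ φ)
      (fun j => (Q.bdryPair (Q.nodes (φ j))).pairing (Q.discreteSol X G (φ j)) (Q.discreteSol X G (φ j)))
      (fun j => (Q.bdryPair (Q.nodes (φ j))).inc) a (fun q => τ (lift 0 q)) where
  coeff j := h.good.hasCoeff hX (Model.nodes_pos _) (hG.smooth _) (hG.past _)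
  X_eq _ := rfl
  h_le _ := Model.Good.step_nodes_le _
  h_lim := h.step_lim
  eq j x hx := h.good.step_discreteSol hX hG.smooth hG.past _ x hx
  sup := let ⟨A, _, H⟩ := h.sup; ⟨A, fun j I hI => H j I (hI.trans h.two_le)⟩
  lim := h.approx_a
  E_eq _ _ := rfl
  inc_lim := by
    refine tendsto_nhdsWithin_iff.2 ⟨?_, Eventually.of_forall fun j =>
      (h.good.bdryPair (Model.nodes_pos (Q := Q) (φ j))).inc_ne⟩
    have := h.mesh_lim.const_mul (Q.N 2 : ℝ)
    rw [mul_zero] at this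
    exact this
  lim_B := h.approx_bdry
  sup_B := let ⟨A, H⟩ := h.sup_bdry h.good; ⟨A, fun j => H j [none] (le_trans (by simp) h.two_le)⟩
  sup_G := by
    obtain ⟨B, hB, hGB⟩ := hG.bound
    refine ⟨|(X 0)⁻¹| * (embedConst n * B), fun j x hx => ?_⟩
    show |(X 0)⁻¹ * G (φ j) x| ≤ _
    rw [abs_mul]
    exact mul_le_mul_of_nonneg_left (abs_dw_le_of_eLpNorm (m := 0) hB (hG.smooth _)
      (fun I hI => hGB _ I (by omega)) (I := []) le_rfl hx) (abs_nonneg _)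

/-- The limit of the scheme, multiplied by the time component of `X`. -/
lemma eq_boundary (hX : X 0 ≠ 0) (hg : MemLp g 2 (vol (bΩ n Q.T)))
    (hG : IsApprox Q.T δ σ g G) (hσ : n + 2 ≤ σ) (hφ : StrictMono φ)
    (h : FamilyLimit Q K s (Q.nodes ∘ φ) (Q.discreteSol X G ∘ φ) a τ) :
    ∃ w₁ w₂ w₃ : Fn (n + 1), HasWeakDeriv (bΩ n Q.T) 1 ![(X, 0)] a w₁ ∧
      HasWeakDeriv (bΩ n Q.T) 1 ![dir none] (fun q => τ (lift 0 q)) w₂ ∧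
      HasWeakDeriv (bΩ n Q.T) 1 ![dir none] (fun q => a q ^ 2) w₃ ∧
      ∀ᵐ q ∂vol (bΩ n Q.T), w₁ q + Q.c 4 * a q + Q.c 5 * w₂ q + Q.c 6 * w₃ q = g q := by
  obtain ⟨w₂, hw₂⟩ := h.memSobolev_bdry.2.2 1 h.one_le fun _ => none
  obtain ⟨w₃, hw₃⟩ := h.exists_weakDeriv_sq
  replace hw₂ : HasWeakDeriv (bΩ n Q.T) 1 ![dir none] (fun q => τ (lift 0 q)) w₂ := by
    convert hw₂ using 2
    simp
  have ha := h.memSobolev_a.2.1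
  refine ⟨fun q => g q - Q.c 4 * a q - Q.c 5 * w₂ q - Q.c 6 * w₃ q, w₂, w₃,
    hasWeakDeriv_one_iff.2 ⟨((hg.sub (ha.const_mul _)).sub (hw₂.1.const_mul _)).sub (hw₃.1.const_mul _),
      fun ψ hψ => ?_⟩, hw₂, hw₃, Eventually.of_forall fun q => by ring⟩
  have hlim : Tendsto (fun j => ∫ x, (Q.scheme X (Q.nodes (φ j)) (G (φ j))).G x * ψ x
      ∂vol (bΩ n Q.T)) atTop
      (𝓝 ((X 0)⁻¹ * ∫ x, g x * ψ x ∂vol (bΩ n Q.T))) := by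
    refine (((hG.weak ψ hψ).comp hφ.tendsto_atTop).const_mul _).congr fun j => ?_
    simp only [Model.scheme, mul_assoc, integral_const_mul, Function.comp]
  have key := (h.schemeLimit hX hG hσ).weak_eq hψ hlim
  have e1 := (hasWeakDeriv_one_iff.1 hw₂).2 ψ hψ
  have e2 := (hasWeakDeriv_one_iff.1 hw₃).2 ψ hψ
  have e3 : ∀ x, a x * dv ((X 0)⁻¹ • X, 0) ψ x = (X 0)⁻¹ * (a x * dv (X, 0) ψ x) := fun x => by
    have : (((X 0)⁻¹ • X, 0) : Cyl (n + 1)) = (X 0)⁻¹ • (X, 0) := by simp [Prod.smul_mk]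
    rw [dv, this, map_smul, smul_eq_mul, dv]; ring
  simp only [e3] at key
  rw [integral_const_mul, e1, e2] at key
  have i : ∀ {f : Fn (n + 1)}, MemLp f 2 (vol (bΩ n Q.T)) →
      Integrable (fun x => f x * ψ x) (vol (bΩ n Q.T)) := fun hf =>
    hf.integrable_mul hψ.memLp
  have e4 : ∫ x, (g x - Q.c 4 * a x - Q.c 5 * w₂ x - Q.c 6 * w₃ x) * ψ x ∂vol (bΩ n Q.T) =
      (∫ x, g x * ψ x ∂vol (bΩ n Q.T)) - Q.c 4 * (∫ x, a x * ψ x ∂vol (bΩ n Q.T)) -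
        Q.c 5 * (∫ x, w₂ x * ψ x ∂vol (bΩ n Q.T)) -
        Q.c 6 * (∫ x, w₃ x * ψ x ∂vol (bΩ n Q.T)) := by
    have i1 : Integrable (fun x => g x * ψ x - Q.c 4 * (a x * ψ x)) (vol (bΩ n Q.T)) :=
      (i hg).sub ((i ha).const_mul _)
    have i2 : Integrable (fun x => g x * ψ x - Q.c 4 * (a x * ψ x) - Q.c 5 * (w₂ x * ψ x))
      (vol (bΩ n Q.T)) := i1.sub ((i hw₂.1).const_mul _)
    rw [← integral_const_mul, ← integral_const_mul, ← integral_const_mul,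
      ← integral_sub (i hg) ((i ha).const_mul _), ← integral_sub i1 ((i hw₂.1).const_mul _),
      ← integral_sub i2 ((i hw₃.1).const_mul _)]
    refine integral_congr_ae (.of_forall fun x => ?_)
    simp only
    ring
  rw [e4]
  refine mul_left_cancel₀ (inv_ne_zero hX) (key.trans ?_)
  ring

end FamilyLimit
end Boundary

end KeyProfile

end

theorem mainTheorem8
    -- the hyperbolic boundary problem, in space dimension `d = n + 1`
    (n : ℕ) (B : Fin (n + 1) → Matrix (Fin 3) (Fin 3) ℝ) (M : Matrix (Fin 2) (Fin 3) ℝ)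
    (lam : Fin 3 → (Fin (n + 1) → ℝ) → ℝ)
    (hyp : KeyProfile.StrictlyHyperbolic B lam)
    (bdry : KeyProfile.NoncharacteristicBoundary B M)
    (weak : KeyProfile.WeaklyStable B M)
    -- the boundary frequency, the resonant phases, the vectors `e` and `b`
    (β : Fin (n + 1) → ℝ) (hβ : KeyProfile.toFreq β ∈ KeyProfile.lopSet B M)
    (om : Fin 3 → (Fin (n + 1) → ℝ) → ℝ) (r ℓ : Fin 3 → Fin 3 → ℝ) (N : Fin 3 → ℤ)
    (res : KeyProfile.IsResonantTriple B lam β om r ℓ N)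
    (e : Fin 3 → ℝ) (b : Fin 2 → ℝ) (lop : KeyProfile.IsLopatinskiiPair B M β e b)
    -- the real constants `c₀, …, c₆`, and the final time
    (c : Fin 7 → ℝ) (T : ℝ) (hT : 0 < T) :
    ∃ δ : ℝ, 0 < δ ∧ ∀ g : KeyProfile.Cyl (n + 1) → ℝ,
      KeyProfile.MemSobolev (KeyProfile.bdryDomain n T) (KeyProfile.alphaTilde (n + 1) - 2) g →
      KeyProfile.VanishesInPast (KeyProfile.bdryDomain n T) g →
      KeyProfile.sobolevNorm (KeyProfile.bdryDomain n T) (KeyProfile.alphaReg (n + 1)) g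
        ≤ ENNReal.ofReal δ →
      ∃ V : KeyProfile.Profile n,
        KeyProfile.IsSolution T
          (KeyProfile.fieldPhase β (om 0)) (KeyProfile.fieldPhase β (om 1))
          (KeyProfile.fieldPhase β (om 2))
          (KeyProfile.fieldLop B M (fun m => om m β) r ℓ e b)
          N c r (fun m => KeyProfile.proj r ℓ m e) g V ∧
        V.MemSobolev T (KeyProfile.alphaReg (n + 1) - 1) ∧
        (KeyProfile.MeanZero (KeyProfile.bdryDomain n T) g → V.MeanZero T) := by
  have hβ0 : β ≠ 0 := KeyProfile.ne_zero_of_mem_sphereReal hβ.1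
  have htime : ∀ m v, KeyProfile.IsNormalGroupVelocity lam β (om m β) v →
      v * fderiv ℝ (om m) β (Pi.single 0 1) = -1 := fun m _ hv =>
    KeyProfile.fderiv_om_time hyp hβ0 (res.smooth m) (res.dispersion m) hv
  obtain ⟨v₁, hv₁, h₁⟩ := res.incoming_one
  obtain ⟨v₂, hv₂, h₂⟩ := res.outgoing_two
  obtain ⟨v₃, hv₃, h₃⟩ := res.incoming_three
  replace h₁ := htime 0 v₁ h₁
  replace h₂ := htime 1 v₂ h₂
  replace h₃ := htime 2 v₃ h₃
  -- incoming phases have a positive, and the outgoing phase a negative time component of the field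
  have hw₁ : 0 < -(fderiv ℝ (om 0) β (Pi.single 0 1)) := by
    by_contra! hw; nlinarith
  have hw₂ : -(fderiv ℝ (om 1) β (Pi.single 0 1)) < 0 := by
    by_contra! hw; nlinarith
  have hw₃ : 0 < -(fderiv ℝ (om 2) β (Pi.single 0 1)) := by
    by_contra! hw; nlinarith
  have hA := res.coordA_self bdry.det_ne_zero
  have hX := KeyProfile.lop_time_ne_zero res bdry.det_ne_zero hβ weak lop
    (by rw [hA]; exact hw₁) (by rw [hA]; exact hw₃)
  -- with `S = T / |v₁₀|` every outgoing characteristic from `t < T` reaches `t ≤ 0`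
  let Q : KeyProfile.Model n :=
    { v := fun m j => -(fderiv ℝ (om m) β (Pi.single j 1))
      c := c
      ε := fun m => ℓ m ⬝ᵥ e
      N := N
      S := T / fderiv ℝ (om 1) β (Pi.single 0 1)
      T := T }
  have hw₂' : 0 < fderiv ℝ (om 1) β (Pi.single 0 1) := by linarith
  have hQ : Q.Good :=
    { v0_pos := hw₁
      v2_pos := hw₃
      v1_neg := hw₂
      N_ne := res.coeff_ne_zero hβ0
      N_eq := res.sum_eq hβ0
      S_pos := div_pos hT hw₂'
      T_le := by
        show T ≤ T / _ * -(-(fderiv ℝ (om 1) β (Pi.single 0 1)))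
        rw [neg_neg, div_mul_cancel₀ _ hw₂'.ne'] }
  -- `α₀ = m + 2`, `α = 2m + 8` and `α̃ - 2 = 3m + 12`, where `n = d - 1`
  set m := (n + 2) / 2 with hm
  have hα₀ : KeyProfile.alphaZero (n + 1) = m + 2 := by
    have : (((n + 1 : ℕ) : ℝ) + 1) / 2 = ((n + 2 : ℕ) : ℝ) / ((2 : ℕ) : ℝ) := by push_cast; ring
    rw [KeyProfile.alphaZero, KeyProfile.bracket, this, Nat.floor_div_eq_div]
  have hα : KeyProfile.alphaReg (n + 1) = 2 * m + 8 := by rw [KeyProfile.alphaReg, hα₀]; ring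
  have hα' : KeyProfile.alphaTilde (n + 1) - 2 = 3 * m + 12 := by
    rw [KeyProfile.alphaTilde, hα, hα₀]; omega
  rw [hα, hα', show 2 * m + 8 - 1 = 2 * m + 7 from rfl]
  -- bounds of order `K = m + 4` in the supremum norm give `s = α - 1 = 2m + 7 = 2K - 1` in `L²`; the
  -- Sobolev embedding needs `n + 2` more derivatives of the source
  obtain ⟨δ, hδ, hfam⟩ := hQ.exists_family hX (K := m + 4) (s := 2 * m + 7) (σ := 3 * m + 12)
    (by omega) (by omega) (by omega) (by omega)
  refine ⟨δ, hδ, fun g hg hgp hgn => ?_⟩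
  obtain ⟨G, hG⟩ := KeyProfile.exists_isApprox hδ (by omega : n + 4 ≤ 2 * m + 8) hg hgp hgn
  obtain ⟨φ, hφ, a, τ, h⟩ := (hfam g G hG).exists_limit hQ (by omega) (by omega) (by omega)
  have hbd := KeyProfile.measurableSet_bdryDomain (n := n) T
  have hint := KeyProfile.measurableSet_intDomain n T
  have hproj : ∀ i q, (Q.ε i * a q) • r i = a q • KeyProfile.proj r ℓ i e := fun i q => by
    rw [KeyProfile.proj, smul_smul, mul_comm (a q)]
  have heq := h.eq_boundary hX hg.2.1 hG (by omega) hφ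
  refine ⟨⟨Q.sig0 a, Q.sig2 a, τ, a, fun q => Q.ε 0 * a q, fun q => Q.ε 2 * a q,
    fun q => τ (KeyProfile.lift 0 q)⟩, ?_, ?_, fun hgm => ?_⟩
  · exact
      { eq_sigma1 := h.eq_transport hQ.v0_pos _ _
        eq_sigma3 := h.eq_transport hQ.v2_pos _ _
        eq_tau2 := h.eq_tau
        eq_a := heq
        trace_sigma1 := h.isTrace_transport hQ.v0_pos _ _
        trace_sigma3 := h.isTrace_transport hQ.v2_pos _ _
        trace_tau2 := h.isTrace_tau
        boundary_sigma1 := ae_of_all _ (hproj 0)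
        boundary_sigma3 := ae_of_all _ (hproj 2)
        past_sigma1 := h.vanishes_transport hQ.v0_pos _ _
        past_sigma3 := h.vanishes_transport hQ.v2_pos _ _
        past_tau2 := h.vanishes_tau
        past_a := h.vanishes_a }
  · exact
      { sigma1 := h.memSobolev_transport hQ.v0_pos _ _
        sigma3 := h.memSobolev_transport hQ.v2_pos _ _
        tau2 := h.memSobolev_tau
        a := h.memSobolev_a
        trSigma1 := h.memSobolev_smul_a _
        trSigma3 := h.memSobolev_smul_a _
        trTau2 := h.memSobolev_bdry }
  · have hu := fun j z hz => hQ.integral_discreteSol hX hG.smooth hG.past (hG.mean hgm) (φ j) z hz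
    have ha := fun z hz => h.integral_a hu (z := z) hz
    exact
      { sigma1 := KeyProfile.meanZero_of_forall hint fun z hz =>
          KeyProfile.integral_transport hQ.v0_pos _ _ ha (KeyProfile.Family.intDomain_subset hz)
        sigma3 := KeyProfile.meanZero_of_forall hint fun z hz =>
          KeyProfile.integral_transport hQ.v2_pos _ _ ha (KeyProfile.Family.intDomain_subset hz)
        tau2 := KeyProfile.meanZero_of_forall hint fun z hz => h.integral_tau hu hz
        a := KeyProfile.meanZero_of_forall hbd ha }
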